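/- **Setting.** Let $I=\mathbb Z\times\{\pm1\}$, $\langle(j,\sigma)\rangle=\max(|j|,1)$, $\mathfrak m_{(j,\sigma)}=\sigma j$, and let $\mathtt g_s$ be the Hilbert space of sequences $x\in\mathbb C^I$ with norm $|x|_s=\big(\sum_k\langle k\rangle^2e^{2s\sqrt{\langle k\rangle}}|x_k|^2\big)^{1/2}<\infty$. $\mathcal V_{s,r}$ is the space of vector fields $V=\sum_{k,q}V^{(k)}_q x^q\partial_{x_k}$ ($q\in\mathbb N^I$ finitely supported) with $V(0)=0$, $V^{(k)}_q=0$ unless $\mathfrak m\cdot q=\mathfrak m_k$, and $\|V\|_{s,r}=\frac1r\sup_{|x|_s<r}|\underline V(x)|_s<\infty$, where $\underline V$ has the coefficients $|V_q^{(k)}|$. The monomial $x^q\partial_{x_k}$ has degree $\|q\|_{\ell^1}-1$; a superscript $\ge d$ means that only monomials of degree $\ge d$ occur. Brackets are $[X,Y]=\sum_j(X[Y^{(j)}]-Y[X^{(j)}])\partial_{x_j}$, $L_X=[X,\cdot]$, and $D(\lambda)=\sum_k\lambda_kx_k\partial_{x_k}$, $L_\lambda=L_{D(\lambda)}$. For $\lambda\in\mathbb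 C^I$ let $\mathcal M_\lambda=\{Q\in\mathbb N^I_{\rm fin}:Q\cdot\lambda=0,\ Q\cdot\mathfrak m=0\}$ with minimal generators $\mathcal G_\lambda=\{Q_i\}$ (its non-zero elements that are not sums of two non-zero elements). Let $\Delta_\lambda=\bigcup_k\Delta^{(k)}_\lambda$, $\Delta_\lambda^{(k)}=\{P\in\mathbb Z^I_{\rm fin}:P\cdot\lambda=0,\ P\cdot\mathfrak m=0,\ P+e_k\in\mathbb N^I\}$, and let $\{P_j\}$ be the elements of $\Delta_\lambda\setminus\mathcal M_\lambda$ that are not of the form $P'+Q$ with $P'\in\Delta_\lambda\setminus\mathcal M_\lambda$, $0\ne Q\in\mathcal M_\lambda$. Let $\mathcal I^{(0)},\mathcal I^{(1)},\mathcal I^{(2)}$ be the vector fields containing only monomials $x^q\partial_{x_k}$ with, respectively, $x^q$ divisible by no $x^{Q_i}$; divisible by some $x^{Q_i}$ but by no $x^{Q_i+Q_j}$; divisible by some $x^{Q_i+Q_j}$ ($i=j$ allowed). Put $\|X\|^{\max}_{s,r}=\max_{j}\|X_j\|_{s,r}$ with $X_j$ the projection of $X$ on $\mathcal I^{(j)}$.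 Let $\tau,C>0$. Consider $\gamma>0$ and $\lambda$ such that: (i) $\lambda_k\ne0$ for all $k$, and $\sup_i\|Q_i\|_{\ell^1}<\infty$, $\sup_k\sup_{P_j\in\Delta^{(k)}_\lambda}\|P_j+e_k\|_{\ell^1}<\infty$; (ii) there are real $\varphi_k$ with $|\lambda_k-\langle k\rangle^2e^{i\varphi_k}|\le\frac12$ and $|e^{i\varphi_{(j,\sigma)}}-e^{i\varphi_{(-j,-\sigma)}}|\ge C$ whenever $\lambda_{(j,\sigma)}\ne\lambda_{(-j,-\sigma)}$; (iii) $|\lambda\cdot p|\ge\gamma\prod_i(1+p_i^2\langle i\rangle^2)^{-\tau}$ for all $p\in\mathbb Z^I_{\rm fin}\setminus\Delta_\lambda$ with $p\cdot\mathfrak m=0$ and $p+e_k\in\mathbb N^I$ for some $k$. Let $\mathtt M_*$ be any degree such that all resonant monomials ($\mathfrak m\cdot q=\mathfrak m_k$, $\lambda\cdot q=\lambda_k$) of degree $\ge\mathtt M_*$ lie in $\mathcal I^{(2)}$ (such degrees exist by (i)). **Statement.** There are constants $\mathtt c>0$ and $\mathfrak C>1$, depending only on $\tau,C$, where $\mathtt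 c$ is admissible in the homological equation, i.e. for some $A=A(\tau,C)$, for all such $\gamma,\lambda$, all $s,r,\delta>0$ and each $Y\in\mathcal V_{s,r}$ without resonant monomials, the equation $L_\lambda X=Y$ has a solution $X\in\mathcal V_{s+\delta,r}$ without resonant monomials with $\|X\|_{s+\delta,r}\le A\,e^{\mathtt c/\delta^6}\gamma^{-1}\|Y\|_{s,r}$, such that the following holds for all such $\gamma,\lambda,\mathtt M_*$. Let $0<\mathtt s<s'$, $r'>0$, $\rho=r'$, $\sigma=s'-\mathtt s$, $\chi=\frac32$, $r_0=2r'$, $s_0=\mathtt s$, $\rho_n=\frac{\rho}{10}2^{-n}$, $\sigma_0=\frac\sigma8$, $\sigma_n=\frac{9\sigma}{4\pi^2n^2}$ ($n\ge1$), $r_{n+1}=r_n-5\rho_n$, $s_{n+1}=s_n+2\sigma_n$ (so $r_n\downarrow r'$, $s_n\uparrow s'$). Let $W_0=D(\lambda)+Z+X_0+N_0$, where $Z\in\mathcal V_{s_0,r_0}$ consists of resonant monomials $x^q\partial_{x_k}$ with $q_k\neq0$ and of degree between $1$ and $\mathtt M_*-1$, $X_0\in\mathcal V^{\ge\mathtt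 M_*}_{s_0,r_0}\cap(\mathcal I^{(0)}\oplus\mathcal I^{(1)})$, $N_0\in\mathcal V^{\ge\mathtt M_*}_{s_0,r_0}\cap\mathcal I^{(2)}$. Put $\varepsilon_0=\gamma^{-1}\|X_0\|^{\max}_{s_0,r_0}$, $\Theta_0=\gamma^{-1}(\|Z\|^{\max}_{s_0,r_0}+\|N_0\|^{\max}_{s_0,r_0})+\varepsilon_0$, and assume $$\varepsilon_0\le(1+\Theta_0)^{-7}\mathtt K^{-1},\quad \mathtt K=\mathfrak C\sup_{n\ge 0}2^{9n}e^{\mathtt C'n^{12}}e^{-\chi^n(2-\chi)},\quad \mathtt C'=2^9\Big(\frac{4\pi^2}{9\sigma}\Big)^6\mathtt c .$$ Then there are $F_i\in\mathcal V^{\ge\mathtt M_*}_{s_{i+1},r_i-3\rho_i}\cap(\mathcal I^{(0)}\oplus\mathcal I^{(1)})$, $i\ge0$, such that: 1. For all $i\ge0$ and $t\ge s_{i+1}$ the time-one flow $\Phi_{F_i}$ of $F_i$ is well defined and analytic on $\bar B_{r_{i+1}}(\mathtt g_t)$, with orbits in $B_{r_i-3\rho_i}(\mathtt g_t)$, and $|\Phi_{F_i}(u)-u|_t\le\rho2^{-2i-7}$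 there. For $n\ge1$ and $t\ge s_n$, $\Psi_n=\Phi_{F_0}\circ\cdots\circ\Phi_{F_{n-1}}$ is a well-defined analytic map $\bar B_{r_n}(\mathtt g_t)\to\bar B_{r_0}(\mathtt g_t)$, and $|\Psi_n(u)-\Psi_{n-1}(u)|_t\le\rho2^{-2n+2}$ on $\bar B_{r_n}(\mathtt g_t)$, with $\Psi_0=\mathrm{id}$. 2. The vector fields $W_i=\exp(L_{F_{i-1}})W_{i-1}$ ($i\ge1$) have the form $W_i=D(\lambda)+Z+X_i+N_i$ with $X_i\in\mathcal V^{\ge\mathtt M_*}_{s_i,r_i}\cap(\mathcal I^{(0)}\oplus\mathcal I^{(1)})$, $N_i\in\mathcal V^{\ge\mathtt M_*}_{s_i,r_i}\cap\mathcal I^{(2)}$; with $\varepsilon_i=\gamma^{-1}\|X_i\|^{\max}_{s_i,r_i}$ and $\Theta_i=\gamma^{-1}(\|Z\|^{\max}_{s_i,r_i}+\|N_i\|^{\max}_{s_i,r_i})+\varepsilon_i$ one has, for all $i\ge0$, $$\varepsilon_i\le\varepsilon_0e^{-\chi^i+1},\qquad\Theta_i\le\Theta_0\sum_{j=0}^i2^{-j}.$$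 3. $\Psi_n$ converges uniformly on $\bar B_{r'}(\mathtt g_{s'})$ to a map $\Psi:\bar B_{r'}(\mathtt g_{s'})\to\bar B_{2r'}(\mathtt g_{s'})$, $\|X_n\|_{s',r'}\to0$, and $\|N_n-N_\infty\|_{s',r'}\to0$ for some $N_\infty\in\mathcal V^{\ge\mathtt M_*}_{s',r'}\cap\mathcal I^{(2)}$. On the open ball $B_{r'}(\mathtt g_{s'})$ the map $\Psi$ is analytic and injective with invertible derivative, and it conjugates $W_0$ to $W_\infty=D(\lambda)+Z+N_\infty$, that is, $D\Psi(x)[W_\infty(x)]=W_0(\Psi(x))$ for all $x\in B_{r'}(\mathtt g_{s'})$ with $W_\infty(x)\in\mathtt g_{s'}$. -/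

import Mathlib

open scoped ENNReal Topology
open Filter Set

namespace ResonantKAM

noncomputable section

/-! ## Indices, multi-indices, momentum -/

/-- The index set `I = ℤ × {+1, -1}`. -/
abbrev Idx : Type := ℤ × ℤˣ

/-- `⟨(j, σ)⟩ = max (|j|, 1)`. -/
def jap (k : Idx) : ℝ := max |(k.1 : ℝ)| 1

/-- The momentum weights `𝔪_{(j, σ)} = σ j`. -/
def mom (k : Idx) : ℤ := (k.2 : ℤ) * k.1

/-- Multi-indices: finitely supported `q : I → ℕ`. -/
abbrev MIdx : Type := Idx →₀ ℕ

/-- The multi-index `e_k`. -/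
def unitIdx (k : Idx) : MIdx := Finsupp.single k 1

/-- `‖q‖_{ℓ¹} = ∑ q_i`. -/
def len (q : MIdx) : ℕ := q.sum fun _ n => n

/-- `𝔪 · q`. -/
def momDot (q : MIdx) : ℤ := q.sum fun h n => (n : ℤ) * mom h

/-- `λ · q`. -/
def dot (lam : Idx → ℂ) (q : MIdx) : ℂ := q.sum fun h n => (n : ℂ) * lam h

/-- `𝔪 · p` for an integer vector `p` with finite support. -/
def zmomDot (p : Idx →₀ ℤ) : ℤ := p.sum fun h n => n * mom h

/-- `λ · p` for an integer vector `p` with finite support. -/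
def zdot (lam : Idx → ℂ) (p : Idx →₀ ℤ) : ℂ := p.sum fun h n => (n : ℂ) * lam h

/-- The inclusion of multi-indices into integer vectors. -/
def toZ (q : MIdx) : Idx →₀ ℤ := Finsupp.mapRange (fun n : ℕ => (n : ℤ)) Nat.cast_zero q

/-! ## The sequence spaces `g_s` -/

/-- The weight `⟨k⟩ e^{s √⟨k⟩}`. -/
def wt (s : ℝ) (k : Idx) : ℝ := jap k * Real.exp (s * Real.sqrt (jap k))

lemma wt_pos (s : ℝ) (k : Idx) : 0 < wt s k :=
  mul_pos (lt_of_lt_of_le one_pos (le_max_right _ _)) (Real.exp_pos _)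

/-- The subspace of the sequences `x` with `∑ ⟨k⟩² e^{2 s √⟨k⟩} |x_k|² < ∞`. -/
def weightedL2 (s : ℝ) : Submodule ℂ (Idx → ℂ) where
  carrier := {x | Memℓp (fun k => (wt s k : ℂ) * x k) 2}
  zero_mem' := by
    have h : (fun k => (wt s k : ℂ) * (0 : Idx → ℂ) k) = (0 : Idx → ℂ) := by
      funext k; simp
    show Memℓp (fun k => (wt s k : ℂ) * (0 : Idx → ℂ) k) 2
    rw [h]; exact zero_memℓp
  add_mem' := by
    intro x y hx hy
    have h : (fun k => (wt s k : ℂ) * (x + y) k)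
        = (fun k => (wt s k : ℂ) * x k) + fun k => (wt s k : ℂ) * y k := by
      funext k; simp [mul_add]
    show Memℓp (fun k => (wt s k : ℂ) * (x + y) k) 2
    rw [h]; exact Memℓp.add hx hy
  smul_mem' := by
    intro c x hx
    have h : (fun k => (wt s k : ℂ) * (c • x) k) = c • fun k => (wt s k : ℂ) * x k := by
      funext k; simp [mul_left_comm]
    show Memℓp (fun k => (wt s k : ℂ) * (c • x) k) 2
    rw [h]; exact Memℓp.const_smul hx c

/-- The space `g_s`. -/
def G (s : ℝ) : Type := weightedL2 s

instance (s : ℝ) : AddCommGroup (G s) := inferInstanceAs (AddCommGroup (weightedL2 s))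

instance (s : ℝ) : Module ℂ (G s) := inferInstanceAs (Module ℂ (weightedL2 s))

/-- The map `x ↦ (⟨k⟩ e^{s √⟨k⟩} x_k)_k` from `g_s` to `ℓ²`. -/
def toL2 (s : ℝ) : G s →ₗ[ℂ] lp (fun _ : Idx => ℂ) 2 where
  toFun x := ⟨fun k => (wt s k : ℂ) * x.1 k, x.2⟩
  map_add' x y := by
    ext k
    exact mul_add (wt s k : ℂ) (x.1 k) (y.1 k)
  map_smul' c x := by
    ext k
    exact mul_left_comm (wt s k : ℂ) c (x.1 k)

lemma toL2_injective (s : ℝ) : Function.Injective (toL2 s) := by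
  intro x y h
  refine Subtype.ext (funext fun k => ?_)
  have hk : (wt s k : ℂ) * x.1 k = (wt s k : ℂ) * y.1 k :=
    congrFun (congrArg (fun z : lp (fun _ : Idx => ℂ) 2 => (z : Idx → ℂ)) h) k
  have hw : (wt s k : ℂ) ≠ 0 := by exact_mod_cast (wt_pos s k).ne'
  exact mul_left_cancel₀ hw hk

/-- The norm of `g_s` is `|x|_s = (∑ ⟨k⟩² e^{2 s √⟨k⟩} |x_k|²)^{1/2}`, the pull-back of the
norm of `ℓ²`. -/
instance (s : ℝ) : NormedAddCommGroup (G s) :=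
  NormedAddCommGroup.induced (G s) (lp (fun _ : Idx => ℂ) 2) (toL2 s) (toL2_injective s)

instance (s : ℝ) : NormedSpace ℂ (G s) :=
  NormedSpace.induced ℂ (G s) (lp (fun _ : Idx => ℂ) 2) (toL2 s)

lemma norm_sq_eq (s : ℝ) (x : G s) :
    ‖x‖ ^ 2 = ∑' k, jap k ^ 2 * Real.exp (2 * s * Real.sqrt (jap k)) * ‖x.1 k‖ ^ 2 := by
  have h : ‖x‖ = ‖toL2 s x‖ := rfl
  have h2 := lp.norm_rpow_eq_tsum (p := 2) (by norm_num) (toL2 s x)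
  simp only [ENNReal.toReal_ofNat, Real.rpow_ofNat] at h2
  rw [h, h2]
  refine tsum_congr fun k => ?_
  have e : (toL2 s x : Idx → ℂ) k = (wt s k : ℂ) * x.1 k := rfl
  rw [e, norm_mul, Complex.norm_real, Real.norm_of_nonneg (wt_pos s k).le, mul_pow, wt, mul_pow,
    ← Real.exp_nat_mul]
  congr 3
  push_cast
  ring

/-! ## Formal and analytic vector fields -/

/-- A formal vector field `∑_{k, q} V_q^{(k)} x^q ∂/∂x_k`, given by `V k q = V_q^{(k)}`. -/
abbrev VF : Type := Idx → MIdx → ℂ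

/-- The value of the `k`-th component of `V` at `x` (an absolutely convergent series at the points
where it is used). -/
def eval (V : VF) (x : Idx → ℂ) (k : Idx) : ℂ := ∑' q : MIdx, V k q * q.prod fun h n => x h ^ n

/-- The `k`-th component at `(|x_h|)_h` of the majorant of `V`. -/
def majorant (V : VF) (x : Idx → ℂ) (k : Idx) : ℝ≥0∞ :=
  ∑' q : MIdx, ‖V k q‖ₑ * q.prod fun h n => ‖x h‖ₑ ^ n

/-- The majorant norm `‖V‖_{s,r} = r⁻¹ sup_{|x|_s < r} |V̲(x)|_s`, with values in `[0, ∞]`. -/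
def vnorm (s r : ℝ) (V : VF) : ℝ≥0∞ :=
  (⨆ x : G s, ⨆ _ : ‖x‖ < r,
    (∑' k, (ENNReal.ofReal (wt s k) * majorant V x.1 k) ^ 2) ^ (1 / 2 : ℝ)) / ENNReal.ofReal r

/-- The space `𝒱_{s,r}`: vector fields which vanish at the origin, preserve momentum, and
have finite majorant norm. -/
structure MemV (s r : ℝ) (V : VF) : Prop where
  zero_at_origin : ∀ k, V k 0 = 0
  momentum : ∀ k q, momDot q ≠ mom k → V k q = 0
  norm_lt_top : vnorm s r V < ⊤

/-- `V` has order at least `d`: only monomials `x^q ∂/∂x_k` of degree `‖q‖ - 1 ≥ d` occur. -/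
def OrderGE (d : ℕ) (V : VF) : Prop := ∀ k q, len q < d + 1 → V k q = 0

/-- The diagonal linear vector field `D(λ) = ∑ λ_k x_k ∂/∂x_k`. -/
def diagVF (lam : Idx → ℂ) : VF := fun k => Pi.single (unitIdx k) (lam k)

/-- The coefficients of the Lie bracket
`[X, Y]^{(j)} = ∑_k (X^{(k)} ∂Y^{(j)}/∂x_k - Y^{(k)} ∂X^{(j)}/∂x_k)`.
The coefficient of `x^q` collects the `a, b` with `a + b = q`, where `x^a` comes from the undifferentiated
factor and `x^b` from the derivative of `x^{b + e_k}`. If `X` and `Y` preserve momentum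
then, for given `a`, at most two values of `k` contribute. -/
def bracket (X Y : VF) : VF := fun j q =>
  ∑ ab ∈ Finset.HasAntidiagonal.antidiagonal q, ∑ᶠ k : Idx,
    ((ab.2 k : ℂ) + 1) *
      (X k ab.1 * Y j (ab.2 + unitIdx k) - Y k ab.1 * X j (ab.2 + unitIdx k))

/-- `exp(L_F) W = ∑_n ad_F^n(W) / n!`, coefficient by coefficient. If `F` has order at least
one then each coefficient is a finite sum. -/
def expLie (F W : VF) : VF := fun j q =>
  ∑' n : ℕ, ((n.factorial : ℂ))⁻¹ * ((bracket F)^[n] W) j q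

/-! ## Resonances -/

/-- `ℳ_λ`: the exponents of the monomial first integrals of `D(λ)`. -/
def integrals (lam : Idx → ℂ) : Set MIdx := {Q | dot lam Q = 0 ∧ momDot Q = 0}

/-- `𝒢_λ = {Q_i}`: the minimal generators of the monoid `ℳ_λ`. -/
def integralGens (lam : Idx → ℂ) : Set MIdx :=
  {Q | Q ∈ integrals lam ∧ Q ≠ 0 ∧
    ∀ A ∈ integrals lam, ∀ B ∈ integrals lam, Q = A + B → A = 0 ∨ B = 0}

/-- `Δ_λ^{(k)}`. -/
def resonancesAt (lam : Idx → ℂ) (k : Idx) : Set (Idx →₀ ℤ) :=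
  {P | zdot lam P = 0 ∧ zmomDot P = 0 ∧ ∀ h, 0 ≤ (P + Finsupp.single k 1 : Idx →₀ ℤ) h}

/-- `Δ_λ = ⋃_k Δ_λ^{(k)}`. -/
def resonances (lam : Idx → ℂ) : Set (Idx →₀ ℤ) := ⋃ k, resonancesAt lam k

/-- `Δ_λ ∖ ℳ_λ`. -/
def offResonances (lam : Idx → ℂ) : Set (Idx →₀ ℤ) := resonances lam \ toZ '' integrals lam

/-- `{P_j}`: the minimal elements of `Δ_λ ∖ ℳ_λ` with respect to translations by `ℳ_λ`. -/
def offGens (lam : Idx → ℂ) : Set (Idx →₀ ℤ) :=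
  {P | P ∈ offResonances lam ∧
    ∀ P' ∈ offResonances lam, ∀ Q ∈ integrals lam, P = P' + toZ Q → Q = 0}

/-- `𝒥^{(1)}`: exponents `q` such that `x^q` is divisible by some `x^{Q_i}`. -/
def J1 (lam : Idx → ℂ) : Set MIdx := {q | ∃ Q ∈ integralGens lam, Q ≤ q}

/-- `𝒥^{(2)}`: exponents `q` such that `x^q` is divisible by some `x^{Q_i + Q_j}`
(`i = j` is allowed). -/
def J2 (lam : Idx → ℂ) : Set MIdx :=
  {q | ∃ Q ∈ integralGens lam, ∃ Q' ∈ integralGens lam, Q + Q' ≤ q}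

/-- The exponents which define `ℐ^{(0)}`, `ℐ^{(1)}` and `ℐ^{(2)}`. -/
def Jpart (lam : Idx → ℂ) : Fin 3 → Set MIdx := ![(J1 lam)ᶜ, J1 lam \ J2 lam, J2 lam]

/-- All monomials `x^q ∂/∂x_k` of `V` have `q ∈ J`. -/
def SupportedIn (J : Set MIdx) (V : VF) : Prop := ∀ k, ∀ q ∉ J, V k q = 0

/-- The projection of `V` onto the monomials `x^q ∂/∂x_k` with `q ∈ J`. -/
def proj (J : Set MIdx) (V : VF) : VF := fun k => J.indicator (V k)

/-- The norm `max_{j = 0, 1, 2} ‖X_j‖_{s,r}`, where `X_j` is the projection of `X` on `ℐ^{(j)}`. -/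
def splitNorm (lam : Idx → ℂ) (s r : ℝ) (V : VF) : ℝ≥0∞ :=
  ⨆ j : Fin 3, vnorm s r (proj (Jpart lam j) V)

/-- The least `d` such that `ℐ^{(0)} ⊕ ℐ^{(1)}` contains no resonant monomial of degree at least
`d`, that is, such that `q ∈ 𝒥^{(2)}` for every resonant monomial `x^q ∂/∂x_k` of
degree `‖q‖ - 1 ≥ d`. Such `d` exist if the generators `Q_i`, `P_j` have bounded degree. -/
def leastDegree (lam : Idx → ℂ) : ℕ :=
  sInf {d | ∀ k q, momDot q = mom k → dot lam q = lam k → d + 1 ≤ len q → q ∈ J2 lam}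

/-- All monomials `x^q ∂/∂x_k` of `V` are resonant (`λ · q = λ_k`, i.e. `L_λ V = 0`) and diagonal
(divisible by `x_k`). -/
def IsDiagResonant (lam : Idx → ℂ) (V : VF) : Prop :=
  ∀ k q, V k q ≠ 0 → dot lam q = lam k ∧ q k ≠ 0

/-! ## Assumptions on the frequencies -/

/-- The assumptions on `λ`: non-zero entries, generators of bounded degree, superlinear growth
(with exponent two), separation of the phases with constant `C`, and the
`(γ, τ)`-Diophantine condition modulo `Δ_λ`. -/
structure FreqAssumptions (τ C γ : ℝ) (lam : Idx → ℂ) : Prop where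
  ne_zero : ∀ k, lam k ≠ 0
  bounded_integralGens : ∃ M : ℕ, ∀ Q ∈ integralGens lam, len Q ≤ M
  bounded_offGens : ∃ M₁ : ℕ, ∀ k, ∀ P ∈ offGens lam, P ∈ resonancesAt lam k →
    ((P + Finsupp.single k 1 : Idx →₀ ℤ).sum fun _ n => n.natAbs) ≤ M₁
  superlinear : ∃ φ : Idx → ℝ,
    (∀ k, ‖lam k - (jap k : ℂ) ^ 2 * Complex.exp (φ k * Complex.I)‖ ≤ 1 / 2) ∧
    ∀ k : Idx, lam k ≠ lam (-k.1, -k.2) →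
      C ≤ ‖Complex.exp (φ k * Complex.I) - Complex.exp (φ (-k.1, -k.2) * Complex.I)‖
  diophantine : ∀ p : Idx →₀ ℤ, p ∉ resonances lam → zmomDot p = 0 →
    (∃ k, ∀ h, 0 ≤ (p + Finsupp.single k 1 : Idx →₀ ℤ) h) →
    γ * p.prod (fun i n => ((1 + (n : ℝ) ^ 2 * jap i ^ 2) ^ τ)⁻¹) ≤ ‖zdot lam p‖

/-- The space `ℛ_{s,r}`: elements of `𝒱_{s,r}` without resonant monomials. -/
def MemR (lam : Idx → ℂ) (s r : ℝ) (V : VF) : Prop :=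
  MemV s r V ∧ ∀ k q, dot lam q = lam k → V k q = 0

/-- `c` is an admissible constant in the exponent of the estimate for the homological equation:
for all frequencies as above, `L_λ X = Y ∈ ℛ_{s,r}` has a solution `X ∈ ℛ_{s+δ,r}` with
`‖X‖_{s+δ,r} ≤ A e^{c/δ⁶} γ⁻¹ ‖Y‖_{s,r}`, where `A` and `c` depend only on `τ` and `C`. -/
def IsHomologicalConst (τ C c : ℝ) : Prop :=
  ∃ A : ℝ, 0 < A ∧ ∀ (γ : ℝ) (lam : Idx → ℂ), 0 < γ → FreqAssumptions τ C γ lam →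
    ∀ s r δ : ℝ, 0 < s → 0 < r → 0 < δ → ∀ Y : VF, MemR lam s r Y →
      ∃ X : VF, MemR lam (s + δ) r X ∧ bracket (diagVF lam) X = Y ∧
        vnorm (s + δ) r X ≤ ENNReal.ofReal (A * Real.exp (c / δ ^ 6) * γ⁻¹) * vnorm s r Y

/-! ## Parameters of the iteration -/

/-- `ρ_n = (ρ/10) 2^{-n}`. -/
def rhoSeq (ρ : ℝ) (n : ℕ) : ℝ := ρ / 10 * (2 ^ n)⁻¹

/-- `σ_0 = σ/8` and `σ_n = 9σ/(4π²n²)` for `n ≥ 1`. -/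
def sigmaSeq (σ : ℝ) (n : ℕ) : ℝ :=
  if n = 0 then σ / 8 else 9 * σ / (4 * Real.pi ^ 2 * (n : ℝ) ^ 2)

/-- `r_0 = 2r'`, `r_{n+1} = r_n - 5ρ_n`, with `ρ = r'`. -/
def rSeq (r' : ℝ) : ℕ → ℝ
  | 0 => 2 * r'
  | n + 1 => rSeq r' n - 5 * rhoSeq r' n

/-- `s_0 = s`, `s_{n+1} = s_n + 2σ_n`, with `σ = s' - s`. -/
def sSeq (s s' : ℝ) : ℕ → ℝ
  | 0 => s
  | n + 1 => sSeq s s' n + 2 * sigmaSeq (s' - s) n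

/-- `sup_n 2^{9n} e^{C' n^{12}} e^{-χ^n (2 - χ)}`, where `C' = 2⁹ (4π²/(9σ))⁶ c`
and `χ = 3/2`. -/
def supConst (c σ : ℝ) : ℝ :=
  ⨆ n : ℕ, (2 : ℝ) ^ (9 * n) *
    Real.exp ((2 ^ 9 * (4 * Real.pi ^ 2 / (9 * σ)) ^ 6 * c) * (n : ℝ) ^ 12) *
    Real.exp (-((3 / 2 : ℝ) ^ n * (2 - 3 / 2)))

/-! ## Flows and conjugation -/

/-- On the closed ball of radius `r` of `g_s`, the map `Φ` is the time-one flow of `F`, along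
integral curves in `g_s` which stay in the open ball of radius `R`. -/
def IsTimeOneFlow (s : ℝ) (F : VF) (r R : ℝ) (Φ : G s → G s) : Prop :=
  ∀ u ∈ Metric.closedBall (0 : G s) r, ∃ y : ℝ → G s, y 0 = u ∧ y 1 = Φ u ∧
    ∀ t ∈ Icc (0 : ℝ) 1, ‖y t‖ < R ∧
      ∃ v : G s, (∀ k, v.1 k = eval F (y t).1 k) ∧ HasDerivWithinAt y v (Icc 0 1) t

/-- `Ψ_0 = id`, `Ψ_n = Φ_0 ∘ ⋯ ∘ Φ_{n-1}`. -/
def compMaps {s : ℝ} (Φ : ℕ → G s → G s) : ℕ → G s → G s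
  | 0 => id
  | n + 1 => compMaps Φ n ∘ Φ n

/-- `Ψ` is an analytic change of variables on the open ball of radius `r` of `g_s` which transforms
`W` into `V`, that is `V(x) = DΨ(x)⁻¹ W(Ψ(x))`. As the linear part `D(λ)` of `V` is unbounded,
the identity is required at the points `x` of the ball where `V(x) ∈ g_s` (for instance at all
finitely supported `x`, if `V - D(λ)` is an analytic vector field). -/
structure Conjugates (s r : ℝ) (Ψ : G s → G s) (W V : VF) : Prop where
  analytic : AnalyticOnNhd ℂ Ψ (Metric.ball 0 r)
  injOn : InjOn Ψ (Metric.ball 0 r)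
  invertible : ∀ x ∈ Metric.ball (0 : G s) r, (fderiv ℂ Ψ x).IsInvertible
  intertwines : ∀ x ∈ Metric.ball (0 : G s) r, ∀ v : G s, (∀ k, v.1 k = eval V x.1 k) →
    ∀ k, (fderiv ℂ Ψ x v).1 k = eval W (Ψ x).1 k

end

end ResonantKAM

open ResonantKAM

open scoped ENNReal Topology
open Filter Set

/-! ## Holomorphic maps between complex Banach spaces -/

namespace ResonantKAM

section Holomorphic

universe u

variable {E F : Type u} [NormedAddCommGroup E] [NormedSpace ℂ E]
  [NormedAddCommGroup F] [NormedSpace ℂ F]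

open Metric

/-! The scheme is a Newton iteration modulo `ℐ^{(2)}`. Put W = Z + N and let Π be the projection
onto exponents outside `J2`. Each step looks for F, with the order and support of X, such that
Π[D(λ) + W, F] = X. What makes this solvable without any smallness of W is algebraic. A monomial of
Z is x_k x^Q ∂_k with Q a non-zero integral, and a monomial of N contains two generators, so
bracketing with W produces divisibility by generators, while anything divisible by two of them is
discarded by Π. `filt_step` turns this into a filtration in which Π[W, ·] moves one level up, and
the fourth level is empty. The Neumann series for F therefore stops after four terms (`homSol`,
`bracket_homSol`), each costing one inversion of L_λ. The inversions are legitimate because resonant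
monomials of degree at least d lie in `ℐ^{(2)}` (`mem_J2_of_resonant`). With this F the term X is
cancelled in exp(L_F)(D(λ) + Z + X + N). The new X comes from [F, X] and the second-order tail and
is quadratic in the old one (`StepHyp.boundX'`, `quad_le`), while the part of [F, W] in `ℐ^{(2)}` is
added to N.

The small divisors are handled by momentum conservation. Passing from s to s + δ gains the factor
e^{-δ(∑ q_h √⟨h⟩ - √⟨k⟩)} on x^q ∂_k. If h is the largest index of q = p + e_h, this exponent is at
least δ/2 ∑ p_i √⟨i⟩ (`sjSum_half_le`). The Diophantine loss can also be made to depend on p alone.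
By `divisor_cases` a small divisor forces either that e_h - e_k contributes neither to the frequency
nor to the momentum, or that ⟨h⟩ and ⟨k⟩ are polynomially bounded in ∑ p_i √⟨i⟩. Quadratic growth,
the separation of phases and the momentum law enter there. The outcome is `exists_divisor_bound`,
with loss e^{1/δ^6}.

The fields F are bounded holomorphic maps on balls of g_t, so their flows are obtained from
Picard-Lindelöf and Gronwall, and Fréchet differentiable maps on open sets of a Banach space are
shown to be analytic (`analyticOnNhd_of_differentiableOn`). The identity DΦ_F(x)[exp(L_F)W(x)] =
W(Φ_F(x)) is delicate because D(λ) is unbounded. It is proved along a trajectory y: the curve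
(exp((1-τ)L_F)W)(y(τ)) solves the variational equation and joins the two sides. Its truncations are
approximate solutions, which is enough (`FlowHyp.fderiv_flow_apply_eq`). The comparison takes place
in g_s with s < t, where D(λ) is a bounded map from g_t (`VBound.fderiv_flow_apply`).

The iteration closes since ε_{n+1} ≤ e^{-χ^n/2} ε_n and χ^n + χ^n/2 = χ^{n+1} for χ = 3/2. The
compositions satisfy Lip(Ψ_n - id) ≤ 1/100 uniformly in n, so the limit is injective with invertible
derivative. The conjugation passes to the limit because W_n(x) - W_∞(x) no longer contains D(λ)x and
tends to zero in g_{s'} (`IterData.intertwines_Psi`). -/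

lemma norm_fderiv_le_of_bounded {f : E → F} {c : E} {R M : ℝ} (hR : 0 < R)
    (hd : DifferentiableOn ℂ f (ball c R)) (hM : ∀ z ∈ ball c R, ‖f z‖ ≤ M) :
    ‖fderiv ℂ f c‖ ≤ 2 * M / R := by
  refine Complex.norm_fderiv_le_div_of_mapsTo_ball hd (fun z hz => ?_) hR
  rw [mem_closedBall, dist_eq_norm]
  have h1 := hM z hz
  have h2 := hM c (mem_ball_self hR)
  have h3 := norm_sub_le (f z) (f c)
  linarith

/-- A Schwarz lemma of second order. After subtracting its linear part at c, f varies by at most 4M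
on the ball (2M from f and 2M from the derivative) and is flat to first order at c, which forces
growth like (‖h‖/R)². -/
lemma norm_sub_sub_fderiv_le {f : E → F} {c : E} {R M : ℝ} (hR : 0 < R)
    (hd : DifferentiableOn ℂ f (ball c R)) (hM : ∀ z ∈ ball c R, ‖f z‖ ≤ M)
    {h : E} (hh : ‖h‖ < R) :
    ‖f (c + h) - f c - fderiv ℂ f c h‖ ≤ 4 * M / R ^ 2 * ‖h‖ ^ 2 := by
  set L := fderiv ℂ f c with hL
  have hLn : ‖L‖ ≤ 2 * M / R := norm_fderiv_le_of_bounded hR hd hM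
  set g : E → F := fun z => f z - L (z - c) with hg
  have hdc : HasFDerivAt f L c :=
    ((hd c (mem_ball_self hR)).differentiableAt (ball_mem_nhds _ hR)).hasFDerivAt
  have hgd : DifferentiableOn ℂ g (ball c R) := by
    refine hd.sub ?_
    exact (L.differentiable.comp (differentiable_id.sub_const c)).differentiableOn
  have hmaps : MapsTo g (ball c R) (closedBall (g c) (4 * M)) := by
    intro z hz
    rw [mem_closedBall, dist_eq_norm]
    have h1 := hM z hz
    have h2 := hM c (mem_ball_self hR)
    have h3 : ‖L (z - c)‖ ≤ 2 * M := by
      refine (L.le_opNorm _).trans ?_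
      have : ‖z - c‖ ≤ R := by rw [← dist_eq_norm]; exact (mem_ball.1 hz).le
      calc ‖L‖ * ‖z - c‖ ≤ 2 * M / R * R := by
            gcongr
            exact (norm_nonneg _).trans hLn
        _ = 2 * M := by field_simp
    have : g z - g c = f z - f c - L (z - c) := by simp [hg]; abel
    rw [this]
    have h4 := norm_sub_le (f z - f c) (L (z - c))
    have h5 := norm_sub_le (f z) (f c)
    linarith
  have hlo : (fun z => g z - g c) =o[𝓝 c] (fun w => ‖w - c‖ ^ 1) := by
    have := hdc.isLittleO
    simp only [pow_one]
    refine (this.congr_left fun z => ?_).norm_right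
    simp [hg]; abel
  have hz : c + h ∈ ball c R := by simpa using hh
  have := Complex.dist_le_mul_div_pow_of_mapsTo_ball_of_isLittleO hgd hmaps hlo hz
  rw [dist_eq_norm] at this
  have e : g (c + h) - g c = f (c + h) - f c - L h := by simp [hg]; abel
  rw [e] at this
  refine this.trans (le_of_eq ?_)
  rw [dist_eq_norm]
  simp only [add_sub_cancel_left, Nat.reduceAdd]
  field_simp

lemma hasFDerivAt_of_norm_sub_le_sq {f : E → F} {L : E →L[ℂ] F} {x : E} {ρ K : ℝ} (hρ : 0 < ρ)
    (h : ∀ v : E, ‖v‖ < ρ → ‖f (x + v) - f x - L v‖ ≤ K * ‖v‖ ^ 2) : HasFDerivAt f L x := by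
  rw [hasFDerivAt_iff_isLittleO_nhds_zero]
  have h1 : (fun v => f (x + v) - f x - L v) =O[𝓝 (0 : E)] fun v => ‖v‖ ^ 2 := by
    refine Asymptotics.IsBigO.of_bound K ?_
    filter_upwards [ball_mem_nhds (0 : E) hρ] with v hv
    have := h v (by simpa using hv)
    simpa using this
  refine h1.trans_isLittleO ?_
  have : (fun v : E => ‖v‖ ^ 2) =o[𝓝 (0 : E)] fun v => ‖v‖ ^ 1 := by
    have h2 : (fun t : ℝ => t ^ 2) =o[𝓝 (0 : ℝ)] fun t => t ^ 1 :=
      Asymptotics.isLittleO_pow_pow (by norm_num)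
    exact h2.comp_tendsto (tendsto_norm_zero (E := E))
  refine Asymptotics.IsLittleO.of_norm_right ?_
  simpa using this

/-- Weierstrass' theorem: on balls of half the radius, Cauchy's estimate turns uniform convergence
of the maps into uniform convergence of their derivatives. The convergence of derivatives is needed
again for the limit of the DΨ_n. -/
lemma differentiableOn_of_tendstoUniformlyOn [CompleteSpace F] {f : ℕ → E → F} {g : E → F}
    {U : Set E} (hU : IsOpen U) (hf : ∀ n, DifferentiableOn ℂ (f n) U)
    (hfg : TendstoUniformlyOn f g atTop U) :
    DifferentiableOn ℂ g U ∧
      ∀ x ∈ U, Tendsto (fun n => fderiv ℂ (f n) x) atTop (𝓝 (fderiv ℂ g x)) := by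
  have key : ∀ x ∈ U, ∃ L : E →L[ℂ] F, HasFDerivAt g L x ∧
      Tendsto (fun n => fderiv ℂ (f n) x) atTop (𝓝 L) := by
    intro x hx
    obtain ⟨R, hR, hRU⟩ := Metric.isOpen_iff.1 hU x hx
    have hsub : ∀ z ∈ ball x (R / 2), ball z (R / 2) ⊆ U := fun z hz =>
      (ball_subset_ball' (by linarith [mem_ball.1 hz])).trans hRU
    have hcau : UniformCauchySeqOn (fun n => fderiv ℂ (f n)) atTop (ball x (R / 2)) := by
      rw [Metric.uniformCauchySeqOn_iff]
      intro ε hε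
      obtain ⟨N, hN⟩ := Metric.uniformCauchySeqOn_iff.1 hfg.uniformCauchySeqOn
        (ε * R / 8) (by positivity)
      refine ⟨N, fun m hm n hn z hz => ?_⟩
      have hmd := (hf m).mono (hsub z hz)
      have hnd := (hf n).mono (hsub z hz)
      have hz' : z ∈ ball z (R / 2) := mem_ball_self (by positivity)
      have hnh := ball_mem_nhds z (show 0 < R / 2 by positivity)
      have e : fderiv ℂ (fun y => f m y - f n y) z = fderiv ℂ (f m) z - fderiv ℂ (f n) z :=
        fderiv_fun_sub ((hmd z hz').differentiableAt hnh) ((hnd z hz').differentiableAt hnh)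
      have := norm_fderiv_le_of_bounded (f := fun y => f m y - f n y) (c := z)
        (M := ε * R / 8) (show 0 < R / 2 by positivity) (hmd.sub hnd) (fun y hy => by
          have := hN m hm n hn y (hsub z hz hy)
          rw [dist_eq_norm] at this; exact this.le)
      rw [dist_eq_norm, ← e]
      refine lt_of_le_of_lt this ?_
      rw [div_lt_iff₀ (by positivity)]
      nlinarith
    have hlim : ∀ z ∈ ball x (R / 2), ∃ L, Tendsto (fun n => fderiv ℂ (f n) z) atTop (𝓝 L) :=
      fun z hz => cauchySeq_tendsto_of_complete (hcau.cauchySeq hz)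
    choose! L hL using hlim
    have hunif : TendstoUniformlyOn (fun n => fderiv ℂ (f n)) L atTop (ball x (R / 2)) :=
      hcau.tendstoUniformlyOn_of_tendsto hL
    have hx2 : x ∈ ball x (R / 2) := mem_ball_self (by positivity)
    have hbU : ball x (R / 2) ⊆ U := (ball_subset_ball (by linarith)).trans hRU
    refine ⟨L x, hasFDerivAt_of_tendstoUniformlyOn isOpen_ball hunif (fun n z hz => ?_)
      (fun z hz => hfg.tendsto_at (hbU hz)) hx2, hL x hx2⟩
    exact (((hf n).mono hbU z hz).differentiableAt (isOpen_ball.mem_nhds hz)).hasFDerivAt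
  refine ⟨fun x hx => ?_, fun x hx => ?_⟩
  · obtain ⟨L, hL, -⟩ := key x hx
    exact hL.differentiableAt.differentiableWithinAt
  · obtain ⟨L, hL, hL'⟩ := key x hx
    rwa [hL.fderiv]

/-- Difference quotients in the direction v are holomorphic, and the quadratic remainder makes them
converge uniformly to the directional derivative, so Weierstrass' theorem applies. -/
lemma differentiableOn_fderiv_apply [CompleteSpace F] {f : E → F} {x : E} {ρ M : ℝ} (hρ : 0 < ρ)
    (hd : DifferentiableOn ℂ f (ball x (3 * ρ))) (hM : ∀ z ∈ ball x (3 * ρ), ‖f z‖ ≤ M) (v : E) :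
    DifferentiableOn ℂ (fun y => fderiv ℂ f y v) (ball x (2 * ρ)) := by
  obtain ⟨τ, hτ, hτv⟩ : ∃ τ : ℝ, 0 < τ ∧ τ * ‖v‖ < ρ := by
    refine ⟨ρ / (‖v‖ + 1), by positivity, ?_⟩
    rw [div_mul_eq_mul_div, div_lt_iff₀ (by positivity)]
    nlinarith [norm_nonneg v]
  set t : ℕ → ℝ := fun n => τ / (n + 1) with ht
  have htpos : ∀ n, 0 < t n := fun n => by positivity
  have htle : ∀ n, t n ≤ τ := fun n => by
    rw [ht]; exact div_le_self hτ.le (by linarith [Nat.cast_nonneg (α := ℝ) n])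
  have hsmall : ∀ n, ‖(t n : ℂ) • v‖ < ρ := fun n => by
    rw [norm_smul, Complex.norm_real, Real.norm_of_nonneg (htpos n).le]
    exact (mul_le_mul_of_nonneg_right (htle n) (norm_nonneg v)).trans_lt hτv
  have hsub : ∀ y ∈ ball x (2 * ρ), ball y ρ ⊆ ball x (3 * ρ) := fun y hy =>
    ball_subset_ball' (by linarith [mem_ball.1 hy])
  have hlim : TendstoUniformlyOn (fun n y => (t n : ℂ)⁻¹ • (f (y + (t n : ℂ) • v) - f y))
      (fun y => fderiv ℂ f y v) atTop (ball x (2 * ρ)) := by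
    have hM0 : 0 ≤ M := (norm_nonneg _).trans (hM x (mem_ball_self (by positivity)))
    rw [Metric.tendstoUniformlyOn_iff]
    intro ε hε
    have h0 : Tendsto (fun n => 4 * M / ρ ^ 2 * ‖v‖ ^ 2 * t n) atTop (𝓝 0) := by
      have : Tendsto t atTop (𝓝 0) := by
        have := (tendsto_one_div_add_atTop_nhds_zero_nat (𝕜 := ℝ)).const_mul τ
        simpa [ht, div_eq_mul_inv] using this
      simpa using this.const_mul (4 * M / ρ ^ 2 * ‖v‖ ^ 2)
    filter_upwards [h0.eventually (gt_mem_nhds hε)] with n hn y hy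
    have hq := norm_sub_sub_fderiv_le hρ (hd.mono (hsub y hy))
      (fun z hz => hM z (hsub y hy hz)) (hsmall n)
    rw [dist_comm, dist_eq_norm]
    have hne : (t n : ℂ) ≠ 0 := by exact_mod_cast (htpos n).ne'
    have e : (t n : ℂ)⁻¹ • (f (y + (t n : ℂ) • v) - f y) - fderiv ℂ f y v
        = (t n : ℂ)⁻¹ • (f (y + (t n : ℂ) • v) - f y - fderiv ℂ f y ((t n : ℂ) • v)) := by
      rw [map_smul, smul_sub _ _ ((t n : ℂ) • _), smul_smul, inv_mul_cancel₀ hne, one_smul]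
    rw [e, norm_smul, norm_inv, Complex.norm_real, Real.norm_of_nonneg (htpos n).le]
    refine lt_of_le_of_lt ?_ hn
    rw [norm_smul, Complex.norm_real, Real.norm_of_nonneg (htpos n).le] at hq
    rw [inv_mul_le_iff₀ (htpos n)]
    refine hq.trans (le_of_eq (by ring))
  refine (differentiableOn_of_tendstoUniformlyOn isOpen_ball (fun n => ?_) hlim).1
  refine DifferentiableOn.const_smul ?_ _
  refine DifferentiableOn.sub ?_ (hd.mono (ball_subset_ball (by linarith)))
  refine hd.comp (by fun_prop) fun y hy => ?_
  refine hsub y hy ?_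
  simpa using hsmall n

/-- Differentiability of each y ↦ f'(y)v has to be upgraded to operator norm. The directional
derivatives assemble into a bounded bilinear map, and their quadratic remainders are bounded by a
constant times ‖v‖, hence uniformly on the unit ball of v. -/
lemma differentiableAt_fderiv_of_ball [CompleteSpace F] {f : E → F} {x : E} {ρ M : ℝ} (hρ : 0 < ρ)
    (hd : DifferentiableOn ℂ f (ball x (3 * ρ))) (hM : ∀ z ∈ ball x (3 * ρ), ‖f z‖ ≤ M) :
    DifferentiableAt ℂ (fderiv ℂ f) x := by
  have hM0 : 0 ≤ M := (norm_nonneg _).trans (hM x (mem_ball_self (by positivity)))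
  have h2 : (0 : ℝ) < 2 * ρ := by positivity
  have hD := differentiableOn_fderiv_apply hρ hd hM
  have hDat : ∀ v, DifferentiableAt ℂ (fun y => fderiv ℂ f y v) x := fun v =>
    (hD v x (mem_ball_self h2)).differentiableAt (ball_mem_nhds _ h2)
  have hB : ∀ v, ∀ y ∈ ball x (2 * ρ), ‖fderiv ℂ f y v‖ ≤ 2 * M / ρ * ‖v‖ := fun v y hy => by
    have hsub : ball y ρ ⊆ ball x (3 * ρ) := ball_subset_ball' (by linarith [mem_ball.1 hy])
    refine ((fderiv ℂ f y).le_opNorm v).trans ?_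
    gcongr
    exact norm_fderiv_le_of_bounded hρ (hd.mono hsub) fun z hz => hM z (hsub hz)
  let B : E →ₗ[ℂ] E →ₗ[ℂ] F := LinearMap.mk₂ ℂ (fun h v => fderiv ℂ (fun y => fderiv ℂ f y v) x h)
    (fun h h' v => by simp) (fun c h v => by simp)
    (fun h v w => by
      simp only [map_add]
      rw [fderiv_fun_add (hDat v) (hDat w)]; rfl)
    (fun c h v => by
      simp only [map_smul]
      rw [fderiv_fun_const_smul (hDat v)]; rfl)
  let B' : E →L[ℂ] E →L[ℂ] F := B.mkContinuous₂ (2 * (2 * M / ρ) / (2 * ρ)) fun h v => by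
    have := norm_fderiv_le_of_bounded h2 (hD v) (hB v)
    have h3 := (fderiv ℂ (fun y => fderiv ℂ f y v) x).le_opNorm h
    calc ‖B h v‖ ≤ ‖fderiv ℂ (fun y => fderiv ℂ f y v) x‖ * ‖h‖ := h3
      _ ≤ 2 * (2 * M / ρ * ‖v‖) / (2 * ρ) * ‖h‖ := by gcongr
      _ = _ := by ring
  have hfin : HasFDerivAt (fderiv ℂ f) B' x := by
    refine hasFDerivAt_of_norm_sub_le_sq h2 (K := 4 * (2 * M / ρ) / (2 * ρ) ^ 2) fun h hh => ?_
    refine ContinuousLinearMap.opNorm_le_bound _ (by positivity) fun v => ?_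
    have := norm_sub_sub_fderiv_le h2 (hD v) (hB v) hh
    calc _ = ‖fderiv ℂ f (x + h) v - fderiv ℂ f x v - fderiv ℂ (fun y => fderiv ℂ f y v) x h‖ := rfl
      _ ≤ _ := this
      _ = _ := by ring
  exact hfin.differentiableAt

lemma differentiableOn_fderiv [CompleteSpace F] {f : E → F} {U : Set E} (hU : IsOpen U)
    (hd : DifferentiableOn ℂ f U) : DifferentiableOn ℂ (fderiv ℂ f) U := by
  intro x hx
  obtain ⟨R, hR, hRU⟩ := Metric.isOpen_iff.1 hU x hx
  obtain ⟨R', hR', hb⟩ := Metric.eventually_nhds_iff_ball.1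
    (((hd x hx).differentiableAt (hU.mem_nhds hx)).continuousAt.norm.eventually
      (gt_mem_nhds (lt_add_one ‖f x‖)))
  have hm : 0 < min R R' := lt_min hR hR'
  have e : 3 * (min R R' / 3) = min R R' := by ring
  refine (differentiableAt_fderiv_of_ball (ρ := min R R' / 3) (M := ‖f x‖ + 1)
    (by positivity) ?_ ?_).differentiableWithinAt
  · rw [e]; exact hd.mono ((ball_subset_ball (min_le_left _ _)).trans hRU)
  · rw [e]; exact fun z hz => (hb z (ball_subset_ball (min_le_right _ _) hz)).le

/-- The target space is quantified inside the induction, because the derivative takes values in `E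
→L[ℂ] F`. This is also why E and F live in one universe. -/
lemma contDiffOn_of_differentiableOn (n : ℕ) : ∀ {F : Type u} [NormedAddCommGroup F]
    [NormedSpace ℂ F] [CompleteSpace F] {f : E → F} {U : Set E}, IsOpen U →
    DifferentiableOn ℂ f U → ContDiffOn ℂ n f U := by
  induction n with
  | zero => intro F _ _ _ f U _ hd; exact contDiffOn_zero.2 hd.continuousOn
  | succ n ih =>
    intro F _ _ _ f U hU hd
    push_cast
    refine (contDiffOn_succ_iff_fderiv_of_isOpen hU).2
      ⟨hd, fun h => absurd h (WithTop.natCast_ne_top (α := ℕ∞) n), ?_⟩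
    exact ih hU (differentiableOn_fderiv hU hd)

/-! ### Higher Cauchy estimates and the Taylor series. -/

lemma norm_iteratedFDeriv_le_of_bounded (m : ℕ) : ∀ {F : Type u} [NormedAddCommGroup F]
    [NormedSpace ℂ F] [CompleteSpace F] {f : E → F} {c : E} {R M δ : ℝ}, 0 < δ → m * δ < R →
    DifferentiableOn ℂ f (ball c R) → (∀ z ∈ ball c R, ‖f z‖ ≤ M) →
    ‖iteratedFDeriv ℂ m f c‖ ≤ M * (2 / δ) ^ m := by
  induction m with
  | zero =>
    intro F _ _ _ f c R M δ _ hR _ hM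
    simpa using hM c (mem_ball_self (by simpa using hR))
  | succ m ih =>
    intro F _ _ _ f c R M δ hδ hR hd hM
    push_cast at hR
    rw [← norm_iteratedFDeriv_fderiv]
    have hsub : ∀ z ∈ ball c (R - δ), ball z δ ⊆ ball c R := fun z hz =>
      ball_subset_ball' (by linarith [mem_ball.1 hz])
    refine (ih (f := fderiv ℂ f) (R := R - δ) (M := 2 * M / δ) hδ (by linarith)
      ((differentiableOn_fderiv isOpen_ball hd).mono (ball_subset_ball (by linarith)))
      fun z hz => ?_).trans (le_of_eq (by ring))
    exact norm_fderiv_le_of_bounded hδ (hd.mono (hsub z hz)) fun y hy => hM y (hsub z hz hy)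

lemma iteratedDeriv_line [CompleteSpace F] {f : E → F} {c y : E} {R : ℝ}
    (hd : DifferentiableOn ℂ f (ball c R)) (n : ℕ) : ∀ t : ℂ, c + t • y ∈ ball c R →
    iteratedDeriv n (fun s : ℂ => f (c + s • y)) t = iteratedFDeriv ℂ n f (c + t • y) fun _ => y := by
  induction n with
  | zero => intro t _; simp
  | succ n ih =>
    intro t ht
    rw [iteratedDeriv_succ]
    have hev : iteratedDeriv n (fun s : ℂ => f (c + s • y)) =ᶠ[𝓝 t]
        fun s => iteratedFDeriv ℂ n f (c + s • y) fun _ => y := by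
      have hc : Continuous fun s : ℂ => c + s • y := by fun_prop
      filter_upwards [(isOpen_ball.preimage hc).mem_nhds ht] with s hs using ih s hs
    rw [hev.deriv_eq]
    refine ContDiffAt.deriv_fderiv_add_smul ?_
    have := contDiffOn_of_differentiableOn (n + 1) isOpen_ball hd
    exact_mod_cast this.contDiffAt (isOpen_ball.mem_nhds ht)

/-- On each complex line through c the one-variable Taylor theorem sums the series. For the radius,
the n-th derivative is estimated by n successive Cauchy estimates, each spending R/(n+2). This costs
(n+2)^n/n! ≤ e^{n+2} and still leaves the radius R/(2e). -/
lemma analyticAt_of_bounded [CompleteSpace F] {f : E → F} {c : E} {R M : ℝ} (hR : 0 < R)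
    (hd : DifferentiableOn ℂ f (ball c R)) (hM : ∀ z ∈ ball c R, ‖f z‖ ≤ M) :
    AnalyticAt ℂ f c := by
  have hM0 : 0 ≤ M := (norm_nonneg _).trans (hM c (mem_ball_self hR))
  let p : FormalMultilinearSeries ℂ E F := fun n => ((n.factorial : ℂ))⁻¹ • iteratedFDeriv ℂ n f c
  set r : NNReal := ⟨R / (2 * Real.exp 1), by positivity⟩ with hr
  have hrv : (r : ℝ) = R / (2 * Real.exp 1) := rfl
  have hrpos : 0 < (r : ℝ) := by rw [hrv]; positivity
  refine ⟨p, r, ⟨?_, by exact_mod_cast hrpos, ?_⟩⟩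
  · refine p.le_radius_of_bound (M * Real.exp 1 ^ 2) fun n => ?_
    have hn : ‖p n‖ ≤ ((n.factorial : ℝ))⁻¹ * (M * (2 / (R / (n + 2))) ^ n) := by
      rw [show p n = ((n.factorial : ℂ))⁻¹ • iteratedFDeriv ℂ n f c from rfl, norm_smul, norm_inv,
        Complex.norm_natCast]
      gcongr
      refine norm_iteratedFDeriv_le_of_bounded n (δ := R / (n + 2)) (by positivity) ?_ hd hM
      rw [mul_div_assoc', div_lt_iff₀ (by positivity)]
      nlinarith
    have he : ((n : ℝ) + 2) ^ n / n.factorial ≤ Real.exp 1 ^ (n + 2) := by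
      have := Real.pow_div_factorial_le_exp (x := (n : ℝ) + 2) (by positivity) n
      rw [← Real.exp_nat_mul]
      simpa using this
    calc ‖p n‖ * (r : ℝ) ^ n
        ≤ ((n.factorial : ℝ))⁻¹ * (M * (2 / (R / (n + 2))) ^ n) * (r : ℝ) ^ n := by gcongr
      _ = M * (((n : ℝ) + 2) ^ n / n.factorial) * (Real.exp 1)⁻¹ ^ n := by
          rw [hrv]
          simp only [div_pow, mul_pow, inv_pow]
          field_simp
      _ ≤ M * Real.exp 1 ^ (n + 2) * (Real.exp 1)⁻¹ ^ n := by gcongr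
      _ = M * Real.exp 1 ^ 2 := by
          rw [pow_add, inv_pow]; field_simp
  · intro y hy
    have hy' : ‖y‖ < R / (2 * Real.exp 1) := by
      have : y ∈ ball (0 : E) r := by rwa [← Metric.eball_coe]
      simpa [hrv] using this
    have hy2 : ‖y‖ * 2 < R := by
      have h1 : R / (2 * Real.exp 1) ≤ R / 2 := by
        gcongr
        nlinarith [Real.add_one_le_exp 1]
      linarith
    have hmem : ∀ ζ ∈ ball (0 : ℂ) 2, c + ζ • y ∈ ball c R := fun ζ hζ => by
      simp only [mem_ball, dist_self_add_left, norm_smul]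
      have : ‖ζ‖ < 2 := by simpa using hζ
      nlinarith [norm_nonneg y]
    have hg : DifferentiableOn ℂ (fun ζ : ℂ => f (c + ζ • y)) (ball 0 2) :=
      hd.comp (by fun_prop) hmem
    have := Complex.hasSum_taylorSeries_on_ball hg (z := 1) (by simp)
    simp only [sub_zero, one_pow, one_smul] at this
    convert this using 2 with n
    rw [iteratedDeriv_line hd n 0 (by simpa using hR)]
    simp [p]

lemma analyticOnNhd_of_differentiableOn [CompleteSpace F] {f : E → F} {U : Set E} (hU : IsOpen U)
    (hd : DifferentiableOn ℂ f U) : AnalyticOnNhd ℂ f U := by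
  intro x hx
  obtain ⟨R, hR, hRU⟩ := Metric.isOpen_iff.1 hU x hx
  obtain ⟨R', hR', hb⟩ := Metric.eventually_nhds_iff_ball.1
    (((hd x hx).differentiableAt (hU.mem_nhds hx)).continuousAt.norm.eventually
      (gt_mem_nhds (lt_add_one ‖f x‖)))
  refine analyticAt_of_bounded (lt_min hR hR')
    (hd.mono ((ball_subset_ball (min_le_left _ _)).trans hRU)) (M := ‖f x‖ + 1) fun z hz => ?_
  exact (hb z (ball_subset_ball (min_le_right _ _) hz)).le

end Holomorphic

end ResonantKAM

open scoped ENNReal Topology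
open Filter Set

/-! ## Time-one flows of bounded holomorphic vector fields on a Banach space -/

namespace ResonantKAM

section Flow

universe u

variable {E : Type u} [NormedAddCommGroup E] [NormedSpace ℂ E]

open Metric

/-! ### Gronwall and Picard-Lindelöf on the unit time interval. -/

lemma gronwallBound_one_le {δ K ε : ℝ} (hK : 0 ≤ K) (hε : 0 ≤ ε) :
    gronwallBound δ K ε 1 ≤ δ * Real.exp K + ε * Real.exp K := by
  rcases hK.eq_or_lt with rfl | hK'
  · simp [gronwallBound_K0]
  · simp only [gronwallBound_of_K_ne_0 hK'.ne', mul_one]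
    refine add_le_add le_rfl ?_
    rw [div_mul_eq_mul_div, div_le_iff₀ hK', mul_assoc]
    refine mul_le_mul_of_nonneg_left ?_ hε
    have h1 := Real.add_one_le_exp (-K)
    have h2 : Real.exp K * Real.exp (-K) = 1 := by rw [← Real.exp_add]; simp
    nlinarith [Real.exp_pos K]

lemma HasDerivWithinAt.Ici_of_Icc {G : Type*} [NormedAddCommGroup G] [NormedSpace ℝ G]
    {y : ℝ → G} {y' : G} {t : ℝ} (h : HasDerivWithinAt y y' (Icc 0 1) t) (ht : t ∈ Ico (0 : ℝ) 1) :
    HasDerivWithinAt y y' (Ici t) t :=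
  h.mono_of_mem_nhdsWithin (mem_of_superset (Icc_mem_nhdsGE ht.2) (Icc_subset_Icc_left ht.1))

/-- The common form of Gronwall for uniqueness, for Lipschitz dependence and for the variational
equation: ε is the defect in the linear differential inequality. -/
lemma norm_le_of_approx_linear {G : Type*} [NormedAddCommGroup G] [NormedSpace ℝ G]
    {z z' : ℝ → G} {δ K ε : ℝ} (hK : 0 ≤ K) (hε : 0 ≤ ε)
    (hz : ∀ t ∈ Icc (0 : ℝ) 1, HasDerivWithinAt z (z' t) (Icc 0 1) t) (h0 : ‖z 0‖ ≤ δ)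
    (hb : ∀ t ∈ Icc (0 : ℝ) 1, ‖z' t‖ ≤ K * ‖z t‖ + ε) :
    ∀ t ∈ Icc (0 : ℝ) 1, ‖z t‖ ≤ (δ + ε) * Real.exp K := by
  intro t ht
  have hδ : 0 ≤ δ := (norm_nonneg _).trans h0
  have h1 := norm_le_gronwallBound_of_norm_deriv_right_le
    (fun t ht => (hz t ht).continuousWithinAt)
    (fun t ht => HasDerivWithinAt.Ici_of_Icc (hz t (Ico_subset_Icc_self ht)) ht) h0
    (fun t ht => hb t (Ico_subset_Icc_self ht)) t ht
  refine h1.trans (((gronwallBound_mono hδ hε hK) (show t - 0 ≤ 1 by linarith [ht.2])).trans ?_)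
  rw [add_mul]
  exact gronwallBound_one_le hK hε

/-- Unit time allows the same number a to be the bound of the field and the radius of the ball. The
Picard fixed point is used directly because it also shows that the curve stays in that ball. -/
lemma exists_trajectory {G : Type*} [NormedAddCommGroup G] [NormedSpace ℝ G] [CompleteSpace G]
    {f : ℝ → G → G} {x₀ : G} {a K : NNReal}
    (hlip : ∀ t ∈ Icc (0 : ℝ) 1, LipschitzOnWith K (f t) (closedBall x₀ a))
    (hcont : ∀ x ∈ closedBall x₀ a, ContinuousOn (f · x) (Icc (0 : ℝ) 1))
    (hb : ∀ t ∈ Icc (0 : ℝ) 1, ∀ x ∈ closedBall x₀ a, ‖f t x‖ ≤ a) :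
    ∃ y : ℝ → G, y 0 = x₀ ∧ (∀ t ∈ Icc (0 : ℝ) 1, y t ∈ closedBall x₀ a) ∧
      ∀ t ∈ Icc (0 : ℝ) 1, HasDerivWithinAt y (f t (y t)) (Icc 0 1) t := by
  let t₀ : Icc (0 : ℝ) 1 := ⟨0, by simp⟩
  have hf : IsPicardLindelof f t₀ x₀ a 0 a K := ⟨hlip, hcont, hb, by simp [t₀]⟩
  have hx : x₀ ∈ closedBall x₀ ((0 : NNReal) : ℝ) := mem_closedBall_self le_rfl
  obtain ⟨α, hα⟩ := ODE.FunSpace.exists_isFixedPt_next hf hx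
  refine ⟨α.compProj, ?_, fun t _ => α.compProj_mem_closedBall hf.mul_max_le, fun t ht => ?_⟩
  · change α.compProj (t₀ : ℝ) = x₀
    rw [ODE.FunSpace.compProj_val, ← hα, ODE.FunSpace.next_apply₀]
  · apply ODE.hasDerivWithinAt_picard_Icc t₀.2 hf.continuousOn_uncurry
      α.continuous_compProj.continuousOn (fun _ ht' ↦ α.compProj_mem_closedBall hf.mul_max_le)
      x₀ ht |>.congr_of_mem _ ht
    intro t' ht'
    nth_rw 1 [← hα]
    rw [ODE.FunSpace.compProj_of_mem ht', ODE.FunSpace.next_apply]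

/-- `f` is holomorphic and bounded by `M ≤ η / 8` on the ball of radius `R + 3 η`. -/
structure FlowHyp (f : E → E) (R η M : ℝ) : Prop where
  pos : 0 < η
  nonneg : 0 ≤ M
  le : 8 * M ≤ η
  diff : DifferentiableOn ℂ f (ball 0 (R + 3 * η))
  bound : ∀ z ∈ ball (0 : E) (R + 3 * η), ‖f z‖ ≤ M

/-- `φ` is a flow of `f` for times in `[0, 1]` and initial points in the ball of radius `R`. -/
structure IsFlow (f : E → E) (R M : ℝ) (φ : ℝ → E → E) : Prop where
  zero : ∀ u ∈ ball (0 : E) R, φ 0 u = u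
  deriv : ∀ u ∈ ball (0 : E) R, ∀ t ∈ Icc (0 : ℝ) 1,
    HasDerivWithinAt (fun t => φ t u) (f (φ t u)) (Icc 0 1) t
  near : ∀ u ∈ ball (0 : E) R, ∀ t ∈ Icc (0 : ℝ) 1, ‖φ t u - u‖ ≤ M

omit [NormedSpace ℂ E] in
lemma ball_subset_ball_add {R η : ℝ} {x : E} (hx : x ∈ ball (0 : E) (R + 2 * η)) :
    ball x η ⊆ ball 0 (R + 3 * η) :=
  ball_subset_ball' (by linarith [mem_ball.1 hx])

namespace FlowHyp

variable {f : E → E} {R η M : ℝ} (H : FlowHyp f R η M)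
include H

lemma mem_of_near {u y : E} (hu : u ∈ ball (0 : E) R) (hy : ‖y - u‖ ≤ M) :
    y ∈ ball (0 : E) (R + η) := by
  have h1 : ‖u‖ < R := by simpa using hu
  have h2 : ‖y‖ ≤ ‖y - u‖ + ‖u‖ := by simpa using norm_add_le (y - u) u
  have := H.le; have := H.pos; have := H.nonneg
  simp only [mem_ball, dist_zero_right]
  linarith

lemma norm_fderiv_le {x : E} (hx : x ∈ ball (0 : E) (R + 2 * η)) :
    ‖fderiv ℂ f x‖ ≤ 2 * M / η :=
  norm_fderiv_le_of_bounded H.pos (H.diff.mono (ball_subset_ball_add hx))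
    fun z hz => H.bound z (ball_subset_ball_add hx hz)

lemma rate_nonneg : 0 ≤ 2 * M / η := div_nonneg (by linarith [H.nonneg]) H.pos.le

lemma rate_le : 2 * M / η ≤ 1 / 4 := by
  rw [div_le_iff₀ H.pos]; linarith [H.le]

lemma norm_sub_le {x y : E} (hx : x ∈ ball (0 : E) (R + 2 * η))
    (hy : y ∈ ball (0 : E) (R + 2 * η)) : ‖f y - f x‖ ≤ 2 * M / η * ‖y - x‖ :=
  (convex_ball (0 : E) (R + 2 * η)).norm_image_sub_le_of_norm_fderiv_le (𝕜 := ℂ)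
    (fun z hz => (H.diff z (ball_subset_ball (by linarith [H.pos]) hz)).differentiableAt
      (isOpen_ball.mem_nhds (ball_subset_ball (by linarith [H.pos]) hz)))
    (fun z hz => H.norm_fderiv_le hz) hx hy

lemma ball_mono : ball (0 : E) (R + η) ⊆ ball 0 (R + 2 * η) :=
  ball_subset_ball (by linarith [H.pos])

lemma exists_isFlow [CompleteSpace E] : ∃ φ, IsFlow f R M φ := by
  have : ∀ u ∈ ball (0 : E) R, ∃ y : ℝ → E, y 0 = u ∧ (∀ t ∈ Icc (0 : ℝ) 1, y t ∈ closedBall u M) ∧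
      ∀ t ∈ Icc (0 : ℝ) 1, HasDerivWithinAt y (f (y t)) (Icc 0 1) t := by
    intro u hu
    have hsub : closedBall u M ⊆ ball 0 (R + 2 * η) := fun y hy =>
      H.ball_mono (H.mem_of_near hu (by rwa [← dist_eq_norm]))
    refine exists_trajectory (f := fun _ => f) (a := ⟨M, H.nonneg⟩) (K := ⟨2 * M / η, H.rate_nonneg⟩)
      (fun t _ => ?_) (fun _ _ => continuousOn_const) fun t _ x hx => ?_
    · refine LipschitzOnWith.of_dist_le_mul fun x hx y hy => ?_
      rw [dist_eq_norm, dist_eq_norm]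
      exact H.norm_sub_le (hsub hy) (hsub hx)
    · exact H.bound x (ball_subset_ball (by linarith [H.pos]) (hsub hx))
  choose! y hy using this
  refine ⟨fun t u => y u t, fun u hu => (hy u hu).1, fun u hu t ht => (hy u hu).2.2 t ht,
    fun u hu t ht => ?_⟩
  rw [← dist_eq_norm]; exact (hy u hu).2.1 t ht

variable {φ : ℝ → E → E} (hφ : IsFlow f R M φ)
include hφ

lemma flow_mem {u : E} (hu : u ∈ ball (0 : E) R) {t : ℝ} (ht : t ∈ Icc (0 : ℝ) 1) :
    φ t u ∈ ball (0 : E) (R + η) := H.mem_of_near hu (hφ.near u hu t ht)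

lemma flow_unique {u : E} (hu : u ∈ ball (0 : E) R) {y : ℝ → E} (h0 : y 0 = u)
    (hy : ∀ t ∈ Icc (0 : ℝ) 1, HasDerivWithinAt y (f (y t)) (Icc 0 1) t)
    (hmem : ∀ t ∈ Icc (0 : ℝ) 1, y t ∈ ball (0 : E) (R + 2 * η)) :
    ∀ t ∈ Icc (0 : ℝ) 1, y t = φ t u := by
  intro t ht
  have := norm_le_of_approx_linear (z := fun t => y t - φ t u) (δ := 0) (ε := 0) H.rate_nonneg le_rfl
    (fun t ht => (hy t ht).sub (hφ.deriv u hu t ht)) (by simp [h0, hφ.zero u hu])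
    (fun t ht => by
      simpa using H.norm_sub_le (H.ball_mono (H.flow_mem hφ hu ht)) (hmem t ht)) t ht
  simpa [sub_eq_zero] using this

lemma norm_flow_sub_le {u u' : E} (hu : u ∈ ball (0 : E) R) (hu' : u' ∈ ball (0 : E) R) {t : ℝ}
    (ht : t ∈ Icc (0 : ℝ) 1) : ‖φ t u' - φ t u‖ ≤ ‖u' - u‖ * Real.exp (2 * M / η) := by
  have := norm_le_of_approx_linear (z := fun t => φ t u' - φ t u) (δ := ‖u' - u‖) (ε := 0)
    H.rate_nonneg le_rfl
    (fun t ht => (hφ.deriv u' hu' t ht).sub (hφ.deriv u hu t ht))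
    (by simp [hφ.zero u hu, hφ.zero u' hu'])
    (fun t ht => by
      simpa using H.norm_sub_le (H.ball_mono (H.flow_mem hφ hu ht))
        (H.ball_mono (H.flow_mem hφ hu' ht))) t ht
  simpa using this

/-- The displacement difference has derivative f(φ u') - f(φ u), of size 2M/η times the distance of
the trajectories, and that distance at most doubles since 2M/η ≤ 1/4. A Lipschitz bound for φ 1 -
id, rather than for φ 1, is what can be summed over the compositions. -/
lemma norm_flow_sub_sub_le {u u' : E} (hu : u ∈ ball (0 : E) R) (hu' : u' ∈ ball (0 : E) R) :
    ‖(φ 1 u' - u') - (φ 1 u - u)‖ ≤ 4 * M / η * ‖u' - u‖ := by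
  have hexp : Real.exp (2 * M / η) ≤ 2 := by
    refine (Real.exp_le_exp.2 (H.rate_le.trans (by norm_num : (1 / 4 : ℝ) ≤ 1 / 2))).trans ?_
    have : Real.exp (1 / 2) ^ 2 = Real.exp 1 := by rw [← Real.exp_nat_mul]; norm_num
    nlinarith [Real.exp_one_lt_d9, Real.exp_pos (1 / 2)]
  have := norm_image_sub_le_of_norm_deriv_le_segment' (f := fun t => φ t u' - φ t u) (a := 0) (b := 1)
    (C := 2 * M / η * (‖u' - u‖ * Real.exp (2 * M / η)))
    (fun t ht => (hφ.deriv u' hu' t ht).sub (hφ.deriv u hu t ht))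
    (fun t ht => (H.norm_sub_le (H.ball_mono (H.flow_mem hφ hu (Ico_subset_Icc_self ht)))
        (H.ball_mono (H.flow_mem hφ hu' (Ico_subset_Icc_self ht)))).trans
        (mul_le_mul_of_nonneg_left (H.norm_flow_sub_le hφ hu hu' (Ico_subset_Icc_self ht))
          H.rate_nonneg)) 1 (by simp)
  simp only [hφ.zero u hu, hφ.zero u' hu', sub_zero, mul_one] at this
  calc ‖(φ 1 u' - u') - (φ 1 u - u)‖ = ‖φ 1 u' - φ 1 u - (u' - u)‖ := by congr 1; abel
    _ ≤ _ := this
    _ ≤ 2 * M / η * (‖u' - u‖ * 2) := by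
        gcongr
        exact H.rate_nonneg
    _ = _ := by ring

lemma continuousOn_fderiv_flow [CompleteSpace E] {u : E} (hu : u ∈ ball (0 : E) R) :
    ContinuousOn (fun t => fderiv ℂ f (φ t u)) (Icc (0 : ℝ) 1) :=
  (differentiableOn_fderiv isOpen_ball H.diff).continuousOn.comp
    (fun t ht => (hφ.deriv u hu t ht).continuousWithinAt)
    fun t ht => ball_subset_ball (by linarith [H.pos]) (H.flow_mem hφ hu ht)

/-- The derivative of the time-one flow solves the variational equation. -/
lemma exists_variational [CompleteSpace E] {u : E} (hu : u ∈ ball (0 : E) R) :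
    ∃ U : ℝ → E →L[ℂ] E, U 0 = ContinuousLinearMap.id ℂ E ∧
      (∀ t ∈ Icc (0 : ℝ) 1,
        HasDerivWithinAt U ((fderiv ℂ f (φ t u)).comp (U t)) (Icc 0 1) t) ∧
      HasFDerivAt (φ 1) (U 1) u := by
  have hA : ∀ t ∈ Icc (0 : ℝ) 1, ‖fderiv ℂ f (φ t u)‖ ≤ 2 * M / η := fun t ht =>
    H.norm_fderiv_le (H.ball_mono (H.flow_mem hφ hu ht))
  obtain ⟨U, hU0, -, hU⟩ := exists_trajectory (G := E →L[ℂ] E)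
    (f := fun t U => (fderiv ℂ f (φ t u)).comp U) (x₀ := ContinuousLinearMap.id ℂ E) (a := 1)
    (K := ⟨2 * M / η, H.rate_nonneg⟩)
    (fun t ht => by
      refine LipschitzOnWith.of_dist_le_mul fun x _ y _ => ?_
      rw [dist_eq_norm, dist_eq_norm, ← ContinuousLinearMap.comp_sub]
      refine (ContinuousLinearMap.opNorm_comp_le _ _).trans ?_
      exact mul_le_mul_of_nonneg_right (hA t ht) (norm_nonneg _))
    (fun x _ => (H.continuousOn_fderiv_flow hφ hu).clm_comp continuousOn_const)
    (fun t ht x hx => by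
      have h1 : ‖x‖ ≤ 2 := by
        have h2 := norm_add_le (x - ContinuousLinearMap.id ℂ E) (ContinuousLinearMap.id ℂ E)
        have h3 : ‖x - ContinuousLinearMap.id ℂ E‖ ≤ 1 := by
          rw [← dist_eq_norm]; simpa using hx
        have h4 := ContinuousLinearMap.norm_id_le (𝕜 := ℂ) (E := E)
        rw [sub_add_cancel] at h2
        linarith
      refine (ContinuousLinearMap.opNorm_comp_le _ _).trans ?_
      have := mul_le_mul ((hA t ht).trans H.rate_le) h1 (norm_nonneg _) (by norm_num)
      simp only [NNReal.coe_one]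
      linarith)
  refine ⟨U, hU0, hU, ?_⟩
  have hRu : 0 < R - ‖u‖ := by have : ‖u‖ < R := by simpa using hu
                               linarith
  have hexp := Real.exp_pos (2 * M / η)
  -- The second entry of the minimum keeps the two trajectories within η of each other, where the
  -- quadratic remainder of f is available.
  refine hasFDerivAt_of_norm_sub_le_sq (ρ := min (R - ‖u‖) (η / Real.exp (2 * M / η)))
    (K := 4 * M / η ^ 2 * Real.exp (2 * M / η) ^ 2 * Real.exp (2 * M / η))
    (lt_min hRu (div_pos H.pos hexp)) fun v hv => ?_
  have hv1 : u + v ∈ ball (0 : E) R := by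
    have := norm_add_le u v
    have := hv.trans_le (min_le_left _ _)
    simp only [mem_ball, dist_zero_right]; linarith
  have hv2 : ‖v‖ * Real.exp (2 * M / η) < η := by
    have := hv.trans_le (min_le_right _ _)
    rwa [lt_div_iff₀ hexp] at this
  have hUv : ∀ t ∈ Icc (0 : ℝ) 1,
      HasDerivWithinAt (fun t => U t v) (fderiv ℂ f (φ t u) (U t v)) (Icc 0 1) t := fun t ht =>
    (((ContinuousLinearMap.apply ℂ E v).restrictScalars ℝ).hasFDerivAt.comp_hasDerivWithinAt t
      (hU t ht))
  have := norm_le_of_approx_linear (z := fun t => φ t (u + v) - φ t u - U t v) (δ := 0)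
    (K := 2 * M / η) (ε := 4 * M / η ^ 2 * Real.exp (2 * M / η) ^ 2 * ‖v‖ ^ 2)
    H.rate_nonneg (by have := H.nonneg; positivity)
    (fun t ht => ((hφ.deriv _ hv1 t ht).sub (hφ.deriv u hu t ht)).sub (hUv t ht))
    (by simp [hφ.zero u hu, hφ.zero _ hv1, hU0]) (fun t ht => by
      have hd : ‖φ t (u + v) - φ t u‖ ≤ ‖v‖ * Real.exp (2 * M / η) := by
        simpa using H.norm_flow_sub_le hφ hu hv1 ht
      have hx := ball_subset_ball_add (H.ball_mono (H.flow_mem hφ hu ht))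
      have hq := norm_sub_sub_fderiv_le H.pos (H.diff.mono hx) (fun z hz => H.bound z (hx hz))
        (hd.trans_lt hv2)
      rw [add_sub_cancel] at hq
      have e : f (φ t (u + v)) - f (φ t u) - fderiv ℂ f (φ t u) (U t v)
          = fderiv ℂ f (φ t u) (φ t (u + v) - φ t u - U t v)
            + (f (φ t (u + v)) - f (φ t u) - fderiv ℂ f (φ t u) (φ t (u + v) - φ t u)) := by
        simp only [map_sub]; abel
      rw [e]
      refine (norm_add_le _ _).trans (add_le_add ?_ ?_)
      · refine (ContinuousLinearMap.le_opNorm _ _).trans ?_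
        exact mul_le_mul_of_nonneg_right (hA t ht) (norm_nonneg _)
      · refine hq.trans ?_
        have := H.nonneg
        calc 4 * M / η ^ 2 * ‖φ t (u + v) - φ t u‖ ^ 2
            ≤ 4 * M / η ^ 2 * (‖v‖ * Real.exp (2 * M / η)) ^ 2 := by gcongr
          _ = _ := by ring) 1 (by simp)
  refine this.trans (le_of_eq (by ring))

lemma differentiableOn_flow [CompleteSpace E] : DifferentiableOn ℂ (φ 1) (ball 0 R) := fun _ hu =>
  let ⟨_, _, _, h⟩ := H.exists_variational hφ hu
  h.differentiableAt.differentiableWithinAt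

/-- Gronwall compares ζ N with the exact solution U(t)v. Only approximate solutions are required, so
an infinite series can be used through its partial sums, without differentiating it term by term. -/
lemma fderiv_flow_apply_eq [CompleteSpace E] {u : E} (hu : u ∈ ball (0 : E) R) {ζ : ℕ → ℝ → E}
    {e : ℕ → ℝ → E} {ε : ℕ → ℝ} {v w : E}
    (hζ : ∀ N, ∀ t ∈ Icc (0 : ℝ) 1,
      HasDerivWithinAt (ζ N) (fderiv ℂ f (φ t u) (ζ N t) + e N t) (Icc 0 1) t)
    (he : ∀ N, ∀ t ∈ Icc (0 : ℝ) 1, ‖e N t‖ ≤ ε N) (hε : Tendsto ε atTop (𝓝 0))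
    (h0 : Tendsto (fun N => ζ N 0) atTop (𝓝 v)) (h1 : Tendsto (fun N => ζ N 1) atTop (𝓝 w)) :
    fderiv ℂ (φ 1) u v = w := by
  obtain ⟨U, hU0, hU, hUd⟩ := H.exists_variational hφ hu
  have hA : ∀ t ∈ Icc (0 : ℝ) 1, ‖fderiv ℂ f (φ t u)‖ ≤ 2 * M / η := fun t ht =>
    H.norm_fderiv_le (H.ball_mono (H.flow_mem hφ hu ht))
  have hUv : ∀ t ∈ Icc (0 : ℝ) 1,
      HasDerivWithinAt (fun t => U t v) (fderiv ℂ f (φ t u) (U t v)) (Icc 0 1) t := fun t ht =>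
    (((ContinuousLinearMap.apply ℂ E v).restrictScalars ℝ).hasFDerivAt.comp_hasDerivWithinAt t
      (hU t ht))
  have key : ∀ N, ‖ζ N 1 - U 1 v‖ ≤ (‖ζ N 0 - v‖ + ε N) * Real.exp (2 * M / η) := fun N => by
    refine norm_le_of_approx_linear (z := fun t => ζ N t - U t v) H.rate_nonneg
      ((norm_nonneg _).trans (he N 0 (by simp))) (fun t ht => (hζ N t ht).sub (hUv t ht))
      (by simp [hU0]) (fun t ht => ?_) 1 (by simp)
    have e' : fderiv ℂ f (φ t u) (ζ N t) + e N t - fderiv ℂ f (φ t u) (U t v)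
        = fderiv ℂ f (φ t u) (ζ N t - U t v) + e N t := by rw [map_sub]; abel
    rw [e']
    refine (norm_add_le _ _).trans (add_le_add ?_ (he N t ht))
    refine (ContinuousLinearMap.le_opNorm _ _).trans ?_
    exact mul_le_mul_of_nonneg_right (hA t ht) (norm_nonneg _)
  have h2 : Tendsto (fun N => (‖ζ N 0 - v‖ + ε N) * Real.exp (2 * M / η)) atTop (𝓝 0) := by
    have := ((tendsto_iff_norm_sub_tendsto_zero.1 h0).add hε).mul_const (Real.exp (2 * M / η))
    simpa using this
  have h3 : Tendsto (fun N => ζ N 1) atTop (𝓝 (U 1 v)) :=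
    tendsto_iff_norm_sub_tendsto_zero.2 (squeeze_zero (fun _ => norm_nonneg _) key h2)
  rw [hUd.fderiv]
  exact tendsto_nhds_unique h3 h1

end FlowHyp

end Flow

end ResonantKAM

open scoped ENNReal Topology
open Filter Set

/-! ## Monomials -/

namespace ResonantKAM

noncomputable section

section Monomials

variable {R : Type*} [CommSemiring R]

/-- The monomial `x^q`. -/
def monom (x : Idx → R) (q : MIdx) : R := q.prod fun h n => x h ^ n

@[simp] lemma monom_zero (x : Idx → R) : monom x 0 = 1 := Finsupp.prod_zero_index

lemma monom_add (x : Idx → R) (a b : MIdx) : monom x (a + b) = monom x a * monom x b :=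
  Finsupp.prod_add_index' (fun _ => pow_zero _) fun _ _ _ => pow_add _ _ _

@[simp] lemma monom_single (x : Idx → R) (h : Idx) : monom x (unitIdx h) = x h := by
  simp [monom, unitIdx]

lemma monom_mul (x y : Idx → R) (q : MIdx) :
    monom (fun h => x h * y h) q = monom x q * monom y q := by
  simp [monom, Finsupp.prod, mul_pow, Finset.prod_mul_distrib]

lemma midx_induction {P : MIdx → Prop} (q : MIdx) (h0 : P 0)
    (h1 : ∀ q h, P q → P (q + unitIdx h)) : P q := by
  have : ∀ (n : ℕ) (h : Idx) (q : MIdx), P q → P (q + Finsupp.single h n) := by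
    intro n h q hq
    induction n with
    | zero => simpa using hq
    | succ n ih =>
      have := h1 _ h ih
      rwa [add_assoc, unitIdx, ← Finsupp.single_add] at this
  induction q using Finsupp.induction with
  | zero => exact h0
  | single_add h n q _ _ ih => rw [add_comm]; exact this n h q ih

/-- The derivative of the monomial `x^q` in the direction `v`. -/
def dmonom (x v : Idx → R) (q : MIdx) : R :=
  ∑ h ∈ q.support, (q h : R) * v h * monom x (q - unitIdx h)

lemma dmonom_eq_sum (x v : Idx → R) (q : MIdx) {S : Finset Idx} (hS : q.support ⊆ S) :
    dmonom x v q = ∑ h ∈ S, (q h : R) * v h * monom x (q - unitIdx h) := by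
  refine Finset.sum_subset hS fun h _ hh => ?_
  rw [Finsupp.notMem_support_iff.1 hh]; simp

@[simp] lemma dmonom_zero (x v : Idx → R) : dmonom x v 0 = 0 := by simp [dmonom]

lemma dmonom_add_unit (x v : Idx → R) (q : MIdx) (h : Idx) :
    dmonom x v (q + unitIdx h) = x h * dmonom x v q + v h * monom x q := by
  classical
  have h1 : (q + unitIdx h).support ⊆ insert h q.support := by
    intro j hj
    by_contra hn
    simp only [Finset.mem_insert, not_or, Finsupp.notMem_support_iff] at hn
    simp [unitIdx, hn.2, Ne.symm hn.1] at hj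
  rw [dmonom_eq_sum x v _ h1, dmonom_eq_sum x v q (Finset.subset_insert h _), Finset.mul_sum]
  have h2 : ∀ j ∈ insert h q.support, ((q + unitIdx h) j : R) * v j * monom x (q + unitIdx h - unitIdx j)
      = x h * ((q j : R) * v j * monom x (q - unitIdx j)) + if j = h then v h * monom x q else 0 := by
    intro j _
    by_cases hjh : j = h
    · subst hjh
      simp only [Finsupp.add_apply, add_tsub_cancel_right, if_true]
      rcases Nat.eq_zero_or_pos (q j) with h0 | h0
      · simp [h0, unitIdx]
      · have : monom x q = x j * monom x (q - unitIdx j) := by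
          conv_lhs => rw [← tsub_add_cancel_of_le (show unitIdx j ≤ q from
            Finsupp.single_le_iff.2 h0)]
          rw [monom_add, monom_single, mul_comm]
        simp only [unitIdx, Finsupp.single_eq_same]
        rw [this]; push_cast [unitIdx]; ring
    · have hz : (unitIdx h) j = 0 := by simp [unitIdx, Ne.symm hjh]
      simp only [Finsupp.add_apply, hz, add_zero, if_neg hjh]
      rcases Nat.eq_zero_or_pos (q j) with h0 | h0
      · simp [h0]
      · rw [tsub_add_eq_add_tsub (show unitIdx j ≤ q from Finsupp.single_le_iff.2 h0) |>.symm,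
          monom_add, monom_single]
        ring
  rw [Finset.sum_congr rfl h2, Finset.sum_add_distrib, Finset.sum_ite_eq' _ h]
  simp

lemma dmonom_add_right (x v w : Idx → R) (q : MIdx) :
    dmonom x (fun h => v h + w h) q = dmonom x v q + dmonom x w q := by
  simp only [dmonom, ← Finset.sum_add_distrib]
  exact Finset.sum_congr rfl fun h _ => by ring

lemma dmonom_smul_right (x v : Idx → R) (c : R) (q : MIdx) :
    dmonom x (fun h => c * v h) q = c * dmonom x v q := by
  simp only [dmonom, Finset.mul_sum]
  exact Finset.sum_congr rfl fun h _ => by ring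

end Monomials

lemma enorm_monom (x : Idx → ℂ) (q : MIdx) : ‖monom x q‖ₑ = monom (fun h => ‖x h‖ₑ) q := by
  induction q using midx_induction with
  | h0 => simp
  | h1 q h ih => simp [monom_add, ih, enorm_mul]

lemma enorm_dmonom_le (x v : Idx → ℂ) (q : MIdx) :
    ‖dmonom x v q‖ₑ ≤ dmonom (fun h => ‖x h‖ₑ) (fun h => ‖v h‖ₑ) q := by
  refine (enorm_sum_le _ _).trans (Finset.sum_le_sum fun h _ => ?_)
  rw [enorm_mul, enorm_mul, enorm_monom]
  gcongr
  rw [← ofReal_norm, Complex.norm_natCast, ENNReal.ofReal_natCast]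

lemma monom_add_dmonom_le (u v : Idx → ℝ≥0∞) (q : MIdx) :
    monom u q + dmonom u v q ≤ monom (fun h => u h + v h) q := by
  induction q using midx_induction with
  | h0 => simp
  | h1 q h ih =>
    rw [monom_add, monom_single, dmonom_add_unit, monom_add, monom_single]
    calc monom u q * u h + (u h * dmonom u v q + v h * monom u q)
        ≤ monom u q * u h + (u h * dmonom u v q + v h * monom u q) + v h * dmonom u v q :=
          le_self_add
      _ = (monom u q + dmonom u v q) * (u h + v h) := by ring
      _ ≤ _ := by gcongr

/-- Second order Taylor estimate for monomials. -/
lemma enorm_monom_sub_le (x v : Idx → ℂ) {t : ℝ≥0∞} (ht : 1 ≤ t) (q : MIdx) :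
    t ^ 2 * ‖monom (fun h => x h + v h) q - monom x q - dmonom x v q‖ₑ
      + t * dmonom (fun h => ‖x h‖ₑ) (fun h => ‖v h‖ₑ) q + monom (fun h => ‖x h‖ₑ) q
      ≤ monom (fun h => ‖x h‖ₑ + t * ‖v h‖ₑ) q := by
  induction q using midx_induction with
  | h0 => simp
  | h1 q h ih =>
    set u : Idx → ℝ≥0∞ := fun h => ‖x h‖ₑ
    set w : Idx → ℝ≥0∞ := fun h => ‖v h‖ₑ
    set A := ‖monom (fun h => x h + v h) q - monom x q - dmonom x v q‖ₑ with hA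
    have e : monom (fun h => x h + v h) (q + unitIdx h) - monom x (q + unitIdx h)
        - dmonom x v (q + unitIdx h)
        = (x h + v h) * (monom (fun h => x h + v h) q - monom x q - dmonom x v q)
          + v h * dmonom x v q := by
      rw [monom_add, monom_single, monom_add, monom_single, dmonom_add_unit]; ring
    have h1 : ‖(x h + v h) * (monom (fun h => x h + v h) q - monom x q - dmonom x v q)
          + v h * dmonom x v q‖ₑ ≤ (u h + w h) * A + w h * dmonom u w q := by
      refine (enorm_add_le _ _).trans ?_
      rw [enorm_mul, enorm_mul]
      gcongr
      · exact enorm_add_le _ _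
      · exact enorm_dmonom_le x v q
    -- Here 1 ≤ t enters: the cross term of v with the old remainder carries only t², while the
    -- product on the right offers t³.
    have ht2 : t ^ 2 * w h * A ≤ t * w h * (t ^ 2 * A) := by
      calc t ^ 2 * w h * A = 1 * (t ^ 2 * w h * A) := (one_mul _).symm
        _ ≤ t * (t ^ 2 * w h * A) := by gcongr
        _ = _ := by ring
    rw [e, dmonom_add_unit, monom_add, monom_single, monom_add, monom_single]
    calc _ ≤ t ^ 2 * ((u h + w h) * A + w h * dmonom u w q)
          + t * (u h * dmonom u w q + w h * monom u q) + monom u q * u h := by gcongr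
      _ = u h * (t ^ 2 * A) + t ^ 2 * w h * A + t ^ 2 * w h * dmonom u w q
          + t * u h * dmonom u w q + t * w h * monom u q + monom u q * u h := by ring
      _ ≤ u h * (t ^ 2 * A) + t * w h * (t ^ 2 * A) + t ^ 2 * w h * dmonom u w q
          + t * u h * dmonom u w q + t * w h * monom u q + monom u q * u h := by gcongr
      _ = (t ^ 2 * A + t * dmonom u w q + monom u q) * (u h + t * w h) := by ring
      _ ≤ _ := by gcongr

/-! ## Weighted norms and the majorant norm -/

/-- The norm of `g_s` for sequences in `[0, ∞]`. -/
def wNorm (s : ℝ) (u : Idx → ℝ≥0∞) : ℝ≥0∞ :=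
  (∑' k, (ENNReal.ofReal (wt s k) * u k) ^ 2) ^ (1 / 2 : ℝ)

lemma ofReal_wt_pos (s : ℝ) (k : Idx) : 0 < ENNReal.ofReal (wt s k) :=
  ENNReal.ofReal_pos.2 (wt_pos s k)

lemma wNorm_le_iff {s : ℝ} {u : Idx → ℝ≥0∞} {T : ℝ≥0∞} :
    wNorm s u ≤ T ↔ ∑' k, (ENNReal.ofReal (wt s k) * u k) ^ 2 ≤ T ^ 2 := by
  rw [wNorm, one_div, ENNReal.rpow_inv_le_iff (by norm_num)]
  norm_num

lemma wNorm_mono {s : ℝ} {u v : Idx → ℝ≥0∞} (h : u ≤ v) : wNorm s u ≤ wNorm s v := by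
  refine ENNReal.rpow_le_rpow (ENNReal.tsum_le_tsum fun k => ?_) (by norm_num)
  gcongr
  exact h k

lemma wNorm_const_mul (s : ℝ) (c : ℝ≥0∞) (u : Idx → ℝ≥0∞) :
    wNorm s (fun k => c * u k) = c * wNorm s u := by
  simp only [wNorm]
  have : ∀ k, (ENNReal.ofReal (wt s k) * (c * u k)) ^ 2
      = c ^ 2 * (ENNReal.ofReal (wt s k) * u k) ^ 2 := fun k => by ring
  simp_rw [this]
  rw [ENNReal.tsum_mul_left, ENNReal.mul_rpow_of_nonneg _ _ (by norm_num : (0 : ℝ) ≤ 1 / 2)]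
  congr 1
  rw [← ENNReal.rpow_natCast, ← ENNReal.rpow_mul]
  norm_num

lemma wNorm_add_le (s : ℝ) (u v : Idx → ℝ≥0∞) :
    wNorm s (fun k => u k + v k) ≤ wNorm s u + wNorm s v := by
  let _ : MeasurableSpace Idx := ⊤
  have := ENNReal.lintegral_Lp_add_le (μ := MeasureTheory.Measure.count) (p := 2)
    (f := fun k => ENNReal.ofReal (wt s k) * u k) (g := fun k => ENNReal.ofReal (wt s k) * v k)
    (measurable_of_countable _).aemeasurable (measurable_of_countable _).aemeasurable (by norm_num)
  simp only [MeasureTheory.lintegral_count, Pi.add_apply, ← mul_add, ENNReal.rpow_ofNat] at this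
  exact this

lemma le_wNorm (s : ℝ) (u : Idx → ℝ≥0∞) (k : Idx) :
    ENNReal.ofReal (wt s k) * u k ≤ wNorm s u := by
  rw [wNorm, one_div, ENNReal.le_rpow_inv_iff (by norm_num)]
  have := ENNReal.le_tsum (f := fun k => (ENNReal.ofReal (wt s k) * u k) ^ 2) k
  simpa using this

lemma wNorm_zero (s : ℝ) : wNorm s (fun _ => 0) = 0 := by simp [wNorm]

lemma wNorm_sum_le {ι : Type*} (s : ℝ) (A : Finset ι) (u : ι → Idx → ℝ≥0∞) :
    wNorm s (fun k => ∑ n ∈ A, u n k) ≤ ∑ n ∈ A, wNorm s (u n) := by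
  classical
  induction A using Finset.induction_on with
  | empty => simp [wNorm_zero]
  | insert a A ha ih =>
    simp only [Finset.sum_insert ha]
    exact (wNorm_add_le s _ _).trans (by gcongr)

lemma wNorm_tsum_le (s : ℝ) (u : ℕ → Idx → ℝ≥0∞) :
    wNorm s (fun k => ∑' n, u n k) ≤ ∑' n, wNorm s (u n) := by
  rw [wNorm_le_iff]
  refine ENNReal.summable.tsum_le_of_sum_le fun A => ?_
  have hlim : Tendsto (fun N => ∑ k ∈ A, (ENNReal.ofReal (wt s k) * ∑ n ∈ Finset.range N, u n k) ^ 2)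
      atTop (𝓝 (∑ k ∈ A, (ENNReal.ofReal (wt s k) * ∑' n, u n k) ^ 2)) := by
    refine tendsto_finsetSum _ fun k _ => ?_
    refine ENNReal.Tendsto.pow (ENNReal.Tendsto.const_mul (ENNReal.tendsto_nat_tsum _)
      (Or.inr ENNReal.ofReal_ne_top))
  refine le_of_tendsto hlim (Eventually.of_forall fun N => ?_)
  refine (ENNReal.sum_le_tsum A).trans (wNorm_le_iff.1 ?_)
  exact (wNorm_sum_le s _ _).trans (ENNReal.sum_le_tsum _)

lemma lt_top_of_wNorm_lt_top {s : ℝ} {u : Idx → ℝ≥0∞} (h : wNorm s u < ⊤) (k : Idx) : u k < ⊤ := by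
  by_contra hn
  have hk : u k = ⊤ := by simpa using hn
  have := le_wNorm s u k
  rw [hk, ENNReal.mul_top (ofReal_wt_pos s k).ne'] at this
  exact absurd (this.trans_lt h) (by simp)

lemma eq_zero_of_wNorm_eq_zero {s : ℝ} {u : Idx → ℝ≥0∞} (h : wNorm s u = 0) : u = 0 := by
  funext k
  have := le_wNorm s u k
  rw [h, nonpos_iff_eq_zero, mul_eq_zero] at this
  exact this.resolve_left (ofReal_wt_pos s k).ne'

lemma sq_wt_enorm (s : ℝ) (x : Idx → ℂ) (k : Idx) : (ENNReal.ofReal (wt s k) * ‖x k‖ₑ) ^ 2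
    = ENNReal.ofReal (‖(wt s k : ℂ) * x k‖ ^ 2) := by
  rw [norm_mul, Complex.norm_real, Real.norm_of_nonneg (wt_pos s k).le,
    ENNReal.ofReal_pow (by have := (wt_pos s k).le; positivity),
    ENNReal.ofReal_mul (wt_pos s k).le, ofReal_norm]

lemma mem_weightedL2_iff {s : ℝ} {x : Idx → ℂ} :
    x ∈ weightedL2 s ↔ wNorm s (fun k => ‖x k‖ₑ) < ⊤ := by
  have h1 : x ∈ weightedL2 s ↔ Summable fun k => ‖(wt s k : ℂ) * x k‖ ^ 2 := by
    change Memℓp _ 2 ↔ _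
    rw [memℓp_gen_iff (by norm_num)]
    simp
  rw [h1, wNorm]
  simp_rw [sq_wt_enorm]
  constructor
  · intro h
    rw [← ENNReal.ofReal_tsum_of_nonneg (fun _ => by positivity) h]
    exact ENNReal.rpow_lt_top_of_nonneg (by norm_num) ENNReal.ofReal_ne_top
  · intro h
    have h2 : ∑' k, ENNReal.ofReal (‖(wt s k : ℂ) * x k‖ ^ 2) ≠ ⊤ := fun hn => by
      rw [hn, ENNReal.top_rpow_of_pos (by norm_num)] at h
      exact lt_irrefl _ h
    have := ENNReal.summable_toReal h2
    exact this.congr fun k => by rw [ENNReal.toReal_ofReal (by positivity)]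

lemma enorm_eq_wNorm {s : ℝ} (x : G s) : ‖x‖ₑ = wNorm s fun k => ‖x.1 k‖ₑ := by
  have h : Summable fun k => ‖(wt s k : ℂ) * x.1 k‖ ^ 2 := by
    have := (memℓp_gen_iff (p := 2) (by norm_num)).1 x.2
    simpa using this
  have h3 : ‖x‖ ^ 2 = ∑' k, ‖(wt s k : ℂ) * x.1 k‖ ^ 2 := by
    have h2 := lp.norm_rpow_eq_tsum (p := 2) (by norm_num) (toL2 s x)
    simp only [ENNReal.toReal_ofNat, Real.rpow_ofNat] at h2
    exact h2
  rw [wNorm]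
  simp_rw [sq_wt_enorm]
  rw [← ENNReal.ofReal_tsum_of_nonneg (fun _ => by positivity) h, ← h3,
    ENNReal.ofReal_pow (norm_nonneg _), ofReal_norm, ← ENNReal.rpow_natCast, ← ENNReal.rpow_mul]
  norm_num

lemma norm_lt_iff_wNorm {s r : ℝ} (x : G s) :
    ‖x‖ < r ↔ wNorm s (fun k => ‖x.1 k‖ₑ) < ENNReal.ofReal r := by
  rw [← enorm_eq_wNorm, ← ofReal_norm, ENNReal.ofReal_lt_ofReal_iff']
  exact ⟨fun h => ⟨h, (norm_nonneg _).trans_lt h⟩, fun h => h.1⟩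

/-- This allows the supremum over g_s in `vnorm` to be tested on arbitrary sequences in [0, ∞] of
finite weighted norm. -/
lemma exists_G_of_wNorm_lt_top {s : ℝ} {u : Idx → ℝ≥0∞} (h : wNorm s u < ⊤) :
    ∃ x : G s, (fun k => ‖x.1 k‖ₑ) = u := by
  have hk : ∀ k, ‖((u k).toReal : ℂ)‖ₑ = u k := fun k => by
    rw [← ofReal_norm, Complex.norm_real, Real.norm_of_nonneg ENNReal.toReal_nonneg,
      ENNReal.ofReal_toReal (lt_top_of_wNorm_lt_top h k).ne]
  exact ⟨⟨fun k => ((u k).toReal : ℂ), mem_weightedL2_iff.2 (by simpa only [hk] using h)⟩,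
    funext hk⟩

/-- The majorant of `V` on sequences in `[0, ∞]`. -/
def maj (V : VF) (u : Idx → ℝ≥0∞) (k : Idx) : ℝ≥0∞ := ∑' q, ‖V k q‖ₑ * monom u q

lemma vnorm_eq (s r : ℝ) (V : VF) : vnorm s r V =
    (⨆ x : G s, ⨆ _ : ‖x‖ < r, wNorm s (maj V fun h => ‖x.1 h‖ₑ)) / ENNReal.ofReal r := rfl

lemma wNorm_maj_le {s r : ℝ} (hr : 0 < r) (V : VF) {u : Idx → ℝ≥0∞}
    (hu : wNorm s u < ENNReal.ofReal r) :
    wNorm s (maj V u) ≤ ENNReal.ofReal r * vnorm s r V := by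
  obtain ⟨x, rfl⟩ := exists_G_of_wNorm_lt_top (hu.trans ENNReal.ofReal_lt_top)
  rw [vnorm_eq, ENNReal.mul_div_cancel (ENNReal.ofReal_pos.2 hr).ne' ENNReal.ofReal_ne_top]
  exact le_iSup₂ (f := fun (x : G s) (_ : ‖x‖ < r) => wNorm s (maj V fun h => ‖x.1 h‖ₑ)) x
    ((norm_lt_iff_wNorm x).2 hu)

lemma vnorm_le {s r : ℝ} {V : VF} {C : ℝ≥0∞}
    (h : ∀ u, wNorm s u < ENNReal.ofReal r → wNorm s (maj V u) ≤ ENNReal.ofReal r * C) :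
    vnorm s r V ≤ C := by
  rw [vnorm_eq]
  refine ENNReal.div_le_of_le_mul' (iSup₂_le fun x hx => h _ ((norm_lt_iff_wNorm x).1 hx))

lemma maj_mono_coeff {V W : VF} (h : ∀ k q, ‖V k q‖ₑ ≤ ‖W k q‖ₑ) (u : Idx → ℝ≥0∞) :
    maj V u ≤ maj W u := fun k =>
  ENNReal.tsum_le_tsum fun q => mul_le_mul_left (h k q) _

lemma maj_add_le (V W : VF) (u : Idx → ℝ≥0∞) (k : Idx) :
    maj (V + W) u k ≤ maj V u k + maj W u k := by
  rw [maj, maj, maj, ← ENNReal.tsum_add]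
  refine ENNReal.tsum_le_tsum fun q => ?_
  rw [← add_mul]
  gcongr
  exact enorm_add_le _ _

lemma maj_smul (c : ℂ) (V : VF) (u : Idx → ℝ≥0∞) (k : Idx) :
    maj (c • V) u k = ‖c‖ₑ * maj V u k := by
  rw [maj, maj, ← ENNReal.tsum_mul_left]
  refine tsum_congr fun q => ?_
  rw [Pi.smul_apply, Pi.smul_apply, smul_eq_mul, enorm_mul, mul_assoc]

variable {s r : ℝ}

lemma vnorm_mono_coeff {V W : VF} (h : ∀ k q, ‖V k q‖ₑ ≤ ‖W k q‖ₑ) : vnorm s r V ≤ vnorm s r W := by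
  rw [vnorm_eq, vnorm_eq]
  refine ENNReal.div_le_div_right (iSup₂_mono fun x _ => wNorm_mono (maj_mono_coeff h _)) _

lemma vnorm_neg (V : VF) : vnorm s r (-V) = vnorm s r V :=
  le_antisymm (vnorm_mono_coeff fun k q => by simp) (vnorm_mono_coeff fun k q => by simp)

lemma vnorm_proj_le (J : Set MIdx) (V : VF) : vnorm s r (proj J V) ≤ vnorm s r V :=
  vnorm_mono_coeff fun k q => by
    classical
    simp only [proj, Set.indicator_apply]
    split_ifs <;> simp

lemma vnorm_add_le (hr : 0 < r) (V W : VF) :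
    vnorm s r (V + W) ≤ vnorm s r V + vnorm s r W := by
  refine vnorm_le fun u hu => ?_
  rw [mul_add]
  exact ((wNorm_mono fun k => maj_add_le V W u k).trans (wNorm_add_le s _ _)).trans
    (add_le_add (wNorm_maj_le hr V hu) (wNorm_maj_le hr W hu))

lemma vnorm_smul (hr : 0 < r) (c : ℂ) (V : VF) : vnorm s r (c • V) ≤ ‖c‖ₑ * vnorm s r V := by
  refine vnorm_le fun u hu => ?_
  have : maj (c • V) u = fun k => ‖c‖ₑ * maj V u k := funext fun k => maj_smul c V u k
  rw [this, wNorm_const_mul, mul_left_comm]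
  gcongr
  exact wNorm_maj_le hr V hu

lemma vnorm_tsum_le (hr : 0 < r) {V : VF} {W : ℕ → VF}
    (h : ∀ k q, ‖V k q‖ₑ ≤ ∑' n, ‖W n k q‖ₑ) : vnorm s r V ≤ ∑' n, vnorm s r (W n) := by
  refine vnorm_le fun u hu => ?_
  have h1 : maj V u ≤ fun k => ∑' n, maj (W n) u k := fun k => by
    simp only [maj]
    rw [ENNReal.tsum_comm]
    refine ENNReal.tsum_le_tsum fun q => ?_
    rw [ENNReal.tsum_mul_right]
    gcongr
    exact h k q
  refine (wNorm_mono h1).trans ((wNorm_tsum_le s _).trans ?_)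
  rw [← ENNReal.tsum_mul_left]
  exact ENNReal.tsum_le_tsum fun n => wNorm_maj_le hr (W n) hu

/-! ### Monotonicity in the parameters -/

/-- `√⟨k⟩` -/
def sj (k : Idx) : ℝ := Real.sqrt (jap k)

/-- `∑_h q_h √⟨h⟩` -/
def sjSum (q : MIdx) : ℝ := q.sum fun h n => (n : ℝ) * sj h

lemma one_le_jap (k : Idx) : 1 ≤ jap k := le_max_right _ _

lemma jap_pos (k : Idx) : 0 < jap k := one_pos.trans_le (one_le_jap k)

lemma one_le_sj (k : Idx) : 1 ≤ sj k := Real.one_le_sqrt.2 (one_le_jap k)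

lemma sj_sq (k : Idx) : sj k ^ 2 = jap k := Real.sq_sqrt (jap_pos k).le

lemma sjSum_add (a b : MIdx) : sjSum (a + b) = sjSum a + sjSum b :=
  Finsupp.sum_add_index' (by simp) fun _ _ _ => by push_cast; ring

lemma sjSum_unit (h : Idx) : sjSum (unitIdx h) = sj h := by simp [sjSum, unitIdx]

lemma sjSum_zero : sjSum 0 = 0 := by simp [sjSum]

lemma wt_add (s δ : ℝ) (k : Idx) : wt (s + δ) k = wt s k * Real.exp (δ * sj k) := by
  rw [wt, wt, mul_assoc, ← Real.exp_add, sj]; ring_nf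

lemma monom_exp (δ : ℝ) (q : MIdx) :
    monom (fun h => ENNReal.ofReal (Real.exp (δ * sj h))) q
      = ENNReal.ofReal (Real.exp (δ * sjSum q)) := by
  induction q using midx_induction with
  | h0 => simp [sjSum_zero]
  | h1 q h ih =>
    rw [monom_add, monom_single, ih, sjSum_add, sjSum_unit, mul_add, Real.exp_add,
      ENNReal.ofReal_mul (Real.exp_pos _).le]

/-- Replacing u_h by e^{δ√⟨h⟩}u_h turns the weight s + δ into s, and the monomial x^q ∂_k picks up
the exponential factor in the hypothesis. Thus a loss δ in s buys precisely this factor, to be spent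
against the small divisors. -/
lemma vnorm_le_of_coeff {s δ r : ℝ} (hr : 0 < r) {X Y : VF} {C : ℝ≥0∞}
    (h : ∀ k q, ‖X k q‖ₑ * ENNReal.ofReal (Real.exp (-(δ * (sjSum q - sj k)))) ≤ C * ‖Y k q‖ₑ) :
    vnorm (s + δ) r X ≤ C * vnorm s r Y := by
  refine vnorm_le fun u hu => ?_
  set e : Idx → ℝ≥0∞ := fun h => ENNReal.ofReal (Real.exp (δ * sj h)) with he
  have hwt : ∀ k, ENNReal.ofReal (wt (s + δ) k) = ENNReal.ofReal (wt s k) * e k := fun k => by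
    rw [wt_add, ENNReal.ofReal_mul (wt_pos s k).le]
  set u' : Idx → ℝ≥0∞ := fun h => e h * u h with hu'
  have h1 : wNorm (s + δ) u = wNorm s u' := by
    simp only [wNorm, hwt, hu', mul_assoc]
  have h2 : ∀ k, ENNReal.ofReal (wt (s + δ) k) * maj X u k
      ≤ ENNReal.ofReal (wt s k) * (C * maj Y u' k) := by
    intro k
    rw [hwt, mul_assoc]
    refine mul_le_mul' le_rfl ?_
    simp only [maj]
    rw [← ENNReal.tsum_mul_left, ← ENNReal.tsum_mul_left]
    refine ENNReal.tsum_le_tsum fun q => ?_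
    have h3 : monom u' q = ENNReal.ofReal (Real.exp (δ * sjSum q)) * monom u q := by
      rw [hu', monom_mul, he, monom_exp]
    have h4 : ENNReal.ofReal (Real.exp (-(δ * (sjSum q - sj k))))
        * ENNReal.ofReal (Real.exp (δ * sjSum q)) = e k := by
      rw [← ENNReal.ofReal_mul (Real.exp_pos _).le, ← Real.exp_add]
      simp only [he]; ring_nf
    calc e k * (‖X k q‖ₑ * monom u q)
        = (‖X k q‖ₑ * ENNReal.ofReal (Real.exp (-(δ * (sjSum q - sj k)))))
          * (ENNReal.ofReal (Real.exp (δ * sjSum q)) * monom u q) := by rw [← h4]; ring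
      _ ≤ (C * ‖Y k q‖ₑ) * (ENNReal.ofReal (Real.exp (δ * sjSum q)) * monom u q) := by
          exact mul_le_mul' (h k q) le_rfl
      _ = C * (‖Y k q‖ₑ * monom u' q) := by rw [h3]; ring
  calc wNorm (s + δ) (maj X u) ≤ wNorm s fun k => C * maj Y u' k := by
        refine ENNReal.rpow_le_rpow (ENNReal.tsum_le_tsum fun k => ?_) (by norm_num)
        exact pow_le_pow_left' (h2 k) 2
    _ = C * wNorm s (maj Y u') := wNorm_const_mul _ _ _
    _ ≤ C * (ENNReal.ofReal r * vnorm s r Y) := by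
        gcongr
        exact wNorm_maj_le hr Y (h1 ▸ hu)
    _ = _ := by ring

/-! ### Momentum conservation against the weights. -/

lemma abs_mom (k : Idx) : |(mom k : ℝ)| = |(k.1 : ℝ)| := by
  rcases Int.units_eq_one_or k.2 with h | h <;> simp [mom, h]

lemma jap_eq (k : Idx) : jap k = max |(mom k : ℝ)| 1 := by rw [abs_mom, jap]

/-- `∑_h q_h ⟨h⟩` -/
def japSum (q : MIdx) : ℝ := q.sum fun h n => (n : ℝ) * jap h

lemma japSum_add (a b : MIdx) : japSum (a + b) = japSum a + japSum b :=
  Finsupp.sum_add_index' (by simp) fun _ _ _ => by push_cast; ring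

lemma japSum_unit (h : Idx) : japSum (unitIdx h) = jap h := by simp [japSum, unitIdx]

lemma japSum_nonneg (q : MIdx) : 0 ≤ japSum q :=
  Finset.sum_nonneg fun h _ => mul_nonneg (Nat.cast_nonneg _) (jap_pos h).le

lemma sjSum_nonneg (q : MIdx) : 0 ≤ sjSum q :=
  Finset.sum_nonneg fun h _ => mul_nonneg (Nat.cast_nonneg _) (zero_le_one.trans (one_le_sj h))

lemma momDot_add (a b : MIdx) : momDot (a + b) = momDot a + momDot b :=
  Finsupp.sum_add_index' (by simp) fun _ _ _ => by push_cast; ring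

lemma momDot_unit (h : Idx) : momDot (unitIdx h) = mom h := by simp [momDot, unitIdx]

lemma abs_momDot_le (q : MIdx) : |(momDot q : ℝ)| ≤ japSum q := by
  induction q using midx_induction with
  | h0 => simp [momDot, japSum]
  | h1 q h ih =>
    rw [momDot_add, momDot_unit, japSum_add, japSum_unit, Int.cast_add]
    refine (abs_add_le _ _).trans (add_le_add ih ?_)
    rw [jap_eq]; exact le_max_left _ _

lemma exists_unit_le {q : MIdx} (hq : q ≠ 0) : ∃ h, q h ≠ 0 ∧ unitIdx h ≤ q := by
  obtain ⟨h, hh⟩ := Finsupp.ne_iff.1 hq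
  exact ⟨h, hh, Finsupp.single_le_iff.2 (Nat.one_le_iff_ne_zero.2 hh)⟩

lemma jap_le_japSum {q : MIdx} {k : Idx} (hq : q ≠ 0) (hm : momDot q = mom k) :
    jap k ≤ japSum q := by
  rw [jap_eq, ← hm]
  refine max_le (abs_momDot_le q) ?_
  obtain ⟨h, -, hh⟩ := exists_unit_le hq
  rw [← tsub_add_cancel_of_le hh, japSum_add, japSum_unit]
  linarith [one_le_jap h, japSum_nonneg (q - unitIdx h)]

lemma sqrt_japSum_le (q : MIdx) : Real.sqrt (japSum q) ≤ sjSum q := by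
  induction q using midx_induction with
  | h0 => simp [sjSum, japSum]
  | h1 q h ih =>
    rw [japSum_add, japSum_unit, sjSum_add, sjSum_unit]
    refine (?_ : _ ≤ Real.sqrt (japSum q) + sj h).trans (by gcongr)
    have h1 := Real.sq_sqrt (japSum_nonneg q)
    have h2 := Real.sqrt_nonneg (japSum q)
    have h3 := one_le_sj h
    refine Real.sqrt_le_iff.2 ⟨by linarith, ?_⟩
    nlinarith [sj_sq h]

lemma sj_le_sjSum {q : MIdx} {k : Idx} (hq : q ≠ 0) (hm : momDot q = mom k) : sj k ≤ sjSum q :=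
  (Real.sqrt_le_sqrt (jap_le_japSum hq hm)).trans (sqrt_japSum_le q)

/-- Momentum conservation is essential: it gives √⟨k⟩ ≤ ∑ q_h √⟨h⟩, so raising s never increases the
contribution of a monomial. -/
lemma vnorm_antitone_s {s s' r : ℝ} (hr : 0 < r) (hs : s ≤ s') {V : VF} (h0 : ∀ k, V k 0 = 0)
    (hm : ∀ k q, momDot q ≠ mom k → V k q = 0) : vnorm s' r V ≤ vnorm s r V := by
  have := vnorm_le_of_coeff (s := s) (δ := s' - s) hr (X := V) (Y := V) (C := 1) fun k q => by
    rw [one_mul]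
    by_cases hq : q = 0
    · simp [hq, h0]
    by_cases hk : momDot q = mom k
    · refine mul_le_of_le_one_right' (ENNReal.ofReal_le_one.2 (Real.exp_le_one_iff.2 ?_))
      have := sj_le_sjSum hq hk
      nlinarith
    · simp [hm k q hk]
  simpa using this

lemma monom_const_mul (c : ℝ≥0∞) (u : Idx → ℝ≥0∞) (q : MIdx) :
    monom (fun h => c * u h) q = c ^ len q * monom u q := by
  rw [monom_mul]
  congr 1
  simp [monom, len, Finsupp.prod, Finsupp.sum, Finset.prod_pow_eq_pow_sum]

lemma len_add (a b : MIdx) : len (a + b) = len a + len b :=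
  Finsupp.sum_add_index' (by simp) fun _ _ _ => rfl

@[simp] lemma len_unit (h : Idx) : len (unitIdx h) = 1 := by simp [len, unitIdx]

lemma len_pos {q : MIdx} (hq : q ≠ 0) : 1 ≤ len q := by
  obtain ⟨h, -, hh⟩ := exists_unit_le hq
  rw [← tsub_add_cancel_of_le hh, len_add, len_unit]; omega

/-- Without constant terms, scaling the argument by c ≥ 1 multiplies the majorant by at least c,
which compensates the division by the radius in the norm. -/
lemma vnorm_monotone_r {s r r' : ℝ} (hr : 0 < r) (hrr : r ≤ r') {V : VF} (h0 : ∀ k, V k 0 = 0) :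
    vnorm s r V ≤ vnorm s r' V := by
  have hr' : 0 < r' := hr.trans_le hrr
  refine vnorm_le fun u hu => ?_
  set c := ENNReal.ofReal (r' / r) with hc
  have hc1 : 1 ≤ c := ENNReal.one_le_ofReal.2 ((one_le_div hr).2 hrr)
  have hcr : c * ENNReal.ofReal r = ENNReal.ofReal r' := by
    rw [hc, ← ENNReal.ofReal_mul (by positivity)]; congr 1; field_simp
  have hcpos : c ≠ 0 := (zero_lt_one.trans_le hc1).ne'
  have h1 : wNorm s (fun h => c * u h) < ENNReal.ofReal r' := by
    rw [wNorm_const_mul, ← hcr]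
    exact (ENNReal.mul_lt_mul_iff_right hcpos ENNReal.ofReal_ne_top).2 hu
  have h2 : c * wNorm s (maj V u) ≤ wNorm s (maj V fun h => c * u h) := by
    rw [← wNorm_const_mul]
    refine wNorm_mono fun k => ?_
    rw [maj, maj, ← ENNReal.tsum_mul_left]
    refine ENNReal.tsum_le_tsum fun q => ?_
    by_cases hq : q = 0
    · simp [hq, h0]
    · rw [monom_const_mul, mul_left_comm]
      gcongr
      exact le_self_pow hc1 (Nat.one_le_iff_ne_zero.1 (len_pos hq))
  have h3 := h2.trans (wNorm_maj_le hr' V h1)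
  rw [← hcr, mul_assoc] at h3
  exact (ENNReal.mul_le_mul_iff_right hcpos ENNReal.ofReal_ne_top).1 h3

end

end ResonantKAM

open scoped ENNReal Topology
open Filter Set

/-! ## Small divisors and the homological equation -/

namespace ResonantKAM

noncomputable section

/-- The Diophantine weight `∏ (1 + p_i² ⟨i⟩²)^τ`. -/
def dioWeight (τ : ℝ) (p : Idx →₀ ℤ) : ℝ := p.prod fun i n => (1 + (n : ℝ) ^ 2 * jap i ^ 2) ^ τ

lemma dioWeight_eq_prod (τ : ℝ) (p : Idx →₀ ℤ) {S : Finset Idx} (hS : p.support ⊆ S) :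
    dioWeight τ p = ∏ i ∈ S, (1 + (p i : ℝ) ^ 2 * jap i ^ 2) ^ τ :=
  Finsupp.prod_of_support_subset p hS _ fun i _ => by simp

lemma dioWeight_pos (τ : ℝ) (p : Idx →₀ ℤ) : 0 < dioWeight τ p :=
  Finset.prod_pos fun i _ => Real.rpow_pos_of_pos (by positivity) _

lemma dioWeight_add_single_le {τ : ℝ} (hτ : 0 < τ) (p : Idx →₀ ℤ) (h : Idx) {e : ℤ}
    (he : e ^ 2 = 1) :
    dioWeight τ (p + Finsupp.single h e) ≤ (2 * (1 + jap h ^ 2)) ^ τ * dioWeight τ p := by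
  classical
  have h1 : (p + Finsupp.single h e).support ⊆ insert h p.support := by
    refine Finsupp.support_add.trans (Finset.union_subset (Finset.subset_insert _ _) ?_)
    refine Finsupp.support_single_subset.trans ?_
    simp
  have hh : h ∈ insert h p.support := Finset.mem_insert_self _ _
  rw [dioWeight_eq_prod τ _ h1, dioWeight_eq_prod τ p (Finset.subset_insert h _),
    ← Finset.mul_prod_erase _ _ hh, ← Finset.mul_prod_erase _ (fun i => (1 + (p i : ℝ) ^ 2 * jap i ^ 2) ^ τ) hh,
    ← mul_assoc]
  have h2 : ∏ i ∈ (insert h p.support).erase h,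
      (1 + (((p + Finsupp.single h e) i : ℤ) : ℝ) ^ 2 * jap i ^ 2) ^ τ
      = ∏ i ∈ (insert h p.support).erase h, (1 + (p i : ℝ) ^ 2 * jap i ^ 2) ^ τ := by
    refine Finset.prod_congr rfl fun i hi => ?_
    have : i ≠ h := (Finset.mem_erase.1 hi).1
    simp [this.symm]
  rw [h2]
  refine mul_le_mul_of_nonneg_right ?_
    (Finset.prod_nonneg fun i _ => Real.rpow_nonneg (by positivity) _)
  rw [← Real.mul_rpow (by positivity) (by positivity)]
  refine Real.rpow_le_rpow (by positivity) ?_ hτ.le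
  have he' : (e : ℝ) ^ 2 = 1 := by exact_mod_cast he
  simp only [Finsupp.add_apply, Finsupp.single_eq_same, Int.cast_add]
  have h3 : ((p h : ℝ) + e) ^ 2 ≤ 2 * (p h : ℝ) ^ 2 + 2 := by nlinarith [sq_nonneg ((p h : ℝ) - e)]
  have h4 : ((p h : ℝ) + e) ^ 2 * jap h ^ 2 ≤ (2 * (p h : ℝ) ^ 2 + 2) * jap h ^ 2 := by gcongr
  have h5 : 0 ≤ (p h : ℝ) ^ 2 * jap h ^ 2 * jap h ^ 2 := by positivity
  nlinarith

lemma card_filter_jap_le (A : Finset Idx) {N : ℝ} (hN : 0 ≤ N) :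
    ((A.filter fun i => jap i ≤ N).card : ℝ) ≤ 6 * N := by
  rcases lt_or_ge N 1 with h1 | h1
  · have : A.filter (fun i => jap i ≤ N) = ∅ := by
      refine Finset.filter_false_of_mem fun i _ hi => ?_
      linarith [one_le_jap i]
    rw [this]; simpa using hN
  · have hsub : A.filter (fun i => jap i ≤ N) ⊆ Finset.Icc (-⌊N⌋) ⌊N⌋ ×ˢ Finset.univ := by
      intro i hi
      have hi2 := (Finset.mem_filter.1 hi).2
      have h3 : |(i.1 : ℝ)| ≤ N := (le_max_left _ _).trans hi2
      have h4 := abs_le.1 h3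
      simp only [Finset.mem_product, Finset.mem_Icc, Finset.mem_univ, and_true]
      refine ⟨?_, Int.le_floor.2 h4.2⟩
      have : -i.1 ≤ ⌊N⌋ := Int.le_floor.2 (by push_cast; linarith)
      linarith
    have hc := Finset.card_le_card hsub
    rw [Finset.card_product, Int.card_Icc] at hc
    have hu : (Finset.univ : Finset ℤˣ).card = 2 := rfl
    rw [hu] at hc
    have hf0 : 0 ≤ ⌊N⌋ := Int.floor_nonneg.2 hN
    have h5 : ((⌊N⌋ + 1 - -⌊N⌋).toNat : ℝ) = 2 * ⌊N⌋ + 1 := by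
      have : ((⌊N⌋ + 1 - -⌊N⌋).toNat : ℤ) = 2 * ⌊N⌋ + 1 := by rw [Int.toNat_of_nonneg] <;> linarith
      exact_mod_cast this
    have hc' : ((A.filter fun i => jap i ≤ N).card : ℝ) ≤ (2 * ⌊N⌋ + 1) * 2 := by
      rw [← h5]; exact_mod_cast hc
    linarith [Int.floor_le N]

lemma log_one_add_le {y : ℝ} (hy : 0 ≤ y) : Real.log (1 + y) ≤ 2 * Real.sqrt y := by
  have h1 : 1 + y ≤ (1 + Real.sqrt y) ^ 2 := by
    nlinarith [Real.sq_sqrt hy, Real.sqrt_nonneg y]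
  have h2 := Real.sqrt_nonneg y
  calc Real.log (1 + y) ≤ Real.log ((1 + Real.sqrt y) ^ 2) := Real.log_le_log (by linarith) h1
    _ = 2 * Real.log (1 + Real.sqrt y) := by rw [Real.log_pow]; norm_num
    _ ≤ 2 * Real.sqrt y := by
        have := Real.log_le_sub_one_of_pos (show 0 < 1 + Real.sqrt y by linarith)
        linarith

/-- The exponent lost by the Diophantine weight. -/
def dioLoss (τ δ : ℝ) : ℝ := 6 * ((8 * τ) ^ 4 / δ ^ 4) * ((8 * τ) ^ 2 / (4 * δ))

/-- With y = n√J and w = √y, the logarithm of the factor is at most 8τw. Completing the square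
absorbs this into δw² at the cost (8τ)²/(4δ). Once J exceeds (8τ/δ)^4 one has 8τ ≤ δw, because J ≤
w^4, and there is no cost at all. -/
lemma dioWeight_factor_le {τ δ n J : ℝ} (hτ : 0 < τ) (hδ : 0 < δ) (hn : 1 ≤ n) (hJ : 1 ≤ J) :
    (1 + n ^ 2 * J ^ 2) ^ τ ≤ Real.exp (δ * (n * Real.sqrt J)
      + if J ≤ (8 * τ) ^ 4 / δ ^ 4 then (8 * τ) ^ 2 / (4 * δ) else 0) := by
  have hJs : 1 ≤ Real.sqrt J := Real.one_le_sqrt.2 hJ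
  have hJ2 : Real.sqrt J ^ 2 = J := Real.sq_sqrt (by linarith)
  set y := n * Real.sqrt J with hy
  have hyJ : Real.sqrt J ≤ y := le_mul_of_one_le_left (by linarith) hn
  have hy1 : 1 ≤ y := hJs.trans hyJ
  have h1 : 1 + n ^ 2 * J ^ 2 ≤ (1 + y) ^ 4 := by
    have e : n ^ 2 * J ^ 2 = y ^ 2 * Real.sqrt J ^ 2 := by rw [hy, hJ2, mul_pow, hJ2]; ring
    have e2 : y ^ 2 * Real.sqrt J ^ 2 ≤ y ^ 2 * y ^ 2 := by gcongr
    have e3 : 0 ≤ y ^ 3 := by positivity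
    have e4 : (1 + y) ^ 4 = 1 + 4 * y + 6 * y ^ 2 + 4 * y ^ 3 + y ^ 2 * y ^ 2 := by ring
    nlinarith [sq_nonneg y]
  have h2 : Real.log (1 + n ^ 2 * J ^ 2) ≤ 8 * Real.sqrt y := by
    calc _ ≤ Real.log ((1 + y) ^ 4) := Real.log_le_log (by positivity) h1
      _ = 4 * Real.log (1 + y) := by rw [Real.log_pow]; norm_num
      _ ≤ 4 * (2 * Real.sqrt y) := by gcongr; exact log_one_add_le (by linarith)
      _ = _ := by ring
  rw [Real.rpow_def_of_pos (by positivity)]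
  refine Real.exp_le_exp.2 ?_
  set w := Real.sqrt y with hw
  have hw2 : w ^ 2 = y := Real.sq_sqrt (by linarith)
  have hw0 : 0 ≤ w := Real.sqrt_nonneg y
  have h3 : Real.log (1 + n ^ 2 * J ^ 2) * τ ≤ 8 * τ * w := by nlinarith
  refine h3.trans ?_
  split_ifs with hN
  · have : δ * y + (8 * τ) ^ 2 / (4 * δ) - 8 * τ * w = (2 * δ * w - 8 * τ) ^ 2 / (4 * δ) := by
      rw [← hw2]; field_simp; ring
    have h4 : 0 ≤ (2 * δ * w - 8 * τ) ^ 2 / (4 * δ) := by positivity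
    linarith
  · have h5 : 8 * τ ≤ δ * w := by
      rw [not_le, div_lt_iff₀ (by positivity)] at hN
      have h6 : J ≤ w ^ 4 := by
        calc J = Real.sqrt J ^ 2 := hJ2.symm
          _ ≤ y ^ 2 := by gcongr
          _ = w ^ 4 := by rw [← hw2]; ring
      have h7 : (8 * τ) ^ 4 ≤ (δ * w) ^ 4 := by
        rw [mul_pow δ w]
        nlinarith [pow_pos hδ 4]
      exact le_of_pow_le_pow_left₀ (by norm_num) (by positivity) h7
    rw [← hw2]
    nlinarith

lemma toZ_apply (q : MIdx) (h : Idx) : toZ q h = (q h : ℤ) := rfl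

lemma toZ_support (q : MIdx) : (toZ q).support = q.support := by
  ext h; simp [toZ_apply]

/-- Only indices with ⟨i⟩ ≤ (8τ/δ)^4 cost a constant factor, and there are at most 6(8τ/δ)^4 of
them. The total loss in the exponent is of order δ^{-5}, whatever the support of q. -/
lemma dioWeight_toZ_le {τ δ : ℝ} (hτ : 0 < τ) (hδ : 0 < δ) (q : MIdx) :
    dioWeight τ (toZ q) ≤ Real.exp (δ * sjSum q + dioLoss τ δ) := by
  set c : Idx → ℝ := fun i => if jap i ≤ (8 * τ) ^ 4 / δ ^ 4 then (8 * τ) ^ 2 / (4 * δ) else 0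
  have h1 : dioWeight τ (toZ q) ≤ ∏ i ∈ q.support, Real.exp (δ * ((q i : ℝ) * sj i) + c i) := by
    rw [dioWeight_eq_prod τ _ (toZ_support q).le]
    refine Finset.prod_le_prod (fun i _ => Real.rpow_nonneg (by positivity) _) fun i hi => ?_
    have hq : (1 : ℝ) ≤ (q i : ℝ) := by
      exact_mod_cast Nat.one_le_iff_ne_zero.2 (Finsupp.mem_support_iff.1 hi)
    rw [toZ_apply, Int.cast_natCast]
    exact dioWeight_factor_le hτ hδ hq (one_le_jap i)
  refine h1.trans ?_
  rw [← Real.exp_sum]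
  refine Real.exp_le_exp.2 ?_
  rw [Finset.sum_add_distrib, ← Finset.mul_sum]
  refine add_le_add le_rfl ?_
  rw [← Finset.sum_filter, Finset.sum_const, nsmul_eq_mul, dioLoss]
  refine mul_le_mul_of_nonneg_right (card_filter_jap_le _ (by positivity)) (by positivity)

/-! ### Linear functionals of integer vectors -/

variable {lam : Idx → ℂ}

lemma dot_add (lam : Idx → ℂ) (a b : MIdx) : dot lam (a + b) = dot lam a + dot lam b :=
  Finsupp.sum_add_index' (by simp) fun _ _ _ => by push_cast; ring

@[simp] lemma dot_unit (lam : Idx → ℂ) (h : Idx) : dot lam (unitIdx h) = lam h := by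
  simp [dot, unitIdx]

lemma zdot_toZ (lam : Idx → ℂ) (q : MIdx) : zdot lam (toZ q) = dot lam q := by
  rw [zdot, dot, Finsupp.sum, Finsupp.sum, toZ_support]
  simp [toZ_apply]

lemma zmomDot_toZ (q : MIdx) : zmomDot (toZ q) = momDot q := by
  rw [zmomDot, momDot, Finsupp.sum, Finsupp.sum, toZ_support]
  simp [toZ_apply]

lemma zdot_add (lam : Idx → ℂ) (a b : Idx →₀ ℤ) : zdot lam (a + b) = zdot lam a + zdot lam b :=
  Finsupp.sum_add_index' (by simp) fun _ _ _ => by push_cast; ring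

lemma zmomDot_add (a b : Idx →₀ ℤ) : zmomDot (a + b) = zmomDot a + zmomDot b :=
  Finsupp.sum_add_index' (by simp) fun _ _ _ => by ring

lemma zdot_single (lam : Idx → ℂ) (h : Idx) (n : ℤ) :
    zdot lam (Finsupp.single h n) = n * lam h := by simp [zdot]

lemma zmomDot_single (h : Idx) (n : ℤ) : zmomDot (Finsupp.single h n) = n * mom h := by
  simp [zmomDot]

lemma toZ_add (a b : MIdx) : toZ (a + b) = toZ a + toZ b := by
  ext h; simp [toZ_apply]

lemma toZ_unit (h : Idx) : toZ (unitIdx h) = Finsupp.single h 1 := by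
  ext i; simp [toZ_apply, unitIdx, Finsupp.single_apply]

namespace FreqAssumptions

variable {τ C γ : ℝ} (H : FreqAssumptions τ C γ lam)
include H

lemma le_dioWeight_mul {p : Idx →₀ ℤ} (h1 : zdot lam p ≠ 0) (h2 : zmomDot p = 0)
    (h3 : ∃ k, ∀ h, 0 ≤ (p + Finsupp.single k 1 : Idx →₀ ℤ) h) :
    γ ≤ dioWeight τ p * ‖zdot lam p‖ := by
  have hp : p ∉ resonances lam := fun hn => by
    obtain ⟨k, hk⟩ := Set.mem_iUnion.1 hn
    exact h1 hk.1
  have := H.diophantine p hp h2 h3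
  have e : p.prod (fun i n => ((1 + (n : ℝ) ^ 2 * jap i ^ 2) ^ τ)⁻¹) = (dioWeight τ p)⁻¹ := by
    simp [Finsupp.prod, dioWeight]
  rw [e, ← div_eq_mul_inv, div_le_iff₀ (dioWeight_pos τ p)] at this
  rwa [mul_comm] at this

lemma le_dioWeight_mul_of_nat {q : MIdx} (h1 : dot lam q ≠ 0) (h2 : momDot q = 0) :
    γ ≤ dioWeight τ (toZ q) * ‖dot lam q‖ := by
  rw [← zdot_toZ]
  refine H.le_dioWeight_mul (by rwa [zdot_toZ]) (by rwa [zmomDot_toZ]) ⟨(0, 1), fun h => ?_⟩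
  rw [← toZ_unit, ← toZ_add, toZ_apply]
  positivity

lemma norm_lam_le (k : Idx) : ‖lam k‖ ≤ jap k ^ 2 + 1 / 2 := by
  obtain ⟨φ, hφ, -⟩ := H.superlinear
  have h1 : ‖(jap k : ℂ) ^ 2 * Complex.exp (φ k * Complex.I)‖ = jap k ^ 2 := by
    rw [norm_mul, Complex.norm_exp_ofReal_mul_I, mul_one, norm_pow, Complex.norm_real,
      Real.norm_of_nonneg (jap_pos k).le]
  have := norm_add_le (lam k - (jap k : ℂ) ^ 2 * Complex.exp (φ k * Complex.I))
    ((jap k : ℂ) ^ 2 * Complex.exp (φ k * Complex.I))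
  rw [sub_add_cancel, h1] at this
  linarith [hφ k]

/-- The Diophantine condition at e_{(0,1)}, whose momentum vanishes, bounds γ from above. This
settles the divisors that are not small. -/
lemma gamma_le : γ ≤ 2 ^ τ * (3 / 2) := by
  have h := H.le_dioWeight_mul_of_nat (q := unitIdx (0, 1)) (by simpa using H.ne_zero (0, 1))
    (by simp [momDot_unit, mom])
  have hj : jap ((0, 1) : Idx) = 1 := by simp [jap]
  have h2 := H.norm_lam_le (0, 1)
  rw [dot_unit, toZ_unit] at h
  have h3 : dioWeight τ (Finsupp.single ((0, 1) : Idx) 1) = 2 ^ τ := by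
    simp [dioWeight, hj]; norm_num
  rw [h3] at h
  rw [hj] at h2
  refine h.trans ?_
  gcongr
  linarith

lemma norm_sub_ge (h k : Idx) : |jap h ^ 2 - jap k ^ 2| - 1 ≤ ‖lam h - lam k‖ := by
  obtain ⟨φ, hφ, -⟩ := H.superlinear
  have h1 : ∀ k, ‖(jap k : ℂ) ^ 2 * Complex.exp (φ k * Complex.I)‖ = jap k ^ 2 := fun k => by
    rw [norm_mul, Complex.norm_exp_ofReal_mul_I, mul_one, norm_pow, Complex.norm_real,
      Real.norm_of_nonneg (jap_pos k).le]
  have h2 : ∀ k, |‖lam k‖ - jap k ^ 2| ≤ 1 / 2 := fun k => by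
    rw [← h1 k]; exact (abs_norm_sub_norm_le _ _).trans (hφ k)
  have h3 := abs_norm_sub_norm_le (lam h) (lam k)
  have h4 := h2 h
  have h5 := h2 k
  rw [abs_le] at h4 h5
  rcases abs_cases (jap h ^ 2 - jap k ^ 2) with h6 | h6 <;>
  rcases abs_cases (‖lam h‖ - ‖lam k‖) with h7 | h7 <;> linarith

lemma norm_sub_neg_ge {k : Idx} (hk : lam k ≠ lam (-k.1, -k.2)) :
    C * jap k ^ 2 - 1 ≤ ‖lam (-k.1, -k.2) - lam k‖ := by
  obtain ⟨φ, hφ, hs⟩ := H.superlinear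
  have hj : jap ((-k.1, -k.2) : Idx) = jap k := by simp [jap]
  have h1 := hφ k
  have h2 := hφ (-k.1, -k.2)
  rw [hj] at h2
  set a := Complex.exp (φ k * Complex.I)
  set b := Complex.exp (φ (-k.1, -k.2) * Complex.I)
  have h3 : C * jap k ^ 2 ≤ ‖(jap k : ℂ) ^ 2 * a - (jap k : ℂ) ^ 2 * b‖ := by
    rw [← mul_sub, norm_mul, norm_pow, Complex.norm_real, Real.norm_of_nonneg (jap_pos k).le,
      mul_comm C]
    exact mul_le_mul_of_nonneg_left (hs k hk) (by positivity)
  have e : (jap k : ℂ) ^ 2 * a - (jap k : ℂ) ^ 2 * b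
      = -(lam k - (jap k : ℂ) ^ 2 * a) + (lam (-k.1, -k.2) - (jap k : ℂ) ^ 2 * b)
        - (lam (-k.1, -k.2) - lam k) := by ring
  rw [e] at h3
  have h4 := norm_sub_le (-(lam k - (jap k : ℂ) ^ 2 * a) + (lam (-k.1, -k.2) - (jap k : ℂ) ^ 2 * b))
    (lam (-k.1, -k.2) - lam k)
  have h5 := norm_add_le (-(lam k - (jap k : ℂ) ^ 2 * a)) (lam (-k.1, -k.2) - (jap k : ℂ) ^ 2 * b)
  rw [norm_neg] at h5
  linarith

/-- Each |λ_h| is at most 2(√⟨h⟩)^4, and the fourth power is superadditive on non-negative numbers.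
-/
lemma norm_dot_le (q : MIdx) : ‖dot lam q‖ ≤ 2 * sjSum q ^ 4 := by
  induction q using midx_induction with
  | h0 => simp [dot, sjSum]
  | h1 q h ih =>
    rw [dot_add, dot_unit, sjSum_add, sjSum_unit]
    have h1 := H.norm_lam_le h
    rw [← sj_sq] at h1
    have h2 := one_le_sj h
    have h3 := sjSum_nonneg q
    have h4 : 1 ≤ sj h ^ 4 := one_le_pow₀ h2
    have h5 : sjSum q ^ 4 + sj h ^ 4 ≤ (sjSum q + sj h) ^ 4 := by
      have e : (sjSum q + sj h) ^ 4 = sjSum q ^ 4 + sj h ^ 4 + (4 * sjSum q ^ 3 * sj h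
        + 6 * sjSum q ^ 2 * sj h ^ 2 + 4 * sjSum q * sj h ^ 3) := by ring
      rw [e]
      have : 0 ≤ sj h := by linarith
      have : 0 ≤ 4 * sjSum q ^ 3 * sj h + 6 * sjSum q ^ 2 * sj h ^ 2 + 4 * sjSum q * sj h ^ 3 := by
        positivity
      linarith
    have h6 := norm_add_le (dot lam q) (lam h)
    have e : (sj h ^ 2) ^ 2 = sj h ^ 4 := by ring
    rw [e] at h1
    linarith

end FreqAssumptions

/-! ### Splitting off the largest index. -/

lemma japSum_le_sq (q : MIdx) : japSum q ≤ sjSum q ^ 2 := by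
  have h1 := sqrt_japSum_le q
  have h2 := Real.sq_sqrt (japSum_nonneg q)
  have h3 := Real.sqrt_nonneg (japSum q)
  nlinarith

lemma exists_max_unit {q : MIdx} (hq : q ≠ 0) : ∃ h p, q = p + unitIdx h ∧
    ∀ i, p i ≠ 0 → jap i ≤ jap h := by
  obtain ⟨h, hh, hmax⟩ := Finset.exists_max_image q.support jap (Finsupp.support_nonempty_iff.2 hq)
  have hle : unitIdx h ≤ q :=
    Finsupp.single_le_iff.2 (Nat.one_le_iff_ne_zero.2 (Finsupp.mem_support_iff.1 hh))
  refine ⟨h, q - unitIdx h, (tsub_add_cancel_of_le hle).symm, fun i hi => hmax i ?_⟩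
  rw [Finsupp.mem_support_iff]
  intro h0
  simp [h0] at hi

lemma japSum_le_mul {p : MIdx} {h : Idx} (hp : ∀ i, p i ≠ 0 → jap i ≤ jap h) :
    japSum p ≤ sj h * sjSum p := by
  rw [japSum, sjSum, Finsupp.sum, Finsupp.sum, Finset.mul_sum]
  refine Finset.sum_le_sum fun i hi => ?_
  have h1 : sj i ≤ sj h := Real.sqrt_le_sqrt (hp i (Finsupp.mem_support_iff.1 hi))
  have h2 := one_le_sj i
  rw [← sj_sq i]
  have : (0 : ℝ) ≤ p i := Nat.cast_nonneg _
  calc (p i : ℝ) * sj i ^ 2 = (p i : ℝ) * sj i * sj i := by ring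
    _ ≤ (p i : ℝ) * sj i * sj h := by gcongr
    _ = _ := by ring

/-- Momentum gives ⟨k⟩ ≤ ⟨h⟩ + ∑ p_i⟨i⟩, and maximality of h bounds the sum by √⟨h⟩ ∑ p_i√⟨i⟩.
Completing the square yields the factor 1/2. Hence at least half of ∑ p_i√⟨i⟩ survives in the
exponential gain. -/
lemma sjSum_half_le {p : MIdx} {h k : Idx} (hp : ∀ i, p i ≠ 0 → jap i ≤ jap h)
    (hm : momDot (p + unitIdx h) = mom k) : sj k ≤ sj h + sjSum p / 2 := by
  have hne : p + unitIdx h ≠ 0 := fun h0 => by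
    have := DFunLike.congr_fun h0 h
    simp [unitIdx] at this
  have h1 := jap_le_japSum hne hm
  rw [japSum_add, japSum_unit] at h1
  have h2 := japSum_le_mul hp
  have h3 := sjSum_nonneg p
  have h4 := one_le_sj h
  refine Real.sqrt_le_iff.2 ⟨by positivity, ?_⟩
  nlinarith [sj_sq h]

lemma jap_int (k : Idx) : ∃ n : ℤ, jap k = n := ⟨max |k.1| 1, by simp [jap]⟩

namespace FreqAssumptions

variable {τ C γ : ℝ} (H : FreqAssumptions τ C γ lam)
include H

/-- Either the divisor is not small, or it does not change when the two largest indices are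
removed, or these are controlled by the others. -/
lemma divisor_cases (hC : 0 < C) {p : MIdx} {h k : Idx}
    (hm : momDot (p + unitIdx h) = mom k) :
    1 ≤ ‖dot lam (p + unitIdx h) - lam k‖ ∨ (lam h = lam k ∧ mom h = mom k) ∨
      (jap h ≤ (2 + 2 / C) * (1 + sjSum p) ^ 4 ∧ jap k ≤ (2 + 2 / C) * (1 + sjSum p) ^ 4) := by
  by_contra! hcon
  obtain ⟨hx, hsw, hQ⟩ := hcon
  have hS := sjSum_nonneg p
  set S := sjSum p
  have hC2 : 0 < 2 / C := by positivity
  have hS4 : 1 + S ^ 4 ≤ (1 + S) ^ 4 := by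
    have : (1 + S) ^ 4 = 1 + S ^ 4 + (4 * S + 6 * S ^ 2 + 4 * S ^ 3) := by ring
    have h2 : 0 ≤ 4 * S + 6 * S ^ 2 + 4 * S ^ 3 := by positivity
    linarith
  have hS2 : 1 + S ^ 2 ≤ (1 + S) ^ 4 := by
    have : (1 + S) ^ 4 = 1 + S ^ 2 + (S ^ 4 + 4 * S + 5 * S ^ 2 + 4 * S ^ 3) := by ring
    have h2 : 0 ≤ S ^ 4 + 4 * S + 5 * S ^ 2 + 4 * S ^ 3 := by positivity
    linarith
  have hT0 : 0 ≤ (1 + S) ^ 4 := by positivity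
  set T := (1 + S) ^ 4
  have hT1 : 1 ≤ T := by nlinarith [sq_nonneg S]
  have hTC : 2 * T ≤ (2 + 2 / C) * T := by nlinarith
  -- A small divisor makes λ_h - λ_k comparable with λ·p, so the two possibly large frequencies are
  -- compared only with the remaining indices.
  have hd : ‖lam h - lam k‖ ≤ 1 + 2 * S ^ 4 := by
    have e : lam h - lam k = (dot lam (p + unitIdx h) - lam k) - dot lam p := by
      rw [dot_add, dot_unit]; ring
    rw [e]
    refine (norm_sub_le _ _).trans (add_le_add hx.le (H.norm_dot_le p))
  have hj0 := jap_pos h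
  have hk0 := jap_pos k
  have hj1 := one_le_jap h
  have hk1 := one_le_jap k
  by_cases hjk : jap h = jap k
  · have hbig : ¬ jap h ≤ (2 + 2 / C) * T := fun hle => absurd (hQ hle) (by rw [← hjk]; linarith)
    have h1 : 1 < jap h := by linarith
    have habs : ∀ i, 1 < jap i → jap i = |(mom i : ℝ)| := fun i hi => by
      rw [jap_eq] at hi ⊢
      rcases max_choice |(mom i : ℝ)| 1 with h | h
      · exact h
      · rw [h] at hi; exact absurd hi (lt_irrefl _)
    have hah := habs h h1
    have hak := habs k (hjk ▸ h1)
    have habs2 : |(mom h : ℝ)| = |(mom k : ℝ)| := by rw [← hah, ← hak, hjk]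
    rw [momDot_add, momDot_unit] at hm
    rcases abs_eq_abs.1 habs2 with he | he
    -- Equal momenta with different frequencies leave only the mirror index h = (-k.1, -k.2). There
    -- the separation of phases makes |λ_h - λ_k| at least C⟨k⟩² - 1.
    · have hmm : mom h = mom k := by exact_mod_cast he
      have hlam : lam h ≠ lam k := fun hl => hsw hl hmm
      have hhk : h = (-k.1, -k.2) := by
        have h0 : k.1 ≠ 0 := fun h0 => by
          rw [hjk] at h1; simp [jap, h0] at h1
        obtain ⟨a, b⟩ := h
        obtain ⟨c, d⟩ := k
        simp only [mom] at hmm h0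
        rcases Int.units_eq_one_or b with hb | hb <;> rcases Int.units_eq_one_or d with hb' | hb' <;>
          subst hb <;> subst hb' <;> simp at hmm ⊢
        · exact hlam (by rw [hmm])
        · linarith
        · linarith
        · exact hlam (by rw [hmm])
      subst hhk
      have h3 := H.norm_sub_neg_ge hlam.symm
      have h4 : C * jap k ^ 2 ≤ 2 * T := by linarith
      have h5 : jap k ≤ 2 / C * T := by
        rw [div_mul_eq_mul_div, le_div_iff₀ hC]
        nlinarith
      exact hbig (by rw [hjk]; linarith)
    -- With opposite momenta the balance 2𝔪_k has to be supplied by p, which bounds ⟨k⟩ by (∑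
    -- p_i√⟨i⟩)².
    · have h3 : (momDot p : ℝ) = 2 * mom k := by
        have : (momDot p : ℝ) + mom h = mom k := by exact_mod_cast hm
        linarith
      have h4 := (abs_momDot_le p).trans (japSum_le_sq p)
      rw [h3, abs_mul, ← hak, ← hjk] at h4
      norm_num at h4
      exact hbig (by linarith)
  -- Distinct values of ⟨·⟩ are integers at distance at least one, so the gap between their squares
  -- is at least ⟨h⟩ + ⟨k⟩.
  · have h2 := H.norm_sub_ge h k
    have h3 : jap h + jap k ≤ |jap h ^ 2 - jap k ^ 2| := by
      obtain ⟨a, ha⟩ := jap_int h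
      obtain ⟨b, hb⟩ := jap_int k
      have hab : a ≠ b := fun h => hjk (by rw [ha, hb, h])
      have h4 : (1 : ℝ) ≤ |jap h - jap k| := by
        rw [ha, hb]
        exact_mod_cast Int.one_le_abs (sub_ne_zero.2 hab)
      rw [sq_sub_sq, abs_mul, abs_of_nonneg (by linarith : 0 ≤ jap h + jap k)]
      nlinarith
    exact absurd (hQ (by linarith)) (by linarith)

end FreqAssumptions

lemma one_add_rpow_le {S a δ : ℝ} (hS : 0 ≤ S) (ha : 0 < a) (hδ : 0 < δ) :
    (1 + S) ^ a ≤ Real.exp (δ * S + a ^ 2 / δ) := by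
  rw [Real.rpow_def_of_pos (by linarith)]
  refine Real.exp_le_exp.2 ?_
  have h1 := log_one_add_le hS
  have h2 := Real.sq_sqrt hS
  set w := Real.sqrt S
  have h3 : δ * S + a ^ 2 / δ - 2 * a * w = (δ * w - a) ^ 2 / δ := by
    rw [← h2]; field_simp; ring
  have h4 : 0 ≤ (δ * w - a) ^ 2 / δ := by positivity
  nlinarith

/-- The constant in front of the small divisor estimate. -/
def divConst (τ C : ℝ) : ℝ := 2 ^ τ * (3 / 2) + (4 * (2 + 2 / C) ^ 2) ^ (2 * τ)

lemma divConst_pos {τ C : ℝ} (hC : 0 < C) : 0 < divConst τ C := by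
  unfold divConst; positivity

lemma dioLoss_nonneg {τ δ : ℝ} (hτ : 0 < τ) (hδ : 0 < δ) : 0 ≤ dioLoss τ δ := by
  unfold dioLoss; positivity

lemma one_le_divConst {τ C : ℝ} (hτ : 0 < τ) (hC : 0 < C) : 1 ≤ divConst τ C := by
  have h1 : (1 : ℝ) ≤ 2 ^ τ := Real.one_le_rpow (by norm_num) hτ.le
  have h2 : 0 ≤ (4 * (2 + 2 / C) ^ 2) ^ (2 * τ) := by positivity
  unfold divConst; linarith

namespace FreqAssumptions

variable {τ C γ : ℝ} (H : FreqAssumptions τ C γ lam)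
include H

/-- The point is that the loss involves p only, and neither h nor k. If e_h - e_k is invisible to
frequency and momentum, the Diophantine condition is applied to p itself. If ⟨h⟩ and ⟨k⟩ are bounded
by a power of 1 + ∑ p_i√⟨i⟩, putting these two entries back costs only the power (1 + ∑
p_i√⟨i⟩)^{16τ}, which one more exponential absorbs. -/
lemma small_divisor (hτ : 0 < τ) (hC : 0 < C) {δ : ℝ} (hδ : 0 < δ) {p : MIdx} {h k : Idx}
    (hm : momDot (p + unitIdx h) = mom k) (hne : dot lam (p + unitIdx h) ≠ lam k) :
    γ ≤ divConst τ C * Real.exp (2 * δ * sjSum p + (dioLoss τ δ + (16 * τ) ^ 2 / δ))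
      * ‖dot lam (p + unitIdx h) - lam k‖ := by
  have hS := sjSum_nonneg p
  have hL := dioLoss_nonneg hτ hδ
  have hB := divConst_pos (τ := τ) hC
  have hB1 := one_le_divConst hτ hC
  have hE0 : 0 ≤ 2 * δ * sjSum p + (dioLoss τ δ + (16 * τ) ^ 2 / δ) := by positivity
  have hE := Real.one_le_exp hE0
  set E := Real.exp (2 * δ * sjSum p + (dioLoss τ δ + (16 * τ) ^ 2 / δ)) with hEdef
  set x := ‖dot lam (p + unitIdx h) - lam k‖ with hx
  have hx0 : 0 ≤ x := norm_nonneg _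
  have hW : dioWeight τ (toZ p) ≤ Real.exp (δ * sjSum p + dioLoss τ δ) := dioWeight_toZ_le hτ hδ p
  have hsub : dot lam (p + unitIdx h) - lam k ≠ 0 := sub_ne_zero.2 hne
  rcases H.divisor_cases hC hm with h1 | ⟨h1, h2⟩ | ⟨h1, h2⟩
  · calc γ ≤ 2 ^ τ * (3 / 2) := H.gamma_le
      _ ≤ divConst τ C := by unfold divConst; exact le_add_of_nonneg_right (by positivity)
      _ = divConst τ C * 1 * 1 := by ring
      _ ≤ _ := by gcongr
  · have hd : dot lam p = dot lam (p + unitIdx h) - lam k := by rw [dot_add, dot_unit, h1]; ring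
    have hmp : momDot p = 0 := by rw [momDot_add, momDot_unit, h2] at hm; linarith
    have h3 := H.le_dioWeight_mul_of_nat (q := p) (by rw [hd]; exact hsub) hmp
    rw [hd] at h3
    refine h3.trans (mul_le_mul_of_nonneg_right ?_ hx0)
    refine hW.trans ?_
    calc _ ≤ E := by
          refine Real.exp_le_exp.2 ?_
          have : 0 ≤ δ * sjSum p + (16 * τ) ^ 2 / δ := by positivity
          linarith
      _ = 1 * E := (one_mul _).symm
      _ ≤ _ := by gcongr
  · set P : Idx →₀ ℤ := toZ p + Finsupp.single h 1 + Finsupp.single k (-1) with hP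
    have hzP : zdot lam P = dot lam (p + unitIdx h) - lam k := by
      rw [hP, zdot_add, zdot_add, zdot_toZ, zdot_single, zdot_single, dot_add, dot_unit]
      push_cast; ring
    have hmP : zmomDot P = 0 := by
      rw [hP, zmomDot_add, zmomDot_add, zmomDot_toZ, zmomDot_single, zmomDot_single]
      rw [momDot_add, momDot_unit] at hm
      linarith
    have h3 := H.le_dioWeight_mul (p := P) (by rw [hzP]; exact hsub) hmP ⟨k, fun i => by
      have : P + Finsupp.single k 1 = toZ (p + unitIdx h) := by
        rw [hP, toZ_add, toZ_unit, add_assoc, ← Finsupp.single_add]; simp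
      rw [this, toZ_apply]; positivity⟩
    rw [hzP] at h3
    refine h3.trans (mul_le_mul_of_nonneg_right ?_ hx0)
    set Q := (2 + 2 / C) * (1 + sjSum p) ^ 4 with hQ
    have hQ1 : 1 ≤ Q := (one_le_jap h).trans h1
    have hfac : ∀ i, jap i ≤ Q → (2 * (1 + jap i ^ 2)) ^ τ ≤ (4 * Q ^ 2) ^ τ := fun i hi => by
      refine Real.rpow_le_rpow (by positivity) ?_ hτ.le
      have := jap_pos i
      nlinarith
    calc dioWeight τ P ≤ (2 * (1 + jap k ^ 2)) ^ τ * ((2 * (1 + jap h ^ 2)) ^ τ *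
          dioWeight τ (toZ p)) := by
          refine (dioWeight_add_single_le hτ _ k (by norm_num)).trans ?_
          refine mul_le_mul_of_nonneg_left ?_ (by positivity)
          exact dioWeight_add_single_le hτ _ h (by norm_num)
      _ ≤ (4 * Q ^ 2) ^ τ * ((4 * Q ^ 2) ^ τ * Real.exp (δ * sjSum p + dioLoss τ δ)) := by
          have := (dioWeight_pos τ (toZ p)).le
          exact mul_le_mul (hfac k h2) (mul_le_mul (hfac h h1) hW this (by positivity))
            (by positivity) (by positivity)
      _ = (4 * (2 + 2 / C) ^ 2) ^ (2 * τ) * ((1 + sjSum p) ^ (16 * τ) *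
          Real.exp (δ * sjSum p + dioLoss τ δ)) := by
          rw [← mul_assoc, ← mul_assoc, ← Real.rpow_add (by positivity), ← two_mul]
          congr 1
          have e : 4 * Q ^ 2 = (4 * (2 + 2 / C) ^ 2) * (1 + sjSum p) ^ 8 := by rw [hQ]; ring
          rw [e, Real.mul_rpow (by positivity) (by positivity)]
          congr 1
          rw [← Real.rpow_natCast, ← Real.rpow_mul (by positivity)]
          congr 1; push_cast; ring
      _ ≤ (4 * (2 + 2 / C) ^ 2) ^ (2 * τ) * (Real.exp (δ * sjSum p + (16 * τ) ^ 2 / δ) *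
          Real.exp (δ * sjSum p + dioLoss τ δ)) := by
          gcongr
          exact one_add_rpow_le hS (by positivity) hδ
      _ = (4 * (2 + 2 / C) ^ 2) ^ (2 * τ) * E := by
          rw [← Real.exp_add, hEdef]; congr 2; ring
      _ ≤ divConst τ C * E := by
          gcongr
          unfold divConst
          exact le_add_of_nonneg_left (by positivity)

end FreqAssumptions

/-- The powers δ^{-5} and δ^{-1} are absorbed by δ^{-6} with coefficient one. All dependence on τ
then sits in the prefactor, and the exponent becomes exactly 1/δ^6. -/
lemma exists_loss_const (a b : ℝ) (ha : 0 ≤ a) (hb : 0 ≤ b) :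
    ∃ A : ℝ, ∀ x : ℝ, 0 ≤ x → a * x ^ 5 + b * x ≤ A + x ^ 6 := by
  refine ⟨a * (2 * a) ^ 5 + b * (1 + 2 * b), fun x hx => ?_⟩
  have h1 : a * x ^ 5 ≤ a * (2 * a) ^ 5 + x ^ 6 / 2 := by
    rcases le_total x (2 * a) with h | h
    · have : a * x ^ 5 ≤ a * (2 * a) ^ 5 := by gcongr
      have : 0 ≤ x ^ 6 / 2 := by positivity
      linarith
    · have h3 : a * x ^ 5 ≤ x / 2 * x ^ 5 := by gcongr; linarith
      have h2 : 0 ≤ a * (2 * a) ^ 5 := by positivity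
      have h4 : x / 2 * x ^ 5 = x ^ 6 / 2 := by ring
      linarith
  have h2 : b * x ≤ b * (1 + 2 * b) + x ^ 6 / 2 := by
    rcases le_total x (1 + 2 * b) with h | h
    · have : b * x ≤ b * (1 + 2 * b) := by gcongr
      have : 0 ≤ x ^ 6 / 2 := by positivity
      linarith
    · have hx1 : 1 ≤ x := by linarith
      have h5 : x ^ 2 ≤ x ^ 6 := pow_le_pow_right₀ hx1 (by norm_num)
      have h6 : 0 ≤ b * (1 + 2 * b) := by positivity
      nlinarith
  linarith

/-- The inverse of `L_λ` on non-resonant vector fields (resonant monomials are mapped to zero). -/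
def invL (lam : Idx → ℂ) (V : VF) : VF := fun k q => V k q / (dot lam q - lam k)

/-- Uniform small divisor estimate with exponential loss. -/
lemma exists_divisor_bound {τ C : ℝ} (hτ : 0 < τ) (hC : 0 < C) : ∃ A : ℝ, 1 ≤ A ∧
    ∀ (γ : ℝ) (lam : Idx → ℂ), 0 < γ → FreqAssumptions τ C γ lam → ∀ δ : ℝ, 0 < δ →
    ∀ (k : Idx) (q : MIdx), q ≠ 0 → momDot q = mom k → dot lam q ≠ lam k →
      Real.exp (-(δ * (sjSum q - sj k))) ≤
        A * Real.exp (1 / δ ^ 6) * γ⁻¹ * ‖dot lam q - lam k‖ := by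
  obtain ⟨A₀, hA₀⟩ := exists_loss_const (6 * ((8 * τ) ^ 4 * 4 ^ 4) * ((8 * τ) ^ 2))
    ((16 * τ) ^ 2 * 4) (by positivity) (by positivity)
  refine ⟨divConst τ C * Real.exp (max A₀ 0), ?_, ?_⟩
  · have h1 := one_le_divConst hτ hC
    have h2 : 1 ≤ Real.exp (max A₀ 0) := Real.one_le_exp (le_max_right _ _)
    nlinarith
  intro γ lam hγ H δ hδ k q hq hm hne
  obtain ⟨h, p, rfl, hp⟩ := exists_max_unit hq
  have hsd := H.small_divisor hτ hC (δ := δ / 4) (by positivity) hm hne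
  have hhalf := sjSum_half_le hp hm
  have hS := sjSum_nonneg p
  have hB := divConst_pos (τ := τ) hC
  have hloss : dioLoss τ (δ / 4) + (16 * τ) ^ 2 / (δ / 4) ≤ max A₀ 0 + 1 / δ ^ 6 := by
    have := hA₀ (1 / δ) (by positivity)
    have e : dioLoss τ (δ / 4) + (16 * τ) ^ 2 / (δ / 4)
        = 6 * ((8 * τ) ^ 4 * 4 ^ 4) * ((8 * τ) ^ 2) * (1 / δ) ^ 5 + (16 * τ) ^ 2 * 4 * (1 / δ) := by
      unfold dioLoss; field_simp
    rw [e]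
    refine this.trans ?_
    rw [one_div_pow]
    gcongr
    exact le_max_left _ _
  have hL : δ / 2 * sjSum p ≤ δ * (sjSum (p + unitIdx h) - sj k) := by
    rw [sjSum_add, sjSum_unit]; nlinarith
  set x := ‖dot lam (p + unitIdx h) - lam k‖
  have hx : 0 ≤ x := norm_nonneg _
  set Λ := δ * (sjSum (p + unitIdx h) - sj k)
  have h1 : γ ≤ divConst τ C * Real.exp (Λ + (max A₀ 0 + 1 / δ ^ 6)) * x := by
    refine hsd.trans ?_
    gcongr
    calc 2 * (δ / 4) * sjSum p = δ / 2 * sjSum p := by ring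
      _ ≤ Λ := hL
  rw [Real.exp_add, Real.exp_add] at h1
  have h2 : Real.exp (-Λ) * γ ≤ divConst τ C * Real.exp (max A₀ 0) * Real.exp (1 / δ ^ 6) * x := by
    have := mul_le_mul_of_nonneg_left h1 (Real.exp_pos (-Λ)).le
    refine this.trans (le_of_eq ?_)
    have e : Real.exp (-Λ) * Real.exp Λ = 1 := by rw [← Real.exp_add]; simp
    linear_combination (divConst τ C * Real.exp (max A₀ 0) * Real.exp (1 / δ ^ 6) * x) * e
  calc Real.exp (-Λ) = Real.exp (-Λ) * γ * γ⁻¹ := by field_simp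
    _ ≤ divConst τ C * Real.exp (max A₀ 0) * Real.exp (1 / δ ^ 6) * x * γ⁻¹ := by gcongr
    _ = _ := by ring

lemma vnorm_invL_le {A s r δ : ℝ} (hr : 0 < r)
    (hA : ∀ (k : Idx) (q : MIdx), q ≠ 0 → momDot q = mom k → dot lam q ≠ lam k →
      Real.exp (-(δ * (sjSum q - sj k))) ≤ A * ‖dot lam q - lam k‖) {Y : VF}
    (hY : MemV s r Y) : vnorm (s + δ) r (invL lam Y) ≤ ENNReal.ofReal A * vnorm s r Y := by
  refine vnorm_le_of_coeff hr fun k q => ?_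
  by_cases h0 : q = 0
  · simp [invL, h0, hY.zero_at_origin]
  by_cases hm : momDot q = mom k
  swap
  · simp [invL, hY.momentum k q hm]
  by_cases hne : dot lam q = lam k
  · simp [invL, hne]
  have h1 := hA k q h0 hm hne
  have hx : 0 < ‖dot lam q - lam k‖ := norm_pos_iff.2 (sub_ne_zero.2 hne)
  have hA0 : 0 ≤ A := by
    have := (Real.exp_pos _).le.trans h1
    exact nonneg_of_mul_nonneg_left this hx
  rw [← ofReal_norm, ← ofReal_norm, ← ENNReal.ofReal_mul (norm_nonneg _), ← ENNReal.ofReal_mul hA0]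
  refine ENNReal.ofReal_le_ofReal ?_
  rw [invL, norm_div, div_mul_eq_mul_div, div_le_iff₀ hx]
  calc ‖Y k q‖ * _ ≤ ‖Y k q‖ * (A * ‖dot lam q - lam k‖) := by gcongr
    _ = _ := by ring

end

end ResonantKAM

open scoped ENNReal Topology
open Filter Set

/-! ## The Lie bracket -/

namespace ResonantKAM

noncomputable section

/-- The vector field `V` preserves momentum. -/
def PreservesMom (V : VF) : Prop := ∀ k q, momDot q ≠ mom k → V k q = 0

/-- The indices of momentum `m`. -/
def momFiber (m : ℤ) : Finset Idx := {(m, 1), (-m, -1)}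

lemma mem_momFiber {m : ℤ} {k : Idx} : k ∈ momFiber m ↔ mom k = m := by
  obtain ⟨a, b⟩ := k
  rcases Int.units_eq_one_or b with rfl | rfl
  · simp [momFiber, mom]
  · simp [momFiber, mom, neg_eq_iff_eq_neg]

/-- The action `X[Y]` of `X` as a derivation on the components of `Y`. -/
def act (X Y : VF) : VF := fun j q =>
  ∑ ab ∈ Finset.HasAntidiagonal.antidiagonal q, ∑ k ∈ momFiber (momDot ab.1),
    ((ab.2 k : ℂ) + 1) * (X k ab.1 * Y j (ab.2 + unitIdx k))

/-- Momentum conservation confines the `finsum` to the two indices of momentum 𝔪·a. It becomes a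
finite sum and can be split into the two derivations. -/
lemma bracket_eq_act {X Y : VF} (hX : PreservesMom X) (hY : PreservesMom Y) :
    bracket X Y = act X Y - act Y X := by
  funext j q
  simp only [bracket, act, Pi.sub_apply]
  rw [← Finset.sum_sub_distrib]
  refine Finset.sum_congr rfl fun ab _ => ?_
  rw [finsum_eq_sum_of_support_subset (s := momFiber (momDot ab.1)), ← Finset.sum_sub_distrib]
  · exact Finset.sum_congr rfl fun k _ => by ring
  · intro k hk
    rw [Finset.mem_coe, mem_momFiber]
    by_contra hn
    refine hk ?_
    simp [hX k ab.1 (Ne.symm hn), hY k ab.1 (Ne.symm hn)]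

lemma act_add_left (X X' Y : VF) : act (X + X') Y = act X Y + act X' Y := by
  funext j q
  simp only [act, Pi.add_apply, ← Finset.sum_add_distrib]
  exact Finset.sum_congr rfl fun _ _ => Finset.sum_congr rfl fun _ _ => by ring

lemma act_add_right (X Y Y' : VF) : act X (Y + Y') = act X Y + act X Y' := by
  funext j q
  simp only [act, Pi.add_apply, ← Finset.sum_add_distrib]
  exact Finset.sum_congr rfl fun _ _ => Finset.sum_congr rfl fun _ _ => by ring

lemma act_neg_left (X Y : VF) : act (-X) Y = -act X Y := by
  funext j q
  simp only [act, Pi.neg_apply, ← Finset.sum_neg_distrib]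
  exact Finset.sum_congr rfl fun _ _ => Finset.sum_congr rfl fun _ _ => by ring

lemma act_neg_right (X Y : VF) : act X (-Y) = -act X Y := by
  funext j q
  simp only [act, Pi.neg_apply, ← Finset.sum_neg_distrib]
  exact Finset.sum_congr rfl fun _ _ => Finset.sum_congr rfl fun _ _ => by ring

namespace PreservesMom

variable {X Y : VF}

lemma add (hX : PreservesMom X) (hY : PreservesMom Y) : PreservesMom (X + Y) := fun k q h => by
  simp [hX k q h, hY k q h]

lemma neg (hX : PreservesMom X) : PreservesMom (-X) := fun k q h => by simp [hX k q h]

lemma sub (hX : PreservesMom X) (hY : PreservesMom Y) : PreservesMom (X - Y) := fun k q h => by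
  simp [hX k q h, hY k q h]

lemma proj (hX : PreservesMom X) (J : Set MIdx) : PreservesMom (proj J X) := fun k q h => by
  simp [ResonantKAM.proj, hX k q h]

lemma invL (hX : PreservesMom X) (lam : Idx → ℂ) : PreservesMom (invL lam X) := fun k q h => by
  simp [ResonantKAM.invL, hX k q h]

lemma diag (lam : Idx → ℂ) : PreservesMom (diagVF lam) := fun k q h => by
  simp only [diagVF]
  refine Pi.single_eq_of_ne (fun hq => h ?_) _
  rw [hq, momDot_unit]

end PreservesMom

lemma exists_of_act_ne_zero {X Y : VF} {j : Idx} {q : MIdx} (h : act X Y j q ≠ 0) :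
    ∃ a b k, a + b = q ∧ mom k = momDot a ∧ X k a ≠ 0 ∧ Y j (b + unitIdx k) ≠ 0 := by
  obtain ⟨ab, hab, h1⟩ := Finset.exists_ne_zero_of_sum_ne_zero h
  obtain ⟨k, hk, h2⟩ := Finset.exists_ne_zero_of_sum_ne_zero h1
  exact ⟨ab.1, ab.2, k, Finset.HasAntidiagonal.mem_antidiagonal.1 hab, mem_momFiber.1 hk,
    left_ne_zero_of_mul (right_ne_zero_of_mul h2), right_ne_zero_of_mul (right_ne_zero_of_mul h2)⟩

lemma exists_of_bracket_ne_zero {X Y : VF} (hX : PreservesMom X) (hY : PreservesMom Y) {j : Idx}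
    {q : MIdx} (h : bracket X Y j q ≠ 0) :
    ∃ a b k, a + b = q ∧ mom k = momDot a ∧
      ((X k a ≠ 0 ∧ Y j (b + unitIdx k) ≠ 0) ∨ (Y k a ≠ 0 ∧ X j (b + unitIdx k) ≠ 0)) := by
  rw [bracket_eq_act hX hY, Pi.sub_apply, Pi.sub_apply] at h
  by_cases h1 : act X Y j q = 0
  · have h2 : act Y X j q ≠ 0 := fun h2 => h (by rw [h1, h2, sub_zero])
    obtain ⟨a, b, k, e, e1, e2⟩ := exists_of_act_ne_zero h2
    exact ⟨a, b, k, e, e1, Or.inr e2⟩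
  · obtain ⟨a, b, k, e, e1, e2⟩ := exists_of_act_ne_zero h1
    exact ⟨a, b, k, e, e1, Or.inl e2⟩

lemma PreservesMom.bracket {X Y : VF} (hX : PreservesMom X) (hY : PreservesMom Y) :
    PreservesMom (bracket X Y) := by
  intro j q hq
  by_contra h
  obtain ⟨a, b, k, rfl, hk, h2⟩ := exists_of_bracket_ne_zero hX hY h
  refine hq ?_
  rw [momDot_add, ← hk, ← momDot_unit, add_comm, ← momDot_add]
  rcases h2 with h2 | h2
  · by_contra h3; exact h2.2 (hY _ _ h3)
  · by_contra h3; exact h2.2 (hX _ _ h3)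

lemma OrderGE.bracket {X Y : VF} {d e : ℕ} (hX : PreservesMom X) (hY : PreservesMom Y)
    (hd : OrderGE d X) (he : OrderGE e Y) : OrderGE (d + e) (bracket X Y) := by
  intro j q hq
  by_contra h
  obtain ⟨a, b, k, rfl, hk, h2⟩ := exists_of_bracket_ne_zero hX hY h
  rw [len_add] at hq
  have hb : len (b + unitIdx k) = len b + 1 := by rw [len_add, len_unit]
  rcases h2 with h2 | h2
  · have h3 : ¬ len a < d + 1 := fun h => h2.1 (hd _ _ h)
    have h4 : ¬ len (b + unitIdx k) < e + 1 := fun h => h2.2 (he _ _ h)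
    omega
  · have h3 : ¬ len a < e + 1 := fun h => h2.1 (he _ _ h)
    have h4 : ¬ len (b + unitIdx k) < d + 1 := fun h => h2.2 (hd _ _ h)
    omega

lemma OrderGE.mono {X : VF} {d e : ℕ} (h : OrderGE d X) (hde : e ≤ d) : OrderGE e X :=
  fun k q hq => h k q (by omega)

lemma bracket_add_left {X X' Y : VF} (hX : PreservesMom X) (hX' : PreservesMom X')
    (hY : PreservesMom Y) : bracket (X + X') Y = bracket X Y + bracket X' Y := by
  rw [bracket_eq_act (hX.add hX') hY, bracket_eq_act hX hY, bracket_eq_act hX' hY, act_add_left,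
    act_add_right]
  abel

lemma bracket_add_right {X Y Y' : VF} (hX : PreservesMom X) (hY : PreservesMom Y)
    (hY' : PreservesMom Y') : bracket X (Y + Y') = bracket X Y + bracket X Y' := by
  rw [bracket_eq_act hX (hY.add hY'), bracket_eq_act hX hY, bracket_eq_act hX hY', act_add_left,
    act_add_right]
  abel

lemma bracket_neg_right {X Y : VF} (hX : PreservesMom X) (hY : PreservesMom Y) :
    bracket X (-Y) = -bracket X Y := by
  rw [bracket_eq_act hX hY.neg, bracket_eq_act hX hY, act_neg_left, act_neg_right]
  abel

lemma bracket_swap {X Y : VF} (hX : PreservesMom X) (hY : PreservesMom Y) :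
    bracket Y X = -bracket X Y := by
  rw [bracket_eq_act hX hY, bracket_eq_act hY hX]
  abel

/-! ### Brackets with the diagonal linear field -/

lemma unitIdx_injective : Function.Injective unitIdx :=
  Finsupp.single_left_injective one_ne_zero

/-- Euler's identity: only the splittings with a = e_k contribute, with the multiplicity q_k. -/
lemma act_diag_left (lam : Idx → ℂ) (X : VF) (j : Idx) (q : MIdx) :
    act (diagVF lam) X j q = dot lam q * X j q := by
  classical
  have h1 : ∀ ab ∈ Finset.HasAntidiagonal.antidiagonal q,
      ∑ k ∈ momFiber (momDot ab.1), ((ab.2 k : ℂ) + 1) *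
        (diagVF lam k ab.1 * X j (ab.2 + unitIdx k))
      = ∑ k ∈ q.support, if ab.1 = unitIdx k then (q k : ℂ) * lam k * X j q else 0 := by
    intro ab hab
    have hq : ab.1 + ab.2 = q := Finset.HasAntidiagonal.mem_antidiagonal.1 hab
    by_cases hu : ∃ k, ab.1 = unitIdx k
    · obtain ⟨k, hk⟩ := hu
      have hqk : q k = ab.2 k + 1 := by rw [← hq, hk]; simp [unitIdx, add_comm]
      rw [Finset.sum_eq_single k, Finset.sum_eq_single k]
      · rw [if_pos hk, hqk, diagVF, hk, Pi.single_eq_same, ← hq, hk, add_comm ab.2]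
        push_cast; ring
      · intro i _ hi
        rw [if_neg]
        rw [hk]; exact fun h => hi (unitIdx_injective h).symm
      · intro h
        rw [Finsupp.notMem_support_iff, hqk] at h
        omega
      · intro i _ hi
        rw [diagVF, hk, Pi.single_eq_of_ne (fun h => hi (unitIdx_injective h).symm)]
        simp
      · intro h
        exact absurd (mem_momFiber.2 (by rw [hk, momDot_unit])) h
    · push Not at hu
      rw [Finset.sum_eq_zero, Finset.sum_eq_zero]
      · intro k _; rw [if_neg (hu k)]
      · intro k _; rw [diagVF, Pi.single_eq_of_ne (hu k)]; simp
  rw [act, Finset.sum_congr rfl h1, Finset.sum_comm, dot, Finsupp.sum, Finset.sum_mul]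
  refine Finset.sum_congr rfl fun k hk => ?_
  have hle : unitIdx k ≤ q :=
    Finsupp.single_le_iff.2 (Nat.one_le_iff_ne_zero.2 (Finsupp.mem_support_iff.1 hk))
  rw [Finset.sum_eq_single (unitIdx k, q - unitIdx k)]
  · simp
  · intro ab hab hne
    refine if_neg fun h => hne ?_
    have hq : ab.1 + ab.2 = q := Finset.HasAntidiagonal.mem_antidiagonal.1 hab
    refine Prod.ext h ?_
    rw [← hq, h]; simp
  · intro h
    exact absurd (Finset.HasAntidiagonal.mem_antidiagonal.2 (add_tsub_cancel_of_le hle)) h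

lemma act_diag_right (lam : Idx → ℂ) {X : VF} (hX : PreservesMom X) (j : Idx) (q : MIdx) :
    act X (diagVF lam) j q = lam j * X j q := by
  classical
  have h1 : ∀ (b : MIdx) (k : Idx), b + unitIdx k = unitIdx j → b = 0 ∧ k = j := by
    intro b k h
    have h2 := congrArg len h
    rw [len_add, len_unit, len_unit] at h2
    have hb : b = 0 := by
      by_contra hb
      have := len_pos hb
      omega
    rw [hb, zero_add] at h
    exact ⟨hb, unitIdx_injective h⟩
  rw [act, Finset.sum_eq_single (q, 0)]
  · by_cases hq : momDot q = mom j
    · rw [Finset.sum_eq_single j]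
      · simp [diagVF, mul_comm]
      · intro k _ hk
        rw [diagVF, Pi.single_eq_of_ne (fun h => hk (h1 _ _ h).2)]; simp
      · intro h; exact absurd (mem_momFiber.2 hq.symm) h
    · rw [hX j q hq, mul_zero]
      refine Finset.sum_eq_zero fun k hk => ?_
      rw [diagVF, Pi.single_eq_of_ne]
      · simp
      · intro h
        exact hq ((mem_momFiber.1 ((h1 _ _ h).2 ▸ hk)).symm)
  · intro ab hab hne
    refine Finset.sum_eq_zero fun k _ => ?_
    rw [diagVF, Pi.single_eq_of_ne]
    · simp
    · intro h
      have hq : ab.1 + ab.2 = q := Finset.HasAntidiagonal.mem_antidiagonal.1 hab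
      refine hne (Prod.ext ?_ (h1 _ _ h).1)
      rw [← hq, (h1 _ _ h).1]; simp
  · intro h; exact absurd (Finset.HasAntidiagonal.mem_antidiagonal.2 (add_zero q)) h

lemma bracket_diag_left (lam : Idx → ℂ) {X : VF} (hX : PreservesMom X) (j : Idx) (q : MIdx) :
    bracket (diagVF lam) X j q = (dot lam q - lam j) * X j q := by
  rw [bracket_eq_act (PreservesMom.diag lam) hX, Pi.sub_apply, Pi.sub_apply, act_diag_left,
    act_diag_right lam hX]
  ring

lemma bracket_diag_invL (lam : Idx → ℂ) {X : VF} (hX : PreservesMom X)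
    (hr : ∀ k q, dot lam q = lam k → X k q = 0) : bracket (diagVF lam) (invL lam X) = X := by
  funext k q
  rw [bracket_diag_left lam (hX.invL lam), invL]
  by_cases h : dot lam q = lam k
  · simp [hr k q h]
  · field_simp [sub_ne_zero.2 h]

/-! ### Norm estimates -/

/-- The derivative of the majorant of `V` in the direction `v`. -/
def dmaj (V : VF) (u v : Idx → ℝ≥0∞) (k : Idx) : ℝ≥0∞ := ∑' q, ‖V k q‖ₑ * dmonom u v q

lemma dmonom_eq_tsum {R : Type*} [CommSemiring R] [TopologicalSpace R] (x v : Idx → R) (q : MIdx) :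
    dmonom x v q = ∑' k, (q k : R) * v k * monom x (q - unitIdx k) := by
  rw [dmonom, tsum_eq_sum]
  intro k hk
  rw [Finsupp.notMem_support_iff.1 hk]; simp

lemma tsum_shift {R : Type*} [CommSemiring R] [TopologicalSpace R] (f : MIdx → R) (x v : Idx → R)
    (k : Idx) : ∑' q : MIdx, f q * ((q k : R) * v k * monom x (q - unitIdx k))
      = ∑' b : MIdx, f (b + unitIdx k) * (((b k : R) + 1) * v k * monom x b) := by
  have hinj : Function.Injective fun b : MIdx => b + unitIdx k := add_left_injective _
  rw [← hinj.tsum_eq]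
  · refine tsum_congr fun b => ?_
    simp [unitIdx]
  · intro q hq
    have hqk : q k ≠ 0 := fun h0 => hq (by simp [h0])
    exact ⟨q - unitIdx k, tsub_add_cancel_of_le (Finsupp.single_le_iff.2 (Nat.one_le_iff_ne_zero.2 hqk))⟩

lemma dmaj_eq (V : VF) (u v : Idx → ℝ≥0∞) (j : Idx) : dmaj V u v j =
    ∑' k, ∑' b : MIdx, ‖V j (b + unitIdx k)‖ₑ * (((b k : ℝ≥0∞) + 1) * v k * monom u b) := by
  simp only [dmaj, dmonom_eq_tsum, ← ENNReal.tsum_mul_left]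
  rw [ENNReal.tsum_comm]
  exact tsum_congr fun k => tsum_shift (fun q => ‖V j q‖ₑ) u v k

lemma ENNReal_tsum_antidiagonal (f : MIdx × MIdx → ℝ≥0∞) :
    ∑' q : MIdx, ∑ ab ∈ Finset.HasAntidiagonal.antidiagonal q, f ab = ∑' ab, f ab := by
  rw [← Finset.HasAntidiagonal.sigmaAntidiagonalEquivProd.tsum_eq f, ENNReal.tsum_sigma']
  refine tsum_congr fun q => ?_
  rw [tsum_fintype, ← Finset.sum_coe_sort]
  rfl

lemma enorm_natCast_add_one (n : ℕ) : ‖((n : ℂ) + 1)‖ₑ = (n : ℝ≥0∞) + 1 := by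
  have : ((n : ℂ) + 1) = ((n + 1 : ℕ) : ℂ) := by push_cast; rfl
  rw [this, ← ofReal_norm, Complex.norm_natCast, ENNReal.ofReal_natCast]
  push_cast; rfl

/-- Tonelli for the full triple sum, with the momentum constraint dropped. The same identity gives
the norm bound for `act` and the absolute convergence needed to evaluate it at a point. -/
lemma tsum_act_eq_dmaj (X Y : VF) (u : Idx → ℝ≥0∞) (j : Idx) :
    ∑' ab : MIdx × MIdx, ∑' k, ((ab.2 k : ℝ≥0∞) + 1) * (‖X k ab.1‖ₑ * ‖Y j (ab.2 + unitIdx k)‖ₑ)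
      * (monom u ab.1 * monom u ab.2) = dmaj Y u (maj X u) j := by
  rw [dmaj_eq, ENNReal.tsum_comm]
  refine tsum_congr fun k => ?_
  rw [ENNReal.tsum_prod', ENNReal.tsum_comm]
  refine tsum_congr fun b => ?_
  rw [maj, ← ENNReal.tsum_mul_left, ← ENNReal.tsum_mul_right, ← ENNReal.tsum_mul_left]
  refine tsum_congr fun a => ?_
  ring

lemma maj_act_le (X Y : VF) (u : Idx → ℝ≥0∞) (j : Idx) :
    maj (act X Y) u j ≤ dmaj Y u (maj X u) j := by
  rw [← tsum_act_eq_dmaj, ← ENNReal_tsum_antidiagonal, maj]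
  refine ENNReal.tsum_le_tsum fun q => ?_
  refine (mul_le_mul' (enorm_sum_le _ _) le_rfl).trans ?_
  rw [Finset.sum_mul]
  refine Finset.sum_le_sum fun ab hab => ?_
  have hq : ab.1 + ab.2 = q := Finset.HasAntidiagonal.mem_antidiagonal.1 hab
  refine (mul_le_mul' (enorm_sum_le _ _) le_rfl).trans ?_
  rw [Finset.sum_mul]
  refine le_trans (le_of_eq ?_) (ENNReal.sum_le_tsum (momFiber (momDot ab.1)))
  refine Finset.sum_congr rfl fun k _ => ?_
  rw [enorm_mul, enorm_mul, enorm_natCast_add_one, ← hq, monom_add]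

lemma mul_dmaj_le (Y : VF) (u v : Idx → ℝ≥0∞) (t : ℝ≥0∞) (j : Idx) :
    t * dmaj Y u v j ≤ maj Y (fun h => u h + t * v h) j := by
  rw [dmaj, maj, ← ENNReal.tsum_mul_left]
  refine ENNReal.tsum_le_tsum fun q => ?_
  rw [mul_left_comm, ← dmonom_smul_right]
  exact mul_le_mul' le_rfl (le_add_self.trans (monom_add_dmonom_le u _ q))

/-- Cauchy's estimate for majorants, by scaling. With t = (r' - r)/c the point u + tv still lies in
the ball of radius r', and since all terms are non-negative the part linear in t is at most the
whole majorant. The case c = 0, where t is meaningless, is trivial. -/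
lemma wNorm_dmaj_le {s r r' c b : ℝ} {Y : VF} {u v : Idx → ℝ≥0∞} (hr : 0 ≤ r) (hrr : r < r')
    (hc : 0 ≤ c) (hu : wNorm s u < ENNReal.ofReal r) (hv : wNorm s v ≤ ENNReal.ofReal c)
    (hY : vnorm s r' Y ≤ ENNReal.ofReal b) :
    wNorm s (dmaj Y u v) ≤ ENNReal.ofReal (r' * b * c / (r' - r)) := by
  rcases hc.eq_or_lt with rfl | hc'
  · have hv0 : v = 0 := eq_zero_of_wNorm_eq_zero (le_antisymm (by simpa using hv) zero_le)
    have : dmaj Y u v = fun _ => 0 := by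
      funext j
      simp [dmaj, dmonom, hv0]
    rw [this, wNorm_zero]; exact zero_le
  · have hd : 0 < r' - r := sub_pos.2 hrr
    have hr' : 0 < r' := hr.trans_lt hrr
    set t := ENNReal.ofReal ((r' - r) / c) with ht
    have htpos : t ≠ 0 := (ENNReal.ofReal_pos.2 (by positivity)).ne'
    have htc : t * ENNReal.ofReal c = ENNReal.ofReal (r' - r) := by
      rw [ht, ← ENNReal.ofReal_mul (by positivity)]; congr 1; field_simp
    have h1 : wNorm s (fun h => u h + t * v h) < ENNReal.ofReal r' := by
      refine (wNorm_add_le s u _).trans_lt ?_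
      rw [wNorm_const_mul]
      calc wNorm s u + t * wNorm s v ≤ wNorm s u + ENNReal.ofReal (r' - r) := by
            rw [← htc]; gcongr
        _ < ENNReal.ofReal r + ENNReal.ofReal (r' - r) :=
            ENNReal.add_lt_add_right ENNReal.ofReal_ne_top hu
        _ = ENNReal.ofReal r' := by rw [← ENNReal.ofReal_add hr hd.le]; congr 1; ring
    have h2 : t * wNorm s (dmaj Y u v) ≤ ENNReal.ofReal r' * ENNReal.ofReal b := by
      rw [← wNorm_const_mul]
      refine (wNorm_mono fun j => mul_dmaj_le Y u v t j).trans ((wNorm_maj_le hr' Y h1).trans ?_)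
      gcongr
    have h3 : t * ENNReal.ofReal (r' * b * c / (r' - r)) = ENNReal.ofReal r' * ENNReal.ofReal b := by
      rw [ht, ← ENNReal.ofReal_mul (by positivity), ← ENNReal.ofReal_mul hr'.le]
      congr 1; field_simp
    rw [← h3] at h2
    exact (ENNReal.mul_le_mul_iff_right htpos ENNReal.ofReal_ne_top).1 h2

/-- Only Y is differentiated, so only Y needs the larger radius. -/
lemma vnorm_act_le {s r r' a b : ℝ} {X Y : VF} (hr : 0 < r) (hrr : r < r') (ha : 0 ≤ a)
    (hX : vnorm s r X ≤ ENNReal.ofReal a) (hY : vnorm s r' Y ≤ ENNReal.ofReal b) :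
    vnorm s r (act X Y) ≤ ENNReal.ofReal (r' / (r' - r) * a * b) := by
  have hd : 0 < r' - r := sub_pos.2 hrr
  refine vnorm_le fun u hu => ?_
  have hv : wNorm s (maj X u) ≤ ENNReal.ofReal (r * a) := by
    rw [ENNReal.ofReal_mul hr.le]
    exact (wNorm_maj_le hr X hu).trans (by gcongr)
  refine (wNorm_mono fun j => maj_act_le X Y u j).trans
    ((wNorm_dmaj_le hr.le hrr (by positivity) hu hv hY).trans (le_of_eq ?_))
  rw [← ENNReal.ofReal_mul hr.le]
  congr 1; field_simp

/-- `V ∈ 𝒱_{s,r}` with norm at most `a`. -/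
structure VBound (s r : ℝ) (V : VF) (a : ℝ) : Prop where
  zero_at_origin : ∀ k, V k 0 = 0
  mom : PreservesMom V
  nonneg : 0 ≤ a
  le : vnorm s r V ≤ ENNReal.ofReal a

namespace VBound

variable {s r a b : ℝ} {V W : VF}

lemma memV (h : VBound s r V a) : MemV s r V :=
  ⟨h.zero_at_origin, h.mom, h.le.trans_lt ENNReal.ofReal_lt_top⟩

lemma of_memV (h : MemV s r V) : VBound s r V (vnorm s r V).toReal :=
  ⟨h.zero_at_origin, h.momentum, ENNReal.toReal_nonneg,
    by rw [ENNReal.ofReal_toReal h.norm_lt_top.ne]⟩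

lemma toReal_le (h : VBound s r V a) : (vnorm s r V).toReal ≤ a :=
  ENNReal.toReal_le_of_le_ofReal h.nonneg h.le

lemma mono (h : VBound s r V a) {s' r' a' : ℝ} (hs : s ≤ s') (hr' : 0 < r') (hr : r' ≤ r)
    (ha : a ≤ a') : VBound s' r' V a' :=
  ⟨h.zero_at_origin, h.mom, h.nonneg.trans ha,
    (vnorm_antitone_s hr' hs h.zero_at_origin h.mom).trans
      ((vnorm_monotone_r hr' hr h.zero_at_origin).trans (h.le.trans (ENNReal.ofReal_le_ofReal ha)))⟩

lemma weaken (h : VBound s r V a) {a' : ℝ} (ha : a ≤ a') : VBound s r V a' :=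
  ⟨h.zero_at_origin, h.mom, h.nonneg.trans ha, h.le.trans (ENNReal.ofReal_le_ofReal ha)⟩

lemma add (hr : 0 < r) (hV : VBound s r V a) (hW : VBound s r W b) : VBound s r (V + W) (a + b) :=
  ⟨fun k => by simp [hV.zero_at_origin, hW.zero_at_origin], hV.mom.add hW.mom,
    add_nonneg hV.nonneg hW.nonneg, by
      rw [ENNReal.ofReal_add hV.nonneg hW.nonneg]
      exact (vnorm_add_le hr V W).trans (add_le_add hV.le hW.le)⟩

lemma neg (hV : VBound s r V a) : VBound s r (-V) a :=
  ⟨fun k => by simp [hV.zero_at_origin], hV.mom.neg, hV.nonneg, by rw [vnorm_neg]; exact hV.le⟩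

lemma sub (hr : 0 < r) (hV : VBound s r V a) (hW : VBound s r W b) :
    VBound s r (V - W) (a + b) := by
  rw [sub_eq_add_neg]; exact hV.add hr hW.neg

lemma proj (hV : VBound s r V a) (J : Set MIdx) : VBound s r (proj J V) a :=
  ⟨fun k => by simp [ResonantKAM.proj, hV.zero_at_origin], hV.mom.proj J,
    hV.nonneg, (vnorm_proj_le J V).trans hV.le⟩

lemma smul (hr : 0 < r) (hV : VBound s r V a) (c : ℂ) : VBound s r (c • V) (‖c‖ * a) :=
  ⟨fun k => by simp [hV.zero_at_origin], fun k q h => by simp [hV.mom k q h],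
    mul_nonneg (norm_nonneg _) hV.nonneg, by
      rw [ENNReal.ofReal_mul (norm_nonneg _), ofReal_norm]
      exact (vnorm_smul hr c V).trans (by gcongr; exact hV.le)⟩

lemma bracket {r' : ℝ} (hr : 0 < r) (hrr : r < r') (hV : VBound s r' V a) (hW : VBound s r' W b) :
    VBound s r (bracket V W) (2 * (r' / (r' - r)) * a * b) where
  zero_at_origin k := by
    by_contra h
    obtain ⟨x, y, i, hxy, -, h2⟩ := exists_of_bracket_ne_zero hV.mom hW.mom h
    have hx : x = 0 := (add_eq_zero.1 hxy).1
    rcases h2 with h2 | h2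
    · exact h2.1 (by rw [hx]; exact hV.zero_at_origin i)
    · exact h2.1 (by rw [hx]; exact hW.zero_at_origin i)
  mom := hV.mom.bracket hW.mom
  nonneg := by
    have := hV.nonneg; have := hW.nonneg
    have hd : 0 < r' - r := sub_pos.2 hrr
    have : 0 < r' := hr.trans hrr
    positivity
  le := by
    have hd : 0 < r' - r := sub_pos.2 hrr
    have hr' : 0 < r' := hr.trans hrr
    have ha := hV.nonneg; have hb := hW.nonneg
    have hV' := hV.mono le_rfl hr hrr.le le_rfl
    have hW' := hW.mono le_rfl hr hrr.le le_rfl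
    rw [bracket_eq_act hV.mom hW.mom, sub_eq_add_neg]
    refine (vnorm_add_le hr _ _).trans ?_
    rw [vnorm_neg]
    refine (add_le_add (vnorm_act_le hr hrr ha hV'.le hW.le)
      (vnorm_act_le hr hrr hb hW'.le hV.le)).trans (le_of_eq ?_)
    rw [← ENNReal.ofReal_add (by positivity) (by positivity)]
    congr 1; ring

end VBound

end

end ResonantKAM

open scoped ENNReal Topology
open Filter Set

/-! ## Evaluation of vector fields -/

namespace ResonantKAM

noncomputable section

lemma summable_of_tsum_enorm_ne_top {ι : Type*} {f : ι → ℂ} (h : ∑' i, ‖f i‖ₑ ≠ ⊤) :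
    Summable f := by
  refine Summable.of_norm ((ENNReal.summable_toReal h).congr fun i => ?_)
  rw [toReal_enorm]

/-- The derivative of the `j`-th component of `Y` at `x` in the direction `v`. -/
def deval (Y : VF) (x v : Idx → ℂ) (j : Idx) : ℂ := ∑' q, Y j q * dmonom x v q

lemma enorm_eval_le (V : VF) (x : Idx → ℂ) (k : Idx) :
    ‖eval V x k‖ₑ ≤ maj V (fun h => ‖x h‖ₑ) k := by
  refine (enorm_tsum_le_tsum_enorm).trans (le_of_eq ?_)
  refine tsum_congr fun q => ?_
  rw [enorm_mul]
  exact congrArg _ (enorm_monom x q)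

lemma enorm_deval_le (V : VF) (x v : Idx → ℂ) (k : Idx) :
    ‖deval V x v k‖ₑ ≤ dmaj V (fun h => ‖x h‖ₑ) (fun h => ‖v h‖ₑ) k := by
  refine (enorm_tsum_le_tsum_enorm).trans (ENNReal.tsum_le_tsum fun q => ?_)
  rw [enorm_mul]
  gcongr
  exact enorm_dmonom_le x v q

lemma summable_eval {V : VF} {x : Idx → ℂ} {k : Idx} (h : maj V (fun h => ‖x h‖ₑ) k ≠ ⊤) :
    Summable fun q => V k q * monom x q := by
  refine summable_of_tsum_enorm_ne_top (ne_of_eq_of_ne (tsum_congr fun q => ?_) h)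
  rw [enorm_mul, enorm_monom]

lemma summable_deval {V : VF} {x v : Idx → ℂ} {k : Idx}
    (h : dmaj V (fun h => ‖x h‖ₑ) (fun h => ‖v h‖ₑ) k ≠ ⊤) :
    Summable fun q => V k q * dmonom x v q := by
  refine summable_of_tsum_enorm_ne_top (ne_top_of_le_ne_top h (ENNReal.tsum_le_tsum fun q => ?_))
  rw [enorm_mul]
  gcongr
  exact enorm_dmonom_le x v q

lemma eval_add {V W : VF} {x : Idx → ℂ} {k : Idx} (hV : maj V (fun h => ‖x h‖ₑ) k ≠ ⊤)
    (hW : maj W (fun h => ‖x h‖ₑ) k ≠ ⊤) : eval (V + W) x k = eval V x k + eval W x k := by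
  refine Eq.trans (tsum_congr fun q => ?_) ((summable_eval hV).tsum_add (summable_eval hW))
  exact add_mul _ _ _

lemma eval_neg (V : VF) (x : Idx → ℂ) (k : Idx) : eval (-V) x k = -eval V x k := by
  rw [eval, eval, ← tsum_neg]
  exact tsum_congr fun q => neg_mul _ _

lemma eval_smul (c : ℂ) (V : VF) (x : Idx → ℂ) (k : Idx) : eval (c • V) x k = c * eval V x k := by
  rw [eval, eval, ← tsum_mul_left]
  exact tsum_congr fun q => mul_assoc _ _ _

lemma deval_add {V : VF} {x v w : Idx → ℂ} {k : Idx}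
    (hv : dmaj V (fun h => ‖x h‖ₑ) (fun h => ‖v h‖ₑ) k ≠ ⊤)
    (hw : dmaj V (fun h => ‖x h‖ₑ) (fun h => ‖w h‖ₑ) k ≠ ⊤) :
    deval V x (v + w) k = deval V x v k + deval V x w k := by
  refine Eq.trans (tsum_congr fun q => ?_) ((summable_deval hv).tsum_add (summable_deval hw))
  rw [← mul_add, ← dmonom_add_right]
  rfl

lemma deval_smul (V : VF) (x v : Idx → ℂ) (c : ℂ) (k : Idx) :
    deval V x (c • v) k = c * deval V x v k := by
  rw [deval, deval, ← tsum_mul_left]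
  refine tsum_congr fun q => ?_
  change V k q * dmonom x (fun h => c * v h) q = _
  rw [dmonom_smul_right, mul_left_comm]

lemma eval_diagVF (lam : Idx → ℂ) (x : Idx → ℂ) (k : Idx) :
    eval (diagVF lam) x k = lam k * x k := by
  rw [eval, tsum_eq_single (unitIdx k)]
  · rw [diagVF, Pi.single_eq_same]
    exact congrArg _ (monom_single x k)
  · intro q hq
    rw [diagVF, Pi.single_eq_of_ne hq, zero_mul]

lemma dmonom_mul_self (lam x : Idx → ℂ) (q : MIdx) :
    dmonom x (fun k => lam k * x k) q = dot lam q * monom x q := by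
  induction q using midx_induction with
  | h0 => simp [dot]
  | h1 q h ih =>
    rw [dmonom_add_unit, ih, dot_add, dot_unit, monom_add, monom_single]
    ring

/-- Both sides are rearrangements of one triple series. Finiteness of the corresponding `dmaj` is
its absolute convergence and justifies every exchange of summations. -/
lemma eval_act {X Y : VF} (hX : PreservesMom X) {x : Idx → ℂ} {j : Idx}
    (hfin : dmaj Y (fun h => ‖x h‖ₑ) (maj X fun h => ‖x h‖ₑ) j ≠ ⊤) :
    eval (act X Y) x j = deval Y x (eval X x) j := by
  set u : Idx → ℝ≥0∞ := fun h => ‖x h‖ₑ with hu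
  set g : (MIdx × MIdx) × Idx → ℂ := fun p => ((p.1.2 p.2 : ℂ) + 1) *
    (X p.2 p.1.1 * Y j (p.1.2 + unitIdx p.2)) * (monom x p.1.1 * monom x p.1.2) with hg
  have hgs : Summable g := by
    refine summable_of_tsum_enorm_ne_top ?_
    rw [ENNReal.tsum_prod']
    refine ne_of_eq_of_ne ?_ hfin
    rw [← tsum_act_eq_dmaj]
    refine tsum_congr fun ab => tsum_congr fun k => ?_
    simp only [hg, enorm_mul, enorm_natCast_add_one, enorm_monom, hu]
  -- the left-hand side
  have h1 : eval (act X Y) x j = ∑' ab, ∑' k, g (ab, k) := by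
    have hs : Summable fun ab => ∑' k, g (ab, k) := hgs.prod
    rw [← Finset.HasAntidiagonal.sigmaAntidiagonalEquivProd.tsum_eq, Summable.tsum_sigma]
    · refine tsum_congr fun q => ?_
      rw [tsum_fintype, act]
      change (∑ ab ∈ Finset.HasAntidiagonal.antidiagonal q, _) * monom x q = _
      rw [Finset.sum_mul, ← Finset.sum_coe_sort]
      refine Finset.sum_congr rfl fun ab _ => ?_
      have hq : ab.1.1 + ab.1.2 = q := Finset.HasAntidiagonal.mem_antidiagonal.1 ab.2
      rw [Finset.sum_mul, tsum_eq_sum (s := momFiber (momDot ab.1.1))]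
      · refine Finset.sum_congr rfl fun k _ => ?_
        have hm : monom x q = monom x ab.1.1 * monom x ab.1.2 := by
          rw [← monom_add, hq]
        rw [hm]; rfl
      · intro k hk
        rw [mem_momFiber] at hk
        have : X k ab.1.1 = 0 := hX _ _ (Ne.symm hk)
        change _ * (X k ab.1.1 * _) * _ = _
        rw [this]; ring
    · exact (Equiv.summable_iff _).2 hs
  -- the right-hand side
  have hv : ∀ k, ‖eval X x k‖ₑ ≤ maj X u k := fun k => enorm_eval_le X x k
  set v := eval X x with hvdef
  set f : MIdx → Idx → ℂ := fun q k => Y j q * ((q k : ℂ) * v k * monom x (q - unitIdx k)) with hf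
  have hfs : Summable (Function.uncurry f) := by
    refine summable_of_tsum_enorm_ne_top ?_
    rw [ENNReal.tsum_prod']
    refine ne_top_of_le_ne_top hfin (ENNReal.tsum_le_tsum fun q => ?_)
    rw [dmonom_eq_tsum, ← ENNReal.tsum_mul_left]
    refine ENNReal.tsum_le_tsum fun k => ?_
    simp only [hf, Function.uncurry_apply_pair, enorm_mul, enorm_monom]
    gcongr
    · rw [← ofReal_norm, Complex.norm_natCast, ENNReal.ofReal_natCast]
    · exact hv k
  have h2 : deval Y x v j = ∑' k, ∑' b : MIdx, Y j (b + unitIdx k) *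
      (((b k : ℂ) + 1) * v k * monom x b) := by
    simp only [deval, dmonom_eq_tsum, ← tsum_mul_left]
    rw [← hfs.tsum_comm]
    exact tsum_congr fun k => tsum_shift (fun q => Y j q) x v k
  have hgs' : Summable (Function.uncurry fun ab k => g (ab, k)) := hgs
  rw [h1, h2, ← hgs'.tsum_comm]
  refine tsum_congr fun k => ?_
  have h3 : Summable fun ab : MIdx × MIdx => g (ab, k) := by
    exact hgs.prod_symm.prod_factor k
  have h4 : Summable (Function.uncurry fun (a b : MIdx) => g ((a, b), k)) := h3
  rw [h3.tsum_prod, ← h4.tsum_comm]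
  refine tsum_congr fun b => ?_
  rw [hvdef]
  simp only [hg, eval]
  rw [← tsum_mul_left, ← tsum_mul_right, ← tsum_mul_left]
  refine tsum_congr fun a => ?_
  simp only [monom]
  ring

/-! ### The spaces `g_s` -/

instance completeSpace_G (s : ℝ) : CompleteSpace (G s) := by
  have hiso : Isometry (toL2 s) := AddMonoidHomClass.isometry_of_norm _ fun _ => rfl
  have hsurj : Function.Surjective (toL2 s) := by
    intro y
    have h : ∀ k, (wt s k : ℂ) * ((wt s k : ℂ)⁻¹ * (y : Idx → ℂ) k) = (y : Idx → ℂ) k := fun k =>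
      mul_inv_cancel_left₀ (by exact_mod_cast (wt_pos s k).ne') _
    refine ⟨⟨fun k => (wt s k : ℂ)⁻¹ * (y : Idx → ℂ) k, ?_⟩, ?_⟩
    · change Memℓp (fun k => (wt s k : ℂ) * ((wt s k : ℂ)⁻¹ * (y : Idx → ℂ) k)) 2
      simp only [h]
      exact y.2
    · exact Subtype.ext (funext h)
  exact (completeSpace_congr (e := Equiv.ofBijective (toL2 s) ⟨toL2_injective s, hsurj⟩)
    hiso.isUniformEmbedding).2 inferInstance

@[simp] lemma G_add_val {s : ℝ} (x y : G s) : (x + y).1 = x.1 + y.1 := rfl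
@[simp] lemma G_sub_val {s : ℝ} (x y : G s) : (x - y).1 = x.1 - y.1 := rfl
@[simp] lemma G_smul_val {s : ℝ} (c : ℂ) (x : G s) : (c • x).1 = c • x.1 := rfl

lemma G_ext {s : ℝ} {x y : G s} (h : ∀ k, x.1 k = y.1 k) : x = y := Subtype.ext (funext h)

lemma wNorm_lt_top {s : ℝ} (x : G s) : wNorm s (fun k => ‖x.1 k‖ₑ) < ⊤ := by
  rw [← enorm_eq_wNorm]; exact enorm_lt_top

lemma norm_le_of_wNorm_le {s b : ℝ} (hb : 0 ≤ b) {x : G s}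
    (h : wNorm s (fun k => ‖x.1 k‖ₑ) ≤ ENNReal.ofReal b) : ‖x‖ ≤ b := by
  rw [← enorm_eq_wNorm, ← ofReal_norm] at h
  exact (ENNReal.ofReal_le_ofReal_iff hb).1 h

/-- The coordinate functionals are continuous. -/
lemma exists_coord (s : ℝ) (k : Idx) : ∃ L : G s →L[ℂ] ℂ, ∀ x, L x = x.1 k := by
  refine ⟨LinearMap.mkContinuous
    { toFun := fun x => x.1 k, map_add' := fun _ _ => rfl, map_smul' := fun _ _ => rfl }
    (wt s k)⁻¹ fun x => ?_, fun _ => rfl⟩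
  have h := le_wNorm s (fun k => ‖x.1 k‖ₑ) k
  rw [← enorm_eq_wNorm, ← ofReal_norm, ← ofReal_norm, ← ENNReal.ofReal_mul (wt_pos s k).le,
    ENNReal.ofReal_le_ofReal_iff (norm_nonneg _)] at h
  rw [← div_eq_inv_mul, le_div_iff₀ (wt_pos s k), mul_comm]
  exact h

lemma exists_multiplier {t t' K : ℝ} (hK : 0 ≤ K) (m : Idx → ℂ)
    (h : ∀ k, wt t' k * ‖m k‖ ≤ K * wt t k) :
    ∃ L : G t →L[ℂ] G t', (∀ x k, (L x).1 k = m k * x.1 k) ∧ ∀ x, ‖L x‖ ≤ K * ‖x‖ := by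
  have h1 : ∀ x : G t, wNorm t' (fun k => ‖m k * x.1 k‖ₑ) ≤ ENNReal.ofReal (K * ‖x‖) := by
    intro x
    have h2 : wNorm t' (fun k => ‖m k * x.1 k‖ₑ) ≤
        wNorm t (fun k => ENNReal.ofReal K * ‖x.1 k‖ₑ) := by
      refine ENNReal.rpow_le_rpow (ENNReal.tsum_le_tsum fun k => ?_) (by norm_num)
      refine pow_le_pow_left' ?_ 2
      change ENNReal.ofReal (wt t' k) * ‖m k * x.1 k‖ₑ ≤
        ENNReal.ofReal (wt t k) * (ENNReal.ofReal K * ‖x.1 k‖ₑ)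
      rw [enorm_mul, ← mul_assoc, ← mul_assoc, ← ofReal_norm (m k),
        ← ENNReal.ofReal_mul (wt_pos _ _).le, ← ENNReal.ofReal_mul (wt_pos _ _).le, mul_comm (wt t k)]
      exact mul_le_mul' (ENNReal.ofReal_le_ofReal (h k)) le_rfl
    rwa [wNorm_const_mul, ← enorm_eq_wNorm, ← ofReal_norm, ← ENNReal.ofReal_mul hK] at h2
  have h3 : ∀ x : G t, (fun k => m k * x.1 k) ∈ weightedL2 t' := fun x =>
    mem_weightedL2_iff.2 ((h1 x).trans_lt ENNReal.ofReal_lt_top)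
  let L₀ : G t →ₗ[ℂ] G t' :=
    { toFun := fun x => ⟨fun k => m k * x.1 k, h3 x⟩
      map_add' := fun x y => G_ext fun k => mul_add _ _ _
      map_smul' := fun c x => G_ext fun k => mul_left_comm _ _ _ }
  have h4 : ∀ x, ‖L₀ x‖ ≤ K * ‖x‖ := fun x =>
    norm_le_of_wNorm_le (mul_nonneg hK (norm_nonneg _)) (h1 x)
  exact ⟨L₀.mkContinuous K h4, fun _ _ => rfl, h4⟩

lemma exists_inclusion {t t' : ℝ} (h : t' ≤ t) :
    ∃ L : G t →L[ℂ] G t', (∀ x, (L x).1 = x.1) ∧ ∀ x, ‖L x‖ ≤ ‖x‖ := by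
  obtain ⟨L, h1, h2⟩ := exists_multiplier (t := t) (t' := t') zero_le_one 1 fun k => by
    simp only [Pi.one_apply, norm_one, mul_one, one_mul, wt]
    have := jap_pos k
    gcongr
  exact ⟨L, fun x => funext fun k => by simp [h1], fun x => by simpa using h2 x⟩

/-- D(λ) grows like ⟨k⟩² = (√⟨k⟩)^4. The fourth term of the exponential series, with 24 = 4!, shows
that any positive gap in s compensates this growth. -/
lemma exists_diag_multiplier {t t' : ℝ} (h : t' < t) {lam : Idx → ℂ}
    (hlam : ∀ k, ‖lam k‖ ≤ jap k ^ 2 + 1 / 2) :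
    ∃ L : G t →L[ℂ] G t', ∀ x k, (L x).1 k = lam k * x.1 k := by
  have hd : 0 < t - t' := sub_pos.2 h
  obtain ⟨L, h1, -⟩ := exists_multiplier (t := t) (t' := t') (K := 2 * (24 / (t - t') ^ 4))
    (by positivity) lam fun k => by
    have e : wt t k = wt t' k * Real.exp ((t - t') * sj k) := by rw [← wt_add]; congr 1; ring
    have h1 := one_le_sj k
    have h2 := Real.pow_div_factorial_le_exp ((t - t') * sj k) (by positivity) 4
    have h3 : jap k ^ 2 = sj k ^ 4 := by rw [← sj_sq]; ring
    have h4 : ‖lam k‖ ≤ 2 * sj k ^ 4 := by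
      have := hlam k
      have h5 : 1 ≤ sj k ^ 4 := one_le_pow₀ h1
      rw [h3] at this; linarith
    have h5 : sj k ^ 4 ≤ 24 / (t - t') ^ 4 * Real.exp ((t - t') * sj k) := by
      rw [div_mul_eq_mul_div, le_div_iff₀ (by positivity)]
      rw [mul_pow, div_le_iff₀ (by positivity)] at h2
      have : ((Nat.factorial 4 : ℕ) : ℝ) = 24 := by norm_num [Nat.factorial]
      rw [this] at h2
      linarith
    rw [e]
    have hw := (wt_pos t' k).le
    calc wt t' k * ‖lam k‖ ≤ wt t' k * (2 * (24 / (t - t') ^ 4 * Real.exp ((t - t') * sj k))) := by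
          gcongr; linarith
      _ = _ := by ring
  exact ⟨L, h1⟩

/-! ### Vector fields as maps on `g_s` -/

open Classical in
/-- The map on `g_s` defined by the vector field `V`. -/
def ev (s : ℝ) (V : VF) (x : G s) : G s :=
  -- Zero is a default value only. Inside a ball where V has finite norm, `VBound.ev_val` excludes
  -- this branch.
  if h : eval V x.1 ∈ weightedL2 s then ⟨eval V x.1, h⟩ else 0

namespace VBound

variable {s r a b : ℝ} {V W : VF}

lemma wNorm_maj_le (h : VBound s r V a) (hr : 0 < r) {u : Idx → ℝ≥0∞}
    (hu : wNorm s u < ENNReal.ofReal r) : wNorm s (maj V u) ≤ ENNReal.ofReal (r * a) := by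
  rw [ENNReal.ofReal_mul hr.le]
  exact (ResonantKAM.wNorm_maj_le hr V hu).trans (by gcongr; exact h.le)

lemma maj_ne_top (h : VBound s r V a) (hr : 0 < r) {x : G s} (hx : ‖x‖ < r) (k : Idx) :
    maj V (fun h => ‖x.1 h‖ₑ) k ≠ ⊤ :=
  (lt_top_of_wNorm_lt_top ((h.wNorm_maj_le hr ((norm_lt_iff_wNorm x).1 hx)).trans_lt
    ENNReal.ofReal_lt_top) k).ne

lemma wNorm_dmaj_lt_top (h : VBound s r V a) {x : G s} (hx : ‖x‖ < r) {v : Idx → ℝ≥0∞}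
    (hv : wNorm s v < ⊤) : wNorm s (dmaj V (fun h => ‖x.1 h‖ₑ) v) < ⊤ := by
  have h0 := norm_nonneg x
  exact (wNorm_dmaj_le (r := (‖x‖ + r) / 2) (by linarith) (by linarith) ENNReal.toReal_nonneg
    ((norm_lt_iff_wNorm x).1 (by linarith)) (ENNReal.ofReal_toReal hv.ne).ge h.le).trans_lt
      ENNReal.ofReal_lt_top

lemma dmaj_ne_top (h : VBound s r V a) {x : G s} (hx : ‖x‖ < r) {v : Idx → ℝ≥0∞}
    (hv : wNorm s v < ⊤) (k : Idx) : dmaj V (fun h => ‖x.1 h‖ₑ) v k ≠ ⊤ :=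
  (lt_top_of_wNorm_lt_top (h.wNorm_dmaj_lt_top hx hv) k).ne

lemma eval_mem (h : VBound s r V a) (hr : 0 < r) {x : G s} (hx : ‖x‖ < r) :
    eval V x.1 ∈ weightedL2 s :=
  mem_weightedL2_iff.2 ((wNorm_mono fun k => enorm_eval_le V x.1 k).trans_lt
    ((h.wNorm_maj_le hr ((norm_lt_iff_wNorm x).1 hx)).trans_lt ENNReal.ofReal_lt_top))

lemma ev_val (h : VBound s r V a) (hr : 0 < r) {x : G s} (hx : ‖x‖ < r) :
    (ev s V x).1 = eval V x.1 := by
  have e : ev s V x = ⟨eval V x.1, h.eval_mem hr hx⟩ := dif_pos _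
  rw [e]

lemma norm_ev_le (h : VBound s r V a) (hr : 0 < r) {x : G s} (hx : ‖x‖ < r) :
    ‖ev s V x‖ ≤ r * a := by
  refine norm_le_of_wNorm_le (mul_nonneg hr.le h.nonneg) ?_
  rw [h.ev_val hr hx]
  exact (wNorm_mono fun k => enorm_eval_le V x.1 k).trans
    (h.wNorm_maj_le hr ((norm_lt_iff_wNorm x).1 hx))

/-- With T = ρ/‖v‖ the sequence |x| + T|v| stays in the ball of radius r. The second-order estimate
for monomials then bounds T² times the Taylor remainder by the majorant at that sequence, which is a
remainder of order ‖v‖². -/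
lemma exists_hasFDerivAt (h : VBound s r V a) (hr : 0 < r) {x : G s} (hx : ‖x‖ < r) :
    ∃ L : G s →L[ℂ] G s, HasFDerivAt (ev s V) L x ∧ ∀ v, (L v).1 = deval V x.1 v.1 := by
  set ρ := (r - ‖x‖) / 2 with hρ
  have hρ0 : 0 < ρ := by rw [hρ]; linarith
  have h0 := norm_nonneg x
  have ha := h.nonneg
  have h1 : ∀ v : G s, wNorm s (fun k => ‖deval V x.1 v.1 k‖ₑ) ≤
      ENNReal.ofReal (r * a * ‖v‖ / (r - (‖x‖ + r) / 2)) := fun v =>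
    (wNorm_mono fun k => enorm_deval_le V x.1 v.1 k).trans
      (wNorm_dmaj_le (r := (‖x‖ + r) / 2) (by linarith) (by linarith) (norm_nonneg v)
        ((norm_lt_iff_wNorm x).1 (by linarith))
        (by rw [← enorm_eq_wNorm, ofReal_norm]) h.le)
  have h2 : ∀ v : G s, deval V x.1 v.1 ∈ weightedL2 s := fun v =>
    mem_weightedL2_iff.2 ((h1 v).trans_lt ENNReal.ofReal_lt_top)
  let L₀ : G s →ₗ[ℂ] G s :=
    { toFun := fun v => ⟨deval V x.1 v.1, h2 v⟩
      map_add' := fun v w => G_ext fun k => deval_add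
        (h.dmaj_ne_top hx (wNorm_lt_top v) k) (h.dmaj_ne_top hx (wNorm_lt_top w) k)
      map_smul' := fun c v => G_ext fun k => deval_smul V x.1 v.1 c k }
  have hd : r - (‖x‖ + r) / 2 = ρ := by rw [hρ]; ring
  have h3 : ∀ v, ‖L₀ v‖ ≤ r * a / ρ * ‖v‖ := fun v => by
    refine norm_le_of_wNorm_le (by positivity) ((h1 v).trans (le_of_eq ?_))
    rw [hd]; congr 1; ring
  refine ⟨L₀.mkContinuous _ h3, hasFDerivAt_of_norm_sub_le_sq hρ0 (K := r * a / ρ ^ 2) ?_,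
    fun _ => rfl⟩
  intro v hv
  rcases eq_or_ne v 0 with rfl | hv0
  · simp
  have hvp : 0 < ‖v‖ := norm_pos_iff.2 hv0
  have hxv : ‖x + v‖ < r := (norm_add_le _ _).trans_lt (by rw [hρ] at hv; linarith)
  set T := ENNReal.ofReal (ρ / ‖v‖) with hT
  have hT1 : 1 ≤ T := by
    rw [hT, ENNReal.one_le_ofReal, one_le_div hvp]; exact hv.le
  have hTv : T * ‖v‖ₑ = ENNReal.ofReal ρ := by
    rw [hT, ← ofReal_norm, ← ENNReal.ofReal_mul (by positivity)]; congr 1; field_simp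
  set u : Idx → ℝ≥0∞ := fun k => ‖x.1 k‖ₑ + T * ‖v.1 k‖ₑ with hu
  have hun : wNorm s u < ENNReal.ofReal r := by
    refine (wNorm_add_le s _ _).trans_lt ?_
    rw [wNorm_const_mul, ← enorm_eq_wNorm, ← enorm_eq_wNorm, hTv, ← ofReal_norm,
      ← ENNReal.ofReal_add h0 hρ0.le, ENNReal.ofReal_lt_ofReal_iff hr, hρ]
    linarith
  have h4 : ∀ k, T ^ 2 * ‖(ev s V (x + v) - ev s V x - L₀.mkContinuous _ h3 v).1 k‖ₑ ≤
      maj V u k := by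
    intro k
    have e1 : (ev s V (x + v) - ev s V x - L₀.mkContinuous _ h3 v).1 k
        = ∑' q, V k q * (monom (fun h => x.1 h + v.1 h) q - monom x.1 q - dmonom x.1 v.1 q) := by
      rw [G_sub_val, G_sub_val, Pi.sub_apply, Pi.sub_apply, h.ev_val hr hx, h.ev_val hr hxv]
      have s1 : Summable fun q => V k q * monom (fun h => x.1 h + v.1 h) q :=
        summable_eval (h.maj_ne_top hr hxv k)
      have s2 := summable_eval (h.maj_ne_top hr hx k)
      have s3 := summable_deval (h.dmaj_ne_top hx (wNorm_lt_top v) k)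
      simp only [mul_sub]
      rw [(s1.sub s2).tsum_sub s3, s1.tsum_sub s2]
      rfl
    rw [e1]
    refine (mul_le_mul' le_rfl enorm_tsum_le_tsum_enorm).trans ?_
    rw [← ENNReal.tsum_mul_left]
    refine ENNReal.tsum_le_tsum fun q => ?_
    rw [enorm_mul, mul_left_comm]
    gcongr
    exact (le_self_add.trans le_self_add).trans (enorm_monom_sub_le x.1 v.1 hT1 q)
  have h5 : T ^ 2 * ‖ev s V (x + v) - ev s V x - L₀.mkContinuous _ h3 v‖ₑ ≤
      ENNReal.ofReal (r * a) := by
    rw [enorm_eq_wNorm, ← wNorm_const_mul]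
    exact (wNorm_mono h4).trans (h.wNorm_maj_le hr hun)
  rw [hT, ← ofReal_norm, ← ENNReal.ofReal_pow (by positivity), ← ENNReal.ofReal_mul (by positivity),
    ENNReal.ofReal_le_ofReal_iff (by positivity)] at h5
  rw [div_mul_eq_mul_div, le_div_iff₀ (by positivity)]
  rw [div_pow, div_mul_eq_mul_div, div_le_iff₀ (by positivity)] at h5
  linarith

lemma differentiableAt_ev (h : VBound s r V a) (hr : 0 < r) {x : G s} (hx : ‖x‖ < r) :
    DifferentiableAt ℂ (ev s V) x := by
  obtain ⟨L, h1, -⟩ := h.exists_hasFDerivAt hr hx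
  exact h1.differentiableAt

lemma fderiv_ev_val (h : VBound s r V a) (hr : 0 < r) {x : G s} (hx : ‖x‖ < r) (v : G s) :
    (fderiv ℂ (ev s V) x v).1 = deval V x.1 v.1 := by
  obtain ⟨L, h1, h2⟩ := h.exists_hasFDerivAt hr hx
  rw [h1.fderiv, h2]

/-- The value of a bracket of vector fields. -/
lemma eval_bracket (hV : VBound s r V a) (hW : VBound s r W b) (hr : 0 < r) {x : G s}
    (hx : ‖x‖ < r) (j : Idx) : eval (ResonantKAM.bracket V W) x.1 j
      = deval W x.1 (eval V x.1) j - deval V x.1 (eval W x.1) j := by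
  have hxw := (norm_lt_iff_wNorm x).1 hx
  have h1 := hW.dmaj_ne_top hx ((hV.wNorm_maj_le hr hxw).trans_lt ENNReal.ofReal_lt_top) j
  have h2 := hV.dmaj_ne_top hx ((hW.wNorm_maj_le hr hxw).trans_lt ENNReal.ofReal_lt_top) j
  rw [bracket_eq_act hV.mom hW.mom, sub_eq_add_neg, eval_add, eval_neg, eval_act hV.mom h1,
    eval_act hW.mom h2, sub_eq_add_neg]
  · exact ne_top_of_le_ne_top h1 (maj_act_le _ _ _ _)
  · refine ne_of_eq_of_ne ?_ (ne_top_of_le_ne_top h2 (maj_act_le _ _ _ _))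
    simp [maj]

/-- D(λ) is not in any 𝒱_{s,r}, so the general formula for brackets does not cover it. Finiteness of
the norm of D(λ)x in g_s is enough here. -/
lemma eval_bracket_diag (hV : VBound s r V a) (hr : 0 < r) {x : G s}
    (hx : ‖x‖ < r) (lam : Idx → ℂ) (hl : wNorm s (fun k => ‖lam k * x.1 k‖ₑ) < ⊤) (j : Idx) :
    eval (ResonantKAM.bracket V (diagVF lam)) x.1 j
      = lam j * eval V x.1 j - deval V x.1 (fun k => lam k * x.1 k) j := by
  have s1 := summable_eval (hV.maj_ne_top hr hx j)
  have s2 := summable_deval (v := fun k => lam k * x.1 k) (hV.dmaj_ne_top hx hl j)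
  have e : lam j * eval V x.1 j = ∑' q, lam j * (V j q * monom x.1 q) := by
    rw [tsum_mul_left]; rfl
  rw [e, deval, ← (s1.mul_left (lam j)).tsum_sub s2]
  refine tsum_congr fun q => ?_
  rw [bracket_swap (PreservesMom.diag lam) hV.mom, Pi.neg_apply, Pi.neg_apply,
    bracket_diag_left lam hV.mom, dmonom_mul_self]
  change _ * monom x.1 q = _
  ring

end VBound

end

end ResonantKAM

open scoped ENNReal Topology
open Filter Set

/-! ## Resonances -/

namespace ResonantKAM

variable {lam : Idx → ℂ}

lemma J1_upward {q q' : MIdx} (h : q ∈ J1 lam) (hq : q ≤ q') : q' ∈ J1 lam :=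
  let ⟨Q, hQ, hle⟩ := h
  ⟨Q, hQ, hle.trans hq⟩

lemma J2_upward {q q' : MIdx} (h : q ∈ J2 lam) (hq : q ≤ q') : q' ∈ J2 lam :=
  let ⟨Q, hQ, Q', hQ', hle⟩ := h
  ⟨Q, hQ, Q', hQ', hle.trans hq⟩

lemma J2_subset_J1 : J2 lam ⊆ J1 lam := fun _ ⟨Q, hQ, _, _, hle⟩ =>
  ⟨Q, hQ, le_self_add.trans hle⟩

lemma add_mem_J2 {a b q : MIdx} (ha : a ∈ J1 lam) (hb : b ∈ J1 lam) (hq : a + b ≤ q) :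
    q ∈ J2 lam := by
  obtain ⟨Q, hQ, hle⟩ := ha
  obtain ⟨Q', hQ', hle'⟩ := hb
  exact ⟨Q, hQ, Q', hQ', (add_le_add hle hle').trans hq⟩

/-! ### Decomposition of resonant monomials into generators. -/

lemma integrals_add {a b : MIdx} (ha : a ∈ integrals lam) (hb : b ∈ integrals lam) :
    a + b ∈ integrals lam := by
  refine ⟨?_, ?_⟩
  · rw [dot_add, ha.1, hb.1, add_zero]
  · rw [momDot_add, ha.2, hb.2, add_zero]

lemma zero_mem_integrals : (0 : MIdx) ∈ integrals lam := by simp [integrals, dot, momDot]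

lemma exists_gen_add : ∀ (n : ℕ) (Q : MIdx), len Q ≤ n → Q ∈ integrals lam → Q ≠ 0 →
    ∃ Q₁ ∈ integralGens lam, ∃ Q' ∈ integrals lam, Q = Q₁ + Q' := by
  intro n
  induction n with
  | zero =>
    intro Q hn _ h0
    have := len_pos h0
    omega
  | succ n ih =>
    intro Q hn hQ h0
    by_cases hg : Q ∈ integralGens lam
    · exact ⟨Q, hg, 0, zero_mem_integrals, (add_zero Q).symm⟩
    · have : ∃ a ∈ integrals lam, ∃ b ∈ integrals lam, Q = a + b ∧ a ≠ 0 ∧ b ≠ 0 := by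
        by_contra hno
        push Not at hno
        exact hg ⟨hQ, h0, fun a ha b hb he => or_iff_not_imp_left.2 (hno a ha b hb he)⟩
      obtain ⟨a, ha, b, hb, rfl, ha0, hb0⟩ := this
      rw [len_add] at hn
      have := len_pos hb0
      obtain ⟨Q₁, hQ₁, a', ha', rfl⟩ := ih a (by omega) ha ha0
      exact ⟨Q₁, hQ₁, a' + b, integrals_add ha' hb, add_assoc _ _ _⟩

lemma mem_J1_of_integrals {Q : MIdx} (hQ : Q ∈ integrals lam) (h0 : Q ≠ 0) : Q ∈ J1 lam := by
  obtain ⟨Q₁, hQ₁, Q', -, rfl⟩ := exists_gen_add _ Q le_rfl hQ h0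
  exact ⟨Q₁, hQ₁, le_self_add⟩

/-- Removing one generator, of length at most M, leaves a non-zero integral, which contains a second
generator. -/
lemma mem_J2_of_integrals {M : ℕ} (hM : ∀ Q ∈ integralGens lam, len Q ≤ M) {Q : MIdx}
    (hQ : Q ∈ integrals lam) (h0 : M < len Q) : Q ∈ J2 lam := by
  have hne : Q ≠ 0 := by
    rintro rfl
    simp [len] at h0
  obtain ⟨Q₁, hQ₁, Q', hQ', rfl⟩ := exists_gen_add _ Q le_rfl hQ hne
  have h1 := hM Q₁ hQ₁
  rw [len_add] at h0
  have hne' : Q' ≠ 0 := by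
    rintro rfl
    simp [len] at h0
    simp [len] at h1
    omega
  exact add_mem_J2 ⟨Q₁, hQ₁, le_rfl⟩ (mem_J1_of_integrals hQ' hne') le_rfl

lemma toZ_sub_single_mem {k : Idx} {q : MIdx} (hm : momDot q = mom k) (hd : dot lam q = lam k) :
    toZ q - Finsupp.single k 1 ∈ resonancesAt lam k := by
  have h1 : toZ q - Finsupp.single k 1 = toZ q + Finsupp.single k (-1 : ℤ) := by
    rw [Finsupp.single_neg, sub_eq_add_neg]
  refine ⟨?_, ?_, fun h => ?_⟩
  · rw [h1, zdot_add, zdot_toZ, zdot_single, hd]; push_cast; ring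
  · rw [h1, zmomDot_add, zmomDot_toZ, zmomDot_single, hm]; ring
  · rw [sub_add_cancel, toZ_apply]; positivity

lemma toZ_injective : Function.Injective toZ := by
  intro a b h
  ext i
  have := DFunLike.congr_fun h i
  rw [toZ_apply, toZ_apply] at this
  exact_mod_cast this

lemma exists_toZ_eq {P : Idx →₀ ℤ} (h : ∀ i, 0 ≤ P i) : ∃ q : MIdx, toZ q = P := by
  refine ⟨Finsupp.mapRange Int.toNat (by simp) P, ?_⟩
  ext i
  rw [toZ_apply, Finsupp.mapRange_apply, Int.toNat_of_nonneg (h i)]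

/-- Descent on the length of q by subtracting integrals. The index k must be seen not to change.
Since q - e_k is not an integral it has the entry -1 at k, so P' is negative at k, while an element
of Δ^{(k')} can be negative only at k'. -/
lemma exists_offGen_add (k : Idx) : ∀ (n : ℕ) (q : MIdx), len q ≤ n → momDot q = mom k →
    dot lam q = lam k → toZ q - Finsupp.single k 1 ∉ toZ '' integrals lam →
    ∃ q₀, ∃ Q ∈ integrals lam, q = q₀ + Q ∧ toZ q₀ - Finsupp.single k 1 ∈ offGens lam ∧
      toZ q₀ - Finsupp.single k 1 ∈ resonancesAt lam k := by
  intro n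
  induction n with
  | zero =>
    intro q hn hm hd hP
    have hq0 : q = 0 := by
      by_contra h0
      have := len_pos h0
      omega
    have hres := toZ_sub_single_mem hm hd
    refine ⟨q, 0, zero_mem_integrals, (add_zero q).symm, ⟨⟨mem_iUnion.2 ⟨k, hres⟩, hP⟩, ?_⟩, hres⟩
    intro P' hP' Q hQ he
    by_contra hQ0
    obtain ⟨i, hi, -⟩ := exists_unit_le hQ0
    obtain ⟨k', h1, h2, h3⟩ := mem_iUnion.1 hP'.1
    have h4 : ∀ h, P' h = - (Finsupp.single k (1 : ℤ)) h - Q h := fun h => by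
      have := DFunLike.congr_fun he h
      simp only [hq0, Finsupp.coe_add, Finsupp.coe_sub, Pi.add_apply, Pi.sub_apply, toZ_apply,
        Finsupp.coe_zero, Pi.zero_apply] at this
      push_cast at this
      linarith
    have h5 := h3 k
    have h6 := h3 i
    rw [Finsupp.add_apply, h4] at h5 h6
    simp only [Finsupp.single_apply] at h5 h6
    split_ifs at h5 h6 <;> simp_all <;> omega
  | succ n ih =>
    intro q hn hm hd hP
    have hres := toZ_sub_single_mem hm hd
    by_cases hg : toZ q - Finsupp.single k 1 ∈ offGens lam
    · exact ⟨q, 0, zero_mem_integrals, (add_zero q).symm, hg, hres⟩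
    · have : ∃ P' ∈ offResonances lam, ∃ Q ∈ integrals lam,
          toZ q - Finsupp.single k 1 = P' + toZ Q ∧ Q ≠ 0 := by
        by_contra hno
        push Not at hno
        exact hg ⟨⟨mem_iUnion.2 ⟨k, hres⟩, hP⟩, hno⟩
      obtain ⟨P', hP', Q, hQ, he, hQ0⟩ := this
      obtain ⟨k', h1, h2, h3⟩ := mem_iUnion.1 hP'.1
      have hval : ∀ h, (q h : ℤ) - Finsupp.single k (1 : ℤ) h = P' h + Q h := fun h => by
        have := DFunLike.congr_fun he h
        simpa only [Finsupp.coe_add, Finsupp.coe_sub, Pi.add_apply, Pi.sub_apply, toZ_apply] using this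
      have hnn : ∀ h, h ≠ k' → 0 ≤ P' h := fun h hh => by
        have := h3 h
        rwa [Finsupp.add_apply, Finsupp.single_eq_of_ne hh, add_zero] at this
      have hqk : q k = 0 := by
        by_contra hqk
        obtain ⟨q', hq'⟩ := exists_toZ_eq (P := toZ q - Finsupp.single k 1) fun h => by
          rw [Finsupp.sub_apply, toZ_apply]
          by_cases hh : h = k
          · rw [hh, Finsupp.single_eq_same]; omega
          · rw [Finsupp.single_eq_of_ne hh]; omega
        refine hP ⟨q', ⟨?_, ?_⟩, hq'⟩
        · rw [← zdot_toZ, hq']; exact hres.1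
        · rw [← zmomDot_toZ, hq']; exact hres.2.1
      have hkk : k' = k := by
        by_contra hne
        have h4 := hval k
        have h5 := hnn k (Ne.symm hne)
        rw [hqk, Finsupp.single_eq_same] at h4
        push_cast at h4
        omega
      subst hkk
      obtain ⟨q', hq'⟩ := exists_toZ_eq (P := P' + Finsupp.single k' 1) h3
      have hPq : P' = toZ q' - Finsupp.single k' 1 := by rw [hq', add_sub_cancel_right]
      have hqq : q = q' + Q := toZ_injective (by
        rw [toZ_add, ← sub_add_cancel (toZ q) (Finsupp.single k' 1), he, hPq]; abel)
      have hl := len_pos hQ0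
      subst hqq
      rw [len_add] at hn
      rw [momDot_add, hQ.2, add_zero] at hm
      rw [dot_add, hQ.1, add_zero] at hd
      obtain ⟨q₀, Q', hQ', rfl, h5, h6⟩ := ih q' (by omega) hm hd (hPq ▸ hP'.2)
      exact ⟨q₀, Q' + Q, integrals_add hQ' hQ, add_assoc _ _ _, h5, h6⟩

lemma sum_natAbs_toZ (q : MIdx) : ((toZ q).sum fun _ n => n.natAbs) = len q := by
  rw [toZ, Finsupp.sum_mapRange_index (by simp)]
  simp [len]

/-- Resonant monomials of degree at least `d ≥ leastDegree` lie in `ℐ^{(2)}`. -/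
lemma mem_J2_of_resonant {τ C γ : ℝ} (hF : FreqAssumptions τ C γ lam) {d : ℕ}
    (hd : leastDegree lam ≤ d) {k : Idx} {q : MIdx} (hm : momDot q = mom k)
    (hr : dot lam q = lam k) (hq : d + 1 ≤ len q) : q ∈ J2 lam := by
  -- Non-emptiness has to be proved, since the infimum of the empty set would be zero and would say
  -- nothing.
  have hne : {d | ∀ k q, momDot q = mom k → dot lam q = lam k → d + 1 ≤ len q →
      q ∈ J2 lam}.Nonempty := by
    obtain ⟨M, hM⟩ := hF.bounded_integralGens
    obtain ⟨M₁, hM₁⟩ := hF.bounded_offGens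
    -- Either q = Q + e_k, or q = q₀ + Q with q₀ of length at most M₁. In both cases this degree
    -- leaves the integral Q with length greater than M, hence with two generators.
    refine ⟨M + M₁ + 1, fun k q hm hr hq => ?_⟩
    by_cases hP : toZ q - Finsupp.single k 1 ∈ toZ '' integrals lam
    · obtain ⟨Q, hQ, he⟩ := hP
      have hqQ : q = Q + unitIdx k := toZ_injective (by rw [toZ_add, he, toZ_unit]; abel)
      rw [hqQ, len_add, len_unit] at hq
      exact J2_upward (mem_J2_of_integrals hM hQ (by omega)) (hqQ ▸ le_self_add)
    · obtain ⟨q₀, Q, hQ, rfl, h1, h2⟩ := exists_offGen_add k _ q le_rfl hm hr hP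
      have h3 := hM₁ k _ h1 h2
      rw [sub_add_cancel, sum_natAbs_toZ] at h3
      rw [len_add] at hq
      exact J2_upward (mem_J2_of_integrals hM hQ (by omega)) le_add_self
  exact Nat.sInf_mem hne k q hm hr ((Nat.add_le_add_right hd 1).trans hq)

/-- The monomial x_k ∂_k is resonant of degree zero, and an exponent of length one has no room for
two generators. -/
lemma one_le_of_leastDegree_le {τ C γ : ℝ} (hF : FreqAssumptions τ C γ lam) {d : ℕ}
    (hd : leastDegree lam ≤ d) : 1 ≤ d := by
  by_contra h
  have h2 := mem_J2_of_resonant hF hd (momDot_unit (0, 1)) (dot_unit lam (0, 1))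
    (by rw [len_unit]; omega)
  obtain ⟨Q, hQ, Q', hQ', hle⟩ := h2
  obtain ⟨c, hc⟩ := exists_add_of_le hle
  have h3 := congrArg len hc
  rw [len_unit, len_add, len_add] at h3
  have := len_pos hQ.2.1
  have := len_pos hQ'.2.1
  omega

lemma not_resonant_of_supportedIn {τ C γ : ℝ} (hF : FreqAssumptions τ C γ lam) {d : ℕ}
    (hd : leastDegree lam ≤ d) {X : VF} (hm : PreservesMom X) (ho : OrderGE d X)
    (hs : SupportedIn (J2 lam)ᶜ X) : ∀ k q, dot lam q = lam k → X k q = 0 := by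
  intro k q hr
  by_contra hne
  have h1 : momDot q = mom k := by by_contra h; exact hne (hm k q h)
  have h2 : d + 1 ≤ len q := by by_contra h; exact hne (ho k q (by omega))
  exact hne (hs k q fun hq => hq (mem_J2_of_resonant hF hd h1 hr h2))

/-- Resonance and momentum make q - e_k an integral, and the order makes it non-zero. -/
lemma IsDiagResonant.mem_J1 {Z : VF} (hZ : IsDiagResonant lam Z) (hm : PreservesMom Z)
    (ho : OrderGE 1 Z) {k : Idx} {q : MIdx} (h : Z k q ≠ 0) :
    q k ≠ 0 ∧ q - unitIdx k ∈ J1 lam := by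
  obtain ⟨hr, hk⟩ := hZ k q h
  have h1 : momDot q = mom k := by by_contra h'; exact h (hm k q h')
  have h2 : ¬ len q < 1 + 1 := fun h' => h (ho k q h')
  have hle : unitIdx k ≤ q := Finsupp.single_le_iff.2 (Nat.one_le_iff_ne_zero.2 hk)
  have e : q - unitIdx k + unitIdx k = q := tsub_add_cancel_of_le hle
  refine ⟨hk, mem_J1_of_integrals ⟨?_, ?_⟩ fun h0 => ?_⟩
  · have := dot_add lam (q - unitIdx k) (unitIdx k)
    rw [e, dot_unit, hr] at this
    exact (right_eq_add.1 this)
  · have := momDot_add (q - unitIdx k) (unitIdx k)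
    rw [e, momDot_unit, h1] at this
    exact (right_eq_add.1 this)
  · have := len_add (q - unitIdx k) (unitIdx k)
    rw [e, h0, len_unit] at this
    simp [len] at this
    simp only [len] at h2
    omega

/-! ### Nilpotency of the bracket with `Z + N` -/

/-- The filtration of the monomials outside `ℐ^{(2)}` which makes the bracket with `Z + N`
nilpotent. -/
def Filt (lam : Idx → ℂ) : ℕ → Idx → MIdx → Prop
  | 0, _, _ => True
  | 1, k, q => q ∈ J1 lam ∨ q k ≠ 0
  | 2, _, q => q ∈ J1 lam
  | 3, k, q => q k ≠ 0 ∧ q - unitIdx k ∈ J1 lam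
  | _, _, _ => False

lemma unit_le_iff {k : Idx} {q : MIdx} : unitIdx k ≤ q ↔ q k ≠ 0 :=
  Finsupp.single_le_iff.trans Nat.one_le_iff_ne_zero

lemma unit_add_sub {k : Idx} {q : MIdx} (h : q k ≠ 0) : unitIdx k + (q - unitIdx k) = q :=
  add_tsub_cancel_of_le (unit_le_iff.2 h)

/-- Taking away one factor x_k can damage only one of the two generators. -/
lemma mem_J1_of_add_unit_mem_J2 {b : MIdx} {k : Idx} (h : b + unitIdx k ∈ J2 lam) :
    b ∈ J1 lam := by
  obtain ⟨Q, hQ, Q', hQ', hle⟩ := h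
  by_cases hk : Q k = 0
  · refine ⟨Q, hQ, fun i => ?_⟩
    have := hle i
    by_cases hi : i = k
    · rw [hi, hk]; exact Nat.zero_le _
    · have e : unitIdx k i = 0 := Finsupp.single_eq_of_ne hi
      simp only [Finsupp.add_apply, e] at this
      omega
  · refine ⟨Q', hQ', ?_⟩
    have h1 := unit_add_sub hk
    rw [← h1, add_assoc, add_comm b] at hle
    exact le_add_self.trans (le_of_add_le_add_left hle)

variable {W Y : VF}

/-- A monomial of W contains a generator even after removal of its own variable x_k, or it contains
two generators. A result with two generators is discarded by the projection, so a surviving term of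
[W, Y] restricts where the generator of Y sits. The surviving classes are, in turn: exponents
containing a generator or the variable x_j of the component, those containing a generator, those
where the generator is disjoint from one factor x_j, and none. -/
lemma filt_step (hW : ∀ k q, W k q ≠ 0 → (q k ≠ 0 ∧ q - unitIdx k ∈ J1 lam) ∨ q ∈ J2 lam)
    (hWm : PreservesMom W) (hYm : PreservesMom Y) {i : ℕ} (hi : i < 4)
    (hY : ∀ k q, Y k q ≠ 0 → Filt lam i k q) (j : Idx) (q : MIdx)
    (hne : proj (J2 lam)ᶜ (bracket W Y) j q ≠ 0) : Filt lam (i + 1) j q := by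
  have hq2 : q ∉ J2 lam := fun h => hne (indicator_of_notMem (notMem_compl_iff.2 h) _)
  have hne' : bracket W Y j q ≠ 0 := fun h => hne
    ((indicator_of_mem (s := (J2 lam)ᶜ) hq2 (bracket W Y j)).trans h)
  obtain ⟨a, b, k, rfl, -, h | h⟩ := exists_of_bracket_ne_zero hWm hYm hne'
  -- W is the undifferentiated factor. Its generator and its factor x_k, which restores the variable
  -- lost by Y, make the product contain a generator times the full exponent of Y. Hence that
  -- exponent must be free of generators.
  · obtain ⟨h1, h2⟩ := h
    have hF := hY _ _ h2
    rcases hW _ _ h1 with ⟨hak, ha⟩ | ha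
    · have e : a + b = (a - unitIdx k) + (b + unitIdx k) := by
        rw [add_comm b, ← add_assoc, tsub_add_cancel_of_le (unit_le_iff.2 hak)]
      have hJ : a + b ∈ J1 lam := J1_upward ha (e ▸ le_self_add)
      have hno : b + unitIdx k ∉ J1 lam := fun hb => hq2 (add_mem_J2 ha hb e.ge)
      interval_cases i
      · exact Or.inl hJ
      · exact hJ
      · exact absurd hF hno
      · exact absurd (J1_upward hF.2 tsub_le_self) hno
    · exact absurd (J2_upward ha le_self_add) hq2
  -- Now the derivative in x_k falls on W and may destroy its generator.
  · obtain ⟨h1, h2⟩ := h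
    have hF := hY _ _ h1
    rcases hW _ _ h2 with ⟨hbj, hb⟩ | hb
    · have hb1 : b + unitIdx k ∈ J1 lam := J1_upward hb tsub_le_self
      -- If the derivative has damaged the generator of a monomial of Z, then it has not removed the
      -- distinguished variable x_j, which must still divide x^b.
      have hjk : b ∉ J1 lam → b j ≠ 0 := fun hbn hbj0 => by
        by_cases hjk : j = k
        · subst hjk
          rw [add_tsub_cancel_right] at hb
          exact hbn hb
        · have e : unitIdx k j = 0 := Finsupp.single_eq_of_ne hjk
          rw [Finsupp.add_apply, hbj0, e] at hbj
          exact hbj rfl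
      interval_cases i
      · by_cases hbJ : b ∈ J1 lam
        · exact Or.inl (J1_upward hbJ le_add_self)
        · have := hjk hbJ
          refine Or.inr ?_
          rw [Finsupp.add_apply]; omega
      · rcases hF with hF | hF
        · exact J1_upward hF le_self_add
        · refine J1_upward hb1 ?_
          rw [add_comm a b]
          exact add_le_add le_rfl (unit_le_iff.2 hF)
      · have hbJ : b ∉ J1 lam := fun hbJ => hq2 (add_mem_J2 hF hbJ le_rfl)
        have h3 := hjk hbJ
        refine ⟨by rw [Finsupp.add_apply]; omega, J1_upward hF ?_⟩
        rw [add_tsub_assoc_of_le (unit_le_iff.2 h3)]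
        exact le_self_add
      · refine absurd (add_mem_J2 hF.2 hb1 (le_of_eq ?_)) hq2
        rw [add_comm b, ← add_assoc, tsub_add_cancel_of_le (unit_le_iff.2 hF.1)]
    · have hbJ := mem_J1_of_add_unit_mem_J2 hb
      have hno : a ∉ J1 lam := fun ha => hq2 (add_mem_J2 ha hbJ le_rfl)
      have hak : a k = 0 := by
        by_contra hak
        refine hq2 (J2_upward hb ?_)
        rw [add_comm a b]
        exact add_le_add le_rfl (unit_le_iff.2 hak)
      interval_cases i
      · exact Or.inl (J1_upward hbJ le_add_self)
      · exact absurd hF (by rintro (h | h); exacts [hno h, h hak])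
      · exact absurd hF hno
      · exact absurd hak hF.1

end ResonantKAM

open scoped ENNReal Topology
open Filter Set

/-! ## One step of the iteration -/

namespace ResonantKAM

noncomputable section

lemma proj_add (J : Set MIdx) (V W : VF) : proj J (V + W) = proj J V + proj J W :=
  funext fun k => indicator_add J (V k) (W k)

lemma proj_compl_add (J : Set MIdx) (V : VF) : proj Jᶜ V + proj J V = V :=
  funext fun k => indicator_compl_add_self J (V k)

lemma proj_neg (J : Set MIdx) (V : VF) : proj J (-V) = -proj J V :=
  funext fun k => indicator_neg J (V k)

lemma supportedIn_proj (J : Set MIdx) (V : VF) : SupportedIn J (proj J V) := fun _ _ hq =>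
  indicator_of_notMem hq _

namespace SupportedIn

variable {J : Set MIdx} {V W : VF}

lemma add (hV : SupportedIn J V) (hW : SupportedIn J W) : SupportedIn J (V + W) :=
  fun k q hq => by simp [hV k q hq, hW k q hq]

lemma neg (hV : SupportedIn J V) : SupportedIn J (-V) := fun k q hq => by simp [hV k q hq]

lemma invL (hV : SupportedIn J V) (lam : Idx → ℂ) : SupportedIn J (invL lam V) :=
  fun k q hq => by simp [ResonantKAM.invL, hV k q hq]

end SupportedIn

namespace OrderGE

variable {d : ℕ} {V W : VF}

lemma add (hV : OrderGE d V) (hW : OrderGE d W) : OrderGE d (V + W) :=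
  fun k q hq => by simp [hV k q hq, hW k q hq]

lemma neg (hV : OrderGE d V) : OrderGE d (-V) := fun k q hq => by simp [hV k q hq]

lemma invL (hV : OrderGE d V) (lam : Idx → ℂ) : OrderGE d (invL lam V) :=
  fun k q hq => by simp [ResonantKAM.invL, hV k q hq]

lemma proj (hV : OrderGE d V) (J : Set MIdx) : OrderGE d (proj J V) :=
  fun k q hq => by simp [ResonantKAM.proj, hV k q hq]

end OrderGE

/-! ### The exponential series -/

lemma PreservesMom.iterate {F B : VF} (hF : PreservesMom F) (hB : PreservesMom B) (n : ℕ) :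
    PreservesMom ((ResonantKAM.bracket F)^[n] B) := by
  induction n with
  | zero => exact hB
  | succ n ih => rw [Function.iterate_succ_apply']; exact hF.bracket ih

lemma OrderGE.iterate {F B : VF} {d e : ℕ} (hF : PreservesMom F) (hB : PreservesMom B)
    (hFo : OrderGE d F) (hBo : OrderGE e B) (n : ℕ) :
    OrderGE (n * d + e) ((ResonantKAM.bracket F)^[n] B) := by
  induction n with
  | zero => rw [zero_mul, zero_add]; exact hBo
  | succ n ih =>
    rw [Function.iterate_succ_apply']
    exact (OrderGE.bracket hF (hF.iterate hB n) hFo ih).mono (by rw [add_mul]; omega)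

/-- The tail `∑_{n ≥ N} ad_F^n(B) / (n+1)!`. -/
def expTail (F B : VF) (N : ℕ) : VF := fun j q =>
  ∑' n : ℕ, ((n + N + 1).factorial : ℂ)⁻¹ * ((bracket F)^[n + N] B) j q

section

variable {F B : VF} (hF : PreservesMom F) (hB : PreservesMom B) (hFo : OrderGE 1 F)
  (hBo : OrderGE 1 B)
include hF hB hFo hBo

lemma iterate_eq_zero {n : ℕ} {j : Idx} {q : MIdx} (h : len q ≤ n) :
    ((bracket F)^[n] B) j q = 0 :=
  OrderGE.iterate hF hB hFo hBo n j q (by omega)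

lemma summable_expTail (N : ℕ) (j : Idx) (q : MIdx) :
    Summable fun n : ℕ => ((n + N + 1).factorial : ℂ)⁻¹ * ((bracket F)^[n + N] B) j q := by
  refine summable_of_ne_finset_zero (s := Finset.range (len q)) fun n hn => ?_
  rw [Finset.mem_range, not_lt] at hn
  rw [iterate_eq_zero hF hB hFo hBo (by omega), mul_zero]

lemma expTail_eq_add (N : ℕ) : expTail F B N =
    ((N + 1).factorial : ℂ)⁻¹ • ((bracket F)^[N] B) + expTail F B (N + 1) := by
  funext j q
  rw [expTail, (summable_expTail hF hB hFo hBo N j q).tsum_eq_zero_add]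
  simp only [Pi.add_apply, Pi.smul_apply, smul_eq_mul, zero_add, expTail]
  congr 1
  refine tsum_congr fun n => ?_
  rw [show n + 1 + N = n + (N + 1) by ring]

end

/-- Separating V leaves a series in B = [F, V]. This B has finite majorant norm in the application,
while V contains D(λ). At each coefficient the series is a finite sum, since every bracket with F
raises the order. -/
lemma expLie_eq_add {F V : VF} (hF : PreservesMom F) (hV : PreservesMom V) (hFo : OrderGE 1 F)
    (hBo : OrderGE 1 (bracket F V)) : expLie F V = V + expTail F (bracket F V) 0 := by
  funext j q
  have h := summable_expTail hF (hF.bracket hV) hFo hBo 0 j q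
  simp only [add_zero] at h
  have h' : Summable fun n : ℕ => ((n.factorial : ℂ))⁻¹ * ((bracket F)^[n] V) j q :=
    (summable_nat_add_iff 1).1 (h.congr fun n => by rw [Function.iterate_succ_apply])
  rw [expLie, h'.tsum_eq_zero_add]
  simp only [Nat.factorial_zero, Nat.cast_one, inv_one, one_mul, Function.iterate_zero, id_eq,
    Pi.add_apply, expTail, add_zero, Function.iterate_succ_apply]

lemma natCast_pow_le_exp_mul_factorial (n : ℕ) : (n : ℝ) ^ n ≤ Real.exp 1 ^ n * n.factorial := by
  have h := Real.pow_div_factorial_le_exp (n : ℝ) (Nat.cast_nonneg n) n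
  rw [div_le_iff₀ (by positivity)] at h
  rwa [← Real.exp_nat_mul, mul_one]

namespace VBound

variable {s r η f b : ℝ} {F B : VF}

/-- The n brackets share the radius loss η, each spending η/n. The resulting n^n is compensated by
the factorial through n^n ≤ e^n n!. -/
lemma iterate_bracket (hη : 0 < η) (hηr : η < r) (hF : VBound s r F f) (hB : VBound s r B b)
    (n : ℕ) : VBound s (r - η) (((n.factorial : ℂ))⁻¹ • ((ResonantKAM.bracket F)^[n] B))
      ((2 * Real.exp 1 * r * f / η) ^ n * b) := by
  have hr : 0 < r := hη.trans hηr
  have hf := hF.nonneg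
  have hb := hB.nonneg
  rcases Nat.eq_zero_or_pos n with rfl | hn
  · simpa using hB.mono le_rfl (by linarith) (by linarith : r - η ≤ r) le_rfl
  have hn' : (0 : ℝ) < n := Nat.cast_pos.2 hn
  have h : ∀ m ≤ n, VBound s (r - m * (η / n)) ((ResonantKAM.bracket F)^[m] B)
      ((2 * n * r * f / η) ^ m * b) := by
    intro m
    induction m with
    | zero => intro _; simpa using hB
    | succ m ih =>
      intro hm
      have h1 : (m : ℝ) + 1 ≤ n := by exact_mod_cast hm
      have h2 : ((m : ℝ) + 1) * (η / n) ≤ η := by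
        rw [← mul_div_assoc, div_le_iff₀ hn']; nlinarith
      have h3 : 0 < η / n := by positivity
      have h4 : (0 : ℝ) ≤ m * (η / n) := by positivity
      rw [Function.iterate_succ_apply']
      have h5 := VBound.bracket (r := r - ((m + 1 : ℕ) : ℝ) * (η / n)) (r' := r - m * (η / n))
        (by push_cast; linarith) (by push_cast; linarith)
        (hF.mono le_rfl (by linarith) (by linarith) le_rfl) (ih (by omega))
      refine h5.weaken ?_
      have e : r - m * (η / n) - (r - ((m + 1 : ℕ) : ℝ) * (η / n)) = η / n := by push_cast; ring
      rw [e, pow_succ]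
      have h6 : (r - m * (η / n)) / (η / n) ≤ r / (η / n) := by gcongr; linarith
      calc 2 * ((r - m * (η / n)) / (η / n)) * f * ((2 * n * r * f / η) ^ m * b)
          ≤ 2 * (r / (η / n)) * f * ((2 * n * r * f / η) ^ m * b) := by gcongr
        _ = _ := by field_simp
  have h1 := (h n le_rfl).smul (by
    rw [mul_div_cancel₀ _ hn'.ne']; linarith) ((n.factorial : ℂ))⁻¹
  rw [mul_div_cancel₀ _ hn'.ne'] at h1
  refine h1.weaken ?_
  rw [norm_inv, Complex.norm_natCast, ← mul_assoc]
  gcongr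
  rw [inv_mul_le_iff₀ (by positivity)]
  have h2 := natCast_pow_le_exp_mul_factorial n
  calc (2 * n * r * f / η) ^ n = (n : ℝ) ^ n * (2 * r * f / η) ^ n := by
        rw [← mul_pow]; congr 1; ring
    _ ≤ (Real.exp 1 ^ n * n.factorial) * (2 * r * f / η) ^ n := by gcongr
    _ = _ := by rw [mul_comm (Real.exp 1 ^ n), mul_assoc, ← mul_pow]; congr 2; ring

lemma expTail (hη : 0 < η) (hηr : η < r) (hF : VBound s r F f) (hB : VBound s r B b)
    (hκ : 2 * Real.exp 1 * r * f / η ≤ 1 / 2) (N : ℕ) :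
    VBound s (r - η) (expTail F B N) ((2 * Real.exp 1 * r * f / η) ^ N * (2 * b)) := by
  have hr : 0 < r := hη.trans hηr
  have hf := hF.nonneg
  have hb := hB.nonneg
  set κ := 2 * Real.exp 1 * r * f / η with hκd
  have hκ0 : 0 ≤ κ := by positivity
  have hsum : HasSum (fun n : ℕ => κ ^ (n + N) * b) (κ ^ N * b * (1 - κ)⁻¹) := by
    refine ((hasSum_geometric_of_lt_one hκ0 (by linarith)).mul_left (κ ^ N * b)).congr_fun
      fun n => ?_
    ring
  refine ⟨fun k => ?_, fun k q hq => ?_, by positivity, ?_⟩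
  · refine (tsum_congr fun n => ?_).trans tsum_zero
    have := (hF.iterate_bracket hη hηr hB (n + N)).zero_at_origin k
    simp only [Pi.smul_apply, smul_eq_mul, mul_eq_zero, inv_eq_zero, Nat.cast_eq_zero] at this
    rw [this.resolve_left (Nat.factorial_ne_zero _), mul_zero]
  · refine (tsum_congr fun n => ?_).trans tsum_zero
    rw [hF.mom.iterate hB.mom (n + N) k q hq, mul_zero]
  · refine (vnorm_tsum_le (by linarith) (W := fun n =>
      (((n + N).factorial : ℂ))⁻¹ • ((ResonantKAM.bracket F)^[n + N] B)) fun k q => ?_).trans ?_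
    · refine enorm_tsum_le_tsum_enorm.trans (ENNReal.tsum_le_tsum fun n => ?_)
      rw [Pi.smul_apply, Pi.smul_apply, smul_eq_mul, enorm_mul, enorm_mul]
      gcongr
      rw [← ofReal_norm, ← ofReal_norm, norm_inv, norm_inv, Complex.norm_natCast,
        Complex.norm_natCast]
      refine ENNReal.ofReal_le_ofReal (inv_anti₀ (by positivity) ?_)
      exact_mod_cast Nat.factorial_le (Nat.le_succ _)
    · refine (ENNReal.tsum_le_tsum fun n =>
        (hF.iterate_bracket hη hηr hB (n + N)).le).trans ?_
      rw [← ENNReal.ofReal_tsum_of_nonneg (fun n => by positivity) hsum.summable, hsum.tsum_eq]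
      refine ENNReal.ofReal_le_ofReal ?_
      have : (1 - κ)⁻¹ ≤ 2 := by
        rw [inv_le_comm₀ (by linarith) (by norm_num)]; linarith
      calc κ ^ N * b * (1 - κ)⁻¹ ≤ κ ^ N * b * 2 := by gcongr
        _ = _ := by ring

end VBound

/-! ### The homological equation modulo `ℐ^{(2)}` -/

section

variable (lam : Idx → ℂ) (W X : VF)

/-- The terms of the solution of `Π [D + W, F] = X` given by the nilpotency of `Π [W, ·]`. -/
def homTerm : ℕ → VF
  | 0 => invL lam X
  | n + 1 => invL lam (proj (J2 lam)ᶜ (bracket W (homTerm n)))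

/-- The solution `F` of `Π [D + W, F] = X`. -/
def homSol : VF := homTerm lam W X 0 - homTerm lam W X 1 + homTerm lam W X 2 - homTerm lam W X 3

end

section

variable {lam : Idx → ℂ} {W X : VF}

lemma homTerm_mom (hW : PreservesMom W) (hX : PreservesMom X) (n : ℕ) :
    PreservesMom (homTerm lam W X n) := by
  induction n with
  | zero => exact hX.invL lam
  | succ n ih => exact ((hW.bracket ih).proj _).invL lam

lemma homTerm_orderGE {d : ℕ} (hW : PreservesMom W) (hX : PreservesMom X) (hWo : OrderGE 1 W)
    (hXo : OrderGE d X) (n : ℕ) : OrderGE d (homTerm lam W X n) := by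
  induction n with
  | zero => exact hXo.invL lam
  | succ n ih =>
    exact (((OrderGE.bracket hW (homTerm_mom hW hX n) hWo ih).mono (by omega)).proj _).invL lam

lemma homTerm_supportedIn (hXs : SupportedIn (J2 lam)ᶜ X) (n : ℕ) :
    SupportedIn (J2 lam)ᶜ (homTerm lam W X n) := by
  cases n with
  | zero => exact hXs.invL lam
  | succ n => exact (supportedIn_proj _ _).invL lam

lemma homTerm_filt (hW : PreservesMom W) (hX : PreservesMom X)
    (hWs : ∀ k q, W k q ≠ 0 → (q k ≠ 0 ∧ q - unitIdx k ∈ J1 lam) ∨ q ∈ J2 lam) (n : ℕ)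
    (hn : n < 4) : ∀ k q, homTerm lam W X n k q ≠ 0 → Filt lam n k q := by
  induction n with
  | zero => intro k q _; trivial
  | succ n ih =>
    intro k q hne
    refine filt_step hWs hW (homTerm_mom hW hX n) (by omega) (ih (by omega)) k q fun h => hne ?_
    simp only [homTerm, invL]
    rw [h, zero_div]

lemma proj_bracket_homTerm_three (hW : PreservesMom W) (hX : PreservesMom X)
    (hWs : ∀ k q, W k q ≠ 0 → (q k ≠ 0 ∧ q - unitIdx k ∈ J1 lam) ∨ q ∈ J2 lam) :
    proj (J2 lam)ᶜ (bracket W (homTerm lam W X 3)) = 0 := by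
  funext k q
  by_contra h
  exact filt_step hWs hW (homTerm_mom hW hX 3) (by omega) (homTerm_filt hW hX hWs 3 (by omega)) k q h

/-- Each further term costs one bracket, paid with ρ in the radius, and one division by λ·q - λ_k,
paid with δ in s. -/
lemma homTerm_bound {s r δ ρ E x w : ℝ} (hρ : 0 < ρ) (hρr : 5 * ρ < r) (hδ : 0 ≤ δ) (hE0 : 0 ≤ E)
    (hE : ∀ (s r a : ℝ) (Y : VF), 0 < r → VBound s r Y a → VBound (s + δ) r (invL lam Y) (E * a))
    (hW : VBound s r W w) (hX : VBound s r X x) (n : ℕ) (hn : n ≤ 3) :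
    VBound (s + (n + 1) * δ) (r - n * ρ) (homTerm lam W X n)
      ((E * (2 * (r / ρ)) * w) ^ n * (E * x)) := by
  have hr : 0 < r := by linarith
  have hw := hW.nonneg
  have hx := hX.nonneg
  induction n with
  | zero => simpa [homTerm] using hE s r x X hr hX
  | succ n ih =>
    have hn' : (n : ℝ) + 1 ≤ 3 := by exact_mod_cast hn
    have h0 : (0 : ℝ) ≤ n := Nat.cast_nonneg n
    have h1 := VBound.bracket (r := r - ((n + 1 : ℕ) : ℝ) * ρ) (r' := r - n * ρ)
      (by push_cast; nlinarith) (by push_cast; nlinarith)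
      (hW.mono (by nlinarith) (by nlinarith) (by nlinarith) le_rfl) (ih (by omega))
    have h2 := hE _ _ _ _ (by push_cast; nlinarith) (h1.proj (J2 lam)ᶜ)
    have e : s + (n + 1) * δ + δ = s + (((n + 1 : ℕ) : ℝ) + 1) * δ := by push_cast; ring
    rw [e] at h2
    refine h2.weaken ?_
    have e2 : r - n * ρ - (r - ((n + 1 : ℕ) : ℝ) * ρ) = ρ := by push_cast; ring
    have h3 : (r - n * ρ) / ρ ≤ r / ρ := by gcongr; nlinarith
    rw [e2, pow_succ]
    calc E * (2 * ((r - n * ρ) / ρ) * w * ((E * (2 * (r / ρ)) * w) ^ n * (E * x)))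
        ≤ E * (2 * (r / ρ) * w * ((E * (2 * (r / ρ)) * w) ^ n * (E * x))) := by gcongr
      _ = _ := by ring

lemma homSol_mom (hW : PreservesMom W) (hX : PreservesMom X) : PreservesMom (homSol lam W X) :=
  (((homTerm_mom hW hX 0).sub (homTerm_mom hW hX 1)).add (homTerm_mom hW hX 2)).sub
    (homTerm_mom hW hX 3)

lemma homSol_orderGE {d : ℕ} (hW : PreservesMom W) (hX : PreservesMom X) (hWo : OrderGE 1 W)
    (hXo : OrderGE d X) : OrderGE d (homSol lam W X) := by
  have h := homTerm_orderGE (lam := lam) hW hX hWo hXo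
  rw [homSol, sub_eq_add_neg, sub_eq_add_neg]
  exact (((h 0).add (h 1).neg).add (h 2)).add (h 3).neg

lemma homSol_supportedIn (hXs : SupportedIn (J2 lam)ᶜ X) :
    SupportedIn (J2 lam)ᶜ (homSol lam W X) := by
  have h := homTerm_supportedIn (W := W) hXs
  rw [homSol, sub_eq_add_neg, sub_eq_add_neg]
  exact (((h 0).add (h 1).neg).add (h 2)).add (h 3).neg

/-- Four divisions lose 4δ and three brackets lose 3ρ. The cube is a convenient majorant of 1 + β +
β² + β³. -/
lemma homSol_bound {s r δ ρ E x w : ℝ} (hρ : 0 < ρ) (hρr : 5 * ρ < r) (hδ : 0 ≤ δ) (hE0 : 0 ≤ E)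
    (hE : ∀ (s r a : ℝ) (Y : VF), 0 < r → VBound s r Y a → VBound (s + δ) r (invL lam Y) (E * a))
    (hW : VBound s r W w) (hX : VBound s r X x) :
    VBound (s + 4 * δ) (r - 3 * ρ) (homSol lam W X)
      (E * x * (1 + E * (2 * (r / ρ)) * w) ^ 3) := by
  have hr : 0 < r := by linarith
  have hw := hW.nonneg
  have hx := hX.nonneg
  have h : ∀ n ≤ 3, VBound (s + 4 * δ) (r - 3 * ρ) (homTerm lam W X n)
      ((E * (2 * (r / ρ)) * w) ^ n * (E * x)) := fun n hn => by
    have hn' : (n : ℝ) ≤ 3 := by exact_mod_cast hn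
    exact (homTerm_bound hρ hρr hδ hE0 hE hW hX n hn).mono (by nlinarith) (by linarith)
      (by nlinarith) le_rfl
  have hr3 : 0 < r - 3 * ρ := by linarith
  refine (((VBound.sub hr3 (h 0 (by omega)) (h 1 (by omega))).add hr3 (h 2 (by omega))).sub hr3
    (h 3 le_rfl)).weaken ?_
  set β := E * (2 * (r / ρ)) * w with hβ
  have hβ0 : 0 ≤ β := by positivity
  have hEx : 0 ≤ E * x := by positivity
  have : E * x * (1 + β) ^ 3 - (β ^ 0 * (E * x) + β ^ 1 * (E * x) + β ^ 2 * (E * x) + β ^ 3 * (E * x))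
      = E * x * (2 * β + 2 * β ^ 2) := by ring
  have h2 : 0 ≤ E * x * (2 * β + 2 * β ^ 2) := by positivity
  linarith

/-- `F = homSol` solves `[D + W, F] = X` modulo `ℐ^{(2)}`. -/
lemma bracket_homSol {τ C γ : ℝ} (hA : FreqAssumptions τ C γ lam) {d : ℕ}
    (hd : leastDegree lam ≤ d) (hW : PreservesMom W) (hX : PreservesMom X) (hWo : OrderGE 1 W)
    (hXo : OrderGE d X) (hXs : SupportedIn (J2 lam)ᶜ X)
    (hWs : ∀ k q, W k q ≠ 0 → (q k ≠ 0 ∧ q - unitIdx k ∈ J1 lam) ∨ q ∈ J2 lam) :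
    bracket (diagVF lam + W) (homSol lam W X)
      = X + proj (J2 lam) (bracket W (homSol lam W X)) := by
  have hm := homTerm_mom (lam := lam) hW hX
  have hD := PreservesMom.diag lam
  have h0 : bracket (diagVF lam) (homTerm lam W X 0) = X :=
    bracket_diag_invL lam hX (not_resonant_of_supportedIn hA hd hX hXo hXs)
  have h1 : ∀ n, bracket (diagVF lam) (homTerm lam W X (n + 1))
      = proj (J2 lam)ᶜ (bracket W (homTerm lam W X n)) := fun n => by
    have h2 := (hW.bracket (hm n)).proj (J2 lam)ᶜ
    exact bracket_diag_invL lam h2 (not_resonant_of_supportedIn hA hd h2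
      (((OrderGE.bracket hW (hm n) hWo (homTerm_orderGE hW hX hWo hXo n)).mono (by omega)).proj _)
      (supportedIn_proj _ _))
  have hlin : ∀ V, PreservesMom V → bracket V (homSol lam W X) =
      bracket V (homTerm lam W X 0) - bracket V (homTerm lam W X 1)
      + bracket V (homTerm lam W X 2) - bracket V (homTerm lam W X 3) := by
    intro V hV
    rw [homSol, sub_eq_add_neg, sub_eq_add_neg,
      bracket_add_right hV (((hm 0).add (hm 1).neg).add (hm 2)) (hm 3).neg,
      bracket_add_right hV ((hm 0).add (hm 1).neg) (hm 2), bracket_add_right hV (hm 0) (hm 1).neg,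
      bracket_neg_right hV (hm 1), bracket_neg_right hV (hm 3), sub_eq_add_neg, sub_eq_add_neg]
  have h4 : proj (J2 lam)ᶜ (bracket W (homSol lam W X)) =
      proj (J2 lam)ᶜ (bracket W (homTerm lam W X 0))
      - proj (J2 lam)ᶜ (bracket W (homTerm lam W X 1))
      + proj (J2 lam)ᶜ (bracket W (homTerm lam W X 2)) := by
    rw [hlin W hW, sub_eq_add_neg, sub_eq_add_neg, proj_add, proj_add, proj_add, proj_neg, proj_neg,
      proj_bracket_homTerm_three hW hX hWs, neg_zero, add_zero, sub_eq_add_neg]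
  rw [bracket_add_left hD hW (homSol_mom hW hX), hlin _ hD, h0, h1, h1, h1]
  conv_lhs => rw [← proj_compl_add (J2 lam) (bracket W (homSol lam W X)), h4]
  abel

end

/-! ### The transformed vector field -/

/-- The part in `ℐ^{(0)} ⊕ ℐ^{(1)}` of the transformed field. -/
def stepX (lam : Idx → ℂ) (Z N X F : VF) : VF :=
  proj (J2 lam)ᶜ (bracket F X + expTail F (bracket F (diagVF lam + Z + X + N)) 1)

/-- The increment of the part in `ℐ^{(2)}`. -/
def stepN (lam : Idx → ℂ) (Z N X F : VF) : VF :=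
  proj (J2 lam) (bracket F (Z + N) + bracket F X
    + expTail F (bracket F (diagVF lam + Z + X + N)) 1)

/-- The hypotheses of one step of the iteration. -/
structure StepHyp (lam : Idx → ℂ) (d : ℕ) (Z N X : VF) : Prop where
  diag : IsDiagResonant lam Z
  orderZ : OrderGE 1 Z
  orderN : OrderGE d N
  suppN : SupportedIn (J2 lam) N
  orderX : OrderGE d X
  suppX : SupportedIn (J2 lam)ᶜ X
  momZ : PreservesMom Z
  momN : PreservesMom N
  momX : PreservesMom X
  one_le : 1 ≤ d

namespace StepHyp

variable {lam : Idx → ℂ} {d : ℕ} {Z N X : VF} (H : StepHyp lam d Z N X)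
include H

lemma momW : PreservesMom (Z + N) := H.momZ.add H.momN

lemma orderW : OrderGE 1 (Z + N) := H.orderZ.add (H.orderN.mono H.one_le)

lemma momV : PreservesMom (diagVF lam + Z + X + N) :=
  (((PreservesMom.diag lam).add H.momZ).add H.momX).add H.momN

lemma suppW (k : Idx) (q : MIdx) (h : (Z + N) k q ≠ 0) :
    (q k ≠ 0 ∧ q - unitIdx k ∈ J1 lam) ∨ q ∈ J2 lam := by
  by_cases hZ : Z k q = 0
  · right
    by_contra hq
    exact h (by simp [hZ, H.suppN k q hq])
  · exact Or.inl (H.diag.mem_J1 H.momZ H.orderZ hZ)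

lemma momF : PreservesMom (homSol lam (Z + N) X) := homSol_mom H.momW H.momX

lemma orderF : OrderGE d (homSol lam (Z + N) X) := homSol_orderGE H.momW H.momX H.orderW H.orderX

variable {τ C γ : ℝ} (hA : FreqAssumptions τ C γ lam) (hd : leastDegree lam ≤ d)
include hA hd

/-- The term -X is the cancellation that the homological equation is made for. What [F, Z + N]
leaves besides it lies in `ℐ^{(2)}` and will be absorbed by N. -/
lemma bracket_eq : bracket (homSol lam (Z + N) X) (diagVF lam + Z + X + N)
    = -X + proj (J2 lam) (bracket (homSol lam (Z + N) X) (Z + N))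
      + bracket (homSol lam (Z + N) X) X := by
  have hF := H.momF
  have hDW : PreservesMom (diagVF lam + (Z + N)) := (PreservesMom.diag lam).add H.momW
  have e : diagVF lam + Z + X + N = (diagVF lam + (Z + N)) + X := by abel
  rw [e, bracket_add_right hF hDW H.momX, bracket_swap hDW hF,
    bracket_homSol hA hd H.momW H.momX H.orderW H.orderX H.suppX H.suppW, bracket_swap hF H.momW,
    proj_neg, neg_add, neg_neg]

lemma orderB : OrderGE d (bracket (homSol lam (Z + N) X) (diagVF lam + Z + X + N)) := by
  rw [H.bracket_eq hA hd]
  exact (H.orderX.neg.add (((OrderGE.bracket H.momF H.momW H.orderF H.orderW).mono (by omega)).proj _)).add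
    ((OrderGE.bracket H.momF H.momX H.orderF H.orderX).mono (by omega))

lemma expLie_eq : diagVF lam + Z + stepX lam Z N X (homSol lam (Z + N) X)
      + (N + stepN lam Z N X (homSol lam (Z + N) X))
    = expLie (homSol lam (Z + N) X) (diagVF lam + Z + X + N) := by
  have hFo := H.orderF.mono H.one_le
  have hBo := (H.orderB hA hd).mono H.one_le
  rw [expLie_eq_add H.momF H.momV hFo hBo, expTail_eq_add H.momF (H.momF.bracket H.momV) hFo hBo,
    stepX, stepN]
  simp only [Function.iterate_zero, id_eq, zero_add, Nat.factorial_one, Nat.cast_one, inv_one,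
    one_smul]
  set R := expTail (homSol lam (Z + N) X)
    (bracket (homSol lam (Z + N) X) (diagVF lam + Z + X + N)) 1
  rw [H.bracket_eq hA hd, add_assoc (bracket (homSol lam (Z + N) X) (Z + N)),
    proj_add (J2 lam) (bracket (homSol lam (Z + N) X) (Z + N))]
  have e := proj_compl_add (J2 lam) (bracket (homSol lam (Z + N) X) X + R)
  calc _ = diagVF lam + Z + N + proj (J2 lam) (bracket (homSol lam (Z + N) X) (Z + N))
      + (proj (J2 lam)ᶜ (bracket (homSol lam (Z + N) X) X + R)
        + proj (J2 lam) (bracket (homSol lam (Z + N) X) X + R)) := by abel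
    _ = _ := by rw [e]; abel

lemma orderTail : OrderGE d (expTail (homSol lam (Z + N) X)
    (bracket (homSol lam (Z + N) X) (diagVF lam + Z + X + N)) 1) := by
  intro j q hq
  refine (tsum_congr fun n => ?_).trans tsum_zero
  rw [OrderGE.iterate H.momF (H.momF.bracket H.momV) H.orderF (H.orderB hA hd) (n + 1) j q
    (by omega), mul_zero]

lemma orderX' : OrderGE d (stepX lam Z N X (homSol lam (Z + N) X)) :=
  (((OrderGE.bracket H.momF H.momX H.orderF H.orderX).mono (by omega)).add (H.orderTail hA hd)).proj _

lemma orderN' : OrderGE d (stepN lam Z N X (homSol lam (Z + N) X)) :=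
  ((((OrderGE.bracket H.momF H.momW H.orderF H.orderW).mono (by omega)).add
    ((OrderGE.bracket H.momF H.momX H.orderF H.orderX).mono (by omega))).add
      (H.orderTail hA hd)).proj _

section

variable {s r ρ f x w : ℝ} (hρ : 0 < ρ) (hρr : 5 * ρ < r)
  (hF : VBound s (r - 3 * ρ) (homSol lam (Z + N) X) f)
  (hW : VBound s r (Z + N) w) (hX : VBound s r X x)
include hρ hρr hF

omit H hA hd in
lemma bracket_bound {V : VF} {v : ℝ} (hV : VBound s r V v) :
    VBound s (r - 4 * ρ) (bracket (homSol lam (Z + N) X) V) (2 * (r / ρ) * f * v) := by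
  have hf := hF.nonneg
  have hv := hV.nonneg
  refine (VBound.bracket (by linarith) (by linarith) hF
    (hV.mono le_rfl (by linarith) (by linarith) le_rfl)).weaken ?_
  have e : r - 3 * ρ - (r - 4 * ρ) = ρ := by ring
  rw [e]
  have h3 : (r - 3 * ρ) / ρ ≤ r / ρ := by gcongr; linarith
  gcongr

include hW hX

lemma boundB : VBound s (r - 4 * ρ) (bracket (homSol lam (Z + N) X) (diagVF lam + Z + X + N))
    (x + 2 * (r / ρ) * f * (w + x)) := by
  have hr : 0 < r - 4 * ρ := by linarith
  rw [H.bracket_eq hA hd]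
  refine (((hX.mono le_rfl hr (by linarith) le_rfl).neg.add hr
    ((bracket_bound hρ hρr hF hW).proj _)).add hr (bracket_bound hρ hρr hF hX)).weaken ?_
  linarith

variable (hκ : 4 * Real.exp 1 * (r / ρ) * f ≤ 1 / 2)
include hκ

omit H hA hd hW hX hρr hκ in
lemma rate_le : 2 * Real.exp 1 * (r - 4 * ρ) * f / (ρ / 2) ≤ 4 * Real.exp 1 * (r / ρ) * f := by
  have hf := hF.nonneg
  have e : 4 * Real.exp 1 * (r / ρ) * f = 2 * Real.exp 1 * r * f / (ρ / 2) := by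
    field_simp; ring
  rw [e]
  gcongr
  linarith

/-- Radii: F is bounded on r - 3ρ, the bracket with the whole field on r - 4ρ, and the series on r -
9ρ/2. The last half of ρ, down to r - 5ρ, is kept so that trajectories starting in the closed ball
of radius r - 5ρ stay where the series is defined. -/
lemma boundTail (n : ℕ) : VBound s (r - 9 / 2 * ρ) (expTail (homSol lam (Z + N) X)
    (bracket (homSol lam (Z + N) X) (diagVF lam + Z + X + N)) n)
    ((4 * Real.exp 1 * (r / ρ) * f) ^ n * (2 * (x + 2 * (r / ρ) * f * (w + x)))) := by
  have hf := hF.nonneg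
  have hB := H.boundB hA hd hρ hρr hF hW hX
  have hb := hB.nonneg
  have h1 := rate_le hρ hF
  have h := VBound.expTail (η := ρ / 2) (by linarith) (by linarith)
    (hF.mono le_rfl (by linarith) (by linarith : r - 4 * ρ ≤ r - 3 * ρ) le_rfl) hB (h1.trans hκ) n
  have e : r - 4 * ρ - ρ / 2 = r - 9 / 2 * ρ := by ring
  rw [e] at h
  refine h.weaken ?_
  have : 0 ≤ 2 * Real.exp 1 * (r - 4 * ρ) * f / (ρ / 2) := by
    have : 0 < r - 4 * ρ := by linarith
    positivity
  gcongr

omit hκ in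
lemma boundIter (n : ℕ) : VBound s (r - 9 / 2 * ρ) ((n.factorial : ℂ)⁻¹ •
    ((bracket (homSol lam (Z + N) X))^[n]
      (bracket (homSol lam (Z + N) X) (diagVF lam + Z + X + N))))
    ((4 * Real.exp 1 * (r / ρ) * f) ^ n * (x + 2 * (r / ρ) * f * (w + x))) := by
  have hf := hF.nonneg
  have hB := H.boundB hA hd hρ hρr hF hW hX
  have hb := hB.nonneg
  have h1 := rate_le hρ hF
  have h := VBound.iterate_bracket (η := ρ / 2) (by linarith) (by linarith)
    (hF.mono le_rfl (by linarith) (by linarith : r - 4 * ρ ≤ r - 3 * ρ) le_rfl) hB n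
  have e : r - 4 * ρ - ρ / 2 = r - 9 / 2 * ρ := by ring
  rw [e] at h
  refine h.weaken ?_
  have : 0 ≤ 2 * Real.exp 1 * (r - 4 * ρ) * f / (ρ / 2) := by
    have : 0 < r - 4 * ρ := by linarith
    positivity
  gcongr

lemma boundX' : VBound s (r - 5 * ρ) (stepX lam Z N X (homSol lam (Z + N) X))
    (2 * (r / ρ) * f * x
      + 4 * Real.exp 1 * (r / ρ) * f * (2 * (x + 2 * (r / ρ) * f * (w + x)))) := by
  have hr : 0 < r - 5 * ρ := by linarith
  have h1 := (H.boundTail hA hd hρ hρr hF hW hX hκ 1).mono le_rfl hr (by linarith) le_rfl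
  rw [pow_one] at h1
  exact (((bracket_bound hρ hρr hF hX).mono le_rfl hr (by linarith) le_rfl).add hr h1).proj _

lemma boundN' : VBound s (r - 5 * ρ) (stepN lam Z N X (homSol lam (Z + N) X))
    (2 * (r / ρ) * f * w + 2 * (r / ρ) * f * x
      + 4 * Real.exp 1 * (r / ρ) * f * (2 * (x + 2 * (r / ρ) * f * (w + x)))) := by
  have hr : 0 < r - 5 * ρ := by linarith
  have h1 := (H.boundTail hA hd hρ hρr hF hW hX hκ 1).mono le_rfl hr (by linarith) le_rfl
  rw [pow_one] at h1
  exact ((((bracket_bound hρ hρr hF hW).mono le_rfl hr (by linarith) le_rfl).add hr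
    ((bracket_bound hρ hρr hF hX).mono le_rfl hr (by linarith) le_rfl)).add hr h1).proj _

end

end StepHyp

end

end ResonantKAM

open scoped ENNReal Topology
open Filter Set

/-! ## Flows of vector fields -/

namespace ResonantKAM

noncomputable section

namespace VBound

variable {s t r ρ f : ℝ} {F : VF}

/-- A small vector field satisfies the hypotheses for the existence of the flow. -/
lemma flowHyp (hρ : 0 < ρ) (hρr : 5 * ρ < r) (hF : VBound s (r - 3 * ρ) F f)
    (hf : 24 * (r * f) ≤ ρ) (ht : s ≤ t) : FlowHyp (ev t F) (r - 4 * ρ) (ρ / 3) (r * f) := by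
  have hr3 : 0 < r - 3 * ρ := by linarith
  have hF' := hF.mono ht hr3 le_rfl le_rfl
  have hf0 := hF.nonneg
  -- Initial points are taken in the ball of radius r - 4ρ, so the unit ρ up to the domain of F
  -- splits into the three margins η = ρ/3 used by the theory of flows.
  have e : r - 4 * ρ + 3 * (ρ / 3) = r - 3 * ρ := by ring
  refine ⟨by linarith, mul_nonneg (by linarith) hf0, by linarith, ?_, ?_⟩
  · rw [e]
    exact fun x hx => (hF'.differentiableAt_ev hr3 (by simpa using hx)).differentiableWithinAt
  · rw [e]
    exact fun x hx => (hF'.norm_ev_le hr3 (by simpa using hx)).trans (by nlinarith)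

variable {φ : ℝ → G t → G t}

lemma isTimeOneFlow (hρ : 0 < ρ) (hρr : 5 * ρ < r) (hF : VBound s (r - 3 * ρ) F f)
    (hf : 24 * (r * f) ≤ ρ) (ht : s ≤ t) (hφ : IsFlow (ev t F) (r - 4 * ρ) (r * f) φ) :
    IsTimeOneFlow t F (r - 5 * ρ) (r - 3 * ρ) (φ 1) := by
  have H := hF.flowHyp hρ hρr hf ht
  intro u hu
  have hu' : u ∈ Metric.ball (0 : G t) (r - 4 * ρ) := by
    rw [mem_closedBall_zero_iff] at hu
    rw [mem_ball_zero_iff]; linarith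
  refine ⟨fun t => φ t u, hφ.zero u hu', rfl, fun τ hτ => ?_⟩
  have h1 : ‖φ τ u‖ < r - 3 * ρ := by
    have := mem_ball_zero_iff.1 (H.flow_mem hφ hu' hτ)
    linarith
  refine ⟨h1, ev t F (φ τ u), fun k => ?_, hφ.deriv u hu' τ hτ⟩
  rw [(hF.mono ht (by linarith) le_rfl le_rfl).ev_val (by linarith) h1]

lemma analyticOnNhd_flow (hρ : 0 < ρ) (hρr : 5 * ρ < r) (hF : VBound s (r - 3 * ρ) F f)
    (hf : 24 * (r * f) ≤ ρ) (ht : s ≤ t) (hφ : IsFlow (ev t F) (r - 4 * ρ) (r * f) φ) :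
    AnalyticOnNhd ℂ (φ 1) (Metric.closedBall 0 (r - 5 * ρ)) :=
  (analyticOnNhd_of_differentiableOn Metric.isOpen_ball
    ((hF.flowHyp hρ hρr hf ht).differentiableOn_flow hφ)).mono
      (Metric.closedBall_subset_ball (by linarith))

/-- The time-one flow of `F` transforms `D(λ) + P` into `exp(L_F)(D(λ) + P)`. -/
lemma fderiv_flow_apply {lam : Idx → ℂ} {P : VF} {p b κ b' : ℝ}
    (hρ : 0 < ρ) (hρr : 5 * ρ < r) (hF : VBound s (r - 3 * ρ) F f)
    (hf : 24 * (r * f) ≤ ρ) (hst : s < t) (hφ : IsFlow (ev t F) (r - 4 * ρ) (r * f) φ)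
    (hlam : ∀ k, ‖lam k‖ ≤ jap k ^ 2 + 1 / 2) (hFo : OrderGE 1 F)
    (hP : VBound s (r - 3 * ρ) P p) (hBo : OrderGE 1 (ResonantKAM.bracket F (diagVF lam + P)))
    (hκ0 : 0 ≤ κ) (hκ : κ < 1)
    (hit : ∀ n : ℕ, VBound s (r - 9 / 2 * ρ) ((n.factorial : ℂ)⁻¹ •
      ((ResonantKAM.bracket F)^[n] (ResonantKAM.bracket F (diagVF lam + P)))) (κ ^ n * b))
    (htail : ∀ n : ℕ, VBound s (r - 9 / 2 * ρ)
      (ResonantKAM.expTail F (ResonantKAM.bracket F (diagVF lam + P)) n) (κ ^ n * b'))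
    {x v : G t} (hx : ‖x‖ ≤ r - 5 * ρ)
    (hv : ∀ k, v.1 k = eval (expLie F (diagVF lam + P)) x.1 k) (k : Idx) :
    (fderiv ℂ (φ 1) x v).1 k = eval (diagVF lam + P) (φ 1 x).1 k := by
  have hr3 : 0 < r - 3 * ρ := by linarith
  have hr9 : 0 < r - 9 / 2 * ρ := by linarith
  have hf0 := hF.nonneg
  have hDm := PreservesMom.diag lam
  have hVm : PreservesMom (diagVF lam + P) := hDm.add hP.mom
  -- The identity is established in g_s, where D(λ) is bounded from g_t. The inclusion ι carries the
  -- trajectories and the flow of g_t to those of g_s.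
  obtain ⟨ι, hι, hιn⟩ := exists_inclusion hst.le
  obtain ⟨Dm, hDmv⟩ := exists_diag_multiplier hst hlam
  have Ht := hF.flowHyp hρ hρr hf hst.le
  have Hs := hF.flowHyp hρ hρr hf le_rfl
  obtain ⟨ψ, hψ⟩ := Hs.exists_isFlow
  have hball : ∀ {u : G t}, u ∈ Metric.ball (0 : G t) (r - 4 * ρ) →
      ι u ∈ Metric.ball (0 : G s) (r - 4 * ρ) := fun {u} hu => by
    rw [mem_ball_zero_iff] at hu ⊢
    exact (hιn u).trans_lt hu
  have hFt := hF.mono hst.le hr3 le_rfl le_rfl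
  have hyn : ∀ {u : G t}, u ∈ Metric.ball (0 : G t) (r - 4 * ρ) → ∀ τ ∈ Icc (0 : ℝ) 1,
      ‖φ τ u‖ < r - 3 * ρ := fun {u} hu τ hτ => by
    have := mem_ball_zero_iff.1 (Ht.flow_mem hφ hu hτ)
    linarith
  have hιF : ∀ {u : G t}, ‖u‖ < r - 3 * ρ → ι (ev t F u) = ev s F (ι u) := fun {u} hu => by
    refine Subtype.ext ?_
    rw [hι, hFt.ev_val hr3 hu, hF.ev_val hr3 ((hιn u).trans_lt hu), hι]
  have hιderiv : ∀ {u : G t}, u ∈ Metric.ball (0 : G t) (r - 4 * ρ) → ∀ τ ∈ Icc (0 : ℝ) 1,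
      HasDerivWithinAt (fun τ => ι (φ τ u)) (ev s F (ι (φ τ u))) (Icc 0 1) τ := fun {u} hu τ hτ => by
    have := (ι.restrictScalars ℝ).hasFDerivAt.comp_hasDerivWithinAt τ (hφ.deriv u hu τ hτ)
    rw [← hιF (hyn hu τ hτ)]
    exact this
  have hιφ : ∀ {u : G t}, u ∈ Metric.ball (0 : G t) (r - 4 * ρ) → ∀ τ ∈ Icc (0 : ℝ) 1,
      ι (φ τ u) = ψ τ (ι u) := fun {u} hu =>
    Hs.flow_unique hψ (hball hu) (y := fun τ => ι (φ τ u)) (by rw [hφ.zero u hu]) (hιderiv hu)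
      fun τ hτ => by
        rw [mem_ball_zero_iff]
        have h1 := mem_ball_zero_iff.1 (Ht.flow_mem hφ hu hτ)
        have h2 := hιn (φ τ u)
        linarith
  have hxb : x ∈ Metric.ball (0 : G t) (r - 4 * ρ) := by rw [mem_ball_zero_iff]; linarith
  set y : ℝ → G t := fun τ => φ τ x with hy
  have hy9 : ∀ τ ∈ Icc (0 : ℝ) 1, ‖ι (y τ)‖ < r - 9 / 2 * ρ := fun τ hτ => by
    have h1 := hφ.near x hxb τ hτ
    have h2 : ‖y τ‖ ≤ ‖y τ - x‖ + ‖x‖ := by simpa using norm_add_le (y τ - x) x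
    have h3 := hιn (y τ)
    linarith
  have hy3 : ∀ τ ∈ Icc (0 : ℝ) 1, ‖ι (y τ)‖ < r - 3 * ρ := fun τ hτ =>
    (hιn (y τ)).trans_lt (hyn hxb τ hτ)
  -- the iterated brackets
  set B : ℕ → VF := fun n => (ResonantKAM.bracket F)^[n] (ResonantKAM.bracket F (diagVF lam + P))
    with hBdef
  have hB : ∀ n, ∃ a, VBound s (r - 9 / 2 * ρ) (B n) a := fun n => by
    have h := (hit n).smul hr9 (n.factorial : ℂ)
    rw [smul_smul, mul_inv_cancel₀ (by exact_mod_cast Nat.factorial_ne_zero n), one_smul] at h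
    exact ⟨_, h⟩
  choose a ha using hB
  have hF9 := hF.mono le_rfl hr9 (by linarith) le_rfl
  have hP9 := hP.mono le_rfl hr9 (by linarith) le_rfl
  have hBsucc : ∀ n, B (n + 1) = ResonantKAM.bracket F (B n) := fun n =>
    Function.iterate_succ_apply' _ _ _
  -- Lie derivatives along the trajectory
  have hL : ∀ τ ∈ Icc (0 : ℝ) 1, ∀ n, fderiv ℂ (ev s (B n)) (ι (y τ)) (ev s F (ι (y τ)))
      = ev s (B (n + 1)) (ι (y τ)) + fderiv ℂ (ev s F) (ι (y τ)) (ev s (B n) (ι (y τ))) := by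
    intro τ hτ n
    have hyτ := hy9 τ hτ
    refine Subtype.ext (funext fun j => ?_)
    rw [G_add_val, Pi.add_apply, (ha n).fderiv_ev_val hr9 hyτ, (ha (n + 1)).ev_val hr9 hyτ,
      hF9.fderiv_ev_val hr9 hyτ, hF9.ev_val hr9 hyτ, (ha n).ev_val hr9 hyτ, hBsucc,
      hF9.eval_bracket (ha n) hr9 hyτ]
    ring
  have hlx : ∀ u : G t, wNorm s (fun k => ‖lam k * (ι u).1 k‖ₑ) < ⊤ := fun u => by
    have := wNorm_lt_top (Dm u)
    simpa only [hDmv, hι] using this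
  have hL0 : ∀ τ ∈ Icc (0 : ℝ) 1, Dm (ev t F (y τ)) + fderiv ℂ (ev s P) (ι (y τ)) (ev s F (ι (y τ)))
      = ev s (B 0) (ι (y τ))
        + fderiv ℂ (ev s F) (ι (y τ)) (Dm (y τ) + ev s P (ι (y τ))) := by
    intro τ hτ
    have hyτ := hy9 τ hτ
    have hyt := hyn hxb τ hτ
    have hfin := hF9.maj_ne_top hr9 hyτ
    refine Subtype.ext (funext fun j => ?_)
    have e0 : eval (B 0) (ι (y τ)).1 j = eval (ResonantKAM.bracket F (diagVF lam)) (ι (y τ)).1 j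
        + eval (ResonantKAM.bracket F P) (ι (y τ)).1 j := by
      have hb := ((hF9.mono le_rfl hr9 le_rfl le_rfl))
      rw [← eval_add]
      · rw [hBdef]
        simp only [Function.iterate_zero, id_eq]
        rw [bracket_add_right hF.mom hDm hP.mom]
      -- The norm of [F, D(λ)] is not bounded directly. It is written as the difference of [F, D(λ)
      -- + P] and [F, P], both already controlled.
      · have h1 : maj (ResonantKAM.bracket F (diagVF lam)) (fun h => ‖(ι (y τ)).1 h‖ₑ) j
            = maj (ResonantKAM.bracket F (diagVF lam + P) - ResonantKAM.bracket F P)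
              (fun h => ‖(ι (y τ)).1 h‖ₑ) j := by
          rw [bracket_add_right hF.mom hDm hP.mom, add_sub_cancel_right]
        have h2 := (hF.bracket hr9 (by linarith) hP)
        have h3 := ((ha 0).sub hr9 h2).maj_ne_top hr9 hyτ j
        rw [h1]; exact h3
      · exact (hF.bracket hr9 (by linarith) hP).maj_ne_top hr9 hyτ j
    rw [map_add, G_add_val, G_add_val, G_add_val, Pi.add_apply, Pi.add_apply, Pi.add_apply, hDmv,
      hP9.fderiv_ev_val hr9 hyτ, (ha 0).ev_val hr9 hyτ, hF9.fderiv_ev_val hr9 hyτ,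
      hF9.fderiv_ev_val hr9 hyτ, hF9.ev_val hr9 hyτ, hP9.ev_val hr9 hyτ, hFt.ev_val hr3 hyt, e0,
      hF9.eval_bracket hP9 hr9 hyτ, hF9.eval_bracket_diag hr9 hyτ lam (hlx _)]
    have e1 : (Dm (y τ)).1 = fun k => lam k * (ι (y τ)).1 k := funext fun k => by rw [hDmv, hι]
    rw [e1, hι]
    ring
  -- the approximate solutions of the variational equation
  set c : ℕ → ℝ → ℂ := fun n τ => (1 - (τ : ℂ)) ^ n * ((n.factorial : ℂ))⁻¹ with hc
  -- This is the truncation of (exp((1-τ)L_F)W)(y(τ)). At τ = 1 only W(Φ_F(x)) is left, and at τ = 0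
  -- the partial sums converge to exp(L_F)W(x) = v.
  set ζ : ℕ → ℝ → G s := fun N τ => Dm (y τ) + ev s P (ι (y τ))
    + ∑ n ∈ Finset.range N, c (n + 1) τ • ev s (B n) (ι (y τ)) with hζ
  set e : ℕ → ℝ → G s := fun N τ => c N τ • ev s (B N) (ι (y τ)) with he
  have hcd : ∀ n (τ : ℝ), HasDerivWithinAt (c (n + 1)) (-c n τ) (Icc 0 1) τ := by
    intro n τ
    have h1 : HasDerivAt (fun z : ℂ => (1 - z) ^ (n + 1) * (((n + 1).factorial : ℂ))⁻¹)
        (((n + 1 : ℕ) * (1 - (τ : ℂ)) ^ n * (-1)) * (((n + 1).factorial : ℂ))⁻¹) (τ : ℂ) := by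
      have h2 := ((hasDerivAt_id (τ : ℂ)).const_sub 1).pow (n + 1)
      exact h2.mul_const _
    have h3 := h1.comp_ofReal.hasDerivWithinAt (s := Icc (0 : ℝ) 1)
    refine h3.congr_deriv ?_
    rw [hc, Nat.factorial_succ]
    push_cast
    have : ((n : ℂ) + 1) ≠ 0 := by exact_mod_cast Nat.succ_ne_zero n
    field_simp
  have hζd : ∀ N, ∀ τ ∈ Icc (0 : ℝ) 1,
      HasDerivWithinAt (ζ N) (fderiv ℂ (ev s F) (ψ τ (ι x)) (ζ N τ) + e N τ) (Icc 0 1) τ := by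
    intro N τ hτ
    have hyτ := hy9 τ hτ
    have d0 := (Dm.restrictScalars ℝ).hasFDerivAt.comp_hasDerivWithinAt τ (hφ.deriv x hxb τ hτ)
    have d1 := ((hP9.differentiableAt_ev hr9 hyτ).hasFDerivAt.restrictScalars ℝ
      ).comp_hasDerivWithinAt τ (hιderiv hxb τ hτ)
    have d2 : ∀ n, HasDerivWithinAt (fun τ => c (n + 1) τ • ev s (B n) (ι (y τ)))
        (c (n + 1) τ • fderiv ℂ (ev s (B n)) (ι (y τ)) (ev s F (ι (y τ)))
          + (-c n τ) • ev s (B n) (ι (y τ))) (Icc 0 1) τ := fun n => by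
      have d4 := (((ha n).differentiableAt_ev hr9 hyτ).hasFDerivAt.restrictScalars ℝ
          ).comp_hasDerivWithinAt τ (hιderiv hxb τ hτ)
      exact (hcd n τ).smul d4
    have d3 := (d0.add d1).add (HasDerivWithinAt.fun_sum (u := Finset.range N) fun n _ => d2 n)
    refine d3.congr_deriv ?_
    rw [← hιφ hxb τ hτ]
    have e2 : ∀ n ∈ Finset.range N, c (n + 1) τ • fderiv ℂ (ev s (B n)) (ι (y τ)) (ev s F (ι (y τ)))
          + (-c n τ) • ev s (B n) (ι (y τ))
        = fderiv ℂ (ev s F) (ι (y τ)) (c (n + 1) τ • ev s (B n) (ι (y τ)))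
          + (e (n + 1) τ - e n τ) := by
      intro n _
      rw [hL τ hτ n, map_smul, he, smul_add, neg_smul]
      abel
    -- The sum telescopes to e N - e 0. The last term cancels the first bracket produced by `hL0`,
    -- so the only defect is e N.
    rw [Finset.sum_congr rfl e2, Finset.sum_add_distrib, Finset.sum_range_sub (fun n => e n τ), hζ, map_add, map_sum]
    have e3 := hL0 τ hτ
    have e4 : e 0 τ = ev s (B 0) (ι (y τ)) := by simp [he, hc]
    change Dm (ev t F (y τ)) + fderiv ℂ (ev s P) (ι (y τ)) (ev s F (ι (y τ))) + _ = _
    rw [e3, e4]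
    abel
  have hen : ∀ N, ∀ τ ∈ Icc (0 : ℝ) 1, ‖e N τ‖ ≤ (r - 9 / 2 * ρ) * (κ ^ N * b) := by
    intro N τ hτ
    have h1 := (hit N).norm_ev_le hr9 (hy9 τ hτ)
    have h2 : ev s ((N.factorial : ℂ)⁻¹ • B N) (ι (y τ)) = (N.factorial : ℂ)⁻¹ • ev s (B N) (ι (y τ)) := by
      refine Subtype.ext (funext fun j => ?_)
      rw [G_smul_val, Pi.smul_apply, (ha N).ev_val hr9 (hy9 τ hτ), (hit N).ev_val hr9 (hy9 τ hτ),
        eval_smul, smul_eq_mul]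
    rw [he]
    simp only [hc]
    rw [mul_smul, ← h2, norm_smul, norm_pow]
    have h3 : ‖(1 - (τ : ℂ))‖ ≤ 1 := by
      rw [← Complex.ofReal_one, ← Complex.ofReal_sub, Complex.norm_real, Real.norm_eq_abs, abs_le]
      constructor <;> linarith [hτ.1, hτ.2]
    exact (mul_le_of_le_one_left (norm_nonneg _) (pow_le_one₀ (norm_nonneg _) h3)).trans h1
  have hpow : Tendsto (fun N : ℕ => κ ^ N) atTop (𝓝 0) := tendsto_pow_atTop_nhds_zero_of_lt_one hκ0 hκ
  -- the initial values
  have hx9 : ‖ι x‖ < r - 9 / 2 * ρ := (hιn x).trans_lt (by linarith)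
  have hy0 : y 0 = x := hφ.zero x hxb
  have hinit : ∀ N, ι v = ζ N 0
      + ev s (ResonantKAM.expTail F (ResonantKAM.bracket F (diagVF lam + P)) N) (ι x) := by
    intro N
    induction N with
    | zero =>
      refine Subtype.ext (funext fun j => ?_)
      simp only [hζ, Finset.range_zero, Finset.sum_empty, add_zero, hy0]
      rw [G_add_val, G_add_val, Pi.add_apply, Pi.add_apply, hι, hv, hDmv, hP9.ev_val hr9 hx9,
        (htail 0).ev_val hr9 hx9, expLie_eq_add hF.mom hVm hFo hBo, hι, ← eval_diagVF]
      have h1 := (hP9.maj_ne_top hr9 hx9 j)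
      have h2 := ((htail 0).maj_ne_top hr9 hx9 j)
      rw [hι] at h1 h2
      have h3 : maj (diagVF lam) (fun h => ‖x.1 h‖ₑ) j ≠ ⊤ := by
        rw [maj, tsum_eq_single (unitIdx j)]
        · rw [monom_single]
          exact ENNReal.mul_ne_top enorm_ne_top enorm_ne_top
        · intro q hq
          rw [diagVF, Pi.single_eq_of_ne hq, enorm_zero, zero_mul]
      have h4 : maj (diagVF lam + P) (fun h => ‖x.1 h‖ₑ) j ≠ ⊤ :=
        ne_top_of_le_ne_top (ENNReal.add_ne_top.2 ⟨h3, h1⟩) (maj_add_le _ _ _ _)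
      rw [eval_add h4 h2, eval_add h3 h1]
    | succ N ih =>
      have h1 : ev s (ResonantKAM.expTail F (ResonantKAM.bracket F (diagVF lam + P)) N) (ι x)
          = c (N + 1) 0 • ev s (B N) (ι x)
            + ev s (ResonantKAM.expTail F (ResonantKAM.bracket F (diagVF lam + P)) (N + 1)) (ι x) := by
        refine Subtype.ext (funext fun j => ?_)
        rw [G_add_val, G_smul_val, Pi.add_apply, Pi.smul_apply, (htail N).ev_val hr9 hx9,
          (ha N).ev_val hr9 hx9, (htail (N + 1)).ev_val hr9 hx9,
          expTail_eq_add hF.mom (hF.mom.bracket hVm) hFo hBo N, eval_add, eval_smul]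
        · simp only [hc, Complex.ofReal_zero, sub_zero, one_pow, one_mul]
          rfl
        · exact ((ha N).smul hr9 _).maj_ne_top hr9 hx9 j
        · exact (htail (N + 1)).maj_ne_top hr9 hx9 j
      rw [ih, h1]
      simp only [hζ, Finset.sum_range_succ, hy0]
      abel
  have h0 : Tendsto (fun N => ζ N 0) atTop (𝓝 (ι v)) := by
    rw [tendsto_iff_norm_sub_tendsto_zero]
    refine squeeze_zero (g := fun N => (r - 9 / 2 * ρ) * (κ ^ N * b')) (fun _ => norm_nonneg _)
      (fun N => ?_) ?_
    · rw [norm_sub_rev, hinit N, add_sub_cancel_left]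
      exact (htail N).norm_ev_le hr9 hx9
    · simpa using (hpow.mul_const b').const_mul (r - 9 / 2 * ρ)
  have h1 : Tendsto (fun N => ζ N 1) atTop (𝓝 (Dm (y 1) + ev s P (ι (y 1)))) := by
    refine tendsto_const_nhds.congr fun N => ?_
    simp [hζ, hc]
  have hmain := Hs.fderiv_flow_apply_eq hψ (hball hxb) hζd hen
    (by simpa using (hpow.mul_const b).const_mul (r - 9 / 2 * ρ)) h0 h1
  -- back to the smaller space
  have hd1 : HasFDerivAt (φ 1) (fderiv ℂ (φ 1) x) x :=
    ((Ht.differentiableOn_flow hφ x hxb).differentiableAt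
      (Metric.isOpen_ball.mem_nhds hxb)).hasFDerivAt
  have hd2 : HasFDerivAt (ψ 1) (fderiv ℂ (ψ 1) (ι x)) (ι x) :=
    ((Hs.differentiableOn_flow hψ _ (hball hxb)).differentiableAt
      (Metric.isOpen_ball.mem_nhds (hball hxb))).hasFDerivAt
  have hcomm : (fun u => ι (φ 1 u)) =ᶠ[𝓝 x] fun u => ψ 1 (ι u) := by
    filter_upwards [Metric.isOpen_ball.mem_nhds hxb] with u hu
    exact hιφ hu 1 (by simp)
  have hd3 := (ι.hasFDerivAt (x := φ 1 x)).comp x hd1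
  have hd4 := (hd2.comp x ι.hasFDerivAt).congr_of_eventuallyEq hcomm
  have hd5 := DFunLike.congr_fun (hd3.unique hd4) v
  simp only [ContinuousLinearMap.comp_apply] at hd5
  rw [hmain] at hd5
  have hd6 := congrFun (congrArg Subtype.val hd5) k
  have h1m : (1 : ℝ) ∈ Icc (0 : ℝ) 1 := by simp
  have hy19 := hy9 1 h1m
  rw [hι, G_add_val, Pi.add_apply, hDmv, hP9.ev_val hr9 hy19, hι] at hd6
  have h1 := (hP9.maj_ne_top hr9 hy19 k)
  rw [hι] at h1
  rw [hd6, eval_add _ h1, eval_diagVF]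
  rw [maj, tsum_eq_single (unitIdx k)]
  · rw [monom_single]
    exact ENNReal.mul_ne_top enorm_ne_top enorm_ne_top
  · intro q hq
    rw [diagVF, Pi.single_eq_of_ne hq, enorm_zero, zero_mul]

end VBound

end

end ResonantKAM

open scoped ENNReal Topology
open Filter Set

/-! ## Parameters and constants -/

namespace ResonantKAM

noncomputable section

/-! ### The sequences of radii and weights -/

lemma rhoSeq_pos {r' : ℝ} (h : 0 < r') (n : ℕ) : 0 < rhoSeq r' n := by
  rw [rhoSeq]; positivity

lemma rSeq_eq (r' : ℝ) (n : ℕ) : rSeq r' n = r' * (1 + (2 ^ n)⁻¹) := by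
  induction n with
  | zero => simp [rSeq]; ring
  | succ n ih => rw [rSeq, ih, rhoSeq, pow_succ]; field_simp; ring

lemma lt_rSeq {r' : ℝ} (h : 0 < r') (n : ℕ) : r' < rSeq r' n := by
  rw [rSeq_eq]
  have : (0 : ℝ) < (2 ^ n)⁻¹ := by positivity
  nlinarith

lemma five_rhoSeq_lt {r' : ℝ} (h : 0 < r') (n : ℕ) : 5 * rhoSeq r' n < rSeq r' n := by
  have := lt_rSeq h (n + 1)
  rw [rSeq] at this
  linarith

lemma rSeq_div_rhoSeq_le {r' : ℝ} (h : 0 < r') (n : ℕ) : rSeq r' n / rhoSeq r' n ≤ 20 * 2 ^ n := by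
  rw [div_le_iff₀ (rhoSeq_pos h n), rSeq_eq, rhoSeq]
  have h1 : ((2 : ℝ) ^ n)⁻¹ ≤ 1 := inv_le_one_of_one_le₀ (one_le_pow₀ (by norm_num))
  have h2 : 20 * 2 ^ n * (r' / 10 * ((2 : ℝ) ^ n)⁻¹) = 2 * r' := by field_simp; ring
  rw [h2]; nlinarith

lemma sigmaSeq_pos {σ : ℝ} (h : 0 < σ) (n : ℕ) : 0 < sigmaSeq σ n := by
  rw [sigmaSeq]
  split_ifs with hn
  · positivity
  · have : (0 : ℝ) < n := by exact_mod_cast Nat.pos_of_ne_zero hn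
    positivity

lemma sSeq_eq (s s' : ℝ) (n : ℕ) :
    sSeq s s' n = s + 2 * ∑ i ∈ Finset.range n, sigmaSeq (s' - s) i := by
  induction n with
  | zero => simp [sSeq]
  | succ n ih => rw [sSeq, ih, Finset.sum_range_succ]; ring

lemma sSeq_lt_succ {s s' : ℝ} (h : s < s') (n : ℕ) : sSeq s s' n < sSeq s s' (n + 1) := by
  rw [sSeq]
  have := sigmaSeq_pos (sub_pos.2 h) n
  linarith

/-- By ζ(2) = π²/6 the terms with n ≥ 1 add up to 3σ/8 and the term n = 0 is σ/8. The choice of σ_n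
makes the total loss 2∑σ_n equal to σ. -/
lemma sum_sigmaSeq_le {σ : ℝ} (h : 0 < σ) (n : ℕ) :
    ∑ i ∈ Finset.range n, sigmaSeq σ i ≤ σ / 2 := by
  have h1 : ∀ i : ℕ, sigmaSeq σ i
      ≤ (if i = 0 then σ / 8 else 0) + 9 * σ / (4 * Real.pi ^ 2) * (1 / (i : ℝ) ^ 2) := by
    intro i
    rw [sigmaSeq]
    split_ifs with hi
    · simp [hi]
    · rw [zero_add]
      have : (i : ℝ) ≠ 0 := by exact_mod_cast hi
      refine le_of_eq ?_
      field_simp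
  have h2 := sum_le_hasSum (Finset.range n) (fun i _ => by positivity) hasSum_zeta_two
  have h3 : ∑ i ∈ Finset.range n, (if i = 0 then σ / 8 else 0) ≤ σ / 8 := by
    rw [Finset.sum_ite_eq']
    split_ifs <;> linarith
  calc ∑ i ∈ Finset.range n, sigmaSeq σ i
      ≤ ∑ i ∈ Finset.range n, ((if i = 0 then σ / 8 else 0)
        + 9 * σ / (4 * Real.pi ^ 2) * (1 / (i : ℝ) ^ 2)) := Finset.sum_le_sum fun i _ => h1 i
    _ ≤ σ / 8 + 9 * σ / (4 * Real.pi ^ 2) * (Real.pi ^ 2 / 6) := by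
        rw [Finset.sum_add_distrib, ← Finset.mul_sum]
        gcongr
    _ = σ / 2 := by have := Real.pi_pos; field_simp; ring

lemma sSeq_lt {s s' : ℝ} (h : s < s') (n : ℕ) : sSeq s s' n < s' := by
  refine (sSeq_lt_succ h n).trans_le ?_
  have := sum_sigmaSeq_le (sub_pos.2 h) (n + 1)
  rw [sSeq_eq]
  linarith

/-! ### The smallness constant -/

/-- The exponential (3/2)^n beats n^{12}. Boundedness must be known because the real supremum of an
unbounded family is zero by convention. -/
lemma bddAbove_supConst (c σ : ℝ) : BddAbove (range fun n : ℕ => (2 : ℝ) ^ (9 * n) *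
    Real.exp ((2 ^ 9 * (4 * Real.pi ^ 2 / (9 * σ)) ^ 6 * c) * (n : ℝ) ^ 12) *
    Real.exp (-((3 / 2 : ℝ) ^ n * (2 - 3 / 2)))) := by
  set D := 2 ^ 9 * (4 * Real.pi ^ 2 / (9 * σ)) ^ 6 * c
  refine Filter.IsBoundedUnder.bddAbove_range ⟨1, ?_⟩
  have h1 := (tendsto_pow_const_div_const_pow_of_one_lt 12 (by norm_num : (1 : ℝ) < 3 / 2)).const_mul
    (9 + |D|)
  rw [mul_zero] at h1
  rw [eventually_map]
  filter_upwards [h1.eventually (gt_mem_nhds (by norm_num : (0 : ℝ) < 1 / 2)), eventually_ge_atTop 1]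
    with n hn hn1
  have hp : (0 : ℝ) < (3 / 2) ^ n := by positivity
  rw [← mul_div_assoc, div_lt_iff₀ hp] at hn
  have h2 : (2 : ℝ) ^ (9 * n) ≤ Real.exp (9 * (n : ℝ) ^ 12) := by
    have h3 : (2 : ℝ) ≤ Real.exp 1 := by linarith [Real.exp_one_gt_d9]
    calc (2 : ℝ) ^ (9 * n) ≤ Real.exp 1 ^ (9 * n) := by gcongr
      _ = Real.exp (9 * n) := by rw [← Real.exp_nat_mul]; push_cast; ring_nf
      _ ≤ _ := by
        refine Real.exp_le_exp.2 ?_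
        have : (n : ℝ) ≤ (n : ℝ) ^ 12 := le_self_pow₀ (by exact_mod_cast hn1) (by norm_num)
        linarith
  calc (2 : ℝ) ^ (9 * n) * Real.exp (D * (n : ℝ) ^ 12) * Real.exp (-((3 / 2 : ℝ) ^ n * (2 - 3 / 2)))
      ≤ Real.exp (9 * (n : ℝ) ^ 12) * Real.exp (D * (n : ℝ) ^ 12)
        * Real.exp (-((3 / 2 : ℝ) ^ n * (2 - 3 / 2))) := by gcongr
    _ = Real.exp (9 * (n : ℝ) ^ 12 + D * (n : ℝ) ^ 12 + -((3 / 2 : ℝ) ^ n * (2 - 3 / 2))) := by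
        rw [Real.exp_add, Real.exp_add]
    _ ≤ 1 := by
        rw [Real.exp_le_one_iff]
        have : D * (n : ℝ) ^ 12 ≤ |D| * (n : ℝ) ^ 12 := by gcongr; exact le_abs_self D
        linarith

lemma le_supConst (c σ : ℝ) (n : ℕ) : (2 : ℝ) ^ (9 * n) *
    Real.exp ((2 ^ 9 * (4 * Real.pi ^ 2 / (9 * σ)) ^ 6 * c) * (n : ℝ) ^ 12) *
    Real.exp (-((3 / 2 : ℝ) ^ n * (2 - 3 / 2))) ≤ supConst c σ :=
  le_ciSup (bddAbove_supConst c σ) n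

lemma supConst_pos (c σ : ℝ) : 0 < supConst c σ := lt_of_lt_of_le (by positivity) (le_supConst c σ 0)

/-- For n ≥ 1 the formula for σ_n reproduces the exponent in the supremum already with constant 1.
The exceptional value σ_0 = σ/8 dictates 64: 512/σ_0^6 = 2^9 (4/σ)^6 · 64. It is compared with the
term n = 1, since the term n = 0 has no factor e^{C'}, and the comparison uses 4 ≤ 4π²/9. -/
lemma exp_sigmaSeq_le_supConst {σ : ℝ} (hσ : 0 < σ) (n : ℕ) :
    Real.exp (512 / sigmaSeq σ n ^ 6) * 2 ^ (9 * n) * Real.exp (-((3 / 2 : ℝ) ^ n / 2))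
      ≤ supConst 64 σ := by
  rcases Nat.eq_zero_or_pos n with rfl | hn
  · refine le_trans ?_ (le_supConst 64 σ 1)
    have hpi : 3 < Real.pi := Real.pi_gt_three
    have h1 : 512 / sigmaSeq σ 0 ^ 6 ≤ 2 ^ 9 * (4 * Real.pi ^ 2 / (9 * σ)) ^ 6 * 64 := by
      have e1 : 512 / sigmaSeq σ 0 ^ 6 = 2 ^ 9 * (4 / σ) ^ 6 * 64 := by
        rw [sigmaSeq, if_pos rfl]; field_simp; norm_num
      rw [e1]
      have : 4 / σ ≤ 4 * Real.pi ^ 2 / (9 * σ) := by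
        rw [div_le_div_iff₀ hσ (by positivity)]
        have h9 : 9 ≤ Real.pi ^ 2 := by nlinarith
        nlinarith
      gcongr
    have h2 : (1 : ℝ) ≤ 2 ^ (9 * 1) * Real.exp (-((3 / 2 : ℝ) ^ 1 * (2 - 3 / 2))) := by
      have h3 := Real.add_one_le_exp (-((3 / 2 : ℝ) ^ 1 * (2 - 3 / 2)))
      norm_num at h3 ⊢
      linarith
    calc Real.exp (512 / sigmaSeq σ 0 ^ 6) * 2 ^ (9 * 0) * Real.exp (-((3 / 2 : ℝ) ^ 0 / 2))
        ≤ Real.exp (2 ^ 9 * (4 * Real.pi ^ 2 / (9 * σ)) ^ 6 * 64) * 2 ^ (9 * 0) * 1 := by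
          gcongr
          rw [Real.exp_le_one_iff]; norm_num
      _ = 1 * Real.exp (2 ^ 9 * (4 * Real.pi ^ 2 / (9 * σ)) ^ 6 * 64) := by ring
      _ ≤ 2 ^ (9 * 1) * Real.exp (-((3 / 2 : ℝ) ^ 1 * (2 - 3 / 2)))
          * Real.exp (2 ^ 9 * (4 * Real.pi ^ 2 / (9 * σ)) ^ 6 * 64) := by gcongr
      _ = _ := by push_cast; ring_nf
  · refine le_trans (le_of_eq_of_le (b := 2 ^ (9 * n)
      * Real.exp ((2 ^ 9 * (4 * Real.pi ^ 2 / (9 * σ)) ^ 6 * 1) * (n : ℝ) ^ 12)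
      * Real.exp (-((3 / 2 : ℝ) ^ n * (2 - 3 / 2)))) ?_ ?_) (le_supConst 64 σ n)
    · have hn' : (n : ℝ) ≠ 0 := by exact_mod_cast hn.ne'
      have e1 : 512 / sigmaSeq σ n ^ 6
          = (2 ^ 9 * (4 * Real.pi ^ 2 / (9 * σ)) ^ 6 * 1) * (n : ℝ) ^ 12 := by
        have := Real.pi_pos
        rw [sigmaSeq, if_neg hn.ne']; field_simp; norm_num
      rw [e1, mul_comm (Real.exp _) ((2 : ℝ) ^ (9 * n))]
      ring_nf
    · gcongr
      norm_num

/-! ### Split norms -/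

lemma proj_Jpart_sum (lam : Idx → ℂ) (V : VF) :
    proj (Jpart lam 0) V + proj (Jpart lam 1) V + proj (Jpart lam 2) V = V := by
  classical
  funext k q
  simp only [Pi.add_apply, proj, Jpart, Matrix.cons_val_zero, Matrix.cons_val_one,
    Matrix.cons_val, indicator_apply, mem_compl_iff, Set.mem_sdiff]
  have h := @J2_subset_J1 lam q
  by_cases h1 : q ∈ J1 lam <;> by_cases h2 : q ∈ J2 lam
  · simp [h1, h2]
  · simp [h1, h2]
  · exact absurd (h h2) h1
  · simp [h1, h2]

section

variable {lam : Idx → ℂ} {s r : ℝ} {V W : VF}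

lemma splitNorm_le : splitNorm lam s r V ≤ vnorm s r V := iSup_le fun _ => vnorm_proj_le _ _

lemma vnorm_le_splitNorm (hr : 0 < r) : vnorm s r V ≤ 3 * splitNorm lam s r V := by
  have h : ∀ j, vnorm s r (proj (Jpart lam j) V) ≤ splitNorm lam s r V := fun j =>
    le_iSup (fun j => vnorm s r (proj (Jpart lam j) V)) j
  calc vnorm s r V
      = vnorm s r (proj (Jpart lam 0) V + proj (Jpart lam 1) V + proj (Jpart lam 2) V) := by
        rw [proj_Jpart_sum]
    _ ≤ (vnorm s r (proj (Jpart lam 0) V) + vnorm s r (proj (Jpart lam 1) V))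
        + vnorm s r (proj (Jpart lam 2) V) :=
        (vnorm_add_le hr _ _).trans (add_le_add (vnorm_add_le hr _ _) le_rfl)
    _ ≤ splitNorm lam s r V + splitNorm lam s r V + splitNorm lam s r V := by
        gcongr <;> exact h _
    _ = _ := by ring

lemma splitNorm_add_le (hr : 0 < r) :
    splitNorm lam s r (V + W) ≤ splitNorm lam s r V + splitNorm lam s r W := by
  refine iSup_le fun j => ?_
  rw [proj_add]
  exact (vnorm_add_le hr _ _).trans (add_le_add
    (le_iSup (fun j => vnorm s r (proj (Jpart lam j) V)) j)
    (le_iSup (fun j => vnorm s r (proj (Jpart lam j) W)) j))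

lemma splitNorm_ne_top (h : MemV s r V) : splitNorm lam s r V ≠ ⊤ :=
  (splitNorm_le.trans_lt h.norm_lt_top).ne

lemma MemV.vBound (h : MemV s r V) (hr : 0 < r) :
    VBound s r V (3 * (splitNorm lam s r V).toReal) :=
  ⟨h.zero_at_origin, h.momentum, by positivity, by
    rw [ENNReal.ofReal_mul (by norm_num), ENNReal.ofReal_toReal (splitNorm_ne_top h)]
    simpa using vnorm_le_splitNorm (lam := lam) (s := s) (V := V) hr⟩

lemma VBound.splitNorm_toReal_le {a : ℝ} (h : VBound s r V a) : (splitNorm lam s r V).toReal ≤ a :=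
  (ENNReal.toReal_mono h.memV.norm_lt_top.ne splitNorm_le).trans h.toReal_le

lemma splitNorm_toReal_mono {s' r' : ℝ} (h : MemV s r V) (hs : s ≤ s') (hr' : 0 < r') (hr : r' ≤ r) :
    (splitNorm lam s' r' V).toReal ≤ (splitNorm lam s r V).toReal := by
  refine ENNReal.toReal_mono (splitNorm_ne_top h) (iSup_mono fun j => ?_)
  have h1 := (VBound.of_memV h).proj (Jpart lam j)
  exact (vnorm_antitone_s hr' hs h1.zero_at_origin h1.mom).trans
    (vnorm_monotone_r hr' hr h1.zero_at_origin)

lemma MemV.mono {s' r' : ℝ} (h : MemV s r V) (hs : s ≤ s') (hr' : 0 < r') (hr : r' ≤ r) :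
    MemV s' r' V :=
  ((VBound.of_memV h).mono hs hr' hr le_rfl).memV

end

/-! ### Scalar estimates for one step -/

/-- A numerical constant in the estimate of the generating field. -/
def genConst : ℝ := 829440000

/-- A numerical constant in the quadratic estimate of the error. -/
def quadConst : ℝ := 510 * genConst ^ 2

lemma one_le_genConst : 1 ≤ genConst := by rw [genConst]; norm_num

lemma genConst_le_quadConst : genConst ≤ quadConst := by
  have := one_le_genConst
  rw [quadConst]; nlinarith

lemma quadConst_pos : 0 < quadConst := by have := one_le_genConst; rw [quadConst]; positivity

/-- In the application E bounds γ L_λ⁻¹, p is 2^n, R is r_n/ρ_n and T is Θ₀. The factor 3 comes from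
the three pieces of the split norm, and 6T is three times the bound 2Θ₀ for Z + N. The constant
`genConst` is 20 · 3 · 240³. -/
lemma gen_bound {E p R ε T : ℝ} (hE : 1 ≤ E) (hp : 1 ≤ p) (hR0 : 0 ≤ R) (hR : R ≤ 20 * p)
    (hε : 0 ≤ ε) (hT : 0 ≤ T) :
    R * (E * (3 * ε) * (1 + E * (2 * R) * (6 * T)) ^ 3)
      ≤ genConst * (E ^ 4 * p ^ 4 * (1 + T) ^ 3 * ε) := by
  have h1 : 1 + E * (2 * R) * (6 * T) ≤ 240 * E * p * (1 + T) := by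
    have h2 : E * (2 * R) * (6 * T) ≤ E * (2 * (20 * p)) * (6 * T) := by gcongr
    have h3 : 1 ≤ E * p := one_le_mul_of_one_le_of_one_le hE hp
    nlinarith
  calc R * (E * (3 * ε) * (1 + E * (2 * R) * (6 * T)) ^ 3)
      ≤ 20 * p * (E * (3 * ε) * (240 * E * p * (1 + T)) ^ 3) := by gcongr
    _ = _ := by rw [genConst]; ring

section

variable {E p g ε T Q : ℝ} (hE : 1 ≤ E) (hp : 1 ≤ p) (hε : 0 ≤ ε) (hT : 0 ≤ T)
  (hg0 : 0 ≤ g) (hg : g ≤ genConst * (E ^ 4 * p ^ 4 * (1 + T) ^ 3 * ε))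
  (hQ : E ^ 8 * p ^ 9 * (1 + T) ^ 7 * ε ≤ Q)
include hE hp hε hT hg hQ

lemma gen_le : g * p ^ 5 ≤ genConst * Q := by
  have hc := one_le_genConst
  have h1 : E ^ 4 * p ^ 9 * (1 + T) ^ 3 * ε ≤ E ^ 8 * p ^ 9 * (1 + T) ^ 7 * ε := by
    have h2 : E ^ 4 ≤ E ^ 8 := pow_le_pow_right₀ hE (by norm_num)
    have h3 : (1 + T) ^ 3 ≤ (1 + T) ^ 7 := pow_le_pow_right₀ (by linarith) (by norm_num)
    gcongr
  calc g * p ^ 5 ≤ genConst * (E ^ 4 * p ^ 4 * (1 + T) ^ 3 * ε) * p ^ 5 := by gcongr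
    _ = genConst * (E ^ 4 * p ^ 9 * (1 + T) ^ 3 * ε) := by ring
    _ ≤ genConst * (E ^ 8 * p ^ 9 * (1 + T) ^ 7 * ε) := by gcongr
    _ ≤ _ := by gcongr

include hg0

/-- The worst term is g²T. The square of E⁴p⁴(1+T)³ε times 1 + T gives E⁸p⁸(1+T)⁷ε², hence the
exponents in the smallness condition. The ninth power of p keeps a spare factor 2^n, used to sum the
increments of Θ. The three contributions add up to 510 = 78 + 288 + 144. -/
lemma quad_le (hg1 : g ≤ 1) :
    (2 * g * (3 * ε) + 4 * Real.exp 1 * g * (2 * (3 * ε + 2 * g * (6 * T + 3 * ε)))) * p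
      ≤ quadConst * Q * ε := by
  have hc := one_le_genConst
  have he : Real.exp 1 ≤ 3 := by linarith [Real.exp_one_lt_d9]
  set q := E ^ 8 * p ^ 8 * (1 + T) ^ 7 * ε with hq
  have hq0 : 0 ≤ q := by positivity
  have h2 : E ^ 4 ≤ E ^ 8 := pow_le_pow_right₀ hE (by norm_num)
  have h2' : p ^ 4 ≤ p ^ 8 := pow_le_pow_right₀ hp (by norm_num)
  have h3 : (1 + T) ^ 3 ≤ (1 + T) ^ 7 := pow_le_pow_right₀ (by linarith) (by norm_num)
  have hgq : g ≤ genConst * q := hg.trans (by rw [hq]; gcongr)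
  have hg2 : g ^ 2 * T ≤ genConst ^ 2 * q * ε := by
    calc g ^ 2 * T ≤ (genConst * (E ^ 4 * p ^ 4 * (1 + T) ^ 3 * ε)) ^ 2 * (1 + T) := by
          gcongr; linarith
      _ = genConst ^ 2 * q * ε := by rw [hq]; ring
  have h4 : 2 * g * (3 * ε) + 4 * Real.exp 1 * g * (2 * (3 * ε + 2 * g * (6 * T + 3 * ε)))
      ≤ 2 * g * (3 * ε) + 4 * 3 * g * (2 * (3 * ε + 2 * g * (6 * T + 3 * ε))) := by gcongr
  have h5 : g * (g * ε) ≤ 1 * (g * ε) := by gcongr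
  have h6 : g * ε ≤ genConst * q * ε := by gcongr
  have h7 : genConst * q * ε ≤ genConst ^ 2 * q * ε := by
    have : genConst ≤ genConst ^ 2 := by nlinarith
    gcongr
  have h8 : 2 * g * (3 * ε) + 4 * Real.exp 1 * g * (2 * (3 * ε + 2 * g * (6 * T + 3 * ε)))
      ≤ quadConst * q * ε := by
    rw [quadConst]
    calc _ ≤ _ := h4
      _ = 78 * (g * ε) + 288 * (g ^ 2 * T) + 144 * (g * (g * ε)) := by ring
      _ ≤ 78 * (genConst ^ 2 * q * ε) + 288 * (genConst ^ 2 * q * ε)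
          + 144 * (genConst ^ 2 * q * ε) := by linarith
      _ = _ := by ring
  have hqp : q * p ≤ Q := by refine le_trans (le_of_eq ?_) hQ; rw [hq]; ring
  have := quadConst_pos
  calc _ ≤ quadConst * q * ε * p := by gcongr
    _ = quadConst * (q * p) * ε := by ring
    _ ≤ _ := by gcongr

end

end

end ResonantKAM

open scoped ENNReal Topology
open Filter Set

/-! ## The iteration -/

namespace ResonantKAM

noncomputable section

/-- The data of the iterative scheme, and the smallness condition. -/
structure IterData (τ C : ℝ) where
  (A γ s s' r' ε₀ Θ₀ : ℝ)
  lam : Idx → ℂ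
  d : ℕ
  (Z X₀ N₀ : VF)
  one_le_A : 1 ≤ A
  γ_pos : 0 < γ
  freq : FreqAssumptions τ C γ lam
  divisors : ∀ δ : ℝ, 0 < δ → ∀ (k : Idx) (q : MIdx), q ≠ 0 → momDot q = mom k → dot lam q ≠ lam k →
    Real.exp (-(δ * (sjSum q - sj k))) ≤ A * Real.exp (1 / δ ^ 6) * γ⁻¹ * ‖dot lam q - lam k‖
  degree : leastDegree lam ≤ d
  lt : s < s'
  r_pos : 0 < r'
  memZ : MemV s (2 * r') Z
  diagZ : IsDiagResonant lam Z
  orderZ : OrderGE 1 Z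
  memX₀ : MemV s (2 * r') X₀
  orderX₀ : OrderGE d X₀
  suppX₀ : SupportedIn (J2 lam)ᶜ X₀
  memN₀ : MemV s (2 * r') N₀
  orderN₀ : OrderGE d N₀
  suppN₀ : SupportedIn (J2 lam) N₀
  ε₀_eq : ε₀ = γ⁻¹ * (splitNorm lam s (2 * r') X₀).toReal
  Θ₀_eq : Θ₀ = γ⁻¹ * ((splitNorm lam s (2 * r') Z).toReal + (splitNorm lam s (2 * r') N₀).toReal) + ε₀
  small : ε₀ ≤ ((1 + Θ₀) ^ 7)⁻¹ * (300 * quadConst * A ^ 8 * supConst 64 (s' - s))⁻¹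

namespace IterData

variable {τ C : ℝ} (H : IterData τ C)

/-- The pairs `(X_n, N_n)`. -/
def XN : ℕ → VF × VF
  | 0 => (H.X₀, H.N₀)
  | n + 1 =>
    (stepX H.lam H.Z (XN n).2 (XN n).1 (homSol H.lam (H.Z + (XN n).2) (XN n).1),
      (XN n).2 + stepN H.lam H.Z (XN n).2 (XN n).1 (homSol H.lam (H.Z + (XN n).2) (XN n).1))

/-- The part of the `n`-th field in `ℐ^{(0)} ⊕ ℐ^{(1)}`. -/
def X (n : ℕ) : VF := (H.XN n).1

/-- The part of the `n`-th field in `ℐ^{(2)}`. -/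
def N (n : ℕ) : VF := (H.XN n).2

/-- The generating field of the `n`-th step. -/
def F (n : ℕ) : VF := homSol H.lam (H.Z + H.N n) (H.X n)

/-- The weight at the `n`-th step. -/
def sn (n : ℕ) : ℝ := sSeq H.s H.s' n

/-- The radius at the `n`-th step. -/
def rn (n : ℕ) : ℝ := rSeq H.r' n

/-- The loss of radius at the `n`-th step. -/
def rho (n : ℕ) : ℝ := rhoSeq H.r' n

/-- The size of `X_n`. -/
def eps (n : ℕ) : ℝ := H.γ⁻¹ * (splitNorm H.lam (H.sn n) (H.rn n) (H.X n)).toReal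

/-- The size of `Z + N_n`, plus that of `X_n`. -/
def theta (n : ℕ) : ℝ := H.γ⁻¹ * ((splitNorm H.lam (H.sn n) (H.rn n) H.Z).toReal
  + (splitNorm H.lam (H.sn n) (H.rn n) (H.N n)).toReal) + H.eps n

lemma N_succ (n : ℕ) : H.N (n + 1) = H.N n + stepN H.lam H.Z (H.N n) (H.X n) (H.F n) := rfl

lemma rn_succ (n : ℕ) : H.rn (n + 1) = H.rn n - 5 * H.rho n := rfl

lemma rho_pos (n : ℕ) : 0 < H.rho n := rhoSeq_pos H.r_pos n

lemma rho_lt (n : ℕ) : 5 * H.rho n < H.rn n := five_rhoSeq_lt H.r_pos n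

lemma rn_pos (n : ℕ) : 0 < H.rn n := H.r_pos.trans (lt_rSeq H.r_pos n)

lemma rn_antitone : Antitone H.rn := antitone_nat_of_succ_le fun n => by
  rw [rn_succ]; linarith [H.rho_pos n]

lemma sn_monotone : Monotone H.sn := monotone_nat_of_le_succ fun n => (sSeq_lt_succ H.lt n).le

lemma sn_lt (n : ℕ) : H.sn n < H.s' := sSeq_lt H.lt n

lemma r_lt_rn (n : ℕ) : H.r' < H.rn n := lt_rSeq H.r_pos n

lemma rn_le_zero (n : ℕ) : H.rn n ≤ 2 * H.r' := H.rn_antitone n.zero_le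

lemma rho_eq (n : ℕ) : H.rho n = H.r' / 10 * (2 ^ n)⁻¹ := rfl

lemma eps_nonneg (n : ℕ) : 0 ≤ H.eps n :=
  mul_nonneg (inv_nonneg.2 H.γ_pos.le) ENNReal.toReal_nonneg

lemma eps_zero : H.eps 0 = H.ε₀ := H.ε₀_eq.symm

lemma theta_zero : H.theta 0 = H.Θ₀ := by rw [H.Θ₀_eq, ← H.eps_zero]; rfl

lemma ε₀_nonneg : 0 ≤ H.ε₀ := H.eps_zero ▸ H.eps_nonneg 0

lemma eps_le_theta (n : ℕ) : H.eps n ≤ H.theta n :=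
  le_add_of_nonneg_left (mul_nonneg (inv_nonneg.2 H.γ_pos.le)
    (add_nonneg ENNReal.toReal_nonneg ENNReal.toReal_nonneg))

lemma ε₀_le_Θ₀ : H.ε₀ ≤ H.Θ₀ := by
  have := H.eps_le_theta 0
  rwa [H.eps_zero, H.theta_zero] at this

lemma Θ₀_nonneg : 0 ≤ H.Θ₀ := H.ε₀_nonneg.trans H.ε₀_le_Θ₀

lemma one_le_d : 1 ≤ H.d := one_le_of_leastDegree_le H.freq H.degree

/-- The normalized bound for the inverse of `L_λ` at the `n`-th step. -/
def divBound (n : ℕ) : ℝ := H.A * Real.exp (64 / sigmaSeq (H.s' - H.s) n ^ 6)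

lemma one_le_divBound (n : ℕ) : 1 ≤ H.divBound n := by
  have := sigmaSeq_pos (sub_pos.2 H.lt) n
  have h : 1 ≤ Real.exp (64 / sigmaSeq (H.s' - H.s) n ^ 6) := Real.one_le_exp (by positivity)
  exact one_le_mul_of_one_le_of_one_le H.one_le_A h

/-- The loss per division is δ = σ_n/2, so 1/δ^6 = 64/σ_n^6. Four divisions use exactly 2σ_n =
s_{n+1} - s_n. -/
lemma invL_bound (n : ℕ) (s r a : ℝ) (Y : VF) (hr : 0 < r) (hY : VBound s r Y a) :
    VBound (s + sigmaSeq (H.s' - H.s) n / 2) r (invL H.lam Y) (H.divBound n * H.γ⁻¹ * a) := by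
  have hσ := sigmaSeq_pos (sub_pos.2 H.lt) n
  have hγ := H.γ_pos
  have hE := H.one_le_divBound n
  have ha := hY.nonneg
  refine ⟨fun k => by simp [invL, hY.zero_at_origin], hY.mom.invL _, by positivity, ?_⟩
  refine (vnorm_invL_le hr (H.divisors _ (half_pos hσ)) hY.memV).trans ?_
  have e : H.A * Real.exp (1 / (sigmaSeq (H.s' - H.s) n / 2) ^ 6) * H.γ⁻¹
      = H.divBound n * H.γ⁻¹ := by
    rw [divBound]; congr 3; field_simp; norm_num
  rw [e, ENNReal.ofReal_mul (p := H.divBound n * H.γ⁻¹) (by positivity)]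
  exact mul_le_mul' le_rfl hY.le

/-- The ratio of the radius and its loss. -/
def ratio (n : ℕ) : ℝ := H.rn n / H.rho n

lemma ratio_nonneg (n : ℕ) : 0 ≤ H.ratio n := (div_pos (H.rn_pos n) (H.rho_pos n)).le

/-- The bound for the generating field. -/
def fBound (n : ℕ) : ℝ := H.divBound n * (3 * H.eps n) *
  (1 + H.divBound n * (2 * H.ratio n) * (6 * H.Θ₀)) ^ 3

/-- The smallness quantity of the `n`-th step. -/
def smallness (n : ℕ) : ℝ := H.divBound n ^ 8 * (2 ^ n) ^ 9 * (1 + H.Θ₀) ^ 7 * H.eps n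

/-- The bound for `X_{n+1}`. -/
def xBound (n : ℕ) : ℝ := 2 * (H.ratio n * H.fBound n) * (3 * H.eps n) +
  4 * Real.exp 1 * (H.ratio n * H.fBound n) *
    (2 * (3 * H.eps n + 2 * (H.ratio n * H.fBound n) * (6 * H.Θ₀ + 3 * H.eps n)))

/-- The properties of the `n`-th field. -/
structure Inv (n : ℕ) : Prop where
  step : StepHyp H.lam H.d H.Z (H.N n) (H.X n)
  memX : MemV (H.sn n) (H.rn n) (H.X n)
  memN : MemV (H.sn n) (H.rn n) (H.N n)
  eps_le : H.eps n ≤ H.ε₀ * Real.exp (-(3 / 2 : ℝ) ^ n + 1)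
  theta_le : H.theta n ≤ H.Θ₀ * ∑ j ∈ Finset.range (n + 1), ((2 : ℝ) ^ j)⁻¹

lemma sum_two_le (n : ℕ) : ∑ j ∈ Finset.range n, ((2 : ℝ) ^ j)⁻¹ ≤ 2 := by
  have h := sum_le_hasSum (Finset.range n) (fun j _ => by positivity) hasSum_geometric_two
  simpa [one_div, inv_pow] using h

lemma memZ_n (n : ℕ) : MemV (H.sn n) (H.rn n) H.Z :=
  H.memZ.mono (H.sn_monotone n.zero_le) (H.rn_pos n) (H.rn_le_zero n)

lemma inv_zero : H.Inv 0 where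
  step := ⟨H.diagZ, H.orderZ, H.orderN₀, H.suppN₀, H.orderX₀, H.suppX₀, H.memZ.momentum,
    H.memN₀.momentum, H.memX₀.momentum, H.one_le_d⟩
  memX := H.memX₀
  memN := H.memN₀
  eps_le := by simp [H.eps_zero]
  theta_le := by simp [H.theta_zero]

lemma gen_le_pow (n : ℕ) : H.ratio n * H.fBound n
    ≤ genConst * (H.divBound n ^ 4 * (2 ^ n) ^ 4 * (1 + H.Θ₀) ^ 3 * H.eps n) :=
  gen_bound (H.one_le_divBound n) (one_le_pow₀ (by norm_num)) (H.ratio_nonneg n)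
    (rSeq_div_rhoSeq_le H.r_pos n) (H.eps_nonneg n) H.Θ₀_nonneg

lemma fBound_nonneg (n : ℕ) : 0 ≤ H.fBound n := by
  have := H.one_le_divBound n
  have := H.eps_nonneg n
  have := H.ratio_nonneg n
  have := H.Θ₀_nonneg
  rw [fBound]; positivity

lemma gen_nonneg (n : ℕ) : 0 ≤ H.ratio n * H.fBound n := mul_nonneg (H.ratio_nonneg n) (H.fBound_nonneg n)

section

variable {n : ℕ} {H} (I : H.Inv n)
include I

/-- With x = e^{-χ^n/2} the bound on ε_n contains e·x·x. One factor x is absorbed by the supremum,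
the other remains as the gain of the step. In the constant, 300 is 100 times the bound 3 for e. -/
lemma Inv.smallness_le : H.smallness n ≤ Real.exp (-((3 / 2 : ℝ) ^ n / 2)) / (100 * quadConst) := by
  have hA := H.one_le_A
  have hq := quadConst_pos
  have hS := supConst_pos 64 (H.s' - H.s)
  have hT := H.Θ₀_nonneg
  have h0 := H.ε₀_nonneg
  set S := supConst 64 (H.s' - H.s)
  set x := Real.exp (-((3 / 2 : ℝ) ^ n / 2)) with hx
  have hx0 : 0 < x := Real.exp_pos _
  have h1 : Real.exp (-(3 / 2 : ℝ) ^ n + 1) = Real.exp 1 * x * x := by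
    rw [hx, ← Real.exp_add, ← Real.exp_add]; ring_nf
  have h2 : H.divBound n ^ 8 = H.A ^ 8 * Real.exp (512 / sigmaSeq (H.s' - H.s) n ^ 6) := by
    rw [divBound, mul_pow, ← Real.exp_nat_mul]; congr 2; push_cast; ring
  have h3 := exp_sigmaSeq_le_supConst (sub_pos.2 H.lt) n
  have h4 : (1 + H.Θ₀) ^ 7 * H.ε₀ ≤ (300 * quadConst * H.A ^ 8 * S)⁻¹ := by
    calc (1 + H.Θ₀) ^ 7 * H.ε₀
        ≤ (1 + H.Θ₀) ^ 7 * (((1 + H.Θ₀) ^ 7)⁻¹ * (300 * quadConst * H.A ^ 8 * S)⁻¹) := by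
          gcongr; exact H.small
      _ = _ := mul_inv_cancel_left₀ (by positivity) _
  have he : Real.exp 1 ≤ 3 := by linarith [Real.exp_one_lt_d9]
  set e512 := Real.exp (512 / sigmaSeq (H.s' - H.s) n ^ 6)
  rw [smallness, h2]
  calc H.A ^ 8 * e512 * (2 ^ n) ^ 9 * (1 + H.Θ₀) ^ 7 * H.eps n
      ≤ H.A ^ 8 * e512 * (2 ^ n) ^ 9 * (1 + H.Θ₀) ^ 7 * (H.ε₀ * (Real.exp 1 * x * x)) := by
        gcongr; rw [← h1]; exact I.eps_le
    _ = H.A ^ 8 * (e512 * 2 ^ (9 * n) * x) * ((1 + H.Θ₀) ^ 7 * H.ε₀) * Real.exp 1 * x := by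
        rw [mul_comm 9 n, pow_mul]; ring
    _ ≤ H.A ^ 8 * S * (300 * quadConst * H.A ^ 8 * S)⁻¹ * 3 * x := by gcongr
    _ = _ := by field_simp; norm_num

lemma Inv.smallness_le' : H.smallness n ≤ 1 / (100 * quadConst) := by
  have hq := quadConst_pos
  refine I.smallness_le.trans ?_
  gcongr
  rw [Real.exp_le_one_iff]
  have : (0 : ℝ) ≤ (3 / 2) ^ n / 2 := by positivity
  linarith

lemma Inv.gen_small : H.ratio n * H.fBound n * (2 ^ n) ^ 5 ≤ 1 / 10 ^ 6 := by
  have h := gen_le (H.one_le_divBound n) (one_le_pow₀ (by norm_num : (1 : ℝ) ≤ 2)) (H.eps_nonneg n)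
    H.Θ₀_nonneg (H.gen_le_pow n) I.smallness_le'
  refine h.trans ?_
  rw [quadConst, genConst]; norm_num

lemma Inv.gen_le_one : H.ratio n * H.fBound n ≤ 1 / 10 ^ 6 :=
  (le_mul_of_one_le_right (H.gen_nonneg n)
    (one_le_pow₀ (one_le_pow₀ (by norm_num)))).trans I.gen_small

lemma Inv.xBound_le : H.xBound n * 2 ^ n ≤ Real.exp (-((3 / 2 : ℝ) ^ n / 2)) / 100 * H.eps n := by
  have hq := quadConst_pos
  have h := quad_le (H.one_le_divBound n) (one_le_pow₀ (by norm_num : (1 : ℝ) ≤ 2)) (H.eps_nonneg n)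
    H.Θ₀_nonneg (H.gen_nonneg n) (H.gen_le_pow n) I.smallness_le
    (I.gen_le_one.trans (by norm_num))
  refine h.trans (le_of_eq ?_)
  field_simp

lemma Inv.theta_le_two : H.theta n ≤ 2 * H.Θ₀ := by
  have := sum_two_le (n + 1)
  have := H.Θ₀_nonneg
  exact I.theta_le.trans (by nlinarith)

lemma Inv.boundX : VBound (H.sn n) (H.rn n) (H.X n) (H.γ * (3 * H.eps n)) := by
  refine (I.memX.vBound (lam := H.lam) (H.rn_pos n)).weaken (le_of_eq ?_)
  have := H.γ_pos.ne'
  rw [eps]; field_simp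

lemma Inv.boundW : VBound (H.sn n) (H.rn n) (H.Z + H.N n) (H.γ * (6 * H.Θ₀)) := by
  have hγ := H.γ_pos
  refine (((H.memZ_n n).vBound (lam := H.lam) (H.rn_pos n)).add (H.rn_pos n)
    (I.memN.vBound (lam := H.lam) (H.rn_pos n))).weaken ?_
  have h1 := I.theta_le_two
  have h2 := H.eps_nonneg n
  rw [theta] at h1
  set a := (splitNorm H.lam (H.sn n) (H.rn n) H.Z).toReal
  set b := (splitNorm H.lam (H.sn n) (H.rn n) (H.N n)).toReal
  have h3 : H.γ⁻¹ * (a + b) ≤ 2 * H.Θ₀ := by linarith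
  rw [inv_mul_le_iff₀ hγ] at h3
  linarith

lemma Inv.boundF : VBound (H.sn (n + 1)) (H.rn n - 3 * H.rho n) (H.F n) (H.fBound n) := by
  have hσ := sigmaSeq_pos (sub_pos.2 H.lt) n
  have hγ := H.γ_pos
  have hE := H.one_le_divBound n
  have h := homSol_bound (δ := sigmaSeq (H.s' - H.s) n / 2) (E := H.divBound n * H.γ⁻¹)
    (H.rho_pos n) (H.rho_lt n) (by positivity) (by positivity) (H.invL_bound n) I.boundW I.boundX
  have e : H.sn n + 4 * (sigmaSeq (H.s' - H.s) n / 2) = H.sn (n + 1) := by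
    rw [sn, sn, sSeq]; ring
  rw [e] at h
  refine h.weaken (le_of_eq ?_)
  rw [fBound, ratio]
  field_simp

lemma Inv.rate_le : 4 * Real.exp 1 * (H.rn n / H.rho n) * H.fBound n ≤ 1 / 2 := by
  have h := I.gen_le_one
  have h0 := H.gen_nonneg n
  have he : Real.exp 1 ≤ 3 := by linarith [Real.exp_one_lt_d9]
  have e : 4 * Real.exp 1 * (H.rn n / H.rho n) * H.fBound n
      = 4 * Real.exp 1 * (H.ratio n * H.fBound n) := by rw [ratio]; ring
  rw [e]
  calc 4 * Real.exp 1 * (H.ratio n * H.fBound n) ≤ 4 * 3 * (1 / 10 ^ 6) := by gcongr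
    _ ≤ _ := by norm_num

lemma Inv.boundW' : VBound (H.sn (n + 1)) (H.rn n) (H.Z + H.N n) (H.γ * (6 * H.Θ₀)) :=
  I.boundW.mono (H.sn_monotone n.le_succ) (H.rn_pos n) le_rfl le_rfl

lemma Inv.boundX' : VBound (H.sn (n + 1)) (H.rn n) (H.X n) (H.γ * (3 * H.eps n)) :=
  I.boundX.mono (H.sn_monotone n.le_succ) (H.rn_pos n) le_rfl le_rfl

lemma Inv.boundX_succ : VBound (H.sn (n + 1)) (H.rn (n + 1)) (H.X (n + 1)) (H.γ * H.xBound n) := by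
  refine (I.step.boundX' H.freq H.degree (H.rho_pos n) (H.rho_lt n) I.boundF I.boundW' I.boundX'
    I.rate_le).weaken (le_of_eq ?_)
  rw [xBound, ratio]; ring

lemma Inv.boundN_succ : VBound (H.sn (n + 1)) (H.rn (n + 1))
    (stepN H.lam H.Z (H.N n) (H.X n) (H.F n))
    (H.γ * (12 * (H.ratio n * H.fBound n) * H.Θ₀ + H.xBound n)) := by
  refine (I.step.boundN' H.freq H.degree (H.rho_pos n) (H.rho_lt n) I.boundF I.boundW' I.boundX'
    I.rate_le).weaken (le_of_eq ?_)
  rw [xBound, ratio]; ring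

lemma Inv.eps_succ_le : H.eps (n + 1) ≤ H.xBound n := by
  rw [eps, inv_mul_le_iff₀ H.γ_pos]
  exact I.boundX_succ.splitNorm_toReal_le

lemma Inv.eps_le_three : H.eps n ≤ 3 * H.Θ₀ := by
  have h0 := H.ε₀_nonneg
  have h1 : Real.exp (-(3 / 2 : ℝ) ^ n + 1) ≤ 3 := by
    have : (0 : ℝ) ≤ (3 / 2) ^ n := by positivity
    have h2 : Real.exp (-(3 / 2 : ℝ) ^ n + 1) ≤ Real.exp 1 := Real.exp_le_exp.2 (by linarith)
    linarith [Real.exp_one_lt_d9]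
  calc H.eps n ≤ H.ε₀ * Real.exp (-(3 / 2 : ℝ) ^ n + 1) := I.eps_le
    _ ≤ H.ε₀ * 3 := by gcongr
    _ ≤ _ := by linarith [H.ε₀_le_Θ₀]

lemma Inv.xBound_mul_le : H.xBound n * 2 ^ n ≤ H.eps n / 100 := by
  refine I.xBound_le.trans ?_
  have h : Real.exp (-((3 / 2 : ℝ) ^ n / 2)) ≤ 1 := by
    rw [Real.exp_le_one_iff]
    have : (0 : ℝ) ≤ (3 / 2) ^ n / 2 := by positivity
    linarith
  have := H.eps_nonneg n
  calc Real.exp (-((3 / 2 : ℝ) ^ n / 2)) / 100 * H.eps n ≤ 1 / 100 * H.eps n := by gcongr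
    _ = _ := by ring

lemma Inv.gen_mul_le : H.ratio n * H.fBound n * 2 ^ n ≤ 1 / 10 ^ 6 := by
  refine le_trans ?_ I.gen_small
  have h := H.gen_nonneg n
  have : (2 : ℝ) ^ n ≤ (2 ^ n) ^ 5 := le_self_pow₀ (one_le_pow₀ (by norm_num)) (by norm_num)
  gcongr

lemma Inv.stepN_le : 12 * (H.ratio n * H.fBound n) * H.Θ₀ + H.xBound n ≤ H.Θ₀ / 4 * (2 ^ n)⁻¹ := by
  have h1 := I.gen_mul_le
  have h2 := I.xBound_mul_le
  have h3 := I.eps_le_three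
  have hT := H.Θ₀_nonneg
  rw [← div_eq_mul_inv, le_div_iff₀ (by positivity)]
  have h4 : H.ratio n * H.fBound n * 2 ^ n * H.Θ₀ ≤ 1 / 10 ^ 6 * H.Θ₀ := by gcongr
  nlinarith

lemma Inv.succ : H.Inv (n + 1) where
  step := ⟨H.diagZ, H.orderZ, I.step.orderN.add (I.step.orderN' H.freq H.degree),
    I.step.suppN.add (supportedIn_proj _ _), I.step.orderX' H.freq H.degree, supportedIn_proj _ _,
    H.memZ.momentum, I.step.momN.add I.boundN_succ.mom, I.boundX_succ.mom, H.one_le_d⟩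
  memX := I.boundX_succ.memV
  memN := (((VBound.of_memV I.memN).mono (H.sn_monotone n.le_succ) (H.rn_pos _)
    (H.rn_antitone n.le_succ) le_rfl).add (H.rn_pos _) I.boundN_succ).memV
  -- The exponent closes because (3/2)^n + (3/2)^n/2 = (3/2)^{n+1}.
  eps_le := by
    have h0 := H.eps_nonneg n
    have hp : (1 : ℝ) ≤ 2 ^ n := one_le_pow₀ (by norm_num)
    have hx0 : 0 ≤ H.xBound n := (H.eps_nonneg (n + 1)).trans I.eps_succ_le
    have h1 : H.xBound n ≤ Real.exp (-((3 / 2 : ℝ) ^ n / 2)) * H.eps n := by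
      have h2 := I.xBound_le
      have h3 : 0 ≤ Real.exp (-((3 / 2 : ℝ) ^ n / 2)) * H.eps n := by positivity
      nlinarith
    calc H.eps (n + 1) ≤ H.xBound n := I.eps_succ_le
      _ ≤ Real.exp (-((3 / 2 : ℝ) ^ n / 2)) * H.eps n := h1
      _ ≤ Real.exp (-((3 / 2 : ℝ) ^ n / 2)) * (H.ε₀ * Real.exp (-(3 / 2 : ℝ) ^ n + 1)) := by
          gcongr; exact I.eps_le
      _ = H.ε₀ * (Real.exp (-((3 / 2 : ℝ) ^ n / 2)) * Real.exp (-(3 / 2 : ℝ) ^ n + 1)) := by ring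
      _ = _ := by rw [← Real.exp_add, pow_succ]; ring_nf
  -- The increment of N and the new ε are each at most Θ₀/4 · 2^{-n}. Together they give the next
  -- term Θ₀ 2^{-(n+1)}.
  theta_le := by
    have hγ := H.γ_pos
    have hZ : (splitNorm H.lam (H.sn (n + 1)) (H.rn (n + 1)) H.Z).toReal
        ≤ (splitNorm H.lam (H.sn n) (H.rn n) H.Z).toReal :=
      splitNorm_toReal_mono (H.memZ_n n) (H.sn_monotone n.le_succ) (H.rn_pos _)
        (H.rn_antitone n.le_succ)
    have hN1 : (splitNorm H.lam (H.sn (n + 1)) (H.rn (n + 1)) (H.N n)).toReal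
        ≤ (splitNorm H.lam (H.sn n) (H.rn n) (H.N n)).toReal :=
      splitNorm_toReal_mono I.memN (H.sn_monotone n.le_succ) (H.rn_pos _)
        (H.rn_antitone n.le_succ)
    have hN : (splitNorm H.lam (H.sn (n + 1)) (H.rn (n + 1)) (H.N (n + 1))).toReal
        ≤ (splitNorm H.lam (H.sn n) (H.rn n) (H.N n)).toReal
          + H.γ * (12 * (H.ratio n * H.fBound n) * H.Θ₀ + H.xBound n) := by
      have h1 := I.memN.mono (H.sn_monotone n.le_succ) (H.rn_pos (n + 1)) (H.rn_antitone n.le_succ)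
      have h2 := I.boundN_succ.memV
      have h3 := ENNReal.toReal_mono (ENNReal.add_ne_top.2
        ⟨splitNorm_ne_top (lam := H.lam) h1, splitNorm_ne_top (lam := H.lam) h2⟩)
        (splitNorm_add_le (H.rn_pos (n + 1)))
      rw [ENNReal.toReal_add (splitNorm_ne_top h1) (splitNorm_ne_top h2)] at h3
      refine h3.trans (add_le_add hN1 I.boundN_succ.splitNorm_toReal_le)
    have h1 := I.stepN_le
    have h2 := I.theta_le
    have h3 := I.eps_succ_le
    have h4 := I.xBound_mul_le
    have h5 := I.eps_le_three
    have h6 := H.eps_nonneg n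
    have hp : (0 : ℝ) < 2 ^ n := by positivity
    have h7 : H.xBound n ≤ H.Θ₀ / 4 * (2 ^ n)⁻¹ := by
      rw [← div_eq_mul_inv, le_div_iff₀ hp]; linarith [H.Θ₀_nonneg]
    have h8 : H.γ⁻¹ * ((splitNorm H.lam (H.sn (n + 1)) (H.rn (n + 1)) H.Z).toReal
        + (splitNorm H.lam (H.sn (n + 1)) (H.rn (n + 1)) (H.N (n + 1))).toReal)
        ≤ H.γ⁻¹ * ((splitNorm H.lam (H.sn n) (H.rn n) H.Z).toReal
          + (splitNorm H.lam (H.sn n) (H.rn n) (H.N n)).toReal)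
          + (12 * (H.ratio n * H.fBound n) * H.Θ₀ + H.xBound n) := by
      calc _ ≤ H.γ⁻¹ * ((splitNorm H.lam (H.sn n) (H.rn n) H.Z).toReal
            + ((splitNorm H.lam (H.sn n) (H.rn n) (H.N n)).toReal
            + H.γ * (12 * (H.ratio n * H.fBound n) * H.Θ₀ + H.xBound n))) := by gcongr
        _ = _ := by field_simp; ring
    rw [Finset.sum_range_succ, mul_add, theta]
    rw [theta] at h2
    have h9 : H.Θ₀ * ((2 : ℝ) ^ (n + 1))⁻¹ = H.Θ₀ / 4 * (2 ^ n)⁻¹ + H.Θ₀ / 4 * (2 ^ n)⁻¹ := by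
      rw [pow_succ, mul_inv]; ring
    linarith

end

lemma inv (n : ℕ) : H.Inv n := by
  induction n with
  | zero => exact H.inv_zero
  | succ n ih => exact ih.succ

end IterData

end

end ResonantKAM

open scoped ENNReal Topology
open Filter Set

/-! ## The flows and their compositions -/

namespace ResonantKAM

noncomputable section

/-- Coefficients are controlled by the majorant norm. -/
lemma exists_enorm_coeff_le (s : ℝ) {r : ℝ} (hr : 0 < r) (k : Idx) (q : MIdx) :
    ∃ c : ℝ≥0∞, c ≠ ⊤ ∧ ∀ V : VF, ‖V k q‖ₑ ≤ c * vnorm s r V := by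
  classical
  set u : Idx → ℝ≥0∞ := fun h => if h ∈ q.support then 1 else 0 with hu
  have hfin : wNorm s u ≠ ⊤ := by
    refine ENNReal.rpow_ne_top_of_nonneg (by norm_num) ?_
    rw [tsum_eq_sum (s := q.support)]
    · refine ENNReal.sum_ne_top.2 fun h hh => ?_
      simp [hu, Finsupp.mem_support_iff.1 hh]
    · intro h hh
      simp [hu, Finsupp.notMem_support_iff.1 hh]
  set a : ℝ := r / (2 * ((wNorm s u).toReal + 1)) with ha
  have hw : 0 ≤ (wNorm s u).toReal := ENNReal.toReal_nonneg
  have ha0 : 0 < a := by positivity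
  have h1 : wNorm s (fun h => ENNReal.ofReal a * u h) < ENNReal.ofReal r := by
    rw [wNorm_const_mul, ← ENNReal.ofReal_toReal hfin, ← ENNReal.ofReal_mul ha0.le,
      ENNReal.ofReal_lt_ofReal_iff hr, ha, div_mul_eq_mul_div, div_lt_iff₀ (by positivity)]
    nlinarith
  have h2 : monom (fun h => ENNReal.ofReal a * u h) q = ENNReal.ofReal a ^ len q := by
    rw [monom_const_mul]
    have : monom u q = 1 := Finset.prod_eq_one fun h hh => by
      simp [hu, Finsupp.mem_support_iff.1 hh]
    rw [this, mul_one]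
  set b := ENNReal.ofReal (wt s k) * ENNReal.ofReal a ^ len q with hb
  have hb0 : b ≠ 0 := mul_ne_zero (ofReal_wt_pos s k).ne' (pow_ne_zero _ (ENNReal.ofReal_pos.2 ha0).ne')
  have hbt : b ≠ ⊤ := ENNReal.mul_ne_top ENNReal.ofReal_ne_top (ENNReal.pow_ne_top ENNReal.ofReal_ne_top)
  refine ⟨b⁻¹ * ENNReal.ofReal r, ENNReal.mul_ne_top (ENNReal.inv_ne_top.2 hb0) ENNReal.ofReal_ne_top,
    fun V => ?_⟩
  have h3 : b * ‖V k q‖ₑ ≤ ENNReal.ofReal r * vnorm s r V := by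
    refine le_trans ?_ (wNorm_maj_le hr V h1)
    refine le_trans ?_ (le_wNorm s _ k)
    rw [hb, mul_assoc]
    gcongr
    rw [← h2, mul_comm]
    exact ENNReal.le_tsum (f := fun q => ‖V k q‖ₑ * monom (fun h => ENNReal.ofReal a * u h) q) q
  calc ‖V k q‖ₑ = b⁻¹ * (b * ‖V k q‖ₑ) := by
        rw [← mul_assoc, ENNReal.inv_mul_cancel hb0 hbt, one_mul]
    _ ≤ b⁻¹ * (ENNReal.ofReal r * vnorm s r V) := by gcongr
    _ = _ := by rw [mul_assoc]

namespace IterData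

variable {τ C : ℝ} (H : IterData τ C)

/-- The displacement of the flow of the `n`-th step. -/
def disp (n : ℕ) : ℝ := H.rn n * H.fBound n

lemma disp_eq (n : ℕ) : H.disp n = H.ratio n * H.fBound n * H.rho n := by
  have := (H.rho_pos n).ne'
  rw [disp, ratio]; field_simp

lemma disp_small (n : ℕ) : 24 * H.disp n ≤ H.rho n := by
  have h := (H.inv n).gen_le_one
  have := H.rho_pos n
  rw [disp_eq]; nlinarith

lemma disp_le (n : ℕ) : H.disp n ≤ H.r' * (2 ^ (2 * n + 7))⁻¹ := by
  have h := (H.inv n).gen_mul_le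
  have hr := H.r_pos
  have hp : (0 : ℝ) < 2 ^ n := by positivity
  have e : (2 : ℝ) ^ (2 * n + 7) = 2 ^ n * 2 ^ n * 128 := by rw [pow_add, two_mul, pow_add]; norm_num
  rw [← div_eq_mul_inv, le_div_iff₀ (by positivity), e, disp_eq, rho_eq]
  calc H.ratio n * H.fBound n * (H.r' / 10 * (2 ^ n)⁻¹) * (2 ^ n * 2 ^ n * 128)
      = (H.ratio n * H.fBound n * 2 ^ n) * (H.r' * (128 / 10)) := by field_simp
    _ ≤ 1 / 10 ^ 6 * (H.r' * (128 / 10)) := by gcongr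
    _ ≤ H.r' := by linarith

/-- The flow of the `n`-th generating field. -/
lemma exists_flow (t : ℝ) (n : ℕ) : ∃ φ : ℝ → G t → G t, H.sn (n + 1) ≤ t →
    IsFlow (ev t (H.F n)) (H.rn n - 4 * H.rho n) (H.disp n) φ := by
  by_cases ht : H.sn (n + 1) ≤ t
  · obtain ⟨φ, hφ⟩ := ((H.inv n).boundF.flowHyp (H.rho_pos n) (H.rho_lt n) (H.disp_small n)
      ht).exists_isFlow
    exact ⟨φ, fun _ => hφ⟩
  -- For smaller t no flow is asserted and the value is a default. The family must nevertheless be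
  -- defined for all t.
  · exact ⟨fun _ => id, fun h => absurd h ht⟩

/-- A flow of the `n`-th generating field on `g_t`, for large enough `t`. -/
def flow (t : ℝ) (n : ℕ) : ℝ → G t → G t := (H.exists_flow t n).choose

lemma isFlow {t : ℝ} {n : ℕ} (ht : H.sn (n + 1) ≤ t) :
    IsFlow (ev t (H.F n)) (H.rn n - 4 * H.rho n) (H.disp n) (H.flow t n) :=
  (H.exists_flow t n).choose_spec ht

/-- The time-one flow of the `n`-th generating field. -/
def Phi (t : ℝ) (n : ℕ) : G t → G t := H.flow t n 1

section

variable {t : ℝ} {n : ℕ} (ht : H.sn (n + 1) ≤ t)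
include ht

lemma flowHyp : FlowHyp (ev t (H.F n)) (H.rn n - 4 * H.rho n) (H.rho n / 3) (H.disp n) :=
  (H.inv n).boundF.flowHyp (H.rho_pos n) (H.rho_lt n) (H.disp_small n) ht

lemma isTimeOneFlow_Phi :
    IsTimeOneFlow t (H.F n) (H.rn (n + 1)) (H.rn n - 3 * H.rho n) (H.Phi t n) :=
  (H.inv n).boundF.isTimeOneFlow (H.rho_pos n) (H.rho_lt n) (H.disp_small n) ht (H.isFlow ht)

lemma analyticOnNhd_Phi : AnalyticOnNhd ℂ (H.Phi t n) (Metric.closedBall 0 (H.rn (n + 1))) :=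
  (H.inv n).boundF.analyticOnNhd_flow (H.rho_pos n) (H.rho_lt n) (H.disp_small n) ht (H.isFlow ht)

omit ht in
lemma mem_ball_of_mem_closedBall {u : G t} (hu : u ∈ Metric.closedBall (0 : G t) (H.rn (n + 1))) :
    u ∈ Metric.ball (0 : G t) (H.rn n - 4 * H.rho n) :=
  Metric.closedBall_subset_ball (by rw [rn_succ]; linarith [H.rho_pos n]) hu

lemma norm_Phi_sub_le {u : G t} (hu : u ∈ Metric.closedBall (0 : G t) (H.rn (n + 1))) :
    ‖H.Phi t n u - u‖ ≤ H.disp n :=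
  (H.isFlow ht).near u (H.mem_ball_of_mem_closedBall hu) 1 (by simp)

lemma mapsTo_Phi : MapsTo (H.Phi t n) (Metric.closedBall 0 (H.rn (n + 1)))
    (Metric.closedBall 0 (H.rn n)) := by
  intro u hu
  have h1 := H.norm_Phi_sub_le ht hu
  have h2 : ‖H.Phi t n u‖ ≤ ‖H.Phi t n u - u‖ + ‖u‖ := by simpa using norm_add_le (H.Phi t n u - u) u
  rw [mem_closedBall_zero_iff] at hu ⊢
  rw [rn_succ] at hu
  linarith [H.disp_small n, H.rho_pos n]

lemma norm_Phi_sub_sub_le {u u' : G t} (hu : u ∈ Metric.closedBall (0 : G t) (H.rn (n + 1)))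
    (hu' : u' ∈ Metric.closedBall (0 : G t) (H.rn (n + 1))) :
    ‖(H.Phi t n u' - u') - (H.Phi t n u - u)‖ ≤ 1 / 400 * (2 ^ n)⁻¹ * ‖u' - u‖ := by
  refine ((H.flowHyp ht).norm_flow_sub_sub_le (H.isFlow ht) (H.mem_ball_of_mem_closedBall hu)
    (H.mem_ball_of_mem_closedBall hu')).trans ?_
  gcongr
  have h1 := (H.inv n).gen_mul_le
  have h2 := H.rho_pos n
  rw [disp_eq, ← div_eq_mul_inv, le_div_iff₀ (by positivity)]
  have e : 4 * (H.ratio n * H.fBound n * H.rho n) / (H.rho n / 3) * 2 ^ n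
      = 12 * (H.ratio n * H.fBound n * 2 ^ n) := by
    field_simp; ring
  rw [e]; linarith

end

/-! ### Compositions -/

section

variable {t : ℝ} {n : ℕ} (ht : H.sn n ≤ t)
include ht

lemma mapsTo_compMaps : MapsTo (compMaps (H.Phi t) n) (Metric.closedBall 0 (H.rn n))
    (Metric.closedBall 0 (H.rn 0)) := by
  induction n with
  | zero => exact mapsTo_id _
  | succ n ih => exact (ih ((H.sn_monotone n.le_succ).trans ht)).comp (H.mapsTo_Phi ht)

lemma analyticOnNhd_compMaps :
    AnalyticOnNhd ℂ (compMaps (H.Phi t) n) (Metric.closedBall 0 (H.rn n)) := by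
  induction n with
  | zero => exact analyticOnNhd_id
  | succ n ih =>
    exact (ih ((H.sn_monotone n.le_succ).trans ht)).comp (H.analyticOnNhd_Phi ht) (H.mapsTo_Phi ht)

/-- Lipschitz constants of displacements almost add under composition. The new map contributes
2^{-n}/400, which together with the cross term fits into the increment 2^{-n}/200 of the bound. -/
lemma norm_compMaps_sub_sub_le {u u' : G t} (hu : u ∈ Metric.closedBall (0 : G t) (H.rn n))
    (hu' : u' ∈ Metric.closedBall (0 : G t) (H.rn n)) :
    ‖(compMaps (H.Phi t) n u' - u') - (compMaps (H.Phi t) n u - u)‖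
      ≤ 1 / 100 * (1 - (2 ^ n)⁻¹) * ‖u' - u‖ := by
  induction n generalizing u u' with
  | zero => simp [compMaps]
  | succ n ih =>
    have h1 := ih ((H.sn_monotone n.le_succ).trans ht) (H.mapsTo_Phi ht hu) (H.mapsTo_Phi ht hu')
    have h2 := H.norm_Phi_sub_sub_le ht hu hu'
    set y := H.Phi t n u
    set y' := H.Phi t n u'
    have hp : (0 : ℝ) < (2 ^ n)⁻¹ := by positivity
    have hp1 : ((2 : ℝ) ^ n)⁻¹ ≤ 1 := inv_le_one_of_one_le₀ (one_le_pow₀ (by norm_num))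
    have h3 : ‖y' - y‖ ≤ ‖u' - u‖ + 1 / 400 * (2 ^ n)⁻¹ * ‖u' - u‖ := by
      have e : y' - y = (u' - u) + ((y' - u') - (y - u)) := by abel
      rw [e]
      exact (norm_add_le _ _).trans (by linarith)
    change ‖(compMaps (H.Phi t) n y' - u') - (compMaps (H.Phi t) n y - u)‖ ≤ _
    have e : (compMaps (H.Phi t) n y' - u') - (compMaps (H.Phi t) n y - u)
        = ((compMaps (H.Phi t) n y' - y') - (compMaps (H.Phi t) n y - y))
          + ((y' - u') - (y - u)) := by abel
    rw [e, pow_succ, mul_inv]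
    set x := ((2 : ℝ) ^ n)⁻¹
    set D := ‖u' - u‖ with hD
    have hD0 : 0 ≤ D := norm_nonneg _
    have h4 : 1 / 100 * (1 - x) * ‖y' - y‖ ≤ 1 / 100 * (1 - x) * (D + 1 / 400 * x * D) := by
      have : 0 ≤ 1 - x := by linarith
      gcongr
    refine (norm_add_le _ _).trans ((add_le_add (h1.trans h4) h2).trans ?_)
    nlinarith [mul_nonneg hp.le hD0, mul_nonneg (mul_nonneg hp.le hp.le) hD0]

lemma norm_compMaps_sub_le {u : G t} (hu : u ∈ Metric.closedBall (0 : G t) (H.rn n)) :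
    ‖compMaps (H.Phi t) n u - u‖ ≤ H.r' / 4 * (1 - (2 ^ n)⁻¹) := by
  induction n generalizing u with
  | zero => simp [compMaps]
  | succ n ih =>
    have h1 := ih ((H.sn_monotone n.le_succ).trans ht) (H.mapsTo_Phi ht hu)
    have h2 := H.norm_Phi_sub_le ht hu
    have h3 := H.disp_le n
    have e : compMaps (H.Phi t) (n + 1) u - u
        = (compMaps (H.Phi t) n (H.Phi t n u) - H.Phi t n u) + (H.Phi t n u - u) := by
      rw [sub_add_sub_cancel]; rfl
    rw [e]
    refine (norm_add_le _ _).trans ((add_le_add h1 (h2.trans h3)).trans ?_)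
    have hr := H.r_pos
    have hp1 : ((2 : ℝ) ^ n)⁻¹ ≤ 1 := inv_le_one_of_one_le₀ (one_le_pow₀ (by norm_num))
    have hp : (0 : ℝ) < (2 ^ n)⁻¹ := by positivity
    have e2 : ((2 : ℝ) ^ (2 * n + 7))⁻¹ = (2 ^ n)⁻¹ * (2 ^ n)⁻¹ / 128 := by
      rw [pow_add, two_mul, pow_add, mul_inv, mul_inv]; norm_num; ring
    rw [e2, pow_succ, mul_inv]
    set x := ((2 : ℝ) ^ n)⁻¹
    have h5 : x * x ≤ x * 1 := by gcongr
    have h6 : H.r' * (x * x) ≤ H.r' * (x * 1) := by gcongr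
    have h7 : 0 < H.r' * x := by positivity
    nlinarith

-- Ψ_{n+1} - Ψ_n at u is the variation of Ψ_n - id between u and Φ_n(u), plus the displacement
-- Φ_n(u) - u. Both are controlled by that displacement.
omit ht in
lemma norm_compMaps_succ_sub_le (ht : H.sn (n + 1) ≤ t) {u : G t}
    (hu : u ∈ Metric.closedBall (0 : G t) (H.rn (n + 1))) :
    ‖compMaps (H.Phi t) (n + 1) u - compMaps (H.Phi t) n u‖ ≤ H.r' * (4 / 2 ^ (2 * (n + 1))) := by
  have ht' := (H.sn_monotone n.le_succ).trans ht
  have h0 : u ∈ Metric.closedBall (0 : G t) (H.rn n) :=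
    Metric.closedBall_subset_closedBall (H.rn_antitone n.le_succ) hu
  have h1 := H.norm_compMaps_sub_sub_le ht' h0 (H.mapsTo_Phi ht hu)
  have h2 := (H.norm_Phi_sub_le ht hu).trans (H.disp_le n)
  have hp : (0 : ℝ) < (2 ^ n)⁻¹ := by positivity
  have hr := H.r_pos
  set y := H.Phi t n u
  have e : compMaps (H.Phi t) (n + 1) u - compMaps (H.Phi t) n u
      = ((compMaps (H.Phi t) n y - y) - (compMaps (H.Phi t) n u - u)) + (y - u) := by
    change compMaps (H.Phi t) n y - _ = _
    abel
  have h3 : 1 / 100 * (1 - ((2 : ℝ) ^ n)⁻¹) * ‖y - u‖ ≤ 1 * ‖y - u‖ := by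
    gcongr; linarith
  rw [e]
  refine (norm_add_le _ _).trans ?_
  have h4 : H.r' * (2 ^ (2 * n + 7))⁻¹ * 2 ≤ H.r' * (4 / 2 ^ (2 * (n + 1))) := by
    rw [mul_assoc]
    refine mul_le_mul_of_nonneg_left ?_ hr.le
    rw [mul_add, pow_add, pow_add]
    have : (0 : ℝ) < 2 ^ (2 * n) := by positivity
    field_simp; norm_num
  linarith

end

/-! ### Conjugation by one flow and by the compositions -/

/-- The `n`-th field. -/
def W (n : ℕ) : VF := diagVF H.lam + H.Z + H.X n + H.N n

lemma W_succ (n : ℕ) : H.W (n + 1) = expLie (H.F n) (H.W n) :=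
  (H.inv n).step.expLie_eq H.freq H.degree

lemma W_eq (n : ℕ) : H.W n = diagVF H.lam + (H.Z + H.X n + H.N n) := by
  rw [W]; abel

lemma exists_bound (n : ℕ) : ∃ p, VBound (H.sn n) (H.rn n) (H.Z + H.X n + H.N n) p :=
  ⟨_, (((VBound.of_memV (H.memZ_n n)).add (H.rn_pos n) (VBound.of_memV (H.inv n).memX)).add
    (H.rn_pos n) (VBound.of_memV (H.inv n).memN))⟩

/-- The strict inequality provides the gap in s in which D(λ) is bounded. -/
lemma fderiv_Phi_apply {t : ℝ} {n : ℕ} (ht : H.sn (n + 1) < t) {x v : G t}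
    (hx : x ∈ Metric.closedBall (0 : G t) (H.rn (n + 1))) (hv : ∀ k, v.1 k = eval (H.W (n + 1)) x.1 k)
    (k : Idx) : (fderiv ℂ (H.Phi t n) x v).1 k = eval (H.W n) (H.Phi t n x).1 k := by
  have I := H.inv n
  obtain ⟨p, hp⟩ := H.exists_bound n
  have hp' := hp.mono (H.sn_monotone n.le_succ)
    (by linarith [H.rho_lt n, H.rho_pos n] : 0 < H.rn n - 3 * H.rho n)
    (by linarith [H.rho_pos n]) le_rfl
  have hκ := I.rate_le
  have hκ0 : 0 ≤ 4 * Real.exp 1 * (H.rn n / H.rho n) * H.fBound n :=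
    mul_nonneg (mul_nonneg (by positivity) (H.ratio_nonneg n)) (H.fBound_nonneg n)
  have e : diagVF H.lam + H.Z + H.X n + H.N n = diagVF H.lam + (H.Z + H.X n + H.N n) := H.W_eq n
  have hit := I.step.boundIter H.freq H.degree (H.rho_pos n) (H.rho_lt n) I.boundF I.boundW' I.boundX'
  have htail := I.step.boundTail H.freq H.degree (H.rho_pos n) (H.rho_lt n) I.boundF I.boundW'
    I.boundX' hκ
  have hB := (I.step.orderB H.freq H.degree).mono H.one_le_d
  rw [e] at hit htail hB
  rw [W_succ, W_eq] at hv
  rw [W_eq]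
  exact I.boundF.fderiv_flow_apply (H.rho_pos n) (H.rho_lt n) (H.disp_small n) ht (H.isFlow ht.le)
    H.freq.norm_lam_le (I.step.orderF.mono H.one_le_d) hp' hB hκ0 (hκ.trans_lt (by norm_num)) hit
    htail (by rwa [mem_closedBall_zero_iff] at hx) hv k

/-- The vector DΦ_n(x)v lies in g_t and has the coordinates of W_n at Φ_n(x), so it is an admissible
vector for the induction hypothesis. -/
lemma fderiv_compMaps_apply {t : ℝ} {n : ℕ} (ht : H.sn n < t) {x v : G t}
    (hx : x ∈ Metric.closedBall (0 : G t) (H.rn n)) (hv : ∀ k, v.1 k = eval (H.W n) x.1 k) (k : Idx) :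
    (fderiv ℂ (compMaps (H.Phi t) n) x v).1 k = eval (H.W 0) (compMaps (H.Phi t) n x).1 k := by
  induction n generalizing x v with
  | zero =>
    simp only [compMaps]
    rw [fderiv_id]
    exact hv k
  | succ n ih =>
    have ht' := (H.sn_monotone n.le_succ).trans_lt ht
    have h1 := H.mapsTo_Phi ht.le hx
    have h2 := H.fderiv_Phi_apply ht hx hv
    have h3 := ih ht' h1 h2
    simp only [compMaps]
    rw [fderiv_comp x (H.analyticOnNhd_compMaps ht'.le _ h1).differentiableAt
      (H.analyticOnNhd_Phi ht.le _ hx).differentiableAt]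
    exact h3

/-! ### The limit -/

lemma closedBall_subset (n : ℕ) {t : ℝ} :
    Metric.closedBall (0 : G t) H.r' ⊆ Metric.closedBall 0 (H.rn n) :=
  Metric.closedBall_subset_closedBall (H.r_lt_rn n).le

lemma dist_compMaps_le {u : G H.s'} (hu : u ∈ Metric.closedBall (0 : G H.s') H.r') (n : ℕ) :
    dist (compMaps (H.Phi H.s') n u) (compMaps (H.Phi H.s') (n + 1) u) ≤ H.r' * (1 / 4) ^ n := by
  rw [dist_eq_norm, norm_sub_rev]
  refine (H.norm_compMaps_succ_sub_le (H.sn_lt _).le (H.closedBall_subset _ hu)).trans (le_of_eq ?_)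
  have e : (2 : ℝ) ^ (2 * (n + 1)) = 4 ^ n * 4 := by
    rw [pow_mul, pow_succ]; norm_num
  rw [e, one_div, inv_pow]
  field_simp

lemma exists_limit : ∃ Ψ : G H.s' → G H.s', ∀ u ∈ Metric.closedBall (0 : G H.s') H.r',
    ∀ n, dist (compMaps (H.Phi H.s') n u) (Ψ u) ≤ H.r' * (1 / 4) ^ n / (1 - 1 / 4) := by
  have : ∀ u : G H.s', ∃ y, u ∈ Metric.closedBall (0 : G H.s') H.r' → 
      ∀ n, dist (compMaps (H.Phi H.s') n u) y ≤ H.r' * (1 / 4) ^ n / (1 - 1 / 4) := by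
    intro u
    by_cases hu : u ∈ Metric.closedBall (0 : G H.s') H.r'
    · obtain ⟨y, hy⟩ := cauchySeq_tendsto_of_complete
        (cauchySeq_of_le_geometric (1 / 4) H.r' (by norm_num) (H.dist_compMaps_le hu))
      exact ⟨y, fun _ => dist_le_of_le_geometric_of_tendsto (1 / 4) H.r' (by norm_num)
        (H.dist_compMaps_le hu) hy⟩
    · exact ⟨0, fun h => absurd h hu⟩
  choose Ψ hΨ using this
  exact ⟨Ψ, fun u hu => hΨ u hu⟩

/-- The limit of the compositions. -/
def Psi : G H.s' → G H.s' := H.exists_limit.choose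

lemma dist_compMaps_Psi_le {u : G H.s'} (hu : u ∈ Metric.closedBall (0 : G H.s') H.r') (n : ℕ) :
    dist (compMaps (H.Phi H.s') n u) (H.Psi u) ≤ H.r' * (1 / 4) ^ n / (1 - 1 / 4) :=
  H.exists_limit.choose_spec u hu n

lemma tendstoUniformlyOn_Psi :
    TendstoUniformlyOn (compMaps (H.Phi H.s')) H.Psi atTop (Metric.closedBall 0 H.r') := by
  have h : Tendsto (fun n : ℕ => H.r' * (1 / 4 : ℝ) ^ n / (1 - 1 / 4)) atTop (𝓝 0) := by
    simpa using ((tendsto_pow_atTop_nhds_zero_of_lt_one (by norm_num : (0 : ℝ) ≤ 1 / 4)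
      (by norm_num)).const_mul H.r').div_const (1 - 1 / 4)
  refine Metric.tendstoUniformlyOn_iff.2 fun ε hε => ?_
  filter_upwards [h.eventually (gt_mem_nhds hε)] with n hn u hu
  rw [dist_comm]
  exact (H.dist_compMaps_Psi_le hu n).trans_lt hn

lemma tendsto_Psi {u : G H.s'} (hu : u ∈ Metric.closedBall (0 : G H.s') H.r') :
    Tendsto (fun n => compMaps (H.Phi H.s') n u) atTop (𝓝 (H.Psi u)) :=
  H.tendstoUniformlyOn_Psi.tendsto_at hu

lemma norm_Psi_sub_le {u : G H.s'} (hu : u ∈ Metric.closedBall (0 : G H.s') H.r') :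
    ‖H.Psi u - u‖ ≤ H.r' / 4 := by
  refine le_of_tendsto ((H.tendsto_Psi hu).sub_const u).norm (Eventually.of_forall fun n => ?_)
  have hr := H.r_pos
  have hp : (0 : ℝ) < (2 ^ n)⁻¹ := by positivity
  refine (H.norm_compMaps_sub_le (H.sn_lt n).le (H.closedBall_subset n hu)).trans ?_
  nlinarith

lemma norm_Psi_lt {u : G H.s'} (hu : u ∈ Metric.closedBall (0 : G H.s') H.r') :
    ‖H.Psi u‖ < 2 * H.r' := by
  have h1 := H.norm_Psi_sub_le hu
  have h2 : ‖H.Psi u‖ ≤ ‖H.Psi u - u‖ + ‖u‖ := by simpa using norm_add_le (H.Psi u - u) u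
  rw [mem_closedBall_zero_iff] at hu
  linarith [H.r_pos]

lemma norm_Psi_sub_sub_le {u u' : G H.s'} (hu : u ∈ Metric.closedBall (0 : G H.s') H.r')
    (hu' : u' ∈ Metric.closedBall (0 : G H.s') H.r') :
    ‖(H.Psi u' - u') - (H.Psi u - u)‖ ≤ 1 / 100 * ‖u' - u‖ := by
  refine le_of_tendsto (((H.tendsto_Psi hu').sub_const u').sub ((H.tendsto_Psi hu).sub_const u)).norm
    (Eventually.of_forall fun n => ?_)
  have hp : (0 : ℝ) < (2 ^ n)⁻¹ := by positivity
  refine (H.norm_compMaps_sub_sub_le (H.sn_lt n).le (H.closedBall_subset n hu)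
    (H.closedBall_subset n hu')).trans ?_
  gcongr
  linarith

lemma injOn_Psi : InjOn H.Psi (Metric.closedBall 0 H.r') := by
  intro u hu u' hu' he
  have h := H.norm_Psi_sub_sub_le hu hu'
  rw [he] at h
  have e : H.Psi u' - u' - (H.Psi u' - u) = -(u' - u) := by abel
  rw [e, norm_neg] at h
  have h2 : ‖u' - u‖ ≤ 0 := by linarith
  exact (sub_eq_zero.1 (norm_le_zero_iff.1 h2)).symm

lemma Psi_limit : DifferentiableOn ℂ H.Psi (Metric.ball 0 H.r') ∧
    ∀ x ∈ Metric.ball (0 : G H.s') H.r', Tendsto (fun n => fderiv ℂ (compMaps (H.Phi H.s') n) x)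
      atTop (𝓝 (fderiv ℂ H.Psi x)) :=
  differentiableOn_of_tendstoUniformlyOn Metric.isOpen_ball
    (fun n => (H.analyticOnNhd_compMaps (H.sn_lt n).le).differentiableOn.mono
      (Metric.ball_subset_closedBall.trans (H.closedBall_subset n)))
    (H.tendstoUniformlyOn_Psi.mono Metric.ball_subset_closedBall)

lemma analyticOnNhd_Psi : AnalyticOnNhd ℂ H.Psi (Metric.ball 0 H.r') :=
  analyticOnNhd_of_differentiableOn Metric.isOpen_ball H.Psi_limit.1

/-- The Lipschitz bound for Ψ - id gives ‖DΨ(x) - 1‖ ≤ 1/100, and the Neumann series inverts DΨ(x).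
-/
lemma isInvertible_fderiv_Psi {x : G H.s'} (hx : x ∈ Metric.ball (0 : G H.s') H.r') :
    (fderiv ℂ H.Psi x).IsInvertible := by
  have hd : HasFDerivAt (fun u => H.Psi u - u)
      (fderiv ℂ H.Psi x - ContinuousLinearMap.id ℂ (G H.s')) x :=
    ((H.Psi_limit.1 x hx).differentiableAt (Metric.isOpen_ball.mem_nhds hx)).hasFDerivAt.sub
      (hasFDerivAt_id x)
  have h1 : ‖fderiv ℂ H.Psi x - ContinuousLinearMap.id ℂ (G H.s')‖ ≤ 1 / 100 := by
    refine hd.le_of_lip' (by norm_num) ?_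
    filter_upwards [Metric.isOpen_ball.mem_nhds hx] with u hu
    exact H.norm_Psi_sub_sub_le (Metric.ball_subset_closedBall hx) (Metric.ball_subset_closedBall hu)
  have h2 : ‖(1 : G H.s' →L[ℂ] G H.s') - fderiv ℂ H.Psi x‖ < 1 := by
    rw [norm_sub_rev]; exact lt_of_le_of_lt h1 (by norm_num)
  refine ⟨ContinuousLinearEquiv.ofUnit (Units.oneSub _ h2), ?_⟩
  ext1 v
  change ((1 : G H.s' →L[ℂ] G H.s') - (1 - fderiv ℂ H.Psi x)) v = _
  rw [sub_sub_cancel]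

/-! ### The limit vector field -/

/-- The increment of the part in `ℐ^{(2)}`. -/
def dN (n : ℕ) : VF := stepN H.lam H.Z (H.N n) (H.X n) (H.F n)

lemma dN_bound (n : ℕ) : VBound H.s' H.r' (H.dN n) (H.γ * (H.Θ₀ / 4) * (1 / 2) ^ n) := by
  refine ((H.inv n).boundN_succ.mono (H.sn_lt _).le H.r_pos (H.r_lt_rn _).le le_rfl).weaken ?_
  have h := (H.inv n).stepN_le
  have := H.γ_pos
  calc _ ≤ H.γ * (H.Θ₀ / 4 * (2 ^ n)⁻¹) := by gcongr
    _ = H.γ * (H.Θ₀ / 4) * (1 / 2) ^ n := by rw [one_div, inv_pow, mul_assoc]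

/-- The remainder `N_∞ - N_n`. -/
def tailN (n : ℕ) : VF := fun k q => ∑' m, H.dN (m + n) k q

lemma summable_dN (k : Idx) (q : MIdx) : Summable fun m => H.dN m k q := by
  obtain ⟨c, hc, h⟩ := exists_enorm_coeff_le H.s' H.r_pos k q
  refine summable_of_tsum_enorm_ne_top (ne_top_of_le_ne_top ?_
    (ENNReal.tsum_le_tsum fun m => (h (H.dN m)).trans (mul_le_mul' le_rfl (H.dN_bound m).le)))
  rw [ENNReal.tsum_mul_left]
  refine ENNReal.mul_ne_top hc ?_
  rw [← ENNReal.ofReal_tsum_of_nonneg (fun n => (H.dN_bound n).nonneg)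
    ((summable_geometric_two).mul_left _)]
  exact ENNReal.ofReal_ne_top

lemma tailN_bound (n : ℕ) :
    VBound H.s' H.r' (H.tailN n) (H.γ * (H.Θ₀ / 4) * (1 / 2) ^ n * 2) := by
  have hT := H.Θ₀_nonneg
  have hγ := H.γ_pos
  refine ⟨fun k => ?_, fun k q hq => ?_, by positivity, ?_⟩
  · exact (tsum_congr fun m => (H.dN_bound _).zero_at_origin k).trans tsum_zero
  · exact (tsum_congr fun m => (H.dN_bound _).mom k q hq).trans tsum_zero
  · refine (vnorm_tsum_le H.r_pos (W := fun m => H.dN (m + n)) fun k q =>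
      enorm_tsum_le_tsum_enorm).trans ?_
    refine (ENNReal.tsum_le_tsum fun m => (H.dN_bound (m + n)).le).trans ?_
    have h := hasSum_geometric_two.mul_left (H.γ * (H.Θ₀ / 4) * (1 / 2) ^ n)
    have e : ∀ m : ℕ, H.γ * (H.Θ₀ / 4) * (1 / 2) ^ (m + n)
        = H.γ * (H.Θ₀ / 4) * (1 / 2) ^ n * (1 / 2) ^ m := fun m => by rw [pow_add]; ring
    simp only [e]
    rw [← ENNReal.ofReal_tsum_of_nonneg (fun m => by positivity) h.summable, h.tsum_eq]

/-- The limit of the parts in `ℐ^{(2)}`. -/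
def Ninf : VF := H.N₀ + H.tailN 0

lemma Ninf_eq (n : ℕ) : H.Ninf = H.N n + H.tailN n := by
  induction n with
  | zero => rfl
  | succ n ih =>
    rw [ih, N_succ]
    funext k q
    have h := (summable_nat_add_iff n).2 (H.summable_dN k q)
    simp only [Pi.add_apply, tailN]
    rw [h.tsum_eq_zero_add, zero_add, add_assoc]
    congr 2
    exact tsum_congr fun m => by rw [show m + 1 + n = m + (n + 1) by ring]

lemma memV_X (n : ℕ) : VBound H.s' H.r' (H.X n) (H.γ * (3 * H.eps n)) :=
  (H.inv n).boundX.mono (H.sn_lt n).le H.r_pos (H.r_lt_rn n).le le_rfl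

lemma eps_le_pow (n : ℕ) : H.eps n ≤ H.ε₀ * (1 / 2) ^ n := by
  induction n with
  | zero => simp [H.eps_zero]
  | succ n ih =>
    have h1 := (H.inv n).eps_succ_le
    have h2 := (H.inv n).xBound_mul_le
    have h3 := H.eps_nonneg (n + 1)
    have hp : (1 : ℝ) ≤ 2 ^ n := one_le_pow₀ (by norm_num)
    have h4 := H.eps_nonneg n
    have h5 : H.xBound n ≤ H.xBound n * 2 ^ n := le_mul_of_one_le_right (h3.trans h1) hp
    rw [pow_succ]
    linarith

lemma tendsto_eps : Tendsto H.eps atTop (𝓝 0) := by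
  refine squeeze_zero H.eps_nonneg H.eps_le_pow ?_
  simpa using (tendsto_pow_atTop_nhds_zero_of_lt_one (by norm_num : (0 : ℝ) ≤ 1 / 2)
      (by norm_num)).const_mul H.ε₀

lemma tendsto_tail : Tendsto (fun n : ℕ => H.γ * (H.Θ₀ / 4) * (1 / 2 : ℝ) ^ n * 2) atTop (𝓝 0) := by
  simpa using ((tendsto_pow_atTop_nhds_zero_of_lt_one (by norm_num : (0 : ℝ) ≤ 1 / 2)
      (by norm_num)).const_mul (H.γ * (H.Θ₀ / 4))).mul_const 2

lemma tendsto_vnorm_of_bound {s r : ℝ} {V : ℕ → VF} {a : ℕ → ℝ} (h : ∀ n, VBound s r (V n) (a n))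
    (ha : Tendsto a atTop (𝓝 0)) : Tendsto (fun n => vnorm s r (V n)) atTop (𝓝 0) := by
  refine tendsto_of_tendsto_of_tendsto_of_le_of_le tendsto_const_nhds ?_ (fun _ => zero_le)
    fun n => (h n).le
  simpa using ENNReal.tendsto_ofReal ha

lemma tendsto_X : Tendsto (fun n => vnorm H.s' H.r' (H.X n)) atTop (𝓝 0) :=
  tendsto_vnorm_of_bound H.memV_X (by simpa using (H.tendsto_eps.const_mul 3).const_mul H.γ)

lemma N_sub_Ninf (n : ℕ) : H.N n - H.Ninf = -H.tailN n := by rw [H.Ninf_eq n]; abel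

lemma tendsto_N : Tendsto (fun n => vnorm H.s' H.r' (H.N n - H.Ninf)) atTop (𝓝 0) :=
  tendsto_vnorm_of_bound (fun n => by rw [N_sub_Ninf]; exact (H.tailN_bound n).neg) H.tendsto_tail

lemma orderN_inf : OrderGE H.d H.Ninf :=
  H.orderN₀.add fun k q hq => (tsum_congr fun _ =>
    (H.inv _).step.orderN' H.freq H.degree k q hq).trans tsum_zero

lemma suppN_inf : SupportedIn (J2 H.lam) H.Ninf :=
  H.suppN₀.add fun k q hq => (tsum_congr fun _ => supportedIn_proj _ _ k q hq).trans tsum_zero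

lemma memN_inf : MemV H.s' H.r' H.Ninf :=
  ((VBound.of_memV (H.memN₀.mono H.lt.le H.r_pos (by linarith [H.r_pos]))).add H.r_pos
    (H.tailN_bound 0)).memV

lemma maj_diagVF_ne_top (lam : Idx → ℂ) (x : Idx → ℂ) (k : Idx) :
    maj (diagVF lam) (fun h => ‖x h‖ₑ) k ≠ ⊤ := by
  rw [maj, tsum_eq_single (unitIdx k)]
  · rw [monom_single]
    exact ENNReal.mul_ne_top enorm_ne_top enorm_ne_top
  · intro q hq
    rw [diagVF, Pi.single_eq_of_ne hq, enorm_zero, zero_mul]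

/-- In W_n(x) - W_∞(x) = (X_n - (N_∞ - N_n))(x) the unbounded part has cancelled, so W_n(x) lies in
g_{s'} and converges there to v. On the left DΨ_n(x) converges in operator norm. On the right the
limit is taken coordinate by coordinate, where even D(λ) is continuous. -/
lemma intertwines_Psi {x : G H.s'} (hx : x ∈ Metric.ball (0 : G H.s') H.r') {v : G H.s'}
    (hv : ∀ k, v.1 k = eval (diagVF H.lam + H.Z + H.Ninf) x.1 k) (k : Idx) :
    (fderiv ℂ H.Psi x v).1 k = eval (H.W 0) (H.Psi x).1 k := by
  have hr := H.r_pos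
  have hxc := Metric.ball_subset_closedBall hx
  have hxn : ‖x‖ < H.r' := mem_ball_zero_iff.1 hx
  -- the values of the approximating fields
  set vn : ℕ → G H.s' := fun n => v + ev H.s' (H.X n - H.tailN n) x with hvn
  have hE : ∀ n, VBound H.s' H.r' (H.X n - H.tailN n)
      (H.γ * (3 * H.eps n) + H.γ * (H.Θ₀ / 4) * (1 / 2) ^ n * 2) := fun n =>
    (H.memV_X n).sub hr (H.tailN_bound n)
  have hZ := VBound.of_memV (H.memZ.mono H.lt.le hr (by linarith))
  have hfin := hZ.add hr (VBound.of_memV H.memN_inf)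
  have hvnv : ∀ n k, (vn n).1 k = eval (H.W n) x.1 k := by
    intro n k
    have e : H.W n = (diagVF H.lam + H.Z + H.Ninf) + (H.X n - H.tailN n) := by
      rw [W, H.Ninf_eq n]; abel
    have h1 : maj (diagVF H.lam + H.Z + H.Ninf) (fun h => ‖x.1 h‖ₑ) k ≠ ⊤ := by
      rw [add_assoc]
      exact ne_top_of_le_ne_top (ENNReal.add_ne_top.2 ⟨maj_diagVF_ne_top _ _ _,
        hfin.maj_ne_top hr hxn k⟩) (maj_add_le _ _ _ _)
    rw [e, eval_add h1 ((hE n).maj_ne_top hr hxn k), hvn, ← hv k, ← (hE n).ev_val hr hxn]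
    rfl
  have hvlim : Tendsto vn atTop (𝓝 v) := by
    have h1 : Tendsto (fun n => ev H.s' (H.X n - H.tailN n) x) atTop (𝓝 0) := by
      refine squeeze_zero_norm (fun n => (hE n).norm_ev_le hr hxn) ?_
      have := ((H.tendsto_eps.const_mul 3).const_mul H.γ).add H.tendsto_tail
      simpa using this.const_mul H.r'
    simpa using h1.const_add v
  obtain ⟨L, hL⟩ := exists_coord H.s' k
  have hlim1 : Tendsto (fun n => (fderiv ℂ (compMaps (H.Phi H.s') n) x (vn n)).1 k) atTop
      (𝓝 ((fderiv ℂ H.Psi x v).1 k)) := by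
    have h1 : Tendsto (fun n => fderiv ℂ (compMaps (H.Phi H.s') n) x (vn n)) atTop
        (𝓝 (fderiv ℂ H.Psi x v)) :=
      (isBoundedBilinearMap_apply.continuous.tendsto (fderiv ℂ H.Psi x, v)).comp
        ((H.Psi_limit.2 x hx).prodMk_nhds hvlim)
    have h2 := (L.continuous.tendsto _).comp h1
    rw [hL] at h2
    exact h2.congr fun n => hL _
  -- continuity of the initial field
  obtain ⟨p, hp⟩ := H.exists_bound 0
  have hp' : VBound H.s' (2 * H.r') (H.Z + H.X 0 + H.N 0) p :=
    hp.mono H.lt.le (by linarith) le_rfl le_rfl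
  have h2r : 0 < 2 * H.r' := by linarith
  have hval : ∀ y : G H.s', ‖y‖ < 2 * H.r' → eval (H.W 0) y.1 k
      = H.lam k * L y + L (ev H.s' (H.Z + H.X 0 + H.N 0) y) := by
    intro y hy
    rw [W_eq, eval_add (maj_diagVF_ne_top _ _ _) (hp'.maj_ne_top h2r hy k), eval_diagVF, hL, hL,
      hp'.ev_val h2r hy]
  have hΨ := H.norm_Psi_lt hxc
  have hcont : Tendsto (fun n => H.lam k * L (compMaps (H.Phi H.s') n x)
      + L (ev H.s' (H.Z + H.X 0 + H.N 0) (compMaps (H.Phi H.s') n x))) atTop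
      (𝓝 (H.lam k * L (H.Psi x) + L (ev H.s' (H.Z + H.X 0 + H.N 0) (H.Psi x)))) := by
    have h1 := H.tendsto_Psi hxc
    exact (((L.continuous.tendsto _).comp h1).const_mul _).add ((L.continuous.tendsto _).comp
      ((hp'.differentiableAt_ev h2r hΨ).continuousAt.tendsto.comp h1))
  rw [hval _ hΨ]
  refine tendsto_nhds_unique hlim1 (hcont.congr' ?_)
  filter_upwards [(H.tendsto_Psi hxc).norm.eventually (gt_mem_nhds hΨ)] with n hn
  rw [← hval _ hn, H.fderiv_compMaps_apply (H.sn_lt n) (H.closedBall_subset n hxc) (hvnv n) k]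

end IterData

end

end ResonantKAM

open scoped ENNReal Topology
open Filter Set

/-! ## The theorem -/

namespace ResonantKAM

/-- The solution `invL lam Y` of the homological equation. -/
lemma exists_homological {A c γ s r δ : ℝ} {lam : Idx → ℂ} (hr : 0 < r) (hδ : 0 < δ) (hA : 0 ≤ A)
    (hγ : 0 < γ) (hc : 1 ≤ c)
    (hdiv : ∀ (k : Idx) (q : MIdx), q ≠ 0 → momDot q = mom k → dot lam q ≠ lam k →
      Real.exp (-(δ * (sjSum q - sj k))) ≤ A * Real.exp (1 / δ ^ 6) * γ⁻¹ * ‖dot lam q - lam k‖)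
    {Y : VF} (hY : MemR lam s r Y) :
    ∃ X : VF, MemR lam (s + δ) r X ∧ bracket (diagVF lam) X = Y ∧
      vnorm (s + δ) r X ≤ ENNReal.ofReal (A * Real.exp (c / δ ^ 6) * γ⁻¹) * vnorm s r Y := by
  have h1 : vnorm (s + δ) r (invL lam Y)
      ≤ ENNReal.ofReal (A * Real.exp (c / δ ^ 6) * γ⁻¹) * vnorm s r Y := by
    refine (vnorm_invL_le hr hdiv hY.1).trans (mul_le_mul' (ENNReal.ofReal_le_ofReal ?_) le_rfl)
    gcongr
  refine ⟨invL lam Y, ⟨⟨fun k => ?_, fun k q h => ?_, h1.trans_lt ?_⟩, fun k q h => ?_⟩,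
    bracket_diag_invL lam hY.1.momentum hY.2, h1⟩
  · simp [invL, hY.1.zero_at_origin]
  · simp [invL, hY.1.momentum k q h]
  · exact ENNReal.mul_lt_top ENNReal.ofReal_lt_top hY.1.norm_lt_top
  · simp [invL, hY.2 k q h]

end ResonantKAM

open ResonantKAM

theorem lemma4p5 (τ C : ℝ) (hτ : 0 < τ) (hC : 0 < C) :
    ∃ c : ℝ, 0 < c ∧ IsHomologicalConst τ C c ∧
    ∃ K₀ : ℝ, 1 < K₀ ∧
    ∀ (γ : ℝ) (lam : Idx → ℂ), 0 < γ → FreqAssumptions τ C γ lam →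
    ∀ d : ℕ, leastDegree lam ≤ d →
    ∀ s s' r' : ℝ, 0 < s → s < s' → 0 < r' →
    ∀ Z X₀ N₀ : VF,
    -- the diagonal resonant part, of degrees between `1` and `d - 1`
    MemV s (2 * r') Z → IsDiagResonant lam Z → OrderGE 1 Z → (∀ k q, d + 1 ≤ len q → Z k q = 0) →
    -- the perturbation, and the part in `ℐ^{(2)}`
    MemV s (2 * r') X₀ → OrderGE d X₀ → SupportedIn (J2 lam)ᶜ X₀ →
    MemV s (2 * r') N₀ → OrderGE d N₀ → SupportedIn (J2 lam) N₀ →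
    ∀ ε₀ Θ₀ : ℝ,
    ε₀ = γ⁻¹ * (splitNorm lam s (2 * r') X₀).toReal →
    Θ₀ = γ⁻¹ * ((splitNorm lam s (2 * r') Z).toReal + (splitNorm lam s (2 * r') N₀).toReal) + ε₀ →
    -- the smallness condition
    ε₀ ≤ ((1 + Θ₀) ^ 7)⁻¹ * (K₀ * supConst c (s' - s))⁻¹ →
    ∃ (F X N : ℕ → VF) (Φ : (t : ℝ) → ℕ → G t → G t) (ε Θ : ℕ → ℝ),
      X 0 = X₀ ∧ N 0 = N₀ ∧
      -- the generating vector fields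
      (∀ i, MemV (sSeq s s' (i + 1)) (rSeq r' i - 3 * rhoSeq r' i) (F i) ∧ OrderGE d (F i) ∧
        SupportedIn (J2 lam)ᶜ (F i)) ∧
      -- their time-one flows
      (∀ i, ∀ t, sSeq s s' (i + 1) ≤ t →
        IsTimeOneFlow t (F i) (rSeq r' (i + 1)) (rSeq r' i - 3 * rhoSeq r' i) (Φ t i) ∧
        AnalyticOnNhd ℂ (Φ t i) (Metric.closedBall 0 (rSeq r' (i + 1))) ∧
        ∀ u ∈ Metric.closedBall (0 : G t) (rSeq r' (i + 1)),
          ‖Φ t i u - u‖ ≤ r' * (2 ^ (2 * i + 7))⁻¹) ∧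
      -- the compositions `Ψ_n` of these flows
      (∀ n, 1 ≤ n → ∀ t, sSeq s s' n ≤ t →
        MapsTo (compMaps (Φ t) n) (Metric.closedBall 0 (rSeq r' n))
          (Metric.closedBall 0 (rSeq r' 0)) ∧
        AnalyticOnNhd ℂ (compMaps (Φ t) n) (Metric.closedBall 0 (rSeq r' n)) ∧
        ∀ u ∈ Metric.closedBall (0 : G t) (rSeq r' n),
          ‖compMaps (Φ t) n u - compMaps (Φ t) (n - 1) u‖ ≤ r' * (4 / 2 ^ (2 * n))) ∧
      -- the transformed vector fields `W_i = D(λ) + Z + X_i + N_i`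
      (∀ i, diagVF lam + Z + X (i + 1) + N (i + 1)
        = expLie (F i) (diagVF lam + Z + X i + N i)) ∧
      (∀ i, MemV (sSeq s s' i) (rSeq r' i) (X i) ∧ OrderGE d (X i) ∧
        SupportedIn (J2 lam)ᶜ (X i)) ∧
      (∀ i, MemV (sSeq s s' i) (rSeq r' i) (N i) ∧ OrderGE d (N i) ∧
        SupportedIn (J2 lam) (N i)) ∧
      (∀ i, ε i = γ⁻¹ * (splitNorm lam (sSeq s s' i) (rSeq r' i) (X i)).toReal) ∧
      (∀ i, Θ i = γ⁻¹ * ((splitNorm lam (sSeq s s' i) (rSeq r' i) Z).toReal +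
        (splitNorm lam (sSeq s s' i) (rSeq r' i) (N i)).toReal) + ε i) ∧
      (∀ i, ε i ≤ ε₀ * Real.exp (-(3 / 2 : ℝ) ^ i + 1)) ∧
      (∀ i, Θ i ≤ Θ₀ * ∑ j ∈ Finset.range (i + 1), ((2 : ℝ) ^ j)⁻¹) ∧
      -- convergence, and the limit conjugation
      ∃ (Ψ : G s' → G s') (Ninf : VF),
        TendstoUniformlyOn (compMaps (Φ s')) Ψ atTop (Metric.closedBall 0 r') ∧
        MapsTo Ψ (Metric.closedBall 0 r') (Metric.closedBall 0 (2 * r')) ∧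
        Tendsto (fun n => vnorm s' r' (X n)) atTop (𝓝 0) ∧
        Tendsto (fun n => vnorm s' r' (N n - Ninf)) atTop (𝓝 0) ∧
        MemV s' r' Ninf ∧ OrderGE d Ninf ∧ SupportedIn (J2 lam) Ninf ∧
        Conjugates s' r' Ψ (diagVF lam + Z + X₀ + N₀) (diagVF lam + Z + Ninf) := by
  obtain ⟨A, hA1, hA⟩ := exists_divisor_bound hτ hC
  -- The homological estimate already holds with exponent constant 1. The larger 64 is forced by
  -- σ_0, and A⁸ in K₀ stems from the eighth power of the bound for L_λ⁻¹.
  refine ⟨64, by norm_num, ⟨A, by linarith, fun γ lam hγ hfreq s r δ _ hr hδ Y hY =>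
    exists_homological hr hδ (by linarith) hγ (by norm_num) (hA γ lam hγ hfreq δ hδ) hY⟩,
    300 * quadConst * A ^ 8, ?_, ?_⟩
  · have h1 : 1 ≤ quadConst := one_le_genConst.trans genConst_le_quadConst
    have h2 : 1 ≤ A ^ 8 := one_le_pow₀ hA1
    nlinarith
  intro γ lam hγ hfreq d hd s s' r' _ hss hr Z X₀ N₀ hZ hZd hZo _ hX hXo hXs hN hNo hNs ε₀ Θ₀
    hε hΘ hsmall
  let H : IterData τ C :=
    { A := A, γ := γ, s := s, s' := s', r' := r', ε₀ := ε₀, Θ₀ := Θ₀, lam := lam, d := d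
      Z := Z, X₀ := X₀, N₀ := N₀, one_le_A := hA1, γ_pos := hγ, freq := hfreq
      divisors := hA γ lam hγ hfreq, degree := hd, lt := hss, r_pos := hr
      memZ := hZ, diagZ := hZd, orderZ := hZo, memX₀ := hX, orderX₀ := hXo, suppX₀ := hXs
      memN₀ := hN, orderN₀ := hNo, suppN₀ := hNs, ε₀_eq := hε, Θ₀_eq := hΘ, small := hsmall }
  refine ⟨H.F, H.X, H.N, H.Phi, H.eps, H.theta, rfl, rfl,
    fun i => ⟨(H.inv i).boundF.memV, (H.inv i).step.orderF,
      homSol_supportedIn (H.inv i).step.suppX⟩,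
    fun i t ht => ⟨H.isTimeOneFlow_Phi ht, H.analyticOnNhd_Phi ht,
      fun u hu => (H.norm_Phi_sub_le ht hu).trans (H.disp_le i)⟩,
    fun n hn t ht => ?_, H.W_succ,
    fun i => ⟨(H.inv i).memX, (H.inv i).step.orderX, (H.inv i).step.suppX⟩,
    fun i => ⟨(H.inv i).memN, (H.inv i).step.orderN, (H.inv i).step.suppN⟩,
    fun _ => rfl, fun _ => rfl, fun i => (H.inv i).eps_le, fun i => (H.inv i).theta_le,
    H.Psi, H.Ninf, H.tendstoUniformlyOn_Psi,
    fun u hu => mem_closedBall_zero_iff.2 (H.norm_Psi_lt hu).le, H.tendsto_X, H.tendsto_N,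
    H.memN_inf, H.orderN_inf, H.suppN_inf,
    H.analyticOnNhd_Psi, H.injOn_Psi.mono Metric.ball_subset_closedBall,
    fun x hx => H.isInvertible_fderiv_Psi hx, fun x hx v hv => H.intertwines_Psi hx hv⟩
  obtain ⟨m, rfl⟩ : ∃ m, n = m + 1 := ⟨n - 1, by omega⟩
  exact ⟨H.mapsTo_compMaps ht, H.analyticOnNhd_compMaps ht,
    fun u hu => H.norm_compMaps_succ_sub_le ht hu⟩
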